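/- **Setting.** Fix $n\ge 1$, let $\mathcal A=\mathbb C[[h]]$, let $P$ be the permutation operator on $\mathbb C^n\otimes\mathbb C^n$, and let $f(u)=1+\sum_{k\ge1}f_ku^{-k}$, $f_k\in\mathcal A$, be the unique series with $f(u-nh)=\frac{u^2-h^2}{u^2}f(u)$. Put $R(u)=f(u)\bigl(I+\frac hu P\bigr)$, expanded in powers of $u^{-1}$. The Yangian double $\mathrm{DY}_h(\mathfrak{gl}_n)$ is the topological ($h$-torsion-free and $h$-adically complete) associative $\mathcal A$-algebra generated by $c$ and $l_{ij}^{(r)}$ ($1\le i,j\le n$, $r\in\mathbb Z$). Its defining relations are stated in terms of the matrices $L^\pm(u)=(l^\pm_{ij}(u))$ with $$l^+_{ij}(u)=\delta_{ij}-h\sum_{r\ge0}l^{(r)}_{ij}u^{-r-1},\qquad l^-_{ij}(u)=\delta_{ij}+h\sum_{r<0}l^{(r)}_{ij}u^{-r-1},$$ and are $$[L^\pm(u),c]=0,\qquad R(u-v)L_1^\pm(u)L_2^\pm(v)=L_2^\pm(v)L_1^\pm(u)R(u-v),$$ $$R\bigl(u-v-\tfrac12hc\bigr)L_1^+(u)L_2^-(v)=L_2^-(v)L_1^+(u)R\bigl(u-v+\tfrac12hc\bigr),$$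 where in the last relation the $R$-matrices are expanded in negative powers of $u$ and non-negative powers of $v$. Let $\overline{\mathrm{DY}}_h(\mathfrak{gl}_n)_{cr}$ be the quotient by the ideal generated by $c+n$, and let $J_p$ be its left ideal generated by all $l_{ij}^{(r)}$ with $r\ge p$. The completed Yangian double at the critical level is $$\mathrm{DY}_h(\mathfrak{gl}_n)_{cr}=\varprojlim_{p,m}\ \overline{\mathrm{DY}}_h(\mathfrak{gl}_n)_{cr}\big/\bigl(J_p+h^m\,\overline{\mathrm{DY}}_h(\mathfrak{gl}_n)_{cr}\bigr),$$ with the multiplication extended by continuity. **Theorem 4.4.** For $k=1,\dots,n$ let $A_k=\frac1{k!}\sum_{\sigma\in\mathfrak S_k}\operatorname{sgn}(\sigma)\,\sigma$ be the antisymmetrizer acting on $(\mathbb C^n)^{\otimes k}$, put $u_i=u+(i-1)h$, and define the two-sided series $$\ell_k(u)=\operatorname{tr}_{1,\dots,k}\,A_k\,L_1^-(u_1)\cdots L_k^-(u_k)\,L_k^+\bigl(u_k+\tfrac12hn\bigr)^{-1}\cdots L_1^+\bigl(u_1+\tfrac12hn\bigr)^{-1}=\sum_{N\in\mathbb Z}\ell_{k,N}\,u^N,$$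 where the trace is over all $k$ copies of $\operatorname{End}\mathbb C^n$, $L^-(u+a)$ is expanded in powers of $u$, and $L^+(u+a)^{-1}$ in powers of $u^{-1}$. Then for every $N\in\mathbb Z$ the sum defining $\ell_{k,N}$ converges in $\mathrm{DY}_h(\mathfrak{gl}_n)_{cr}$, and $\ell_{k,N}$ belongs to the center of $\mathrm{DY}_h(\mathfrak{gl}_n)_{cr}$. -/

import Mathlib

namespace YangianDouble

/-- The ground ring `ℂ[[h]]`. -/
abbrev Scalars : Type := PowerSeries ℂ

/-- The deformation parameter `h`. -/
noncomputable def hbar : Scalars := PowerSeries.X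

section Shift

variable {M : Type*} [AddCommGroup M] [Module Scalars M]

/-- If `φ(u) = ∑ φ_k u^{-k}` then `shiftInv a φ N` is the coefficient of `u^{-N}` in `φ(u + a)`,
where `(u + a)^{-k} = ∑_m binom(k+m-1, m) (-a)^m u^{-k-m}`. -/
noncomputable def shiftInv (a : Scalars) (φ : ℕ → M) (N : ℕ) : M :=
  ∑ p ∈ Finset.HasAntidiagonal.antidiagonal N, (((N - 1).choose p.2 : Scalars) * (-a) ^ p.2) • φ p.1

end Shift

/-- The complex numbers `g_k` with `f(u) = ∑ g_k h^k u^{-k}`, `g_0 = 1`; the recursion is the unique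
solution of the functional equation of `f`, see `fCoeff_functional`. -/
noncomputable def normCoeff (n : ℕ) : ℕ → ℂ
  | 0 => 1
  | k + 1 => -(normCoeff n k + ∑ j : Fin (k + 1),
      ((k + 1).choose (k + 2 - (j : ℕ)) : ℂ) * (n : ℂ) ^ (k + 2 - (j : ℕ)) * normCoeff n j)
        / ((k + 1) * n)

/-- The coefficient `f_k` of `u^{-k}` in the normalizing series `f(u)`. -/
noncomputable def fCoeff (n k : ℕ) : Scalars := PowerSeries.C (normCoeff n k) * hbar ^ k

theorem fCoeff_zero (n : ℕ) : fCoeff n 0 = 1 := by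
  simp [fCoeff, normCoeff]

/-- The functional equation `f(u - n h) = (1 - h^2 u^{-2}) f(u)`, coefficient by coefficient. -/
theorem fCoeff_functional (n : ℕ) (hn : 1 ≤ n) (N : ℕ) :
    shiftInv (-(n * hbar)) (fCoeff n) N =
      fCoeff n N - (if 2 ≤ N then hbar ^ 2 * fCoeff n (N - 2) else 0) := by
  have hn' : (n : ℂ) ≠ 0 := by exact_mod_cast (by omega : n ≠ 0)
  unfold shiftInv
  rw [Finset.Nat.sum_antidiagonal_eq_sum_range_succ_mk]
  rcases N with _ | _ | k
  · simp [fCoeff]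
  · simp [Finset.sum_range_succ]
  · have key : ∑ x ∈ Finset.range (k + 1),
        ((k + 1).choose (k + 2 - x) : ℂ) * (n : ℂ) ^ (k + 2 - x) * normCoeff n x
        = -(normCoeff n k) - ((k + 1) * n) * normCoeff n (k + 1) := by
      have hk : ((k : ℂ) + 1) ≠ 0 := by exact_mod_cast Nat.succ_ne_zero k
      rw [normCoeff, ← Fin.sum_univ_eq_sum_range (fun x =>
        ((k + 1).choose (k + 2 - x) : ℂ) * (n : ℂ) ^ (k + 2 - x) * normCoeff n x)]
      field_simp
      ring
    have e1 : ∀ x ∈ Finset.range (k + 1), (((k + 1 + 1 - 1).choose (k + 1 + 1 - x) : Scalars) *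
        (- -(n * hbar)) ^ (k + 1 + 1 - x)) • fCoeff n x =
        PowerSeries.C (((k + 1).choose (k + 2 - x) : ℂ) * (n : ℂ) ^ (k + 2 - x) * normCoeff n x)
          * hbar ^ (k + 2) := by
      intro x hx
      have hx' := Finset.mem_range.1 hx
      have : hbar ^ (k + 2) = hbar ^ (k + 2 - x) * hbar ^ x := by
        rw [← pow_add]; congr 1; omega
      rw [this]
      simp only [fCoeff, neg_neg, smul_eq_mul, map_mul, map_pow, map_natCast, mul_pow,
        Nat.add_sub_cancel]
      ring
    rw [Finset.sum_range_succ, Finset.sum_range_succ, Finset.sum_congr rfl e1, ← Finset.sum_mul,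
      ← map_sum, key]
    simp only [fCoeff, map_sub, map_mul, map_neg, map_add, map_natCast, map_one]
    have : k + 1 + 1 - (k + 1) = 1 := by omega
    simp [this]
    ring

/-- Generators of the Yangian double: `l i j r` is `l_{ij}^{(r)}`, and `c` is the central one. -/
inductive Gen (n : ℕ) : Type
  | l (i j : Fin n) (r : ℤ) : Gen n
  | c : Gen n

/-- The free associative `ℂ[[h]]`-algebra on the generators. -/
def Free (n : ℕ) : Type := FreeAlgebra Scalars (Gen n)

noncomputable instance (n : ℕ) : Ring (Free n) := inferInstanceAs (Ring (FreeAlgebra Scalars (Gen n)))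

noncomputable instance (n : ℕ) : Algebra Scalars (Free n) :=
  inferInstanceAs (Algebra Scalars (FreeAlgebra Scalars (Gen n)))

/-- The generator `l_{ij}^{(r)}` of the free algebra. -/
noncomputable def freeL {n : ℕ} (i j : Fin n) (r : ℤ) : Free n := FreeAlgebra.ι Scalars (Gen.l i j r)

/-- The generator `c` of the free algebra. -/
noncomputable def freeC (n : ℕ) : Free n := FreeAlgebra.ι Scalars Gen.c

theorem Free.induction {n : ℕ} {motive : Free n → Prop}
    (scalar : ∀ a : Scalars, motive (algebraMap Scalars (Free n) a))
    (gen_l : ∀ i j r, motive (freeL i j r)) (gen_c : motive (freeC n))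
    (mul : ∀ a b, motive a → motive b → motive (a * b))
    (add : ∀ a b, motive a → motive b → motive (a + b)) (x : Free n) : motive x := by
  refine FreeAlgebra.induction Scalars (Gen n) (motive := motive) scalar ?_ mul add x
  rintro (⟨i, j, r⟩ | _)
  · exact gen_l i j r
  · exact gen_c

/-- The coefficient of `u^a` in `L^+(u)`, `l_{ij}^+(u) = δ_{ij} - h ∑_{k ≥ 0} l_{ij}^{(k)} u^{-k-1}`. -/
noncomputable def Lplus (n : ℕ) (a : ℤ) : Matrix (Fin n) (Fin n) (Free n) :=
  Matrix.of fun i j =>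
    (if a = 0 ∧ i = j then 1 else 0) - (if a < 0 then hbar • freeL i j (-a - 1) else 0)

/-- The coefficient of `u^a` in `L^-(u)`, `l_{ij}^-(u) = δ_{ij} + h ∑_{k < 0} l_{ij}^{(k)} u^{-k-1}`. -/
noncomputable def Lminus (n : ℕ) (a : ℤ) : Matrix (Fin n) (Fin n) (Free n) :=
  Matrix.of fun i j =>
    (if a = 0 ∧ i = j then 1 else 0) + (if 0 ≤ a then hbar • freeL i j (-a - 1) else 0)

section TwoFold

variable {n : ℕ} {D : Type*} [Ring D]

/-- `M ⊗ id`, acting in the first of two copies of `ℂ^n`. -/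
def inFirst (M : Matrix (Fin n) (Fin n) D) : Matrix (Fin n × Fin n) (Fin n × Fin n) D :=
  Matrix.kronecker M 1

/-- `id ⊗ M`, acting in the second of two copies of `ℂ^n`. -/
def inSecond (M : Matrix (Fin n) (Fin n) D) : Matrix (Fin n × Fin n) (Fin n × Fin n) D :=
  Matrix.kronecker 1 M

/-- The permutation operator `P (v ⊗ w) = w ⊗ v`. -/
def permOp (n : ℕ) (D : Type*) [Ring D] : Matrix (Fin n × Fin n) (Fin n × Fin n) D :=
  Matrix.of fun p q => if p.1 = q.2 ∧ p.2 = q.1 then 1 else 0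

end TwoFold

/-- The coefficient of `u^a v^b` (`a, b ∈ ℤ`) in
`(u - v + h P) L_1(u) L_2(v) - L_2(v) L_1(u) (u - v + h P)`, where `L(u) = ∑ L_a u^a`.
Its vanishing is the relation `R(u-v) L_1(u) L_2(v) = L_2(v) L_1(u) R(u-v)`:
the invertible scalar factor `f(u-v) / (u-v)` occurs on both sides and has been cancelled. -/
noncomputable def relSame {n : ℕ} (L : ℤ → Matrix (Fin n) (Fin n) (Free n)) (a b : ℤ) :
    Matrix (Fin n × Fin n) (Fin n × Fin n) (Free n) :=
  (inFirst (L (a - 1)) * inSecond (L b) - inFirst (L a) * inSecond (L (b - 1))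
      + hbar • (permOp n (Free n) * inFirst (L a) * inSecond (L b)))
    - (inSecond (L b) * inFirst (L (a - 1)) - inSecond (L (b - 1)) * inFirst (L a)
      + hbar • (inSecond (L b) * inFirst (L a) * permOp n (Free n)))

/-- The coefficient of `x^{-k}` in `R(x) = f(x) (1 + h x^{-1} P)`. -/
noncomputable def Rcoeff (n k : ℕ) : Matrix (Fin n × Fin n) (Fin n × Fin n) (Free n) :=
  fCoeff n k • (1 : Matrix (Fin n × Fin n) (Fin n × Fin n) (Free n)) +
    (if k = 0 then 0 else hbar * fCoeff n (k - 1)) • permOp n (Free n)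

/-- The coefficient of `u^{-N} v^j` in `R(u - v + z)` expanded in negative powers of `u`:
`(u - v + z)^{-k} = ∑_m binom(k+m-1, m) (v - z)^m u^{-k-m}`. -/
noncomputable def RshiftCoeff {n : ℕ} (z : Free n) (N j : ℕ) :
    Matrix (Fin n × Fin n) (Fin n × Fin n) (Free n) :=
  ∑ p ∈ Finset.HasAntidiagonal.antidiagonal N,
    ((((N - 1).choose p.2 * p.2.choose j : ℕ) : Free n) * (-z) ^ (p.2 - j)) • Rcoeff n p.1

/-- The element `h c / 2`. -/
noncomputable def halfHC (n : ℕ) : Free n := (PowerSeries.C (1 / 2 : ℂ) * hbar) • freeC n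

/-- The coefficient of `u^{-S} v^T` in
`R(u - v - hc/2) L_1^+(u) L_2^-(v) - L_2^-(v) L_1^+(u) R(u - v + hc/2)`. -/
noncomputable def relMixed (n : ℕ) (S T : ℕ) :
    Matrix (Fin n × Fin n) (Fin n × Fin n) (Free n) :=
  ∑ p ∈ Finset.HasAntidiagonal.antidiagonal S, ∑ q ∈ Finset.HasAntidiagonal.antidiagonal T,
    (RshiftCoeff (-halfHC n) p.1 q.1 *
        inFirst (Lplus n (-(p.2 : ℤ))) * inSecond (Lminus n q.2)
      - inSecond (Lminus n q.2) * inFirst (Lplus n (-(p.2 : ℤ))) *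
        RshiftCoeff (halfHC n) p.1 q.1)

/-- The defining relators of the Yangian double. -/
inductive IsRelator (n : ℕ) : Free n → Prop
  | central_plus (a : ℤ) (i j : Fin n) :
      IsRelator n (Lplus n a i j * freeC n - freeC n * Lplus n a i j)
  | central_minus (a : ℤ) (i j : Fin n) :
      IsRelator n (Lminus n a i j * freeC n - freeC n * Lminus n a i j)
  | plus_plus (a b : ℤ) (x y : Fin n × Fin n) : IsRelator n (relSame (Lplus n) a b x y)
  | minus_minus (a b : ℤ) (x y : Fin n × Fin n) : IsRelator n (relSame (Lminus n) a b x y)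
  | plus_minus (S T : ℕ) (x y : Fin n × Fin n) : IsRelator n (relMixed n S T x y)

/-- The two-sided ideal of the free algebra generated by the defining relations. -/
noncomputable def relIdeal (n : ℕ) : TwoSidedIdeal (Free n) := TwoSidedIdeal.span {x | IsRelator n x}

/-- The Yangian double is a topologically free `ℂ[[h]]`-algebra (a deformation of an enveloping algebra
having a topological basis of ordered monomials). Since `L^±(u) ∈ 1 + h(…)`, the relations in terms
of the series `L^±(u)` are all divisible by `h^2`, and they are to be read in an `h`-torsion-free algebra:
an element of the free algebra is zero as soon as some `h^m` times it follows from the relations. -/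
noncomputable def torsionIdeal (n : ℕ) : TwoSidedIdeal (Free n) :=
  TwoSidedIdeal.mk' {x | ∃ m : ℕ, hbar ^ m • x ∈ relIdeal n}
    ⟨0, by simp⟩
    (by
      rintro x y ⟨m, hm⟩ ⟨k, hk⟩
      refine ⟨m + k, ?_⟩
      have h1 : hbar ^ (m + k) • (x + y) = algebraMap Scalars (Free n) (hbar ^ k) * (hbar ^ m • x)
          + algebraMap Scalars (Free n) (hbar ^ m) * (hbar ^ k • y) := by
        rw [← Algebra.smul_def, ← Algebra.smul_def, smul_smul, smul_smul, smul_add, pow_add,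
          mul_comm (hbar ^ k)]
      rw [h1]
      exact add_mem ((relIdeal n).mul_mem_left _ _ hm) ((relIdeal n).mul_mem_left _ _ hk))
    (by
      rintro x ⟨m, hm⟩
      exact ⟨m, by rw [smul_neg]; exact neg_mem hm⟩)
    (by
      rintro x y ⟨m, hm⟩
      exact ⟨m, by rw [← mul_smul_comm]; exact (relIdeal n).mul_mem_left _ _ hm⟩)
    (by
      rintro x y ⟨m, hm⟩
      exact ⟨m, by rw [← smul_mul_assoc]; exact (relIdeal n).mul_mem_right _ _ hm⟩)

theorem mem_torsionIdeal {n : ℕ} {x : Free n} :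
    x ∈ torsionIdeal n ↔ ∃ m : ℕ, hbar ^ m • x ∈ relIdeal n := by
  unfold torsionIdeal
  rw [TwoSidedIdeal.mem_mk']
  rfl

/-- The Yangian double of `gl_n` before completion: the universal `h`-torsion-free `ℂ[[h]]`-algebra
generated by the `l_{ij}^{(r)}` and `c` subject to the defining relations. The `h`-adic completion is
performed below, together with the completion with respect to the left ideals `J_p`. -/
abbrev DY (n : ℕ) : Type := (torsionIdeal n).ringCon.Quotient

/-- The ideal generated by the relation `c = -n`. -/
noncomputable def levelIdeal (n : ℕ) : TwoSidedIdeal (DY n) :=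
  TwoSidedIdeal.span {(torsionIdeal n).ringCon.mk' (freeC n) + (n : DY n)}

/-- The Yangian double at the critical level `c = -n`, before completion. -/
def DYbar (n : ℕ) : Type := (levelIdeal n).ringCon.Quotient

noncomputable instance (n : ℕ) : Ring (DYbar n) :=
  inferInstanceAs (Ring (levelIdeal n).ringCon.Quotient)

noncomputable instance (n : ℕ) : Algebra Scalars (DYbar n) :=
  inferInstanceAs (Algebra Scalars (levelIdeal n).ringCon.Quotient)

/-- The image of the free algebra in the Yangian double at the critical level. -/
noncomputable def toBar (n : ℕ) : Free n →ₐ[Scalars] DYbar n :=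
  ((levelIdeal n).ringCon.mkₐ (α := Scalars)).comp ((torsionIdeal n).ringCon.mkₐ (α := Scalars))

theorem toBar_surjective (n : ℕ) : Function.Surjective (toBar n) :=
  fun x => by
  obtain ⟨y, hy⟩ := RingCon.mkₐ_surjective (α := Scalars) (levelIdeal n).ringCon x
  obtain ⟨z, hz⟩ := RingCon.mkₐ_surjective (α := Scalars) (torsionIdeal n).ringCon y
  exact ⟨z, by rw [← hy, ← hz]; rfl⟩

theorem toBar_eq_zero_of_smul {n : ℕ} {x : Free n} (m : ℕ) (hx : hbar ^ m • x ∈ relIdeal n) :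
    toBar n x = 0 := by
  have h1 : x ∈ torsionIdeal n := mem_torsionIdeal.2 ⟨m, hx⟩
  have h2 : (torsionIdeal n).ringCon.mkₐ (α := Scalars) x = 0 :=
    (RingCon.eq _).2 h1
  show (levelIdeal n).ringCon.mkₐ (α := Scalars) ((torsionIdeal n).ringCon.mkₐ (α := Scalars) x) = 0
  rw [h2, map_zero]

theorem toBar_freeC (n : ℕ) : toBar n (freeC n) = -(n : DYbar n) := by
  have h1 : (torsionIdeal n).ringCon.mk' (freeC n) + (n : DY n) ∈ levelIdeal n :=
    TwoSidedIdeal.subset_span rfl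
  have h2 : (levelIdeal n).ringCon.mkₐ (α := Scalars)
      ((torsionIdeal n).ringCon.mk' (freeC n) + (n : DY n)) = 0 := (RingCon.eq _).2 h1
  rw [map_add, map_natCast] at h2
  exact eq_neg_of_add_eq_zero_left h2

/-- `J_p`: the left ideal generated by all `l_{ij}^{(r)}` with `r ≥ p`. -/
noncomputable def J (n p : ℕ) : Ideal (DYbar n) :=
  Ideal.span {x | ∃ (i j : Fin n) (r : ℤ), (p : ℤ) ≤ r ∧ x = toBar n (freeL i j r)}

/-- The left ideals `J_p + h^m DY`, indexed by `s = (p, m)`, which define the topology. -/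
noncomputable def nbhd (n : ℕ) (s : ℕ × ℕ) : Ideal (DYbar n) :=
  J n s.1 ⊔ Ideal.span {algebraMap Scalars (DYbar n) (hbar ^ s.2)}

theorem inFirst_mul_inSecond {n : ℕ} {D : Type*} [Ring D] (A B : Matrix (Fin n) (Fin n) D)
    (x y : Fin n × Fin n) : (inFirst A * inSecond B) x y = A x.1 y.1 * B x.2 y.2 := by
  obtain ⟨i, k⟩ := x
  obtain ⟨j, l⟩ := y
  simp [inFirst, inSecond, Matrix.mul_apply, Fintype.sum_prod_type, Matrix.one_apply, Matrix.kronecker,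
    Matrix.kroneckerMap_apply]

theorem inSecond_mul_inFirst {n : ℕ} {D : Type*} [Ring D] (A B : Matrix (Fin n) (Fin n) D)
    (x y : Fin n × Fin n) : (inSecond B * inFirst A) x y = B x.2 y.2 * A x.1 y.1 := by
  obtain ⟨i, k⟩ := x
  obtain ⟨j, l⟩ := y
  simp [inFirst, inSecond, Matrix.mul_apply, Fintype.sum_prod_type, Matrix.one_apply, Matrix.kronecker,
    Matrix.kroneckerMap_apply]

theorem permOp_mul {n : ℕ} {D : Type*} [Ring D] (M : Matrix (Fin n × Fin n) (Fin n × Fin n) D)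
    (x y : Fin n × Fin n) : (permOp n D * M) x y = M x.swap y := by
  rw [Matrix.mul_apply, Finset.sum_eq_single x.swap]
  · simp [permOp]
  · rintro ⟨a, b⟩ - hb
    have : ¬ (x.1 = b ∧ x.2 = a) := by
      rintro ⟨rfl, rfl⟩
      exact hb rfl
    simp [permOp, this]
  · simp

theorem mul_permOp {n : ℕ} {D : Type*} [Ring D] (M : Matrix (Fin n × Fin n) (Fin n × Fin n) D)
    (x y : Fin n × Fin n) : (M * permOp n D) x y = M x y.swap := by
  rw [Matrix.mul_apply, Finset.sum_eq_single y.swap]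
  · simp [permOp]
  · rintro ⟨a, b⟩ - hb
    have : ¬ (a = y.2 ∧ b = y.1) := by
      rintro ⟨rfl, rfl⟩
      exact hb rfl
    simp [permOp, this]
  · simp

theorem relSame_apply {n : ℕ} (L : ℤ → Matrix (Fin n) (Fin n) (Free n)) (a b : ℤ)
    (i j k l : Fin n) :
    relSame L a b (i, k) (j, l) =
      (L (a - 1) i j * L b k l - L a i j * L (b - 1) k l + hbar • (L a k j * L b i l))
      - (L b k l * L (a - 1) i j - L (b - 1) k l * L a i j + hbar • (L b k j * L a i l)) := by
  simp only [relSame, Matrix.sub_apply, Matrix.add_apply, Matrix.smul_apply,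
    Matrix.mul_assoc (permOp n (Free n)), permOp_mul, mul_permOp,
    inFirst_mul_inSecond, inSecond_mul_inFirst, Prod.fst_swap, Prod.snd_swap]

theorem Lplus_neg {n : ℕ} (a : ℤ) (ha : a < 0) (i j : Fin n) :
    Lplus n a i j = -(hbar • freeL i j (-a - 1)) := by
  simp [Lplus, ha, ha.ne]

theorem Lplus_zero {n : ℕ} (i j : Fin n) :
    Lplus n 0 i j = if i = j then 1 else 0 := by
  simp [Lplus]

theorem Lminus_nat {n : ℕ} (a : ℕ) (i j : Fin n) :
    Lminus n a i j = (if a = 0 ∧ i = j then 1 else 0) + hbar • freeL i j (-(a : ℤ) - 1) := by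
  simp [Lminus]

theorem exists_of_sub_mem {n : ℕ} (G : Ideal (DYbar n)) (z : Free n)
    (h : ∃ y, toBar n y ∈ G ∧ hbar ^ 2 • z - hbar ^ 2 • y ∈ relIdeal n) : toBar n z ∈ G := by
  obtain ⟨y, hy, h⟩ := h
  rw [← smul_sub] at h
  have := toBar_eq_zero_of_smul 2 h
  rw [map_sub, sub_eq_zero] at this
  rwa [this]

/-- Elements which are congruent, modulo the defining relations, to `h^2` times an element
whose image lies in `G`. -/
def divTwo {n : ℕ} (G : Ideal (DYbar n)) : AddSubgroup (Free n) where
  carrier := {x | ∃ y, toBar n y ∈ G ∧ x - hbar ^ 2 • y ∈ relIdeal n}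
  zero_mem' := ⟨0, by simp, by simp⟩
  add_mem' := by
    rintro a b ⟨x, hx, hx'⟩ ⟨y, hy, hy'⟩
    refine ⟨x + y, by rw [map_add]; exact add_mem hx hy, ?_⟩
    have := add_mem hx' hy'
    rwa [show a - hbar ^ 2 • x + (b - hbar ^ 2 • y) = a + b - hbar ^ 2 • (x + y) by
      rw [smul_add]; abel] at this
  neg_mem' := by
    rintro a ⟨x, hx, hx'⟩
    refine ⟨-x, by rw [map_neg]; exact neg_mem hx, ?_⟩
    have := neg_mem hx'
    rwa [show -(a - hbar ^ 2 • x) = -a - hbar ^ 2 • (-x) by rw [smul_neg]; abel] at this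

theorem mem_divTwo_of_eq {n : ℕ} {G : Ideal (DYbar n)} {x : Free n} (y : Free n)
    (hy : toBar n y ∈ G) (h : x = hbar ^ 2 • y) : x ∈ divTwo G :=
  ⟨y, hy, by rw [h, sub_self]; exact zero_mem _⟩

theorem mem_divTwo_of_rel {n : ℕ} {G : Ideal (DYbar n)} {x : Free n} (h : x ∈ relIdeal n) :
    x ∈ divTwo G := ⟨0, by simp, by simpa using h⟩

theorem relIdeal_of {n : ℕ} {x : Free n} (h : IsRelator n x) : x ∈ relIdeal n :=
  TwoSidedIdeal.subset_span h

theorem freeL_mem_J {n p : ℕ} (i j : Fin n) (r : ℤ) (h : (p : ℤ) ≤ r) :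
    toBar n (freeL i j r) ∈ J n p := Ideal.subset_span ⟨i, j, r, h, rfl⟩

theorem hbar_smul_mem {n : ℕ} {G : Ideal (DYbar n)} {x : DYbar n} (a : Scalars) (h : x ∈ G) :
    a • x ∈ G := by
  rw [Algebra.smul_def]
  exact G.mul_mem_left _ h

theorem mul_plus_mem_J {n : ℕ} (p r : ℕ) : ∀ (s : ℤ) (_ : (p : ℤ) ≤ s) (i j k l : Fin n),
    toBar n (freeL i j s * freeL k l r) ∈ J n p := by
  induction r with
  | zero =>
    intro s hs i j k l
    have hrel := relIdeal_of (IsRelator.plus_plus (-s - 1) 0 (i, k) (j, l))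
    rw [relSame_apply, Lplus_neg (-s - 1 - 1) (by omega), Lplus_neg (-s - 1) (by omega),
      Lplus_neg (-s - 1) (by omega), Lplus_neg (-s - 1) (by omega), Lplus_neg (0 - 1) (by omega)]
      at hrel
    simp only [Lplus_zero] at hrel
    rw [show -(-s - 1) - 1 = s by ring, show -(0 - 1) - 1 = (0 : ℤ) by ring] at hrel
    refine exists_of_sub_mem _ _ ⟨freeL k l 0 * freeL i j s
      - freeL k j s * (if i = l then 1 else 0) + (if k = j then 1 else 0) * freeL i l s, ?_, ?_⟩
    · simp only [map_add, map_sub, map_mul]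
      refine add_mem (sub_mem (Ideal.mul_mem_left _ _ (freeL_mem_J _ _ _ hs)) ?_)
        (Ideal.mul_mem_left _ _ (freeL_mem_J _ _ _ hs))
      split_ifs
      · simpa using freeL_mem_J _ _ _ hs
      · simp
    · have := neg_mem hrel
      convert this using 1
      split_ifs <;> simp [smul_sub, smul_add, smul_smul, pow_two] <;> abel
  | succ r ih =>
    intro s hs i j k l
    have hrel := relIdeal_of (IsRelator.plus_plus (-s - 1) (-(r : ℤ) - 1) (i, k) (j, l))
    rw [relSame_apply, Lplus_neg (-s - 1 - 1) (by omega), Lplus_neg (-s - 1) (by omega),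
      Lplus_neg (-s - 1) (by omega), Lplus_neg (-s - 1) (by omega),
      Lplus_neg (-(r : ℤ) - 1 - 1) (by omega), Lplus_neg (-(r : ℤ) - 1) (by omega),
      Lplus_neg (-(r : ℤ) - 1) (by omega), Lplus_neg (-(r : ℤ) - 1) (by omega)]
      at hrel
    rw [show -(-s - 1) - 1 = s by ring, show -(-s - 1 - 1) - 1 = s + 1 by ring,
      show -(-(r : ℤ) - 1) - 1 = r by ring,
      show -(-(r : ℤ) - 1 - 1) - 1 = ((r + 1 : ℕ) : ℤ) by push_cast; ring] at hrel
    refine exists_of_sub_mem _ _ ⟨freeL i j (s + 1) * freeL k l r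
      + hbar • (freeL k j s * freeL i l r) - freeL k l r * freeL i j (s + 1)
      + freeL k l ((r + 1 : ℕ) : ℤ) * freeL i j s - hbar • (freeL k j r * freeL i l s), ?_, ?_⟩
    · rw [map_sub, map_add, map_sub, map_add, map_smul, map_smul]
      refine sub_mem (add_mem (sub_mem (add_mem (ih _ (by omega) _ _ _ _)
        (hbar_smul_mem _ (ih _ hs _ _ _ _))) ?_) ?_) (hbar_smul_mem _ ?_)
      all_goals rw [map_mul]
      · exact Ideal.mul_mem_left _ _ (freeL_mem_J _ _ _ (by omega))
      · exact Ideal.mul_mem_left _ _ (freeL_mem_J _ _ _ hs)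
      · exact Ideal.mul_mem_left _ _ (freeL_mem_J _ _ _ hs)
    · have := neg_mem hrel
      convert this using 1
      simp [smul_sub, smul_add, smul_smul, pow_two, mul_assoc]
      abel

theorem fCoeff_eq (n k : ℕ) : ∃ a : Scalars, fCoeff n k = hbar ^ k * a :=
  ⟨PowerSeries.C (normCoeff n k), by rw [fCoeff, mul_comm]⟩

theorem Rcoeff_eq (n k : ℕ) (x y : Fin n × Fin n) :
    ∃ a : Scalars, Rcoeff n k x y = algebraMap Scalars (Free n) (hbar ^ k * a) := by
  have h1 : ∃ a : Scalars, (1 : Matrix (Fin n × Fin n) (Fin n × Fin n) (Free n)) x y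
      = algebraMap Scalars (Free n) a := by
    rw [Matrix.one_apply]
    split_ifs
    · exact ⟨1, by simp⟩
    · exact ⟨0, by simp⟩
  have h2 : ∃ a : Scalars, permOp n (Free n) x y = algebraMap Scalars (Free n) a := by
    rw [permOp, Matrix.of_apply]
    split_ifs
    · exact ⟨1, by simp⟩
    · exact ⟨0, by simp⟩
  obtain ⟨b, hb⟩ := h1
  obtain ⟨d, hd⟩ := h2
  obtain ⟨e, he⟩ := fCoeff_eq n k
  rcases k with _ | k
  · refine ⟨e * b, ?_⟩
    simp only [Rcoeff, Matrix.add_apply, Matrix.smul_apply, hb, he]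
    simp [Algebra.smul_def]
  · obtain ⟨e', he'⟩ := fCoeff_eq n k
    refine ⟨e * b + e' * d, ?_⟩
    simp only [Rcoeff, Matrix.add_apply, Matrix.smul_apply, hb, hd, he,
      Nat.add_sub_cancel, he']
    rw [if_neg (by omega), Algebra.smul_def, Algebra.smul_def, ← map_mul, ← map_mul, ← map_add]
    congr 1
    ring

theorem RshiftCoeff_zero_zero {n : ℕ} (z : Free n) : RshiftCoeff z 0 0 = 1 := by
  simp [RshiftCoeff, Rcoeff, fCoeff_zero]

theorem RshiftCoeff_eq_zero {n : ℕ} (z : Free n) (N j : ℕ) (h : N ≤ j) (h0 : 0 < j) :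
    RshiftCoeff z N j = 0 := by
  refine Finset.sum_eq_zero fun p hp => ?_
  have hp' := Finset.HasAntidiagonal.mem_antidiagonal.1 hp
  have : (N - 1).choose p.2 * p.2.choose j = 0 := by
    by_cases hj : p.2 < j
    · rw [Nat.choose_eq_zero_of_lt hj, mul_zero]
    · rw [Nat.choose_eq_zero_of_lt (by omega), zero_mul]
  rw [this]
  simp

theorem RshiftCoeff_eq {n : ℕ} (z : Free n) (a : Scalars) (hz : z = (a * hbar) • freeC n)
    (N j : ℕ) (x y : Fin n × Fin n) :
    ∃ r : Free n, RshiftCoeff z N j x y = hbar ^ (N - j) • r ∧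
      ∃ s : Scalars, toBar n r = algebraMap Scalars (DYbar n) s := by
  have hterm : ∀ p ∈ Finset.HasAntidiagonal.antidiagonal N, ∃ r : Free n,
      ((((N - 1).choose p.2 * p.2.choose j : ℕ) : Free n) * (-z) ^ (p.2 - j)) * Rcoeff n p.1 x y
        = hbar ^ (N - j) • r ∧ ∃ s : Scalars, toBar n r = algebraMap Scalars (DYbar n) s := by
    intro p hp
    have hp' := Finset.HasAntidiagonal.mem_antidiagonal.1 hp
    obtain ⟨b, hb⟩ := Rcoeff_eq n p.1 x y
    by_cases hj : p.2 < j
    · refine ⟨0, ?_, 0, by simp⟩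
      rw [Nat.choose_eq_zero_of_lt hj]
      simp
    · refine ⟨((((N - 1).choose p.2 * p.2.choose j : ℕ) : Scalars) * (-a) ^ (p.2 - j) * b) •
        freeC n ^ (p.2 - j), ?_, ?_⟩
      · rw [hb, hz, ← neg_smul, smul_pow, ← Algebra.commutes, ← Algebra.smul_def,
          ← nsmul_eq_mul, ← Nat.cast_smul_eq_nsmul Scalars, smul_smul, smul_smul, smul_smul]
        congr 1
        rw [show N - j = p.1 + (p.2 - j) by omega, pow_add, ← neg_mul, mul_pow]
        ring
      · refine ⟨((((N - 1).choose p.2 * p.2.choose j : ℕ) : Scalars) * (-a) ^ (p.2 - j) * b) *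
          (-(n : Scalars)) ^ (p.2 - j), ?_⟩
        rw [map_smul, map_pow, toBar_freeC, Algebra.smul_def, map_mul _ _ ((-(n : Scalars)) ^ _),
          map_pow, map_neg, map_natCast]
  choose! r hr s hs using hterm
  refine ⟨∑ p ∈ Finset.HasAntidiagonal.antidiagonal N, r p, ?_,
    ∑ p ∈ Finset.HasAntidiagonal.antidiagonal N, s p, ?_⟩
  · rw [Finset.smul_sum, RshiftCoeff, Matrix.sum_apply]
    exact Finset.sum_congr rfl fun p hp => by rw [Matrix.smul_apply, smul_eq_mul, hr p hp]
  · rw [map_sum, map_sum]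
    exact Finset.sum_congr rfl fun p hp => hs p hp

theorem J_le_nbhd {n : ℕ} (s : ℕ × ℕ) : J n s.1 ≤ nbhd n s := le_sup_left

theorem smul_mem_nbhd {n p m e : ℕ} (h : m ≤ e) (x : DYbar n) : hbar ^ e • x ∈ nbhd n (p, m) := by
  refine (le_sup_right : _ ≤ nbhd n (p, m)) ?_
  obtain ⟨d, rfl⟩ := Nat.exists_eq_add_of_le h
  rw [Ideal.mem_span_singleton']
  refine ⟨hbar ^ d • x, ?_⟩
  rw [← Algebra.commutes, ← Algebra.smul_def, smul_smul, pow_add]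

theorem smul_nbhd {n p m e : ℕ} (x : DYbar n) (hx : x ∈ nbhd n (p, m)) :
    hbar ^ e • x ∈ nbhd n (p, m + e) := by
  obtain ⟨y, hy, z, hz, rfl⟩ := Submodule.mem_sup.1 hx
  rw [smul_add]
  refine add_mem (J_le_nbhd (p, m + e) (hbar_smul_mem _ hy)) ?_
  obtain ⟨w, rfl⟩ := Ideal.mem_span_singleton'.1 hz
  rw [← Algebra.commutes, ← Algebra.smul_def, smul_smul, ← pow_add]
  exact smul_mem_nbhd (by simp only []; omega) _

theorem divTwo_pow {n p m e : ℕ} (h : m + 2 ≤ e) (x : Free n) :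
    hbar ^ e • x ∈ divTwo (nbhd n (p, m)) := by
  refine mem_divTwo_of_eq (hbar ^ (e - 2) • x) ?_ ?_
  · rw [map_smul]
    exact smul_mem_nbhd (by omega) _
  · rw [smul_smul, ← pow_add]
    congr 2
    omega

theorem relMixed_apply {n : ℕ} (S T : ℕ) (i j k l : Fin n) :
    relMixed n S T (i, k) (j, l) =
      ∑ p ∈ Finset.HasAntidiagonal.antidiagonal S, ∑ q ∈ Finset.HasAntidiagonal.antidiagonal T,
        (∑ x, RshiftCoeff (-halfHC n) p.1 q.1 (i, k) x *
            (Lplus n (-(p.2 : ℤ)) x.1 j * Lminus n q.2 x.2 l)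
          - ∑ x, (Lminus n q.2 k x.2 * Lplus n (-(p.2 : ℤ)) i x.1) *
            RshiftCoeff (halfHC n) p.1 q.1 x (j, l)) := by
  simp only [relMixed, Matrix.sum_apply, Matrix.sub_apply, Matrix.mul_assoc (RshiftCoeff _ _ _)]
  refine Finset.sum_congr rfl fun p _ => Finset.sum_congr rfl fun q _ => ?_
  rw [Matrix.mul_apply, Matrix.mul_apply]
  simp only [inFirst_mul_inSecond, inSecond_mul_inFirst]

/-- The left-hand terms of the mixed relation. -/
theorem left_term_mem {n p m e a b : ℕ} (he : 1 ≤ e) (r : Free n) (i j k l : Fin n)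
    (hpos : e < m + 3 → p < a ∧
      toBar n (hbar ^ e • (freeL i j ((a : ℤ) - 1) * freeL k l (-(b : ℤ) - 1)))
        ∈ nbhd n (p, m + 1)) :
    (hbar ^ e • r) * (Lplus n (-(a : ℤ)) i j * Lminus n b k l) ∈ divTwo (nbhd n (p, m + 1)) := by
  rw [smul_mul_assoc]
  by_cases h : e < m + 3
  · obtain ⟨ha, h2⟩ := hpos h
    rw [Lplus_neg _ (by omega), Lminus_nat, neg_neg]
    have e1 : hbar ^ e • (r * (-(hbar • freeL i j ((a : ℤ) - 1)) *
        ((if b = 0 ∧ k = l then 1 else 0) + hbar • freeL k l (-(b : ℤ) - 1)))) =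
        hbar ^ 2 • (-(hbar ^ (e - 1) • (r * ((if b = 0 ∧ k = l then 1 else 0) *
          freeL i j ((a : ℤ) - 1)))) -
        r * (hbar ^ e • (freeL i j ((a : ℤ) - 1) * freeL k l (-(b : ℤ) - 1)))) := by
      have : hbar ^ e = hbar * hbar ^ (e - 1) := by
        rw [← pow_succ']
        congr 1
        omega
      rw [this]
      split_ifs <;> simp [smul_sub, smul_smul, mul_add, smul_add, pow_two] <;> ring_nf <;> abel
    refine mem_divTwo_of_eq _ ?_ e1
    rw [map_sub, map_neg, map_smul, map_mul, map_mul, map_mul]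
    refine sub_mem (neg_mem (hbar_smul_mem _ ?_)) (Ideal.mul_mem_left _ _ h2)
    exact Ideal.mul_mem_left _ _ (Ideal.mul_mem_left _ _
      (J_le_nbhd (p, m + 1) (freeL_mem_J _ _ _ (by simp only []; omega))))
  · exact divTwo_pow (by omega) _

theorem right_term_mem {n p m e a b : ℕ} (he : 1 ≤ e) (r : Free n)
    (hr : ∃ s : Scalars, toBar n r = algebraMap Scalars (DYbar n) s) (i j k l : Fin n)
    (hpos : e < m + 3 → p < a) :
    (Lminus n b k l * Lplus n (-(a : ℤ)) i j) * (hbar ^ e • r) ∈ divTwo (nbhd n (p, m + 1)) := by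
  rw [mul_smul_comm]
  by_cases h : e < m + 3
  · have ha := hpos h
    rw [Lplus_neg _ (by omega), neg_neg]
    have e1 : hbar ^ e • (Lminus n b k l * -(hbar • freeL i j ((a : ℤ) - 1)) * r) =
        hbar ^ 2 • -(hbar ^ (e - 1) • (Lminus n b k l * freeL i j ((a : ℤ) - 1) * r)) := by
      have : hbar ^ e = hbar * hbar ^ (e - 1) := by
        rw [← pow_succ']
        congr 1
        omega
      rw [this]
      simp [smul_smul, pow_two]
      ring_nf
    refine mem_divTwo_of_eq _ ?_ e1
    obtain ⟨s, hs⟩ := hr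
    rw [map_neg, map_smul, map_mul, map_mul, hs, ← Algebra.commutes]
    exact neg_mem (hbar_smul_mem _ (Ideal.mul_mem_left _ _ (Ideal.mul_mem_left _ _
      (J_le_nbhd (p, m + 1) (freeL_mem_J _ _ _ (by simp only []; omega))))))
  · exact divTwo_pow (by omega) _

theorem mixed_step {n T m p q : ℕ} (hT : ∀ t < T, ∀ S : ℕ, q ≤ S → ∀ i j k l : Fin n,
      toBar n (freeL i j S * freeL k l (-(t : ℤ) - 1)) ∈ nbhd n (p, m + 1))
    (hm : ∀ S : ℕ, q ≤ S → ∀ i j k l : Fin n,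
      toBar n (freeL i j S * freeL k l (-(T : ℤ) - 1)) ∈ nbhd n (p, m))
    (S : ℕ) (hS : q + p + T + m + 10 ≤ S) (i j k l : Fin n) :
    toBar n (freeL i j S * freeL k l (-(T : ℤ) - 1)) ∈ nbhd n (p, m + 1) := by
  have hrel : relMixed n (S + 1) T (i, k) (j, l) ∈ divTwo (nbhd n (p, m + 1)) :=
    mem_divTwo_of_rel (relIdeal_of (IsRelator.plus_minus _ _ _ _))
  rw [relMixed_apply, ← Finset.sum_product',
    ← Finset.add_sum_erase _ _ (a := (((0, S + 1), (0, T)) : (ℕ × ℕ) × (ℕ × ℕ)))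
      (by simp)] at hrel
  have hrest : ∀ w ∈ (Finset.HasAntidiagonal.antidiagonal (S + 1) ×ˢ
      Finset.HasAntidiagonal.antidiagonal T).erase (((0, S + 1), (0, T)) : (ℕ × ℕ) × (ℕ × ℕ)),
      (∑ x, RshiftCoeff (-halfHC n) w.1.1 w.2.1 (i, k) x *
            (Lplus n (-(w.1.2 : ℤ)) x.1 j * Lminus n w.2.2 x.2 l)
          - ∑ x, (Lminus n w.2.2 k x.2 * Lplus n (-(w.1.2 : ℤ)) i x.1) *
            RshiftCoeff (halfHC n) w.1.1 w.2.1 x (j, l)) ∈ divTwo (nbhd n (p, m + 1)) := by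
    rintro ⟨⟨N, a⟩, ⟨d, b⟩⟩ hw
    rw [Finset.mem_erase, Finset.mem_product, Finset.HasAntidiagonal.mem_antidiagonal,
      Finset.HasAntidiagonal.mem_antidiagonal] at hw
    obtain ⟨hne, hNa, hdb⟩ := hw
    simp only at hNa hdb ⊢
    have hne' : ¬ (N = 0 ∧ d = 0) := by
      rintro ⟨rfl, rfl⟩
      apply hne
      simp only [zero_add] at hNa hdb
      rw [hNa, hdb]
    by_cases hNd : N ≤ d
    · rw [RshiftCoeff_eq_zero _ _ _ hNd (by omega), RshiftCoeff_eq_zero _ _ _ hNd (by omega)]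
      simp
    · refine sub_mem (sum_mem fun x _ => ?_) (sum_mem fun x _ => ?_)
      · obtain ⟨r, hr, -⟩ := RshiftCoeff_eq (-halfHC n) (-PowerSeries.C (1 / 2 : ℂ))
          (by rw [halfHC, ← neg_smul, neg_mul]) N d (i, k) x
        rw [hr]
        refine left_term_mem (by omega) _ _ _ _ _ fun he => ⟨by omega, ?_⟩
        obtain ⟨a', rfl⟩ : ∃ a', a = a' + 1 := ⟨a - 1, by omega⟩
        rw [map_smul, show ((a' + 1 : ℕ) : ℤ) - 1 = (a' : ℤ) by push_cast; ring]
        rcases Nat.eq_zero_or_pos d with rfl | hd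
        · obtain rfl : b = T := by omega
          have := smul_nbhd (e := N - 0) _ (hm a' (by omega) x.1 j x.2 l)
          refine SetLike.le_def.1 (?_ : nbhd n (p, m + (N - 0)) ≤ nbhd n (p, m + 1)) this
          refine sup_le_sup le_rfl ?_
          rw [Ideal.span_singleton_le_iff_mem, Ideal.mem_span_singleton']
          refine ⟨algebraMap _ _ (hbar ^ (N - 1)), ?_⟩
          rw [← map_mul, ← pow_add]
          congr 2
          simp only []
          omega
        · exact hbar_smul_mem _ (hT b (by omega) a' (by omega) _ _ _ _)
      · obtain ⟨r, hr, hs⟩ := RshiftCoeff_eq (halfHC n) (PowerSeries.C (1 / 2 : ℂ)) rfl N d x (j, l)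
        rw [hr]
        exact right_term_mem (by omega) _ hs _ _ _ _ fun he => by omega
  have hmain := sub_mem hrel (sum_mem hrest)
  rw [add_sub_cancel_right] at hmain
  simp only [RshiftCoeff_zero_zero, Matrix.one_apply, ite_mul, mul_ite, one_mul, mul_one, zero_mul,
    mul_zero, Finset.sum_ite_eq, Finset.sum_ite_eq', Finset.mem_univ, if_true] at hmain
  rw [Lplus_neg _ (by omega), Lminus_nat, neg_neg,
    show ((S + 1 : ℕ) : ℤ) - 1 = S by push_cast; ring] at hmain
  have h2 : hbar ^ 2 • (freeL k l (-(T : ℤ) - 1) * freeL i j (S : ℤ)) ∈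
      divTwo (nbhd n (p, m + 1)) :=
    mem_divTwo_of_eq _ (by
      rw [map_mul]
      exact Ideal.mul_mem_left _ _ (J_le_nbhd (p, m + 1)
        (freeL_mem_J _ _ _ (by simp only []; omega)))) rfl
  have h3 := sub_mem h2 hmain
  have h4 : hbar ^ 2 • (freeL i j (S : ℤ) * freeL k l (-(T : ℤ) - 1)) ∈
      divTwo (nbhd n (p, m + 1)) := by
    convert h3 using 1
    split_ifs <;> simp [smul_smul, pow_two, mul_add, add_mul] <;> abel
  exact exists_of_sub_mem _ _ h4

theorem mixed_all (n T : ℕ) : ∀ m p : ℕ, ∃ q : ℕ, ∀ t < T, ∀ S : ℕ, q ≤ S → ∀ i j k l : Fin n,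
    toBar n (freeL i j S * freeL k l (-(t : ℤ) - 1)) ∈ nbhd n (p, m) := by
  induction T with
  | zero => exact fun m p => ⟨0, fun t ht => absurd ht (by omega)⟩
  | succ T ih =>
    have key : ∀ p m : ℕ, ∃ q : ℕ, ∀ S : ℕ, q ≤ S → ∀ i j k l : Fin n,
        toBar n (freeL i j S * freeL k l (-(T : ℤ) - 1)) ∈ nbhd n (p, m) := by
      intro p m
      induction m with
      | zero =>
        refine ⟨0, fun S _ i j k l => ?_⟩
        have := smul_mem_nbhd (p := p) (le_refl 0)
          (toBar n (freeL i j S * freeL k l (-(T : ℤ) - 1)))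
        simpa using this
      | succ m ihm =>
        obtain ⟨q1, h1⟩ := ihm
        obtain ⟨q2, h2⟩ := ih (m + 1) p
        refine ⟨max q1 q2 + p + T + m + 10, fun S hS i j k l => ?_⟩
        exact mixed_step (q := max q1 q2)
          (fun t ht S hS => h2 t ht S (le_trans (le_max_right _ _) hS))
          (fun S hS => h1 S (le_trans (le_max_left _ _) hS)) S hS i j k l
    intro m p
    obtain ⟨q1, h1⟩ := ih m p
    obtain ⟨q2, h2⟩ := key p m
    refine ⟨max q1 q2, fun t ht S hS => ?_⟩
    rcases Nat.lt_succ_iff_lt_or_eq.1 ht with h | rfl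
    · exact h1 t h S (le_trans (le_max_left _ _) hS)
    · exact h2 S (le_trans (le_max_right _ _) hS)

theorem nbhd_right_of_gen {n : ℕ} {x : DYbar n} {p m q : ℕ}
    (h : ∀ (i j : Fin n) (r : ℤ), (q : ℤ) ≤ r → toBar n (freeL i j r) * x ∈ nbhd n (p, m)) :
    ∀ y ∈ nbhd n (q, m), y * x ∈ nbhd n (p, m) := by
  intro y hy
  obtain ⟨a, ha, b, hb, rfl⟩ := Submodule.mem_sup.1 hy
  rw [add_mul]
  refine add_mem ?_ ?_
  · refine Submodule.span_induction (p := fun a _ => a * x ∈ nbhd n (p, m)) ?_ ?_ ?_ ?_ ha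
    · rintro _ ⟨i, j, r, hr, rfl⟩
      exact h i j r hr
    · simp
    · intro u v _ _ hu hv
      rw [add_mul]
      exact add_mem hu hv
    · intro c u _ hu
      rw [smul_eq_mul, mul_assoc]
      exact Ideal.mul_mem_left _ _ hu
  · obtain ⟨w, rfl⟩ := Ideal.mem_span_singleton'.1 hb
    rw [← Algebra.commutes, ← Algebra.smul_def, smul_mul_assoc]
    exact smul_mem_nbhd le_rfl _

/-- Right multiplication by a fixed element is continuous. -/
theorem nbhd_right (n : ℕ) (x : Free n) : ∀ s : ℕ × ℕ, ∃ s' : ℕ × ℕ,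
    ∀ y ∈ nbhd n s', y * toBar n x ∈ nbhd n s := by
  induction x using Free.induction with
  | scalar r =>
    refine fun s => ⟨s, fun y hy => ?_⟩
    rw [AlgHom.commutes, ← Algebra.commutes]
    exact Ideal.mul_mem_left _ _ hy
  | gen_c =>
    refine fun s => ⟨s, fun y hy => ?_⟩
    rw [toBar_freeC, mul_neg, ← Nat.cast_comm]
    exact neg_mem (Ideal.mul_mem_left _ _ hy)
  | gen_l k l r =>
      rintro ⟨p, m⟩
      rcases le_or_gt 0 r with hr | hr
      · obtain ⟨r, rfl⟩ := Int.eq_ofNat_of_zero_le hr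
        refine ⟨(p, m), nbhd_right_of_gen fun i j s hs => ?_⟩
        have := J_le_nbhd (p, m) (mul_plus_mem_J p r s hs i j k l)
        rwa [map_mul] at this
      · obtain ⟨t, rfl⟩ : ∃ t : ℕ, r = -(t : ℤ) - 1 := ⟨(-r - 1).toNat, by omega⟩
        obtain ⟨q, hq⟩ := mixed_all n (t + 1) m p
        refine ⟨(q, m), nbhd_right_of_gen fun i j s hs => ?_⟩
        obtain ⟨s, rfl⟩ := Int.eq_ofNat_of_zero_le (by omega : 0 ≤ s)
        have := hq t (by omega) s (by omega) i j k l
        rwa [map_mul] at this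
  | mul a b ha hb =>
    intro s
    obtain ⟨s1, h1⟩ := hb s
    obtain ⟨s2, h2⟩ := ha s1
    refine ⟨s2, fun y hy => ?_⟩
    rw [map_mul, ← mul_assoc]
    exact h1 _ (h2 y hy)
  | add a b ha hb =>
    intro s
    obtain ⟨s1, h1⟩ := ha s
    obtain ⟨s2, h2⟩ := hb s
    have mono : ∀ u v w z : ℕ, u ≤ w → v ≤ z → nbhd n (w, z) ≤ nbhd n (u, v) := by
      intro u v w z huw hvz
      refine sup_le_sup (Ideal.span_mono ?_) ?_
      · rintro _ ⟨i, j, r, hr, rfl⟩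
        refine ⟨i, j, r, ?_, rfl⟩
        simp only at hr ⊢
        omega
      · rw [Ideal.span_singleton_le_iff_mem, Ideal.mem_span_singleton']
        refine ⟨algebraMap _ _ (hbar ^ (z - v)), ?_⟩
        rw [← map_mul, ← pow_add]
        congr 2
        simp only []
        omega
    refine ⟨(max s1.1 s2.1, max s1.2 s2.2), fun y hy => ?_⟩
    rw [map_add, mul_add]
    exact add_mem (h1 _ (mono _ _ _ _ (le_max_left _ _) (le_max_left _ _) hy))
      (h2 _ (mono _ _ _ _ (le_max_right _ _) (le_max_right _ _) hy))

theorem nbhd_mono {n u v w z : ℕ} (huw : u ≤ w) (hvz : v ≤ z) : nbhd n (w, z) ≤ nbhd n (u, v) := by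
  refine sup_le_sup (Ideal.span_mono ?_) ?_
  · rintro _ ⟨i, j, r, hr, rfl⟩
    refine ⟨i, j, r, ?_, rfl⟩
    simp only at hr ⊢
    omega
  · rw [Ideal.span_singleton_le_iff_mem, Ideal.mem_span_singleton']
    refine ⟨algebraMap _ _ (hbar ^ (z - v)), ?_⟩
    rw [← map_mul, ← pow_add]
    congr 2
    simp only []
    omega

/-- The left ideals `J_p + h^m DY` are a basis of neighbourhoods of zero of a ring topology. -/
theorem nbhd_basis (n : ℕ) : RingSubgroupsBasis fun s : ℕ × ℕ => (nbhd n s).toAddSubgroup where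
  inter s t := ⟨(max s.1 t.1, max s.2 t.2), fun _ hx =>
    ⟨nbhd_mono (le_max_left _ _) (le_max_left _ _) hx,
      nbhd_mono (le_max_right _ _) (le_max_right _ _) hx⟩⟩
  mul s := ⟨s, by
    rintro _ ⟨a, -, b, hb, rfl⟩
    exact (nbhd n s).mul_mem_left a hb⟩
  leftMul x s := ⟨s, fun y hy => (nbhd n s).mul_mem_left x hy⟩
  rightMul x s := by
    obtain ⟨z, rfl⟩ := toBar_surjective n x
    exact nbhd_right n z s

/-- The topology with neighbourhoods of zero `J_p + h^m DY`. -/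
noncomputable instance (n : ℕ) : TopologicalSpace (DYbar n) := (nbhd_basis n).topology

instance (n : ℕ) : NonarchimedeanRing (DYbar n) := (nbhd_basis n).nonarchimedean

noncomputable instance (n : ℕ) : UniformSpace (DYbar n) :=
  IsTopologicalAddGroup.rightUniformSpace (DYbar n)

instance (n : ℕ) : IsUniformAddGroup (DYbar n) := isUniformAddGroup_of_addCommGroup

/-- The completed Yangian double at the critical level: the inverse limit of the quotients of `DYbar n` by
the left ideals `J_p + h^m DY`, i.e. the inverse limit over `p` of the `h`-adically completed
quotients by `J_p`, with the multiplication extended by continuity. -/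
abbrev DYcr (n : ℕ) : Type := UniformSpace.Completion (DYbar n)

/-- The canonical homomorphism from the free algebra to the completed Yangian double. -/
noncomputable def toCr (n : ℕ) : Free n →+* DYcr n :=
  UniformSpace.Completion.coeRingHom.comp (toBar n).toRingHom

/-- The `m`-th term `binom(s+m, s) a^m L^-_{s+m}` of the coefficient of `u^s` in `L^-(u + a)`. -/
noncomputable def LminusShiftTerm (n : ℕ) (a : Scalars) (s m : ℕ) (i j : Fin n) : DYcr n :=
  toCr n ((((s + m).choose s : Scalars) * a ^ m) • Lminus n ((s + m : ℕ) : ℤ) i j)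

/-- The coefficient of `u^s` in the matrix `L^-(u + a)`. -/
noncomputable def LminusShift (n : ℕ) (a : Scalars) (s : ℕ) : Matrix (Fin n) (Fin n) (DYcr n) :=
  Matrix.of fun i j => ∑' m, LminusShiftTerm n a s m i j

/-- For `a ∈ h ℂ[[h]]` the sums defining `L^-(u + a)` converge. -/
theorem summable_LminusShiftTerm (n : ℕ) (b : Scalars) (s : ℕ) (i j : Fin n) :
    Summable fun m => LminusShiftTerm n (b * hbar) s m i j := by
  apply NonarchimedeanAddGroup.summable_of_tendsto_cofinite_zero
  rw [Nat.cofinite_eq_atTop]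
  have h0 : Filter.Tendsto (fun m => toBar n ((((s + m).choose s : Scalars) * (b * hbar) ^ m) •
      Lminus n ((s + m : ℕ) : ℤ) i j)) Filter.atTop (nhds 0) := by
    rw [(nbhd_basis n).hasBasis_nhds_zero.tendsto_right_iff]
    rintro ⟨p, q⟩ -
    filter_upwards [Filter.eventually_ge_atTop q] with m hm
    have : (((s + m).choose s : Scalars) * (b * hbar) ^ m) • Lminus n ((s + m : ℕ) : ℤ) i j =
        hbar ^ m • ((((s + m).choose s : Scalars) * b ^ m) • Lminus n ((s + m : ℕ) : ℤ) i j) := by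
      rw [smul_smul]
      congr 1
      ring
    rw [this, map_smul]
    exact smul_mem_nbhd hm _
  have h1 := (UniformSpace.Completion.continuous_coe (DYbar n)).tendsto 0
  exact h1.comp h0

/-- The series `L^+(u + a)` in `u^{-1}`. -/
noncomputable def LplusShift (n : ℕ) (a : Scalars) : PowerSeries (Matrix (Fin n) (Fin n) (DYcr n)) :=
  PowerSeries.mk fun N => (shiftInv a (fun k => Lplus n (-(k : ℤ))) N).map (toCr n)

/-- The inverse `L^+(u + a)^{-1}`, a series in `u^{-1}`. -/
noncomputable def LplusShiftInv (n : ℕ) (a : Scalars) :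
    PowerSeries (Matrix (Fin n) (Fin n) (DYcr n)) :=
  PowerSeries.invOfUnit (LplusShift n a) 1

theorem constantCoeff_LplusShift (n : ℕ) (a : Scalars) :
    PowerSeries.constantCoeff (LplusShift n a) = 1 := by
  rw [LplusShift, ← PowerSeries.coeff_zero_eq_constantCoeff_apply, PowerSeries.coeff_mk]
  ext i j
  simp only [shiftInv, Matrix.map_apply]
  simp [Lplus_zero, Matrix.one_apply, apply_ite (toCr n)]

theorem LplusShift_mul_inv (n : ℕ) (a : Scalars) :
    LplusShift n a * LplusShiftInv n a = 1 ∧ LplusShiftInv n a * LplusShift n a = 1 :=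
  ⟨PowerSeries.mul_invOfUnit _ _ (constantCoeff_LplusShift n a),
    PowerSeries.invOfUnit_mul _ _ (constantCoeff_LplusShift n a)⟩

/-- `M_a`: the matrix `M` acting in the `a`-th of `k` tensor copies of `ℂ^n`; the basis vectors of
`(ℂ^n)^{⊗ k}` are indexed by functions `Fin k → Fin n`. -/
def inCopy {n k : ℕ} {D : Type*} [Ring D] (a : Fin k) (M : Matrix (Fin n) (Fin n) D) :
    Matrix (Fin k → Fin n) (Fin k → Fin n) D :=
  Matrix.of fun I K => if ∀ b, b ≠ a → I b = K b then M (I a) (K a) else 0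

/-- The antisymmetrizer `A_k = (1/k!) ∑_σ sgn(σ) σ` on `(ℂ^n)^{⊗ k}`, where
`σ (e_{K 1} ⊗ ⋯ ⊗ e_{K k}) = e_{K (σ⁻¹ 1)} ⊗ ⋯ ⊗ e_{K (σ⁻¹ k)}`. -/
noncomputable def antisymmetrizer (n k : ℕ) : Matrix (Fin k → Fin n) (Fin k → Fin n) (DYcr n) :=
  Matrix.of fun I K => toCr n (algebraMap Scalars (Free n) (PowerSeries.C
    ((1 / (Nat.factorial k : ℂ)) *
      ∑ σ : Equiv.Perm (Fin k), if I = K ∘ σ.symm then ((Equiv.Perm.sign σ : ℤ) : ℂ) else 0)))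

/-- `L_1^-(u_1) ⋯ L_k^-(u_k)` with `u_i = u + (i-1) h`, a series in `u`. -/
noncomputable def minusProduct (n k : ℕ) :
    PowerSeries (Matrix (Fin k → Fin n) (Fin k → Fin n) (DYcr n)) :=
  (List.ofFn fun a : Fin k =>
    PowerSeries.mk fun s => inCopy a (LminusShift n (((a : ℕ) : Scalars) * hbar) s)).prod

/-- `L_k^+(u_k + hn/2)^{-1} ⋯ L_1^+(u_1 + hn/2)^{-1}` with `u_i = u + (i-1) h`, a series
in `u^{-1}`. -/
noncomputable def plusProduct (n k : ℕ) :
    PowerSeries (Matrix (Fin k → Fin n) (Fin k → Fin n) (DYcr n)) :=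
  (List.ofFn fun a : Fin k => PowerSeries.mk fun N => inCopy a (PowerSeries.coeff N
    (LplusShiftInv n (((a : ℕ) : Scalars) * hbar + PowerSeries.C ((n : ℂ) / 2) * hbar)))).reverse.prod

/-- The contribution to `tr A_k L_1^-(u_1) ⋯ L_k^-(u_k) L_k^+(u_k + hn/2)^{-1} ⋯ L_1^+(u_1 + hn/2)^{-1}`
of the coefficient of `u^s` in the `L^-` part and of `u^{-t}` in the `L^+` part, `p = (s, t)`. -/
noncomputable def ellTerm (n k : ℕ) (p : ℕ × ℕ) : DYcr n :=
  Matrix.trace (antisymmetrizer n k * PowerSeries.coeff p.1 (minusProduct n k) *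
    PowerSeries.coeff p.2 (plusProduct n k))

/-- The coefficient of `u^N`, `N ∈ ℤ`, in `ℓ_k(u)`. -/
noncomputable def ellCoeff (n k : ℕ) (N : ℤ) : DYcr n :=
  ∑' p : {p : ℕ × ℕ // (p.1 : ℤ) - (p.2 : ℤ) = N}, ellTerm n k p

end YangianDouble

/-!
The coefficients `ℓ_{k,N}` are shown to converge and to commute with the generators by letting the algebra
act on its quotients by open left ideals.

**The algebraic core.** Let `L₀` be one of the matrices `L^±(v)`, acting on an auxiliary copy of `ℂⁿ`, and
let `T = L₁^-(u₁) ⋯ L_k^-(u_k) L_k^+(u_k + h n / 2)⁻¹ ⋯ L₁^+(u₁ + h n / 2)⁻¹`. The defining relations move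
`L₀` through `T`. Between a factor `L^-` and its inverse partner `L^+` the `R`-matrices cancel, and
`L₀ T = (∏ R_a) T (∏ R'_a) L₀` remains, where `R_a` and `R'_a` are scalar operators in the `a`-th tensor copy
and the auxiliary space (`scalar_mul_prod_exchange`). Since `u_{a+1} = u_a + h`, neighbouring factors satisfy
an exchange relation with `1 - P` (`cross_minus`, `cross_plus`), so that the antisymmetrized product `A T`
is antisymmetric from the right too (`signSum_mul_prod_mul_signSum`); for the same reason `A` reverses
the order of the products of the `R_a` and of the `R'_a` (`signSum_mul_prod_rMat`). In the reversed order the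
partial transposes of `R_a` and `R'_a` are adjacent, and at the critical level they are inverse to each
other: this is where the functional equation `f(u - n h) = (1 - h² u⁻²) f(u)` enters
(`nilEval_normCoeff_functional`). Hence they disappear from the trace (`trace_collapse`), and `L₀`
commutes with `tr A T` (`commute_trace_of_exchange`, and its two cases `commute_trace_plus` and
`commute_trace_minus`).

**Torsion.** As `L^± = 1 + h X^±`, the argument above only shows that `h` times a generator commutes with
`ℓ_{k,N}`, and it is not clear that the completed algebra has no `h`-torsion. Therefore a central element
`ε` with `ε² = h ε` is adjoined, and `L₀ = 1 + ε X₀` is used in place of `1 + h X₀`. The relations between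
`L₀` and `L^±`, with `ε` in place of `h` in the `R`-matrices, are consequences of the defining
relations divided by `h`, which hold because the algebra before completion has no `h`-torsion
(`eval_eq_zero_of_coeff_zero`, `relations_of_hom`). The `ε`-part of the commutator of `L₀` with `ℓ_{k,N}` is
then the commutator of the generators themselves (`plusValue_layerUnit`, `minusValue_layerUnit`).

**Convergence of the series.** On the quotient `W` of the completed algebra by the closure of `J_p + h^m DY`
(`OpenQuotient`) the element `h` is nilpotent, and each vector is annihilated by almost all `l_{ij}^{(r)}`
with `r ≥ 0`. The argument `v` of `L₀` is replaced by a nilpotent variable `z` or by its inverse, which leads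
to the module `V = (W ⊕ ε W)[z] / z^R` (`Layers`). Then all the parameters `ε / (u - v)` are nilpotent, the
`R`-matrices are finite sums over the Laurent polynomials in `u`, the series `L^+(u)⁻¹` acts on
`V[u, u⁻¹]`, the series `L^-(u)` acts on `V((u))`, and `tr A T` maps the first module to the second
(`twoSidedTrace`). Taking coefficients gives `ℓ_{k,N}` as a finite sum on each vector, commuting with the
generators (`apply_pairSum`, `smul_rawTerm_commute`). As the open left ideals form a basis of
neighbourhoods of `0` and have intersection `0`, the series for `ℓ_{k,N}` converges (`summable_ellTerm`) and
commutes with the generators (`generator_commute_ellCoeff`); being central is a closed condition, so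
`ℓ_{k,N}` is central (`ellCoeff_mem_center`).
-/

/-! ### Operators on tensor copies -/

namespace YangianDouble

open Matrix

section Copies

variable {n k : ℕ} {B : Type*} [Ring B]

theorem inCopy_mul_apply (a : Fin k) (M : Matrix (Fin n) (Fin n) B)
    (Z : Matrix (Fin k → Fin n) (Fin k → Fin n) B) (I K : Fin k → Fin n) :
    (inCopy a M * Z) I K = ∑ j, M (I a) j * Z (Function.update I a j) K := by
  rw [Matrix.mul_apply]
  symm
  refine Finset.sum_of_injOn (fun j => Function.update I a j) ?_ ?_ ?_ ?_
  · intro x _ y _ h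
    simpa using congrFun h a
  · simp
  · intro J _ hJ
    have : ¬ ∀ b, b ≠ a → I b = J b := by
      intro h
      refine hJ ⟨J a, by simp, ?_⟩
      funext b
      by_cases hb : b = a
      · subst hb; simp
      · simp [hb, h b hb]
    simp [inCopy, this]
  · intro j _
    have : ∀ b, b ≠ a → I b = Function.update I a j b := fun b hb => by simp [hb]
    simp only [inCopy, Matrix.of_apply]
    rw [if_pos this]
    simp

/-- Acting in the `a`-th tensor copy, as a ring homomorphism. -/
def inCopyHom (n : ℕ) {k : ℕ} (B : Type*) [Ring B] (a : Fin k) :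
    Matrix (Fin n) (Fin n) B →+* Matrix (Fin k → Fin n) (Fin k → Fin n) B where
  toFun := inCopy a
  map_zero' := by ext; simp [inCopy]
  map_add' M N := by ext I K; simp only [inCopy, Matrix.of_apply, Matrix.add_apply]; split_ifs <;> simp
  map_one' := by
    ext I K
    simp only [inCopy, Matrix.of_apply, Matrix.one_apply]
    by_cases h : I = K
    · subst h; simp
    · rw [if_neg h]
      split_ifs with h1 h2
      · refine absurd (funext fun b => ?_) h
        by_cases hb : b = a
        · rw [hb, h2]
        · exact h1 b hb
      · rfl
      · rfl
  map_mul' M N := by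
    ext I K
    rw [inCopy_mul_apply]
    have : ∀ j, (∀ b, b ≠ a → Function.update I a j b = K b) ↔ (∀ b, b ≠ a → I b = K b) := by
      intro j
      refine forall_congr' fun b => forall_congr' fun hb => ?_
      simp [hb]
    simp only [inCopy, Matrix.of_apply, this, Function.update_self]
    split_ifs with h
    · rw [Matrix.mul_apply]
    · simp

theorem inCopyHom_apply (a : Fin k) (M : Matrix (Fin n) (Fin n) B) :
    inCopyHom n B a M = inCopy a M := rfl

theorem inCopy_mul (a : Fin k) (M N : Matrix (Fin n) (Fin n) B) :
    inCopy a (M * N) = inCopy a M * inCopy a N := (inCopyHom n B a).map_mul M N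

theorem inCopy_scalar (a : Fin k) (x : B) :
    inCopy a (Matrix.scalar (Fin n) x) = Matrix.scalar (Fin k → Fin n) x := by
  ext I K
  simp only [inCopy, Matrix.of_apply, Matrix.scalar_apply, Matrix.diagonal_apply]
  by_cases h : I = K
  · subst h; simp
  · rw [if_neg h]
    split_ifs with h1 h2
    · refine absurd (funext fun b => ?_) h
      by_cases hb : b = a
      · rw [hb, h2]
      · exact h1 b hb
    · rfl
    · rfl

theorem inCopy_map {B' : Type*} [Ring B'] (f : B →+* B') (a : Fin k) (M : Matrix (Fin n) (Fin n) B) :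
    (inCopy a M).map f = inCopy a (M.map f) := by
  ext I K
  simp only [inCopy, Matrix.of_apply, Matrix.map_apply]
  split_ifs <;> simp

theorem inCopy_mul_inCopy_apply {a b : Fin k} (hab : a ≠ b) (M N : Matrix (Fin n) (Fin n) B)
    (I K : Fin k → Fin n) : (inCopy a M * inCopy b N) I K =
      if ∀ c, c ≠ a → c ≠ b → I c = K c then M (I a) (K a) * N (I b) (K b) else 0 := by
  rw [inCopy_mul_apply, Finset.sum_eq_single (K a)]
  · simp only [inCopy, Matrix.of_apply, Function.update_of_ne hab.symm]
    have : (∀ c, c ≠ b → Function.update I a (K a) c = K c) ↔ (∀ c, c ≠ a → c ≠ b → I c = K c) := by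
      constructor
      · intro h c h1 h2
        simpa [h1] using h c h2
      · intro h c h2
        by_cases h1 : c = a
        · subst h1; simp
        · simpa [h1] using h c h1 h2
    simp only [this]
    split_ifs <;> simp
  · intro j _ hj
    have : ¬ ∀ c, c ≠ b → Function.update I a j c = K c := fun h => hj (by simpa using h a hab)
    simp [inCopy, this]
  · simp

theorem inCopy_commute {a b : Fin k} (hab : a ≠ b) {M N : Matrix (Fin n) (Fin n) B}
    (h : ∀ i j i' j', Commute (M i j) (N i' j')) : Commute (inCopy a M) (inCopy b N) := by
  ext I K
  rw [inCopy_mul_inCopy_apply hab, inCopy_mul_inCopy_apply hab.symm, (h _ _ _ _).eq]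
  congr 1
  exact propext ⟨fun h c h1 h2 => h c h2 h1, fun h c h1 h2 => h c h2 h1⟩

/-- The permutation `σ` of the tensor copies. -/
def permMat (n : ℕ) {k : ℕ} (B : Type*) [Ring B] (σ : Equiv.Perm (Fin k)) :
    Matrix (Fin k → Fin n) (Fin k → Fin n) B :=
  Matrix.of fun I K => if I = K ∘ σ.symm then 1 else 0

theorem permMat_mul_apply (σ : Equiv.Perm (Fin k)) (Z : Matrix (Fin k → Fin n) (Fin k → Fin n) B)
    (I K : Fin k → Fin n) : (permMat n B σ * Z) I K = Z (I ∘ σ) K := by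
  rw [Matrix.mul_apply, Finset.sum_eq_single (I ∘ σ)]
  · have : I = (I ∘ σ) ∘ σ.symm := by funext b; simp
    simp only [permMat, Matrix.of_apply]
    rw [if_pos this, one_mul]
  · intro J _ hJ
    have : ¬ I = J ∘ σ.symm := by
      rintro rfl
      apply hJ
      funext b; simp
    simp [permMat, this]
  · simp

theorem mul_permMat_apply (σ : Equiv.Perm (Fin k)) (Z : Matrix (Fin k → Fin n) (Fin k → Fin n) B)
    (I K : Fin k → Fin n) : (Z * permMat n B σ) I K = Z I (K ∘ σ.symm) := by
  rw [Matrix.mul_apply, Finset.sum_eq_single (K ∘ σ.symm)]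
  · simp [permMat]
  · intro J _ hJ
    simp [permMat, hJ]
  · simp

theorem permMat_mul (σ τ : Equiv.Perm (Fin k)) :
    permMat n B (σ * τ) = permMat n B σ * permMat n B τ := by
  ext I K
  rw [permMat_mul_apply]
  simp only [permMat, Matrix.of_apply]
  congr 1
  refine propext ⟨?_, ?_⟩
  · rintro rfl
    funext b; simp [Equiv.Perm.mul_def]
  · intro h
    funext b
    simpa [Equiv.Perm.mul_def] using congrFun h (σ.symm b)

theorem permMat_one : permMat n B (1 : Equiv.Perm (Fin k)) = 1 := by
  ext I K
  simp only [permMat, Matrix.of_apply, Matrix.one_apply]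
  rfl

theorem permMat_mul_inCopy (σ : Equiv.Perm (Fin k)) (a : Fin k) (M : Matrix (Fin n) (Fin n) B) :
    permMat n B σ * inCopy a M = inCopy (σ a) M * permMat n B σ := by
  ext I K
  rw [permMat_mul_apply, mul_permMat_apply]
  simp only [inCopy, Matrix.of_apply, Function.comp_apply, Equiv.symm_apply_apply]
  congr 1
  refine propext ⟨?_, ?_⟩
  · intro h b hb
    have := h (σ.symm b) (by rintro rfl; simp at hb)
    simpa using this
  · intro h b hb
    have := h (σ b) (by simpa using hb)
    simpa using this

/-- `∑_σ sgn(σ) σ`. -/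
def signSum (n k : ℕ) (B : Type*) [Ring B] : Matrix (Fin k → Fin n) (Fin k → Fin n) B :=
  ∑ σ : Equiv.Perm (Fin k), (Equiv.Perm.sign σ : ℤ) • permMat n B σ

theorem signSum_mul_permMat (τ : Equiv.Perm (Fin k)) :
    signSum n k B * permMat n B τ = (Equiv.Perm.sign τ : ℤ) • signSum n k B := by
  rw [signSum, Finset.sum_mul, Finset.smul_sum, ← Equiv.sum_comp (Equiv.mulRight τ)
    (fun σ : Equiv.Perm (Fin k) => (Equiv.Perm.sign τ : ℤ) • (Equiv.Perm.sign σ : ℤ) • permMat n B σ)]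
  refine Finset.sum_congr rfl fun σ _ => ?_
  rw [Equiv.coe_mulRight, permMat_mul, smul_mul_assoc, smul_smul]
  congr 1
  rcases Int.units_eq_one_or (Equiv.Perm.sign τ) with h | h <;> simp [h]

theorem permMat_mul_signSum (τ : Equiv.Perm (Fin k)) :
    permMat n B τ * signSum n k B = (Equiv.Perm.sign τ : ℤ) • signSum n k B := by
  rw [signSum, Finset.mul_sum, Finset.smul_sum, ← Equiv.sum_comp (Equiv.mulLeft τ)
    (fun σ : Equiv.Perm (Fin k) => (Equiv.Perm.sign τ : ℤ) • (Equiv.Perm.sign σ : ℤ) • permMat n B σ)]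
  refine Finset.sum_congr rfl fun σ _ => ?_
  rw [Equiv.coe_mulLeft, permMat_mul, mul_smul_comm, smul_smul]
  congr 1
  rcases Int.units_eq_one_or (Equiv.Perm.sign τ) with h | h <;> simp [h]

theorem signSum_mul_signSum :
    signSum n k B * signSum n k B = (k.factorial : ℤ) • signSum n k B := by
  nth_rewrite 1 [signSum]
  rw [Finset.sum_mul]
  have : ∀ σ ∈ (Finset.univ : Finset (Equiv.Perm (Fin k))),
      ((Equiv.Perm.sign σ : ℤ) • permMat n B σ) * signSum n k B = signSum n k B := by
    intro σ _
    rw [smul_mul_assoc, permMat_mul_signSum, smul_smul]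
    rcases Int.units_eq_one_or (Equiv.Perm.sign σ) with h | h <;> simp [h]
  rw [Finset.sum_congr rfl this, Finset.sum_const, Finset.card_univ, Fintype.card_perm,
    Fintype.card_fin, ← Nat.cast_smul_eq_nsmul ℤ]

/-- A matrix which is antisymmetric on the right under adjacent transpositions is antisymmetric under
all permutations. -/
theorem mul_permMat_of_adjacent {X : Matrix (Fin k → Fin n) (Fin k → Fin n) B}
    (h : ∀ a b : Fin k, (b : ℕ) = a + 1 → X * permMat n B (Equiv.swap a b) = -X)
    (σ : Equiv.Perm (Fin k)) : X * permMat n B σ = (Equiv.Perm.sign σ : ℤ) • X := by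
  rcases k with _ | k
  · rw [Subsingleton.elim σ 1, permMat_one]; simp
  have hσ : σ ∈ Submonoid.closure
      (Set.range fun i : Fin k => Equiv.swap i.castSucc i.succ) := by
    rw [Equiv.Perm.mclosure_swap_castSucc_succ]; trivial
  induction hσ using Submonoid.closure_induction with
  | mem x hx =>
    obtain ⟨i, rfl⟩ := hx
    have h1 := h i.castSucc i.succ (by simp)
    simp only [h1]
    rw [Equiv.Perm.sign_swap (Fin.castSucc_lt_succ).ne]
    simp
  | one => rw [permMat_one]; simp
  | mul x y _ _ hx hy =>
    rw [permMat_mul, ← mul_assoc, hx, smul_mul_assoc, hy, smul_smul, Equiv.Perm.sign_mul]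
    simp

theorem mul_signSum_of_adjacent {X : Matrix (Fin k → Fin n) (Fin k → Fin n) B}
    (h : ∀ a b : Fin k, (b : ℕ) = a + 1 → X * permMat n B (Equiv.swap a b) = -X) :
    X * signSum n k B = (k.factorial : ℤ) • X := by
  rw [signSum, Finset.mul_sum]
  have : ∀ σ ∈ (Finset.univ : Finset (Equiv.Perm (Fin k))),
      X * ((Equiv.Perm.sign σ : ℤ) • permMat n B σ) = X := by
    intro σ _
    rw [mul_smul_comm, mul_permMat_of_adjacent h, smul_smul]
    rcases Int.units_eq_one_or (Equiv.Perm.sign σ) with h | h <;> simp [h]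
  rw [Finset.sum_congr rfl this, Finset.sum_const, Finset.card_univ, Fintype.card_perm,
    Fintype.card_fin, ← Nat.cast_smul_eq_nsmul ℤ]

theorem signSum_map {B' : Type*} [Ring B'] (f : B →+* B') :
    (signSum n k B).map f = signSum n k B' := by
  ext I K
  simp only [signSum, Matrix.map_apply, Matrix.sum_apply, Matrix.smul_apply, permMat, Matrix.of_apply,
    map_sum, map_zsmul, apply_ite f, map_one, map_zero]

theorem permMat_commute_scalar (σ : Equiv.Perm (Fin k)) (x : B) :
    Commute (permMat n B σ) (Matrix.scalar (Fin k → Fin n) x) := by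
  ext I K
  rw [permMat_mul_apply, mul_permMat_apply]
  simp only [Matrix.scalar_apply, Matrix.diagonal_apply]
  congr 1
  refine propext ⟨?_, ?_⟩
  · rintro rfl; funext b; simp
  · rintro rfl; funext b; simp

theorem signSum_commute_scalar (x : B) :
    Commute (signSum n k B) (Matrix.scalar (Fin k → Fin n) x) :=
  Commute.sum_left _ _ _ fun σ _ => (permMat_commute_scalar σ x).smul_left _

theorem trace_signSum_mul_comm (X : Matrix (Fin k → Fin n) (Fin k → Fin n) B) :
    Matrix.trace (signSum n k B * X) = Matrix.trace (X * signSum n k B) := by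
  rw [signSum, Finset.sum_mul, Finset.mul_sum, Matrix.trace_sum, Matrix.trace_sum]
  refine Finset.sum_congr rfl fun σ _ => ?_
  rw [smul_mul_assoc, mul_smul_comm, Matrix.trace_smul, Matrix.trace_smul]
  congr 1
  simp only [Matrix.trace, Matrix.diag, permMat_mul_apply, mul_permMat_apply]
  refine Fintype.sum_equiv (Equiv.arrowCongr σ.symm (Equiv.refl _)) _ _ fun I => ?_
  congr 1
  funext b
  simp [Equiv.arrowCongr]

theorem prod_inCopy_apply (M : Fin k → Matrix (Fin n) (Fin n) B) (l : List (Fin k)) (hl : l.Nodup)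
    (I K : Fin k → Fin n) : (l.map fun a => inCopy a (M a)).prod I K =
      if ∀ c, c ∉ l → I c = K c then (l.map fun a => M a (I a) (K a)).prod else 0 := by
  induction l generalizing I with
  | nil =>
    simp only [List.map_nil, List.prod_nil, List.not_mem_nil, not_false_eq_true, forall_true_left,
      Matrix.one_apply]
    congr 1
    exact propext funext_iff
  | cons a l ih =>
    rw [List.nodup_cons] at hl
    rw [List.map_cons, List.prod_cons, inCopy_mul_apply, Finset.sum_eq_single (K a)]
    · rw [ih hl.2]
      have h1 : (∀ c, c ∉ l → Function.update I a (K a) c = K c) ↔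
          (∀ c, c ∉ a :: l → I c = K c) := by
        constructor
        · intro h c hc
          rw [List.mem_cons, not_or] at hc
          simpa [hc.1] using h c hc.2
        · intro h c hc
          by_cases hca : c = a
          · subst hca; simp
          · simpa [hca] using h c (by simp [hca, hc])
      have h2 : (l.map fun b => M b (Function.update I a (K a) b) (K b)) =
          l.map fun b => M b (I b) (K b) := by
        refine List.map_congr_left fun b hb => ?_
        rw [Function.update_of_ne]
        rintro rfl
        exact hl.1 hb
      simp only [h1, h2, List.map_cons, List.prod_cons]
      split_ifs <;> simp
    · intro j _ hj
      rw [ih hl.2, if_neg, mul_zero]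
      intro h
      exact hj (by simpa using h a hl.1)
    · simp

theorem transpose_prod_inCopy (M : Fin k → Matrix (Fin n) (Fin n) B) (l : List (Fin k))
    (hl : l.Nodup) : (l.map fun a => inCopy a (M a)).prodᵀ =
      (l.map fun a => inCopy a (M a)ᵀ).prod := by
  ext I K
  rw [Matrix.transpose_apply, prod_inCopy_apply _ _ hl, prod_inCopy_apply _ _ hl]
  simp only [Matrix.transpose_apply]
  congr 1
  exact propext ⟨fun h c hc => (h c hc).symm, fun h c hc => (h c hc).symm⟩

end Copies

end YangianDouble

/-! ### Moving an operator through a list of factors -/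

namespace YangianDouble

open Matrix

section Lists

variable {R ι : Type*}

theorem prod_map_mul_prod_map_of_commute [Monoid R] (x : R) (f : ι → R) (l : List ι)
    (h : ∀ b ∈ l, Commute x (f b)) : Commute x (l.map f).prod := by
  refine Commute.list_prod_right _ _ fun y hy => ?_
  obtain ⟨b, hb, rfl⟩ := List.mem_map.1 hy
  exact h b hb

/-- Moving `x` to the right through a product of elements with which it commutes up to the factors
`p a` on the left and `q a` on the right. -/
theorem mul_prod_exchange [Monoid R] (x : R) (p q m : ι → R) (l : List ι) (hl : l.Nodup)
    (h : ∀ a, x * m a = p a * m a * x * q a)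
    (hp : ∀ a b, a ≠ b → Commute (p a) (m b)) (hq : ∀ a b, a ≠ b → Commute (q a) (m b)) :
    x * (l.map m).prod = (l.map p).prod * (l.map m).prod * x * (l.reverse.map q).prod := by
  induction l with
  | nil => simp
  | cons a l ih =>
    rw [List.nodup_cons] at hl
    have hne : ∀ b ∈ l, a ≠ b := fun b hb hab => hl.1 (hab ▸ hb)
    have h1 : Commute (q a) (l.map m).prod :=
      prod_map_mul_prod_map_of_commute _ _ _ fun b hb => hq a b (hne b hb)
    have h2 : Commute (m a) (l.map p).prod :=
      prod_map_mul_prod_map_of_commute _ _ _ fun b hb => (hp b a (hne b hb).symm).symm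
    simp only [List.map_cons, List.prod_cons, List.reverse_cons, List.map_append, List.prod_append,
      List.map_nil, List.prod_nil, mul_one]
    calc x * (m a * (l.map m).prod) = x * m a * (l.map m).prod := by rw [mul_assoc]
      _ = p a * m a * x * (q a * (l.map m).prod) := by rw [h]; simp only [mul_assoc]
      _ = p a * m a * (x * (l.map m).prod) * q a := by rw [h1.eq]; simp only [mul_assoc]
      _ = p a * (m a * (l.map p).prod) * (l.map m).prod * x * (l.reverse.map q).prod * q a := by
        rw [ih hl.2]; simp only [mul_assoc]
      _ = _ := by rw [h2.eq]; simp only [mul_assoc]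

/-- Moving `x` through a product with the factors `q a` between them, which turn into `r a`. -/
theorem mul_prod_mul_prod_exchange [Monoid R] (x : R) (q r m : ι → R) (l : List ι) (hl : l.Nodup)
    (h : ∀ a, x * q a * m a = m a * r a * x)
    (hq : ∀ a b, a ≠ b → Commute (q a) (m b)) (hr : ∀ a b, a ≠ b → Commute (r a) (m b)) :
    x * (l.map q).prod * (l.map m).prod = (l.map m).prod * (l.map r).prod * x := by
  induction l with
  | nil => simp
  | cons a l ih =>
    rw [List.nodup_cons] at hl
    have hne : ∀ b ∈ l, a ≠ b := fun b hb hab => hl.1 (hab ▸ hb)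
    have h1 : Commute (m a) (l.map q).prod :=
      prod_map_mul_prod_map_of_commute _ _ _ fun b hb => (hq b a (hne b hb).symm).symm
    have h2 : Commute (r a) (l.map m).prod :=
      prod_map_mul_prod_map_of_commute _ _ _ fun b hb => hr a b (hne b hb)
    simp only [List.map_cons, List.prod_cons]
    calc x * (q a * (l.map q).prod) * (m a * (l.map m).prod)
        = x * q a * ((l.map q).prod * m a) * (l.map m).prod := by simp only [mul_assoc]
      _ = x * q a * m a * (l.map q).prod * (l.map m).prod := by rw [← h1.eq]; simp only [mul_assoc]
      _ = m a * r a * (x * (l.map q).prod * (l.map m).prod) := by rw [h]; simp only [mul_assoc]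
      _ = m a * (r a * (l.map m).prod) * (l.map r).prod * x := by
        rw [ih hl.2]; simp only [mul_assoc]
      _ = _ := by rw [h2.eq]; simp only [mul_assoc]

theorem prod_reverse_mul_prod [Monoid R] (f g : ι → R) (l : List ι) (h : ∀ a, f a * g a = 1) :
    (l.reverse.map f).prod * (l.map g).prod = 1 := by
  induction l with
  | nil => simp
  | cons a l ih =>
    simp only [List.map_cons, List.prod_cons, List.reverse_cons, List.map_append, List.prod_append,
      List.map_nil, List.prod_nil, mul_one]
    rw [mul_assoc, ← mul_assoc (f a), h, one_mul, ih]

theorem prod_map_smul {S : Type*} [CommMonoid S] [Monoid R] [MulAction S R] [IsScalarTower S R R]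
    [SMulCommClass S R R] (s : ι → S) (f : ι → R) (l : List ι) :
    (l.map fun a => s a • f a).prod = (l.map s).prod • (l.map f).prod := by
  induction l with
  | nil => simp
  | cons a l ih =>
    simp only [List.map_cons, List.prod_cons, ih, smul_mul_smul_comm]

theorem finRange_split {k : ℕ} (a b : Fin k) (h : (b : ℕ) = a + 1) :
    ∃ l₁ l₂, List.finRange k = l₁ ++ a :: b :: l₂ := by
  have ha : (a : ℕ) < (List.finRange k).length := by simp
  have hb : (b : ℕ) < (List.finRange k).length := by simp
  refine ⟨(List.finRange k).take a, (List.finRange k).drop (b + 1), ?_⟩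
  conv_lhs => rw [← List.take_append_drop a (List.finRange k)]
  rw [List.drop_eq_getElem_cons ha, ← h, List.drop_eq_getElem_cons hb]
  simp

theorem isChain_finRange (k : ℕ) : (List.finRange k).IsChain fun a b : Fin k => (b : ℕ) = a + 1 := by
  rw [List.isChain_iff_getElem]
  intro i hi
  simp

end Lists

section TwoSpaces

variable {n k : ℕ} {T : Type*} [Ring T]

/-- A matrix acting on a tensor copy, its entries being scalars in the auxiliary space:
an `n × n` matrix over the `n × n` matrices of the auxiliary space. -/
def outer (M : Matrix (Fin n) (Fin n) T) : Matrix (Fin n) (Fin n) (Matrix (Fin n) (Fin n) T) :=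
  M.map (Matrix.scalar (Fin n))

/-- A matrix acting on the auxiliary space. -/
def inner (M : Matrix (Fin n) (Fin n) T) : Matrix (Fin n) (Fin n) (Matrix (Fin n) (Fin n) T) :=
  Matrix.scalar (Fin n) M

/-- The permutation operator of a tensor copy and the auxiliary space. -/
def flipMat (n : ℕ) (T : Type*) [Ring T] : Matrix (Fin n) (Fin n) (Matrix (Fin n) (Fin n) T) :=
  Matrix.of fun i j => Matrix.single j i 1

theorem flipMat_map {T' : Type*} [Ring T'] (f : T →+* T') :
    (flipMat n T).map f.mapMatrix = flipMat n T' := by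
  ext i j p q
  simp [flipMat, Matrix.single_apply, apply_ite f]

theorem outer_map {T' : Type*} [Ring T'] (f : T →+* T') (M : Matrix (Fin n) (Fin n) T) :
    (outer M).map f.mapMatrix = outer (M.map f) := by
  ext i j p q
  simp [outer, Matrix.diagonal_apply, apply_ite f]

theorem inner_map {T' : Type*} [Ring T'] (f : T →+* T') (M : Matrix (Fin n) (Fin n) T) :
    (inner M).map f.mapMatrix = inner (M.map f) := by
  ext i j p q
  simp only [inner, Matrix.map_apply, RingHom.mapMatrix_apply, Matrix.scalar_apply,
    Matrix.diagonal_apply]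
  split_ifs <;> simp

theorem flip_mul_flip {a b : Fin k} (hab : a ≠ b) :
    inCopy a (flipMat n T) * inCopy b (flipMat n T) =
      permMat n _ (Equiv.swap a b) * inCopy a (flipMat n T) := by
  ext1 I K
  rw [inCopy_mul_inCopy_apply hab, permMat_mul_apply]
  simp only [flipMat, inCopy, Matrix.of_apply, Function.comp_apply, Equiv.swap_apply_left]
  by_cases h : I a = K b
  · have : (∀ c, c ≠ a → c ≠ b → I c = K c) ↔ (∀ c, c ≠ a → I (Equiv.swap a b c) = K c) := by
      constructor
      · intro H c hc
        by_cases hcb : c = b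
        · subst hcb; simpa using h
        · rw [Equiv.swap_apply_of_ne_of_ne hc hcb]; exact H c hc hcb
      · intro H c hc hcb
        have := H c hc
        rwa [Equiv.swap_apply_of_ne_of_ne hc hcb] at this
    simp only [this, h, Matrix.single_mul_single_same, mul_one]
  · have : ¬ (∀ c, c ≠ a → I (Equiv.swap a b c) = K c) := fun H => h (by
      have := H b hab.symm
      simpa using this)
    rw [if_neg this, Matrix.single_mul_single_of_ne _ _ _ _ h, ite_self]

theorem flip_mul_flip' {a b : Fin k} (hab : a ≠ b) :
    inCopy a (flipMat n T) * inCopy b (flipMat n T) =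
      inCopy b (flipMat n T) * permMat n _ (Equiv.swap a b) := by
  rw [flip_mul_flip hab, permMat_mul_inCopy, Equiv.swap_apply_left]

end TwoSpaces

section Scalars

variable {n k : ℕ} {S : Type*} [CommRing S]

/-- `1 + θ P` in the `a`-th copy and the auxiliary space. -/
def rMat (n : ℕ) {k : ℕ} (θ : Fin k → S) (a : Fin k) :
    Matrix (Fin k → Fin n) (Fin k → Fin n) (Matrix (Fin n) (Fin n) S) :=
  1 + θ a • inCopy a (flipMat n S)

theorem signSum_flip_flip {a b : Fin k} (hab : a ≠ b) :
    signSum n k _ * (inCopy a (flipMat n S) * inCopy b (flipMat n S)) =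
      -(signSum n k _ * inCopy a (flipMat n S)) := by
  rw [flip_mul_flip hab, ← mul_assoc, signSum_mul_permMat, Equiv.Perm.sign_swap hab]
  simp

theorem flip_flip_signSum {a b : Fin k} (hab : a ≠ b) :
    (inCopy b (flipMat n S) * inCopy a (flipMat n S)) * signSum n k _ =
      -(inCopy a (flipMat n S) * signSum n k _) := by
  rw [flip_mul_flip' hab.symm, mul_assoc, permMat_mul_signSum, Equiv.Perm.sign_swap hab.symm]
  simp

theorem signSum_flip_prod (θ : Fin k → S) (a : Fin k) (l : List (Fin k)) (ha : a ∉ l) :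
    signSum n k _ * inCopy a (flipMat n S) * (l.map (rMat n θ)).prod =
      (l.map fun b => 1 - θ b).prod • (signSum n k _ * inCopy a (flipMat n S)) := by
  induction l with
  | nil => simp
  | cons b l ih =>
    simp only [List.mem_cons, not_or] at ha
    have : signSum n k _ * inCopy a (flipMat n S) * rMat n θ b =
        (1 - θ b) • (signSum n k _ * inCopy a (flipMat n S)) := by
      rw [rMat, mul_add, mul_one, mul_smul_comm, mul_assoc (signSum n k _), signSum_flip_flip ha.1,
        sub_smul, one_smul, smul_neg, sub_eq_add_neg]
    rw [List.map_cons, List.prod_cons, ← mul_assoc, this, smul_mul_assoc, ih ha.2, smul_smul,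
      List.map_cons, List.prod_cons]

theorem prod_flip_signSum (θ : Fin k → S) (a : Fin k) (l : List (Fin k)) (ha : a ∉ l) :
    (l.reverse.map (rMat n θ)).prod * (inCopy a (flipMat n S) * signSum n k _) =
      (l.map fun b => 1 - θ b).prod • (inCopy a (flipMat n S) * signSum n k _) := by
  induction l with
  | nil => simp
  | cons b l ih =>
    simp only [List.mem_cons, not_or] at ha
    have : rMat n θ b * (inCopy a (flipMat n S) * signSum n k _) =
        (1 - θ b) • (inCopy a (flipMat n S) * signSum n k _) := by
      rw [rMat, add_mul, one_mul, smul_mul_assoc, ← mul_assoc, flip_flip_signSum ha.1,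
        sub_smul, one_smul, smul_neg, sub_eq_add_neg]
    rw [List.reverse_cons, List.map_append, List.prod_append, List.map_cons, List.prod_cons,
      List.map_nil, List.prod_nil, mul_one, mul_assoc, this, mul_smul_comm, ih ha.2, smul_smul,
      List.map_cons, List.prod_cons]

/-- The products of parameters that arise when the antisymmetrizer is multiplied by `∏ (1 + θ P)`
telescope. -/
theorem chain_prod (θ : Fin k → S) (c : S) (a : Fin k) (l : List (Fin k))
    (hc : (a :: l).IsChain fun a b => θ a * (1 - θ b) = θ b)
    (hlast : ∀ b, (a :: l).getLast? = some b → θ b = c) :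
    θ a * (l.map fun b => 1 - θ b).prod = c := by
  induction l generalizing a with
  | nil => simpa using hlast a (by simp)
  | cons b l ih =>
    rw [List.isChain_cons_cons] at hc
    rw [List.map_cons, List.prod_cons, ← mul_assoc, hc.1]
    exact ih b hc.2 fun x hx => hlast x (by rwa [List.getLast?_cons_cons])

/-- Multiplied by the antisymmetrizer, the ordered product of the operators `1 + θ P` becomes
affine linear, and symmetric, in the flips; only the last parameter survives. -/
theorem signSum_mul_prod (θ : Fin k → S) (c : S) (l : List (Fin k)) (hl : l.Nodup)
    (hc : l.IsChain fun a b => θ a * (1 - θ b) = θ b)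
    (hlast : ∀ b, l.getLast? = some b → θ b = c) :
    signSum n k _ * (l.map (rMat n θ)).prod =
      signSum n k _ * (1 + c • (l.map fun a => inCopy a (flipMat n S)).sum) := by
  induction l with
  | nil => simp
  | cons a l ih =>
    rw [List.nodup_cons] at hl
    have hl' : ∀ b, l.getLast? = some b → θ b = c := by
      intro b hb
      apply hlast
      cases l with
      | nil => simp at hb
      | cons x l => rwa [List.getLast?_cons_cons]
    rw [List.map_cons, List.prod_cons, ← mul_assoc]
    conv_lhs => rw [rMat]
    rw [mul_add, mul_one, add_mul, ih hl.2 hc.tail hl', mul_smul_comm, smul_mul_assoc,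
      signSum_flip_prod _ _ _ hl.1, smul_smul, chain_prod θ c a l hc hlast, List.map_cons,
      List.sum_cons, smul_add, mul_add, mul_add, mul_add]
    simp only [mul_smul_comm]
    abel

/-- The mirror image of `signSum_mul_prod`, with the same value: this is why the antisymmetrizer
reverses the order of the factors. -/
theorem prod_mul_signSum (θ : Fin k → S) (c : S) (l : List (Fin k)) (hl : l.Nodup)
    (hc : l.IsChain fun a b => θ a * (1 - θ b) = θ b)
    (hlast : ∀ b, l.getLast? = some b → θ b = c) :
    (l.reverse.map (rMat n θ)).prod * signSum n k _ =
      (1 + c • (l.map fun a => inCopy a (flipMat n S)).sum) * signSum n k _ := by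
  induction l with
  | nil => simp
  | cons a l ih =>
    rw [List.nodup_cons] at hl
    have hl' : ∀ b, l.getLast? = some b → θ b = c := by
      intro b hb
      apply hlast
      cases l with
      | nil => simp at hb
      | cons x l => rwa [List.getLast?_cons_cons]
    rw [List.reverse_cons, List.map_append, List.prod_append, List.map_cons, List.prod_cons,
      List.map_nil, List.prod_nil, mul_one, mul_assoc]
    conv_lhs => rw [rMat]
    rw [add_mul, one_mul, mul_add, ih hl.2 hc.tail hl', smul_mul_assoc, mul_smul_comm,
      prod_flip_signSum _ _ _ hl.1, smul_smul, chain_prod θ c a l hc hlast, List.map_cons,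
      List.sum_cons, smul_add, add_mul, add_mul, add_mul]
    simp only [smul_mul_assoc]
    abel

theorem sum_flip_commute_signSum (l : List (Fin k)) (hl : l.Nodup) (hl' : ∀ a, a ∈ l) :
    Commute (signSum n k _) (l.map fun a => inCopy a (flipMat n S)).sum := by
  have h1 : (l.map fun a => inCopy a (flipMat n S)).sum =
      ∑ a : Fin k, inCopy a (flipMat n S) := by
    rw [← List.sum_toFinset _ hl]
    congr 1
    ext a; simp [hl' a]
  rw [h1, signSum]
  refine Commute.sum_left _ _ _ fun σ _ => Commute.smul_left ?_ _
  show _ * _ = _ * _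
  rw [Finset.mul_sum, Finset.sum_mul, ← Equiv.sum_comp σ (fun a => inCopy a (flipMat n S) * permMat n _ σ)]
  exact Finset.sum_congr rfl fun a _ => permMat_mul_inCopy _ _ _

/-- The fusion property of the product of the operators `1 + θ P`: the antisymmetrizer reverses
the order of the factors. -/
theorem signSum_mul_prod_rMat (s θ : Fin k → S) (l : List (Fin k)) (hl : l.Nodup)
    (hl' : ∀ a, a ∈ l) (hc : l.IsChain fun a b => θ a * (1 - θ b) = θ b) :
    signSum n k _ * (l.map fun a => s a • rMat n θ a).prod =
      (l.reverse.map fun a => s a • rMat n θ a).prod * signSum n k _ := by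
  obtain ⟨c, hcl⟩ : ∃ c, ∀ b, l.getLast? = some b → θ b = c := by
    cases h : l.getLast? with
    | none => exact ⟨0, fun b hb => by simp at hb⟩
    | some x => exact ⟨θ x, fun b hb => by simp at hb; rw [hb]⟩
  rw [prod_map_smul, prod_map_smul, mul_smul_comm, smul_mul_assoc, signSum_mul_prod θ c l hl hc hcl,
    prod_mul_signSum θ c l hl hc hcl, mul_add, add_mul, mul_one, one_mul, mul_smul_comm,
    smul_mul_assoc, (sum_flip_commute_signSum l hl hl').eq, List.map_reverse, List.prod_reverse]

end Scalars

end YangianDouble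

/-! ### Fusion, and the trace against the antisymmetrizer -/

namespace YangianDouble

open Matrix

section Fusion

variable {n k : ℕ} {T : Type*} [Ring T]

/-- `(1 - P) X₁ Y₂ (1 + P) = 0` in two tensor copies, entry by entry. -/
def Fused (X Y : Matrix (Fin n) (Fin n) T) : Prop :=
  ∀ i j p q, X i j * Y p q - X p j * Y i q + X i q * Y p j - X p q * Y i j = 0

theorem Fused.mul_eq_zero {X Y : Matrix (Fin n) (Fin n) T} (h : Fused X Y) {a b : Fin k}
    (hab : a ≠ b) :
    (1 - permMat n T (Equiv.swap a b)) * (inCopy a X * inCopy b Y) *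
      (1 + permMat n T (Equiv.swap a b)) = 0 := by
  rw [sub_mul, one_mul, mul_add, mul_one, sub_mul]
  ext I K
  simp only [Matrix.add_apply, Matrix.sub_apply, permMat_mul_apply, mul_permMat_apply,
    inCopy_mul_inCopy_apply hab, Equiv.symm_swap, Function.comp_apply, Equiv.swap_apply_left,
    Equiv.swap_apply_right, Matrix.zero_apply]
  have e : ∀ c, c ≠ a → c ≠ b → Equiv.swap a b c = c := fun c => Equiv.swap_apply_of_ne_of_ne
  by_cases H : ∀ c, c ≠ a → c ≠ b → I c = K c
  · have H1 : ∀ c, c ≠ a → c ≠ b → I (Equiv.swap a b c) = K c := fun c h1 h2 => by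
      rw [e c h1 h2, H c h1 h2]
    have H2 : ∀ c, c ≠ a → c ≠ b → I c = K (Equiv.swap a b c) := fun c h1 h2 => by
      rw [e c h1 h2, H c h1 h2]
    have H3 : ∀ c, c ≠ a → c ≠ b → I (Equiv.swap a b c) = K (Equiv.swap a b c) := fun c h1 h2 => by
      rw [e c h1 h2, H c h1 h2]
    rw [if_pos H, if_pos H1, if_pos H2, if_pos H3]
    rw [← h (I a) (K a) (I b) (K b)]
    abel
  · have H1 : ¬ ∀ c, c ≠ a → c ≠ b → I (Equiv.swap a b c) = K c := fun h' => H fun c h1 h2 => by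
      rw [← h' c h1 h2, e c h1 h2]
    have H2 : ¬ ∀ c, c ≠ a → c ≠ b → I c = K (Equiv.swap a b c) := fun h' => H fun c h1 h2 => by
      rw [h' c h1 h2, e c h1 h2]
    have H3 : ¬ ∀ c, c ≠ a → c ≠ b → I (Equiv.swap a b c) = K (Equiv.swap a b c) :=
      fun h' => H fun c h1 h2 => by
        have := h' c h1 h2
        rwa [e c h1 h2] at this
    rw [if_neg H, if_neg H1, if_neg H2, if_neg H3]
    simp

theorem commute_permMat_inCopy {a b c : Fin k} (hca : c ≠ a) (hcb : c ≠ b)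
    (M : Matrix (Fin n) (Fin n) T) :
    Commute (permMat n T (Equiv.swap a b)) (inCopy c M) := by
  have := permMat_mul_inCopy (Equiv.swap a b) c M
  rwa [Equiv.swap_apply_of_ne_of_ne hca hcb] at this

/-- If the factors at two adjacent places are fused then the antisymmetrized product changes sign
under the transposition of these places from the right too. -/
theorem signSum_mul_prod_swap (M : Fin k → Matrix (Fin n) (Fin n) T)
    (h2 : ∀ X : Matrix (Fin k → Fin n) (Fin k → Fin n) T, X + X = 0 → X = 0)
    (l₁ l₂ : List (Fin k)) (a b : Fin k) (hl : (l₁ ++ a :: b :: l₂).Nodup)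
    (h : Fused (M a) (M b)) :
    signSum n k T * ((l₁ ++ a :: b :: l₂).map fun c => inCopy c (M c)).prod *
      permMat n T (Equiv.swap a b) =
      -(signSum n k T * ((l₁ ++ a :: b :: l₂).map fun c => inCopy c (M c)).prod) := by
  have hab : a ≠ b := by
    rintro rfl
    have := (List.nodup_append.1 hl).2.1
    simp at this
  set q := permMat n T (Equiv.swap a b)
  have hc1 : Commute q (l₁.map fun c => inCopy c (M c)).prod :=
    prod_map_mul_prod_map_of_commute _ _ _ fun c hc => by
      have := (List.nodup_append.1 hl).2.2 c hc
      exact commute_permMat_inCopy (this a (by simp)) (this b (by simp)) _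
  have hc2 : Commute q (l₂.map fun c => inCopy c (M c)).prod :=
    prod_map_mul_prod_map_of_commute _ _ _ fun c hc => by
      have := (List.nodup_append.1 hl).2.1
      rw [List.nodup_cons, List.nodup_cons] at this
      refine commute_permMat_inCopy ?_ ?_ _
      · rintro rfl; exact this.1 (by simp [hc])
      · rintro rfl; exact this.2.1 hc
  -- The antisymmetrizer produces the factor `1 - q` up to the factor `2`.
  have hA : signSum n k T * (1 - q) = signSum n k T + signSum n k T := by
    rw [mul_sub, mul_one, signSum_mul_permMat, Equiv.Perm.sign_swap hab]
    simp
  have hX : (1 - q) * (inCopy a (M a) * inCopy b (M b)) * (1 + q) = 0 := h.mul_eq_zero hab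
  simp only [List.map_append, List.map_cons, List.prod_append, List.prod_cons]
  set x := (l₁.map fun c => inCopy c (M c)).prod
  set y := (l₂.map fun c => inCopy c (M c)).prod
  set w := inCopy a (M a)
  set v := inCopy b (M b)
  have hc1' : (1 - q) * x = x * (1 - q) := by rw [sub_mul, mul_sub, hc1.eq, one_mul, mul_one]
  have hc2' : y * (1 + q) = (1 + q) * y := by rw [add_mul, mul_add, hc2.eq, one_mul, mul_one]
  have key : signSum n k T * (x * (w * (v * y))) * (1 + q) = 0 := by
    refine h2 _ ?_
    rw [← add_mul, ← add_mul, ← hA]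
    calc signSum n k T * (1 - q) * (x * (w * (v * y))) * (1 + q)
        = signSum n k T * ((1 - q) * x) * (w * v) * (y * (1 + q)) := by simp only [mul_assoc]
      _ = signSum n k T * x * ((1 - q) * (w * v) * (1 + q)) * y := by
        rw [hc1', hc2']; simp only [mul_assoc]
      _ = 0 := by rw [hX]; simp
  rw [mul_add, mul_one] at key
  exact eq_neg_of_add_eq_zero_right key

end Fusion

section Trace

variable {n k : ℕ} {S T : Type*} [CommRing S] [Ring T] [Algebra S T]

/-- Matrices over the coefficients, acting on the auxiliary space. -/
def scalarMap (n : ℕ) (S T : Type*) [CommRing S] [Ring T] [Algebra S T] :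
    Matrix (Fin n) (Fin n) S →+* Matrix (Fin n) (Fin n) T :=
  (algebraMap S T).mapMatrix

theorem commute_scalarMap (M : Matrix (Fin n) (Fin n) S) (x : T) :
    Commute (scalarMap n S T M) (Matrix.scalar (Fin n) x) := by
  ext i j
  simp only [scalarMap, RingHom.mapMatrix_apply, Matrix.scalar_apply, Matrix.mul_diagonal,
    Matrix.diagonal_mul, Matrix.map_apply]
  exact Algebra.commutes _ _

/-- `s (1 + θ P)`, acting in a tensor copy and the auxiliary space. -/
def rTwo (n : ℕ) (s θ : S) : Matrix (Fin n) (Fin n) (Matrix (Fin n) (Fin n) S) :=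
  s • (1 + θ • flipMat n S)

theorem inCopy_rTwo (s θ : Fin k → S) (a : Fin k) :
    inCopy a (rTwo n (s a) (θ a)) = s a • rMat n θ a := by
  have : ∀ (r : S) (M : Matrix (Fin n) (Fin n) (Matrix (Fin n) (Fin n) S)),
      inCopy a (r • M) = r • inCopy a M := by
    intro r M
    ext1 I K
    simp only [inCopy, Matrix.of_apply, Matrix.smul_apply]
    split_ifs <;> simp
  rw [rTwo, this, rMat, ← inCopyHom_apply, map_add, map_one, inCopyHom_apply, this]

/-- The partial transpose `Q` of the flip satisfies `Q² = n Q`, so that the partial transposes of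
`s (1 + θ P)` and `s⁻¹ (1 + θ' P)` are inverse to each other when `θ + θ' + n θ θ' = 0`. -/
theorem transpose_rTwo_mul (s θ s' θ' : S) (hs : s * s' = 1) (h : θ + θ' + n * (θ * θ') = 0) :
    (rTwo n s θ)ᵀ * (rTwo n s' θ')ᵀ = 1 := by
  have hQ : (flipMat n S)ᵀ * (flipMat n S)ᵀ = (n : S) • (flipMat n S)ᵀ := by
    ext1 i j
    rw [Matrix.mul_apply]
    simp [flipMat, Matrix.single_mul_single_same, ← Nat.cast_smul_eq_nsmul S]
  simp only [rTwo, Matrix.transpose_smul, Matrix.transpose_add, Matrix.transpose_one]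
  rw [smul_mul_smul_comm, hs, one_smul, mul_add, add_mul, add_mul, smul_mul_smul_comm, hQ, smul_smul]
  simp only [mul_one, one_mul]
  have : θ • (flipMat n S)ᵀ + θ' • (flipMat n S)ᵀ + (θ * θ' * n) • (flipMat n S)ᵀ = 0 := by
    rw [← add_smul, ← add_smul, show θ + θ' + θ * θ' * n = θ + θ' + n * (θ * θ') by ring, h, zero_smul]
  have e : ∀ Q₁ Q₂ Q₃ : Matrix (Fin n) (Fin n) (Matrix (Fin n) (Fin n) S), Q₁ + Q₂ + Q₃ = 0 →
      1 + Q₁ + (Q₂ + Q₃) = 1 := fun Q₁ Q₂ Q₃ h => by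
    rw [show 1 + Q₁ + (Q₂ + Q₃) = 1 + (Q₁ + Q₂ + Q₃) by abel, h, add_zero]
  exact e _ _ _ this

/-- Multiplying by `∏ α` on the left and `∏ β` on the right, where the partial transposes of the
factors are mutually inverse, does not change the trace. -/
theorem trace_collapse (α β : Fin k → Matrix (Fin n) (Fin n) (Matrix (Fin n) (Fin n) S))
    (h : ∀ a, (α a)ᵀ * (β a)ᵀ = 1) (l : List (Fin k)) (hl : l.Nodup)
    (Y : Matrix (Fin k → Fin n) (Fin k → Fin n) T) :
    Matrix.trace (((l.reverse.map fun a => inCopy a (α a)).prod).map (scalarMap n S T) *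
      Y.map (Matrix.scalar (Fin n)) * ((l.map fun a => inCopy a (β a)).prod).map (scalarMap n S T)) =
      Matrix.scalar (Fin n) (Matrix.trace Y) := by
  set 𝓐 := (l.reverse.map fun a => inCopy a (α a)).prod with h𝓐
  set 𝓑 := (l.map fun a => inCopy a (β a)).prod with h𝓑
  have key : 𝓐ᵀ * 𝓑ᵀ = 1 := by
    rw [h𝓐, h𝓑, transpose_prod_inCopy _ _ (List.nodup_reverse.2 hl), transpose_prod_inCopy _ _ hl]
    refine prod_reverse_mul_prod _ _ _ fun a => ?_
    rw [← inCopy_mul, h, ← inCopyHom_apply, map_one]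
  have e1 : Matrix.trace (𝓐.map (scalarMap n S T) * Y.map (Matrix.scalar (Fin n)) *
      𝓑.map (scalarMap n S T)) =
      ∑ K, ∑ J, (∑ I, scalarMap n S T (𝓐 I J * 𝓑 K I)) * Matrix.scalar (Fin n) (Y J K) := by
    simp only [Matrix.trace, Matrix.diag, Matrix.mul_apply, Matrix.map_apply, Finset.sum_mul]
    rw [Finset.sum_comm]
    refine Finset.sum_congr rfl fun K _ => ?_
    rw [Finset.sum_comm]
    refine Finset.sum_congr rfl fun J _ => Finset.sum_congr rfl fun I _ => ?_
    rw [map_mul, mul_assoc, mul_assoc, (commute_scalarMap (𝓑 K I) (Y J K)).eq]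
  rw [e1]
  have e2 : ∀ J K, (∑ I, scalarMap n S T (𝓐 I J * 𝓑 K I)) =
      if J = K then 1 else 0 := by
    intro J K
    have := congrFun (congrFun key J) K
    rw [Matrix.mul_apply, Matrix.one_apply] at this
    rw [← map_sum]
    simp only [Matrix.transpose_apply] at this
    rw [this]
    split_ifs <;> simp
  simp only [e2, ite_mul, one_mul, zero_mul, Finset.sum_ite_eq', Finset.mem_univ, if_true,
    Matrix.trace, Matrix.diag, map_sum]

/-- The antisymmetrized product with fused adjacent factors is antisymmetric from the right too. -/
theorem signSum_mul_prod_mul_signSum [Algebra ℚ T] (M G : Fin k → Matrix (Fin n) (Fin n) T) (ι : T)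
    (hM : ∀ a b : Fin k, (b : ℕ) = a + 1 → Fused (M a) (M b))
    (hG : ∀ a b : Fin k, (b : ℕ) = a + 1 → Fused (G b) (G a)) :
    let X := signSum n k T * (((List.finRange k).map fun a => inCopy a (M a)).prod *
      Matrix.scalar (Fin k → Fin n) ι * ((List.finRange k).reverse.map fun a => inCopy a (G a)).prod)
    X * signSum n k T = (k.factorial : ℤ) • X := by
  intro X
  have hf : ∀ (m : ℤ) (X Y : Matrix (Fin k → Fin n) (Fin k → Fin n) T), m ≠ 0 →
      m • X = m • Y → X = Y := by
    intro m X Y hm h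
    have := congrArg (fun Z => (m⁻¹ : ℚ) • Z) h
    simpa only [← Int.cast_smul_eq_zsmul ℚ, smul_smul,
      inv_mul_cancel₀ (Int.cast_ne_zero.2 hm : (m : ℚ) ≠ 0), one_smul] using this
  -- The factors `2` and `k!` are cancelled by means of the rational scalars.
  have h2 : ∀ X : Matrix (Fin k → Fin n) (Fin k → Fin n) T, X + X = 0 → X = 0 := by
    intro X h
    refine hf 2 X 0 (by norm_num) ?_
    rw [two_smul, h, smul_zero]
  set 𝓜 := ((List.finRange k).map fun a => inCopy a (M a)).prod
  set 𝓖 := ((List.finRange k).reverse.map fun a => inCopy a (G a)).prod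
  have e1 : signSum n k T * 𝓜 * signSum n k T = (k.factorial : ℤ) • (signSum n k T * 𝓜) := by
    refine mul_signSum_of_adjacent fun a b hab => ?_
    obtain ⟨l₁, l₂, hl⟩ := finRange_split a b hab
    have := signSum_mul_prod_swap M h2 l₁ l₂ a b (hl ▸ List.nodup_finRange k) (hM a b hab)
    rwa [← hl] at this
  have e2 : ∀ a b : Fin k, (b : ℕ) = a + 1 →
      signSum n k T * 𝓖 * permMat n T (Equiv.swap a b) = -(signSum n k T * 𝓖) := by
    intro a b hab
    obtain ⟨l₁, l₂, hl⟩ := finRange_split a b hab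
    have hl' : (List.finRange k).reverse = l₂.reverse ++ b :: a :: l₁.reverse := by
      rw [hl]; simp
    have := signSum_mul_prod_swap G h2 l₂.reverse l₁.reverse b a
      (hl' ▸ List.nodup_reverse.2 (List.nodup_finRange k)) (hG a b hab)
    rwa [← hl', Equiv.swap_comm] at this
  refine mul_signSum_of_adjacent fun a b hab => hf (k.factorial : ℤ) _ _
    (by exact_mod_cast k.factorial_ne_zero) ?_
  -- The antisymmetry of the first product lets the antisymmetrizer pass to the second one.
  have e3 : (k.factorial : ℤ) • X = signSum n k T * 𝓜 * Matrix.scalar _ ι * (signSum n k T * 𝓖) := by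
    have : X = signSum n k T * 𝓜 * (Matrix.scalar _ ι * 𝓖) := by
      simp only [X, 𝓜, 𝓖, mul_assoc]
    rw [this, ← smul_mul_assoc, ← e1]
    simp only [mul_assoc]
    rw [← mul_assoc (signSum n k T) (Matrix.scalar _ ι), (signSum_commute_scalar ι).eq]
    simp only [mul_assoc]
  rw [← smul_mul_assoc, smul_neg, e3, mul_assoc _ (signSum n k T * 𝓖), e2 a b hab, mul_neg]

/-- The combination of `mul_prod_exchange` and `mul_prod_mul_prod_exchange`: `x` passes through
the factors `m a`, an intermediate `y` and the factors `g a` in the opposite order, where the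
factors `q a` created by the first exchange are absorbed by the second. -/
theorem mul_prod_mul_mul_prod_exchange {R ι : Type*} [Monoid R] (x y : R) (p q r m g : ι → R)
    (l : List ι) (hl : l.Nodup)
    (h₁ : ∀ a, x * m a = p a * m a * x * q a) (h₂ : ∀ a, x * q a * g a = g a * r a * x)
    (hp : ∀ a b, a ≠ b → Commute (p a) (m b)) (hq : ∀ a b, a ≠ b → Commute (q a) (m b))
    (hq' : ∀ a b, a ≠ b → Commute (q a) (g b)) (hr : ∀ a b, a ≠ b → Commute (r a) (g b))
    (hxy : Commute x y) (hqy : ∀ a, Commute y (q a)) :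
    x * ((l.map m).prod * y * (l.reverse.map g).prod) =
      (l.map p).prod * ((l.map m).prod * y * (l.reverse.map g).prod) * (l.reverse.map r).prod * x := by
  have E1 := mul_prod_exchange x p q m l hl h₁ hp hq
  have E2 := mul_prod_mul_prod_exchange x q r g l.reverse (List.nodup_reverse.2 hl) h₂ hq' hr
  have hqy' : Commute y (l.reverse.map q).prod :=
    prod_map_mul_prod_map_of_commute _ _ _ fun b _ => hqy b
  generalize (l.map m).prod = mm at *
  generalize (l.reverse.map g).prod = gg at *
  generalize (l.map p).prod = pp at *
  generalize (l.reverse.map q).prod = qq at *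
  generalize (l.reverse.map r).prod = rr at *
  calc x * (mm * y * gg) = (x * mm) * y * gg := by simp only [mul_assoc]
    _ = pp * mm * (x * (qq * y)) * gg := by rw [E1]; simp only [mul_assoc]
    _ = pp * mm * (x * y) * qq * gg := by rw [← hqy'.eq]; simp only [mul_assoc]
    _ = pp * mm * y * (x * qq * gg) := by rw [hxy.eq]; simp only [mul_assoc]
    _ = _ := by rw [E2]; simp only [mul_assoc]

/-- The product of the operators `s (1 + θ P)` over the tensor copies, acting in the auxiliary
space by matrices over `T`. -/
def rProd (T : Type*) [Ring T] [Algebra S T] (s θ : Fin k → S) (l : List (Fin k)) :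
    Matrix (Fin k → Fin n) (Fin k → Fin n) (Matrix (Fin n) (Fin n) T) :=
  (scalarMap n S T).mapMatrix (l.map fun a => s a • rMat n θ a).prod

theorem rProd_eq_prod (s θ : Fin k → S) (l : List (Fin k)) : rProd T s θ l =
    (l.map fun a => inCopy a ((rTwo n (s a) (θ a)).map (scalarMap n S T))).prod := by
  rw [rProd, map_list_prod, List.map_map]
  congr 1
  refine List.map_congr_left fun a _ => ?_
  rw [← inCopy_map, inCopy_rTwo]
  rfl

theorem rProd_eq_map (s θ : Fin k → S) (l : List (Fin k)) : rProd T s θ l =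
    ((l.map fun a => inCopy a (rTwo n (s a) (θ a))).prod).map (scalarMap n S T) := by
  simp only [rProd, inCopy_rTwo]
  rfl

theorem signSum_mul_rProd (s θ : Fin k → S) (l : List (Fin k)) (hl : l.Nodup)
    (hl' : ∀ a, a ∈ l) (hc : l.IsChain fun a b => θ a * (1 - θ b) = θ b) :
    signSum n k _ * rProd T s θ l = rProd T s θ l.reverse * signSum n k _ := by
  have := congrArg (scalarMap n S T).mapMatrix (signSum_mul_prod_rMat s θ l hl hl' hc)
  rw [map_mul, map_mul] at this
  rwa [show (scalarMap n S T).mapMatrix (signSum n k _) = signSum n k _ from signSum_map _] at this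

theorem outer_prod_map (M : Fin k → Matrix (Fin n) (Fin n) T) (l : List (Fin k)) :
    (Matrix.scalar (Fin n) : T →+* _).mapMatrix (l.map fun a => inCopy a (M a)).prod =
      (l.map fun a => inCopy a (outer (M a))).prod := by
  rw [map_list_prod, List.map_map]
  congr 1
  refine List.map_congr_left fun a _ => ?_
  exact inCopy_map _ _ _

/-- `L₀` passes through the whole product, leaving scalar factors at both ends. -/
theorem scalar_mul_prod_exchange (L₀ : Matrix (Fin n) (Fin n) T)
    (M G : Fin k → Matrix (Fin n) (Fin n) T) (ι : T) (s s' θ θ' : Fin k → S)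
    (β : Fin k → Matrix (Fin n) (Fin n) (Matrix (Fin n) (Fin n) S))
    (hι : ∀ i j, Commute ι (L₀ i j))
    (h1 : ∀ a, inner L₀ * outer (M a) =
      (rTwo n (s a) (θ a)).map (scalarMap n S T) * outer (M a) * inner L₀ *
        (β a).map (scalarMap n S T))
    (h2 : ∀ a, inner L₀ * (β a).map (scalarMap n S T) * outer (G a) =
      outer (G a) * (rTwo n (s' a) (θ' a)).map (scalarMap n S T) * inner L₀)
    (Y : Matrix (Fin k → Fin n) (Fin k → Fin n) T)
    (hY : Y = ((List.finRange k).map fun a => inCopy a (M a)).prod *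
      Matrix.scalar (Fin k → Fin n) ι * ((List.finRange k).reverse.map fun a => inCopy a (G a)).prod) :
    Matrix.scalar (Fin k → Fin n) L₀ * Y.map (Matrix.scalar (Fin n)) =
      rProd T s θ (List.finRange k) * Y.map (Matrix.scalar (Fin n)) *
        rProd T s' θ' (List.finRange k).reverse * Matrix.scalar (Fin k → Fin n) L₀ := by
  have hcomm : ∀ (a b : Fin k) (N : Matrix (Fin n) (Fin n) (Matrix (Fin n) (Fin n) S))
      (N' : Matrix (Fin n) (Fin n) T), a ≠ b →
      Commute (inCopy a (N.map (scalarMap n S T))) (inCopy b (outer N')) := fun a b N N' hab =>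
    inCopy_commute hab fun _ _ _ _ => commute_scalarMap _ _
  have hx : ∀ a : Fin k, inCopy a (inner L₀) = Matrix.scalar (Fin k → Fin n) L₀ :=
    fun a => inCopy_scalar a L₀
  have hI : (Matrix.scalar (Fin n) : T →+* _).mapMatrix (Matrix.scalar (Fin k → Fin n) ι) =
      Matrix.scalar (Fin k → Fin n) (Matrix.scalar (Fin n) ι) := by
    ext1 J K
    simp only [RingHom.mapMatrix_apply, Matrix.map_apply, Matrix.scalar_apply,
      Matrix.diagonal_apply]
    split_ifs <;> simp
  have hYmap : Y.map (Matrix.scalar (Fin n)) =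
      ((List.finRange k).map fun a => inCopy a (outer (M a))).prod *
      Matrix.scalar (Fin k → Fin n) (Matrix.scalar (Fin n) ι) *
      ((List.finRange k).reverse.map fun a => inCopy a (outer (G a))).prod := by
    rw [← outer_prod_map, ← outer_prod_map, ← hI, ← map_mul, ← map_mul, ← hY]
    rfl
  rw [hYmap, rProd_eq_prod, rProd_eq_prod]
  refine mul_prod_mul_mul_prod_exchange _ _ _
    (fun a => inCopy a ((β a).map (scalarMap n S T))) _ _ _ _ (List.nodup_finRange k)
    (fun a => ?_) (fun a => ?_) (fun a b hab => hcomm a b _ _ hab) (fun a b hab => hcomm a b _ _ hab)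
    (fun a b hab => hcomm a b _ _ hab) (fun a b hab => hcomm a b _ _ hab) ?_ (fun a => ?_)
  · have := congrArg (inCopy a) (h1 a)
    rwa [inCopy_mul, inCopy_mul, inCopy_mul, inCopy_mul, hx] at this
  · have := congrArg (inCopy a) (h2 a)
    rwa [inCopy_mul, inCopy_mul, inCopy_mul, inCopy_mul, hx] at this
  · refine Commute.map (?_ : Commute L₀ (Matrix.scalar (Fin n) ι)) (Matrix.scalar (Fin k → Fin n))
    ext a b
    simp only [Matrix.scalar_apply, Matrix.mul_diagonal, Matrix.diagonal_mul]
    exact (hι a b).eq.symm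
  · ext1 J K
    simp only [Matrix.scalar_apply, Matrix.mul_diagonal, Matrix.diagonal_mul, inCopy,
      Matrix.of_apply]
    split_ifs
    · exact (commute_scalarMap _ _).eq.symm
    · simp

/-- The scalar factors at both ends do not change the trace of an antisymmetric matrix. -/
theorem trace_signSum_mul_rProd [Algebra ℚ T] (s s' θ θ' : Fin k → S)
    (hs : ∀ a, s a * s' a = 1) (hθ : ∀ a, θ a + θ' a + n * (θ a * θ' a) = 0)
    (hc : ∀ a b : Fin k, (b : ℕ) = a + 1 → θ a * (1 - θ b) = θ b)
    (hc' : ∀ a b : Fin k, (b : ℕ) = a + 1 → θ' b * (1 - θ' a) = θ' a)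
    (Y : Matrix (Fin k → Fin n) (Fin k → Fin n) T)
    (hY : signSum n k T * Y * signSum n k T = (k.factorial : ℤ) • (signSum n k T * Y)) :
    Matrix.trace (signSum n k _ * (rProd T s θ (List.finRange k) * Y.map (Matrix.scalar (Fin n)) *
        rProd T s' θ' (List.finRange k).reverse)) =
      Matrix.scalar (Fin n) (Matrix.trace (signSum n k T * Y)) := by
  have hC : (Matrix.scalar (Fin n) : T →+* _).mapMatrix (signSum n k T) = signSum n k _ :=
    signSum_map _
  have F1 := signSum_mul_rProd (n := n) (T := T) s θ _ (List.nodup_finRange k)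
    (fun a => List.mem_finRange a) ((isChain_finRange k).imp fun a b => hc a b)
  have F2 := signSum_mul_rProd (n := n) (T := T) s' θ' _ (List.nodup_reverse.2 (List.nodup_finRange k))
    (fun a => by simp) (List.isChain_reverse.2 ((isChain_finRange k).imp fun a b => hc' a b))
  rw [List.reverse_reverse] at F2
  have F3 := signSum_mul_signSum (n := n) (k := k) (B := Matrix (Fin n) (Fin n) T)
  have F4 := congrArg (Matrix.scalar (Fin n) : T →+* _).mapMatrix hY
  rw [map_mul, map_zsmul, map_mul, hC] at F4
  have F5 := trace_collapse (S := S) (T := T) (fun a => rTwo n (s a) (θ a))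
      (fun a => rTwo n (s' a) (θ' a))
      (fun a => transpose_rTwo_mul _ _ _ _ (hs a) (hθ a)) (List.finRange k) (List.nodup_finRange k)
      (signSum n k T * Y)
  rw [← rProd_eq_map, ← rProd_eq_map] at F5
  change Matrix.trace (_ * (Matrix.scalar (Fin n) : T →+* _).mapMatrix _ * _) = _ at F5
  rw [map_mul, hC] at F5
  rw [← F5]
  change Matrix.trace (_ * (_ * (Matrix.scalar (Fin n) : T →+* _).mapMatrix _ * _)) = _
  have F6 := fun X => trace_signSum_mul_comm (n := n) (k := k) (B := Matrix (Fin n) (Fin n) T) X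
  -- With `A` the antisymmetrizer, `A 𝓐 = 𝓐' A` and `A 𝓒 = 𝓒' A`; the trace is moved to the order
  -- of factors in which the partial transposes cancel.
  generalize (Matrix.scalar (Fin n) : T →+* _).mapMatrix Y = y at *
  generalize signSum n k (Matrix (Fin n) (Fin n) T) = A at *
  generalize rProd T s θ (List.finRange k) = 𝓐 at *
  generalize rProd T s θ (List.finRange k).reverse = 𝓐' at *
  generalize rProd T s' θ' (List.finRange k) = 𝓒' at *
  generalize rProd T s' θ' (List.finRange k).reverse = 𝓒 at *
  have key : (k.factorial : ℤ) • Matrix.trace (A * (𝓐 * y * 𝓒)) =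
      (k.factorial : ℤ) • Matrix.trace (𝓐' * (A * y) * 𝓒') := by
    rw [← Matrix.trace_smul, ← Matrix.trace_smul]
    calc Matrix.trace ((k.factorial : ℤ) • (A * (𝓐 * y * 𝓒)))
        = Matrix.trace (𝓐' * ((k.factorial : ℤ) • (A * y)) * 𝓒) := by
          rw [mul_smul_comm, smul_mul_assoc]
          simp only [← mul_assoc]
          rw [F1]
      _ = Matrix.trace (𝓐' * A * y * 𝓒' * A) := by
          rw [← F4]; simp only [mul_assoc]; rw [F2]
      _ = Matrix.trace (A * 𝓐' * A * y * 𝓒') := by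
          rw [← F6]; simp only [mul_assoc]
      _ = Matrix.trace ((k.factorial : ℤ) • (𝓐' * (A * y) * 𝓒')) := by
          rw [mul_assoc A, ← F1, ← mul_assoc A, F3, smul_mul_assoc, F1]
          simp only [smul_mul_assoc, mul_assoc]
  have := congrArg (fun Z => ((k.factorial : ℤ) : ℚ)⁻¹ • Z) key
  simpa only [← Int.cast_smul_eq_zsmul ℚ, smul_smul, inv_mul_cancel₀
    (show ((k.factorial : ℤ) : ℚ) ≠ 0 by exact_mod_cast k.factorial_ne_zero), one_smul] using this

/-- The exchange relations with `L₀` imply that `L₀` commutes with the trace of the antisymmetrized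
product. -/
theorem commute_trace_of_exchange [Algebra ℚ T] (L₀ : Matrix (Fin n) (Fin n) T)
    (M G : Fin k → Matrix (Fin n) (Fin n) T) (ι : T) (s s' θ θ' : Fin k → S)
    (β : Fin k → Matrix (Fin n) (Fin n) (Matrix (Fin n) (Fin n) S))
    (hs : ∀ a, s a * s' a = 1) (hθ : ∀ a, θ a + θ' a + n * (θ a * θ' a) = 0)
    (hc : ∀ a b : Fin k, (b : ℕ) = a + 1 → θ a * (1 - θ b) = θ b)
    (hc' : ∀ a b : Fin k, (b : ℕ) = a + 1 → θ' b * (1 - θ' a) = θ' a)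
    (hι : ∀ i j, Commute ι (L₀ i j))
    (h1 : ∀ a, inner L₀ * outer (M a) =
      (rTwo n (s a) (θ a)).map (scalarMap n S T) * outer (M a) * inner L₀ *
        (β a).map (scalarMap n S T))
    (h2 : ∀ a, inner L₀ * (β a).map (scalarMap n S T) * outer (G a) =
      outer (G a) * (rTwo n (s' a) (θ' a)).map (scalarMap n S T) * inner L₀)
    (hM : ∀ a b : Fin k, (b : ℕ) = a + 1 → Fused (M a) (M b))
    (hG : ∀ a b : Fin k, (b : ℕ) = a + 1 → Fused (G b) (G a)) (i j : Fin n) :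
    Commute (L₀ i j) (Matrix.trace (signSum n k T *
      (((List.finRange k).map fun a => inCopy a (M a)).prod * Matrix.scalar (Fin k → Fin n) ι *
        ((List.finRange k).reverse.map fun a => inCopy a (G a)).prod))) := by
  have hX := signSum_mul_prod_mul_signSum M G ι hM hG
  simp only at hX
  have E3 := scalar_mul_prod_exchange L₀ M G ι s s' θ θ' β hι h1 h2 _ rfl
  generalize ((List.finRange k).map fun a => inCopy a (M a)).prod *
    Matrix.scalar (Fin k → Fin n) ι *
        ((List.finRange k).reverse.map fun a => inCopy a (G a)).prod = Y at *
  have hmain := trace_signSum_mul_rProd s s' θ θ' hs hθ hc hc' Y hX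
  have htr : ∀ Z : Matrix (Fin k → Fin n) (Fin k → Fin n) (Matrix (Fin n) (Fin n) T),
      Matrix.trace (Matrix.scalar _ L₀ * Z) = L₀ * Matrix.trace Z ∧
        Matrix.trace (Z * Matrix.scalar _ L₀) = Matrix.trace Z * L₀ := by
    intro Z
    simp only [Matrix.trace, Matrix.diag, Matrix.scalar_apply, Matrix.mul_diagonal,
      Matrix.diagonal_mul, Finset.mul_sum, Finset.sum_mul, and_self]
  -- The trace over the tensor copies is compared as an operator on the auxiliary space.
  have hC : Matrix.scalar (Fin n) (Matrix.trace (signSum n k T * Y)) =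
      Matrix.trace (signSum n k _ * Y.map (Matrix.scalar (Fin n))) := by
    rw [← signSum_map (n := n) (k := k) (Matrix.scalar (Fin n) : T →+* _)]
    change _ = Matrix.trace ((Matrix.scalar (Fin n) : T →+* _).mapMatrix _ *
      (Matrix.scalar (Fin n) : T →+* _).mapMatrix _)
    rw [← map_mul, Matrix.trace, map_sum]
    rfl
  have hfin : L₀ * Matrix.scalar (Fin n) (Matrix.trace (signSum n k T * Y)) =
      Matrix.scalar (Fin n) (Matrix.trace (signSum n k T * Y)) * L₀ := by
    conv_lhs => rw [hC, ← (htr _).1, ← mul_assoc, ← (signSum_commute_scalar L₀).eq, mul_assoc, E3,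
      ← mul_assoc, (htr _).2, hmain]
  have := congrFun (congrFun hfin i) j
  simp only [Matrix.scalar_apply, Matrix.mul_diagonal, Matrix.diagonal_mul] at this
  exact this

end Trace

end YangianDouble

/-! ### Evaluation of complex power series at nilpotent elements -/

namespace YangianDouble

open Finset

theorem sum_antidiagonal_eq_sum_range {M : Type*} [AddCommMonoid M] (f : ℕ × ℕ → M) (B : ℕ)
    (h : ∀ a b, B ≤ a + b → f (a, b) = 0) :
    ∑ N ∈ range B, ∑ p ∈ antidiagonal N, f p = ∑ a ∈ range B, ∑ b ∈ range B, f (a, b) := by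
  rw [sum_sigma', ← sum_product']
  symm
  rw [← sum_filter_add_sum_filter_not _ (fun x : ℕ × ℕ => x.1 + x.2 < B), sum_eq_zero
    (s := filter (fun x : ℕ × ℕ => ¬ (x.1 + x.2 < B)) _), add_zero]
  · refine sum_bij' (fun x _ => ⟨x.1 + x.2, x⟩) (fun x _ => x.2) ?_ ?_ ?_ ?_ ?_
    · rintro ⟨a, b⟩ h
      simp only [mem_filter, mem_product, mem_range] at h
      simp [h.2]
    · rintro ⟨N, a, b⟩ h
      simp only [mem_sigma, mem_range, HasAntidiagonal.mem_antidiagonal] at h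
      simp only [mem_filter, mem_product, mem_range]
      omega
    · rintro ⟨a, b⟩ _; rfl
    · rintro ⟨N, a, b⟩ h
      simp only [mem_sigma, mem_range, HasAntidiagonal.mem_antidiagonal] at h
      obtain ⟨_, rfl⟩ := h
      rfl
    · rintro ⟨a, b⟩ _; rfl
  · rintro ⟨a, b⟩ h'
    simp only [mem_filter, not_lt] at h'
    exact h a b h'.2

section Evaluation

variable {S : Type*} [CommRing S]

/-- The binomial series `(1 - w)^{-k}` at a nilpotent `w`; for `k = 0` truncated subtraction makes
all terms but the first vanish. -/
theorem sum_choose_mul_pow (w r : S) (B : ℕ) (hw : w ^ B = 0) (hr : r * (1 - w) = 1) (k : ℕ) :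
    ∑ m ∈ range B, ((k + m - 1).choose m : S) * w ^ m = r ^ k := by
  rcases B with _ | B
  · have : Subsingleton S := subsingleton_of_zero_eq_one (by simpa using hw.symm)
    exact Subsingleton.elim _ _
  induction k with
  | zero =>
    rw [sum_range_succ']
    simp only [zero_add, Nat.add_sub_cancel, Nat.choose_succ_self, Nat.cast_zero, zero_mul,
      sum_const_zero]
    simp
  | succ k ih =>
    have e : (∑ m ∈ range (B + 1), ((k + 1 + m - 1).choose m : S) * w ^ m) * (1 - w) = r ^ k := by
      rw [← ih, mul_sub, mul_one, sum_mul]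
      nth_rewrite 1 [sum_range_succ']
      rw [sum_range_succ (fun m => _ * w ^ m * w), mul_assoc _ (w ^ B), ← pow_succ, hw, mul_zero,
        add_zero, add_zero, sum_range_succ' _ B, add_sub_right_comm, ← sum_sub_distrib]
      congr 1
      · refine sum_congr rfl fun m _ => ?_
        rw [show k + 1 + (m + 1) - 1 = (k + m) + 1 by omega, show k + 1 + m - 1 = k + m by omega,
          show k + (m + 1) - 1 = k + m by omega, Nat.choose_succ_succ]
        push_cast
        ring
      · simp
    calc _ = (∑ m ∈ range (B + 1), ((k + 1 + m - 1).choose m : S) * w ^ m) * (r * (1 - w)) := by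
          rw [hr, mul_one]
      _ = _ := by rw [mul_left_comm, e, pow_succ, mul_comm]

variable [Algebra ℂ S]

/-- The value `∑ φ_k t^k` of a power series with complex coefficients at a nilpotent element. -/
noncomputable def nilEval (φ : ℕ → ℂ) (t : S) : S :=
  ∑ k ∈ range (nilpotencyClass t), φ k • t ^ k

theorem nilEval_eq (φ : ℕ → ℂ) {t : S} {B : ℕ} (ht : t ^ B = 0) :
    nilEval φ t = ∑ k ∈ range B, φ k • t ^ k := by
  have hB : nilpotencyClass t ≤ B := by
    rw [nilpotencyClass]; exact Nat.sInf_le ht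
  refine sum_subset (range_mono hB) fun k _ hk => ?_
  rw [mem_range, not_lt] at hk
  rw [pow_eq_zero_of_le hk (pow_nilpotencyClass ⟨B, ht⟩), smul_zero]

theorem map_nilEval {S' : Type*} [CommRing S'] [Algebra ℂ S'] (f : S →ₐ[ℂ] S') (φ : ℕ → ℂ) {t : S}
    (ht : IsNilpotent t) : f (nilEval φ t) = nilEval φ (f t) := by
  obtain ⟨B, hB⟩ := ht
  rw [nilEval_eq φ hB, nilEval_eq φ (t := f t) (B := B) (by rw [← map_pow, hB, map_zero]), map_sum]
  simp

/-- The double expansion of `φ(v / (1 - w))` at nilpotent `v` and `w`. -/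
theorem sum_sum_choose (φ : ℕ → ℂ) (v w r : S) (B R : ℕ) (hv : v ^ B = 0) (hw : w ^ R = 0)
    (hr : r * (1 - w) = 1) :
    ∑ k ∈ range B, ∑ m ∈ range R, (φ k • v ^ k) * (((k + m - 1).choose m : S) * w ^ m) =
      nilEval φ (v * r) := by
  rw [nilEval_eq φ (B := B) (by rw [mul_pow, hv, zero_mul])]
  refine sum_congr rfl fun k _ => ?_
  rw [← mul_sum, sum_choose_mul_pow w r R hw hr, mul_pow, smul_mul_assoc]

/-- If `φ(x) = ∑ φ_k x^{-k}` then `complexShift c φ N` is the coefficient of `x^{-N}` in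
`φ(x + c)`. -/
noncomputable def complexShift (c : ℂ) (φ : ℕ → ℂ) (N : ℕ) : ℂ :=
  ∑ p ∈ antidiagonal N, ((N - 1).choose p.2 * (-c) ^ p.2) * φ p.1

/-- With `t = x⁻¹`, the value of `φ(x + c)` is that of `φ` at `(x + c)⁻¹ = t (1 + c t)⁻¹`. -/
theorem nilEval_complexShift (c : ℂ) (φ : ℕ → ℂ) (t r : S) (ht : IsNilpotent t)
    (hr : r * (1 + c • t) = 1) : nilEval (complexShift c φ) t = nilEval φ (t * r) := by
  obtain ⟨B, hB⟩ := ht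
  have hw : (-(c • t)) ^ B = 0 := by
    rw [neg_pow, smul_pow, hB, smul_zero, mul_zero]
  rw [← sum_sum_choose φ t (-(c • t)) r B B hB hw (by rw [sub_neg_eq_add, hr]), nilEval_eq _ hB]
  have e : ∀ N, complexShift c φ N • t ^ N = ∑ p ∈ antidiagonal N,
      (φ p.1 • t ^ p.1) * (((p.1 + p.2 - 1).choose p.2 : S) * (-(c • t)) ^ p.2) := by
    intro N
    rw [complexShift, sum_smul]
    refine sum_congr rfl fun p hp => ?_
    rw [HasAntidiagonal.mem_antidiagonal] at hp
    rw [← hp, ← neg_smul, smul_pow, pow_add]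
    simp only [Algebra.smul_def, map_mul, map_pow, map_natCast]
    ring
  simp only [e]
  rw [sum_antidiagonal_eq_sum_range]
  intro a b h
  have : t ^ a * t ^ b = 0 := by rw [← pow_add]; exact pow_eq_zero_of_le h hB
  rw [neg_pow, smul_pow]
  simp only [Algebra.smul_def]
  linear_combination (algebraMap ℂ S (φ a)) * ((a + b - 1).choose b : S) * (-1) ^ b *
      (algebraMap ℂ S (c ^ b)) * this

/-- The sequence `φ` moved one place to the right. -/
def delay {M : Type*} [Zero M] (φ : ℕ → M) : ℕ → M
  | 0 => 0
  | k + 1 => φ k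

theorem nilEval_delay (φ : ℕ → ℂ) (t : S) (ht : IsNilpotent t) :
    nilEval (delay φ) t = t * nilEval φ t := by
  obtain ⟨B, hB⟩ := ht
  rw [nilEval_eq φ hB, nilEval_eq (delay φ) (pow_eq_zero_of_le (Nat.le_succ B) hB),
    sum_range_succ', mul_sum]
  simp only [delay, zero_smul, add_zero]
  refine sum_congr rfl fun k _ => ?_
  rw [pow_succ', mul_smul_comm]

/-- The functional equation of the normalizing series at a nilpotent argument: with `t = h / u` one has
`h / (u - n h) = t (1 - n t)⁻¹`. -/
theorem nilEval_normCoeff_functional (n : ℕ) (hn : 1 ≤ n) (t r : S) (ht : IsNilpotent t)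
    (hr : r * (1 - n * t) = 1) :
    nilEval (normCoeff n) (t * r) = (1 - t ^ 2) * nilEval (normCoeff n) t := by
  have key : ∀ N, complexShift (-n) (normCoeff n) N =
      normCoeff n N - delay (delay (normCoeff n)) N := by
    intro N
    have h1 := congrArg (PowerSeries.coeff N) (fCoeff_functional n hn N)
    have h2 : shiftInv (-(n * hbar)) (fCoeff n) N =
        PowerSeries.C (complexShift (-n) (normCoeff n) N) * hbar ^ N := by
      rw [shiftInv, complexShift, map_sum, sum_mul]
      refine sum_congr rfl fun p hp => ?_
      rw [HasAntidiagonal.mem_antidiagonal] at hp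
      rw [← hp, fCoeff, smul_eq_mul, pow_add]
      simp only [map_mul, map_natCast, map_pow, map_neg]
      ring
    have h3 : (fCoeff n N - (if 2 ≤ N then hbar ^ 2 * fCoeff n (N - 2) else 0)) =
        PowerSeries.C (normCoeff n N - delay (delay (normCoeff n)) N) * hbar ^ N := by
      rcases N with _ | _ | N
      · simp [delay, fCoeff]
      · simp [delay, fCoeff]
      · rw [if_pos (by omega), fCoeff, fCoeff, show N + 1 + 1 - 2 = N by omega, delay, delay]
        simp only [map_sub]
        ring
    rw [h2, h3] at h1
    -- The coefficients are homogeneous in `h`, so the identity over `ℂ` is read off from the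
    -- coefficient of `h^N`.
    simpa only [hbar, PowerSeries.coeff_C_mul, PowerSeries.coeff_X_pow_self, mul_one] using h1
  have h4 := nilEval_complexShift (-n : ℂ) (normCoeff n) t r ht (by
    rw [neg_smul, ← sub_eq_add_neg, Algebra.smul_def, map_natCast, hr])
  rw [← h4, show complexShift (-n : ℂ) (normCoeff n) = _ from funext key, sub_mul, one_mul, pow_two,
    mul_assoc, ← nilEval_delay _ _ ht, ← nilEval_delay _ _ ht]
  obtain ⟨B, hB⟩ := ht
  rw [nilEval_eq _ hB, nilEval_eq _ hB, nilEval_eq _ hB, ← sum_sub_distrib]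
  simp only [sub_smul]

theorem isUnit_nilEval_normCoeff (n : ℕ) (t : S) (ht : IsNilpotent t) :
    IsUnit (nilEval (normCoeff n) t) := by
  obtain ⟨B, hB⟩ := ht
  rw [nilEval_eq _ (pow_eq_zero_of_le (Nat.le_succ B) hB), sum_range_succ']
  have : IsNilpotent (∑ k ∈ range B, normCoeff n (k + 1) • t ^ (k + 1)) := by
    refine isNilpotent_sum fun k _ => ⟨B, ?_⟩
    rw [smul_pow, pow_succ, mul_pow, hB, mul_zero, smul_zero]
  rw [pow_zero, normCoeff, one_smul]
  exact this.isUnit_add_one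

end Evaluation

end YangianDouble

/-! ### Relations with a formal parameter in place of `h` -/

namespace YangianDouble

open Finset

section Generic

variable {n : ℕ} {B B' : Type*} [Ring B] [Ring B']

/-- The coefficient of `u^a` in `1 - x ∑_{r ≥ 0} g^{(r)} u^{-r-1}`. -/
def plusCoeff (x : B) (g : ℤ → Matrix (Fin n) (Fin n) B) (a : ℤ) : Matrix (Fin n) (Fin n) B :=
  Matrix.of fun i j => (if a = 0 ∧ i = j then 1 else 0) - (if a < 0 then x * g (-a - 1) i j else 0)

/-- The coefficient of `u^a` in `1 + x ∑_{r < 0} g^{(r)} u^{-r-1}`. -/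
def minusCoeff (x : B) (g : ℤ → Matrix (Fin n) (Fin n) B) (a : ℤ) : Matrix (Fin n) (Fin n) B :=
  Matrix.of fun i j => (if a = 0 ∧ i = j then 1 else 0) + (if 0 ≤ a then x * g (-a - 1) i j else 0)

theorem plusCoeff_map (f : B →+* B') (x : B) (g : ℤ → Matrix (Fin n) (Fin n) B) (a : ℤ) :
    (plusCoeff x g a).map f = plusCoeff (f x) (fun r => (g r).map f) a := by
  ext i j
  simp [plusCoeff, apply_ite f]

theorem minusCoeff_map (f : B →+* B') (x : B) (g : ℤ → Matrix (Fin n) (Fin n) B) (a : ℤ) :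
    (minusCoeff x g a).map f = minusCoeff (f x) (fun r => (g r).map f) a := by
  ext i j
  simp [minusCoeff, apply_ite f]

/-- The generators `l^{(r)}` of the free algebra as a matrix. -/
noncomputable def freeMat (n : ℕ) (r : ℤ) : Matrix (Fin n) (Fin n) (Free n) :=
  Matrix.of fun i j => freeL i j r

theorem Lplus_eq_plusCoeff (n : ℕ) : Lplus n = plusCoeff (algebraMap _ _ hbar) (freeMat n) := by
  ext a i j
  simp [Lplus, plusCoeff, freeMat, Algebra.smul_def]

theorem Lminus_eq_minusCoeff (n : ℕ) : Lminus n = minusCoeff (algebraMap _ _ hbar) (freeMat n) := by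
  ext a i j
  simp [Lminus, minusCoeff, freeMat, Algebra.smul_def]

theorem inFirst_map (f : B →+* B') (M : Matrix (Fin n) (Fin n) B) :
    (inFirst M).map f = inFirst (M.map f) := by
  ext ⟨i, k⟩ ⟨j, l⟩
  simp [inFirst, Matrix.kronecker, Matrix.kroneckerMap_apply, Matrix.one_apply, apply_ite f]

theorem inSecond_map (f : B →+* B') (M : Matrix (Fin n) (Fin n) B) :
    (inSecond M).map f = inSecond (M.map f) := by
  ext ⟨i, k⟩ ⟨j, l⟩
  simp [inSecond, Matrix.kronecker, Matrix.kroneckerMap_apply, Matrix.one_apply, apply_ite f]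

theorem permOp_map (f : B →+* B') : (permOp n B).map f = permOp n B' := by
  ext x y
  simp [permOp, apply_ite f]

/-- The relation `R(u-v) L_1(u) L_2'(v) = L_2'(v) L_1(u) R(u-v)`, the deformation parameter of the
`R`-matrix being `x`. -/
def genSame (x : B) (L L' : ℤ → Matrix (Fin n) (Fin n) B) (a b : ℤ) :
    Matrix (Fin n × Fin n) (Fin n × Fin n) B :=
  (inFirst (L (a - 1)) * inSecond (L' b) - inFirst (L a) * inSecond (L' (b - 1))
      + x • (permOp n B * inFirst (L a) * inSecond (L' b)))
    - (inSecond (L' b) * inFirst (L (a - 1)) - inSecond (L' (b - 1)) * inFirst (L a)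
      + x • (inSecond (L' b) * inFirst (L a) * permOp n B))

theorem smul_map (f : B →+* B') {m : Type*} (x : B) (M : Matrix m m B) :
    (x • M).map f = f x • M.map f := by
  ext i j
  simp

theorem genSame_map (f : B →+* B') (x : B) (L L' : ℤ → Matrix (Fin n) (Fin n) B) (a b : ℤ) :
    (genSame x L L' a b).map f = genSame (f x) (fun a => (L a).map f) (fun a => (L' a).map f) a b := by
  have h : ∀ M N : Matrix (Fin n × Fin n) (Fin n × Fin n) B, (M * N).map f = M.map f * N.map f :=
    fun M N => Matrix.map_mul
  have h1 : ∀ M N : Matrix (Fin n × Fin n) (Fin n × Fin n) B, (M - N).map f = M.map f - N.map f :=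
    fun M N => by ext; simp
  have h2 : ∀ M N : Matrix (Fin n × Fin n) (Fin n × Fin n) B, (M + N).map f = M.map f + N.map f :=
    fun M N => by ext; simp
  simp only [genSame, h, h1, h2, smul_map, inFirst_map, inSecond_map, permOp_map]

/-- The coefficient of `y^{-k}` in `f(y) (1 + h y^{-1} P)`, the parameter `h` being `x`. -/
noncomputable def genRcoeff (n : ℕ) (κ : ℂ →+* B) (x : B) (k : ℕ) :
    Matrix (Fin n × Fin n) (Fin n × Fin n) B :=
  (κ (normCoeff n k) * x ^ k) • 1 + (κ (delay (normCoeff n) k) * x ^ k) • permOp n B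

/-- The coefficient of `u^{-N} v^j` in `R(u - v - xw)`. -/
noncomputable def genRshift (n : ℕ) (κ : ℂ →+* B) (x w : B) (N j : ℕ) :
    Matrix (Fin n × Fin n) (Fin n × Fin n) B :=
  ∑ p ∈ antidiagonal N,
    ((((N - 1).choose p.2 * p.2.choose j : ℕ) : B) * (x * w) ^ (p.2 - j)) • genRcoeff n κ x p.1

/-- The relation `R(u - v - xw) L_1(u) L_2'(v) = L_2'(v) L_1(u) R(u - v + xw)`. -/
noncomputable def genMixed (n : ℕ) (κ : ℂ →+* B) (x w : B) (L L' : ℤ → Matrix (Fin n) (Fin n) B)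
    (S T : ℕ) : Matrix (Fin n × Fin n) (Fin n × Fin n) B :=
  ∑ p ∈ antidiagonal S, ∑ q ∈ antidiagonal T,
    (genRshift n κ x w p.1 q.1 * inFirst (L (-(p.2 : ℤ))) * inSecond (L' q.2)
      - inSecond (L' q.2) * inFirst (L (-(p.2 : ℤ))) * genRshift n κ x (-w) p.1 q.1)

theorem genRshift_map (f : B →+* B') (κ : ℂ →+* B) (x w : B) (N j : ℕ) :
    f.mapMatrix (genRshift n κ x w N j) = genRshift n (f.comp κ) (f x) (f w) N j := by
  simp only [genRshift, genRcoeff, map_sum]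
  refine sum_congr rfl fun p _ => ?_
  rw [RingHom.mapMatrix_apply, smul_map, Matrix.map_add _ (map_add f), smul_map, smul_map, permOp_map,
    Matrix.map_one _ (map_zero f) (map_one f)]
  simp

theorem genMixed_map (f : B →+* B') (κ : ℂ →+* B) (x w : B) (L L' : ℤ → Matrix (Fin n) (Fin n) B)
    (S T : ℕ) : (genMixed n κ x w L L' S T).map f =
      genMixed n (f.comp κ) (f x) (f w) (fun a => (L a).map f) (fun a => (L' a).map f) S T := by
  rw [← RingHom.mapMatrix_apply]
  simp only [genMixed, map_sum, map_sub, map_mul, genRshift_map, map_neg]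
  simp only [RingHom.mapMatrix_apply, inFirst_map, inSecond_map]

/-- The complex numbers, inside the free algebra. -/
noncomputable def complexFree (n : ℕ) : ℂ →+* Free n :=
  (algebraMap Scalars (Free n)).comp PowerSeries.C

theorem relSame_eq_genSame (L : ℤ → Matrix (Fin n) (Fin n) (Free n)) (a b : ℤ) :
    relSame L a b = genSame (algebraMap _ _ hbar) L L a b := by
  have h : ∀ M : Matrix (Fin n × Fin n) (Fin n × Fin n) (Free n),
      hbar • M = algebraMap Scalars (Free n) hbar • M := fun M => by
    ext; simp [Algebra.smul_def]
  simp only [relSame, genSame, h]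

theorem Rcoeff_eq_genRcoeff (k : ℕ) :
    Rcoeff n k = genRcoeff n (complexFree n) (algebraMap _ _ hbar) k := by
  have h : ∀ (r : Scalars) (M : Matrix (Fin n × Fin n) (Fin n × Fin n) (Free n)),
      r • M = algebraMap Scalars (Free n) r • M := fun r M => by
    ext; simp [Algebra.smul_def]
  rw [Rcoeff, genRcoeff, h, h]
  rcases k with _ | k
  · simp [fCoeff, complexFree, delay]
  · simp only [fCoeff, complexFree, delay, Nat.add_sub_cancel, RingHom.comp_apply, map_mul, map_pow,
      if_neg (Nat.succ_ne_zero k)]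
    congr 2
    rw [← map_pow, ← map_mul, ← map_mul, ← map_pow, ← map_mul]
    congr 1
    ring

theorem relMixed_eq_genMixed (S T : ℕ) : relMixed n S T =
    genMixed n (complexFree n) (algebraMap _ _ hbar) (complexFree n (1 / 2) * freeC n)
      (Lplus n) (Lminus n) S T := by
  have h : halfHC n = algebraMap _ _ hbar * (complexFree n (1 / 2) * freeC n) := by
    rw [halfHC, Algebra.smul_def, complexFree, RingHom.comp_apply, ← mul_assoc, ← map_mul,
      mul_comm hbar]
  simp only [relMixed, genMixed, RshiftCoeff, genRshift, Rcoeff_eq_genRcoeff, h, neg_neg, mul_neg]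

theorem genRshift_zero (κ : ℂ →+* B) (w : B) (N j : ℕ) :
    genRshift n κ 0 w N j = if N = 0 ∧ j = 0 then 1 else 0 := by
  rcases N with _ | N
  · rcases j with _ | j
    · simp [genRshift, genRcoeff, normCoeff, delay]
    · simp [genRshift]
  · rw [if_neg (by omega), genRshift]
    refine sum_eq_zero fun p hp => ?_
    rw [HasAntidiagonal.mem_antidiagonal] at hp
    rcases hp1 : p.1 with _ | q
    · have : (N + 1 - 1).choose p.2 = 0 := Nat.choose_eq_zero_of_lt (by omega)
      rw [this]
      simp
    · simp [genRcoeff]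

/-- For a scalar shift, the coefficients of `R(u - v + c x)` in `u⁻¹` and `v` are linear
combinations of `1` and `P`, with coefficients in terms of those of the shifted normalizing
series. The proof regroups the binomial coefficients in the expansion of `(u - v + c x)^{-k}`. -/
theorem genRshift_scalar (κ : ℂ →+* B) (x : B) (hx : ∀ z, Commute (κ z) x) (c : ℂ) (N j : ℕ) :
    genRshift n κ x (κ (-c)) N j =
      (κ ((N - 1).choose j * complexShift c (normCoeff n) (N - j)) * x ^ (N - j)) • 1 +
      (κ ((N - 1).choose j * complexShift c (delay (normCoeff n)) (N - j)) * x ^ (N - j)) •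
        permOp n B := by
  have key : ∀ φ : ℕ → ℂ, ∑ p ∈ antidiagonal N,
      (((N - 1).choose p.2 * p.2.choose j : ℕ) : B) * (x * κ (-c)) ^ (p.2 - j) *
        (κ (φ p.1) * x ^ p.1) =
      κ ((N - 1).choose j * complexShift c φ (N - j)) * x ^ (N - j) := by
    intro φ
    rcases lt_or_ge N j with h | h
    · rw [Nat.choose_eq_zero_of_lt (by omega)]
      simp only [Nat.cast_zero, zero_mul, map_zero]
      refine sum_eq_zero fun p hp => ?_
      rw [HasAntidiagonal.mem_antidiagonal] at hp
      rw [Nat.choose_eq_zero_of_lt (show p.2 < j by omega)]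
      simp
    · obtain ⟨M, rfl⟩ := Nat.exists_eq_add_of_le' h
      rw [Nat.add_sub_cancel, complexShift, mul_sum, map_sum, sum_mul]
      let e : ℕ × ℕ ↪ ℕ × ℕ := ⟨fun p => (p.1, p.2 + j), fun p q h => by
        simpa [Prod.ext_iff] using h⟩
      have he : ∀ p, e p = (p.1, p.2 + j) := fun p => rfl
      have hsub : (antidiagonal M).map e ⊆ antidiagonal (M + j) := by
        intro p hp
        simp only [mem_map, HasAntidiagonal.mem_antidiagonal, he] at hp ⊢
        obtain ⟨q, hq, rfl⟩ := hp
        simp only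
        omega
      rw [← sum_subset hsub, sum_map]
      · refine sum_congr rfl fun p hp => ?_
        rw [HasAntidiagonal.mem_antidiagonal] at hp
        simp only [he, Nat.add_sub_cancel]
        have e1 : (M + j - 1).choose (p.2 + j) * (p.2 + j).choose j =
            (M + j - 1).choose j * (M - 1).choose p.2 := by
          rcases M with _ | M
          · have : p.2 = 0 := by omega
            simp [this]
          · rcases le_or_gt (p.2 + j) (M + 1 + j - 1) with h' | h'
            · rw [Nat.choose_mul (by omega), show M + 1 + j - 1 - j = M + 1 - 1 by omega,
                show p.2 + j - j = p.2 by omega]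
            · rw [Nat.choose_eq_zero_of_lt h', Nat.choose_eq_zero_of_lt (show M + 1 - 1 < p.2 by omega)]
              simp
        have e2 : (x * κ (-c)) ^ p.2 * (κ (φ p.1) * x ^ p.1) =
            κ ((-c) ^ p.2 * φ p.1) * x ^ M := by
          rw [((hx (-c)).symm).mul_pow, ← map_pow, mul_assoc, ← mul_assoc (κ ((-c) ^ p.2)), ← map_mul,
            ← mul_assoc, ← ((hx _).pow_right p.2).eq, mul_assoc, ← pow_add, add_comm p.2, hp]
        rw [e1, mul_assoc, e2, ← mul_assoc, ← map_natCast κ, ← map_mul]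
        congr 2
        push_cast
        ring
      · intro p hp hp'
        rw [HasAntidiagonal.mem_antidiagonal] at hp
        rw [Nat.choose_eq_zero_of_lt (show p.2 < j from ?_)]
        · simp
        · by_contra hlt
          refine hp' (mem_map.2 ⟨(p.1, p.2 - j), ?_, ?_⟩)
          · rw [HasAntidiagonal.mem_antidiagonal]
            simp only
            omega
          · rw [he]
            ext <;> simp
            omega
  rw [genRshift, ← key, ← key, sum_smul, sum_smul, ← sum_add_distrib]
  refine sum_congr rfl fun p _ => ?_
  rw [genRcoeff, smul_add, smul_smul, smul_smul]

theorem genSame_apply (x : B) (L L' : ℤ → Matrix (Fin n) (Fin n) B) (a b : ℤ)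
    (i j k l : Fin n) :
    genSame x L L' a b (i, k) (j, l) =
      (L (a - 1) i j * L' b k l - L a i j * L' (b - 1) k l + x * (L a k j * L' b i l))
      - (L' b k l * L (a - 1) i j - L' (b - 1) k l * L a i j + x * (L' b k j * L a i l)) := by
  simp only [genSame, Matrix.sub_apply, Matrix.add_apply, Matrix.smul_apply, smul_eq_mul,
    Matrix.mul_assoc (permOp n B), permOp_mul, mul_permOp,
    inFirst_mul_inSecond, inSecond_mul_inFirst, Prod.fst_swap, Prod.snd_swap]

theorem plusCoeff_zero (g : ℤ → Matrix (Fin n) (Fin n) B) (a : ℤ) :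
    plusCoeff 0 g a = if a = 0 then 1 else 0 := by
  ext i j
  by_cases h : a = 0 <;> simp [plusCoeff, h, Matrix.one_apply]

theorem minusCoeff_zero (g : ℤ → Matrix (Fin n) (Fin n) B) (a : ℤ) :
    minusCoeff 0 g a = if a = 0 then 1 else 0 := by
  ext i j
  by_cases h : a = 0 <;> simp [minusCoeff, h, Matrix.one_apply]

theorem inFirst_one : inFirst (1 : Matrix (Fin n) (Fin n) B) = 1 := by
  simp [inFirst]

theorem inSecond_one : inSecond (1 : Matrix (Fin n) (Fin n) B) = 1 := by
  simp [inSecond]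

theorem inFirst_zero : inFirst (0 : Matrix (Fin n) (Fin n) B) = 0 := by
  simp [inFirst]

theorem inSecond_zero : inSecond (0 : Matrix (Fin n) (Fin n) B) = 0 := by
  simp [inSecond]

theorem genSame_zero (L : ℤ → Matrix (Fin n) (Fin n) B) (a b : ℤ) :
    genSame 0 L (fun b => if b = 0 then 1 else 0) a b = 0 := by
  simp only [genSame, zero_smul, add_zero]
  split_ifs <;> simp [inSecond_one, inSecond_zero]

theorem genMixed_zero_left (κ : ℂ →+* B) (w : B) (L : ℤ → Matrix (Fin n) (Fin n) B) (S T : ℕ) :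
    genMixed n κ 0 w (fun b => if b = 0 then 1 else 0) L S T = 0 := by
  refine sum_eq_zero fun p _ => sum_eq_zero fun q _ => ?_
  rw [genRshift_zero, genRshift_zero]
  split_ifs
  · simp only
    split_ifs <;> simp [inFirst_one, inFirst_zero]
  · simp

theorem genMixed_zero_right (κ : ℂ →+* B) (w : B) (L : ℤ → Matrix (Fin n) (Fin n) B) (S T : ℕ) :
    genMixed n κ 0 w L (fun b => if b = 0 then 1 else 0) S T = 0 := by
  refine sum_eq_zero fun p _ => sum_eq_zero fun q _ => ?_
  rw [genRshift_zero, genRshift_zero]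
  split_ifs
  · simp only
    split_ifs <;> simp [inSecond_one, inSecond_zero]
  · simp

theorem map_ringHom_id (M : Matrix (Fin n) (Fin n) B) : M.map (RingHom.id B) = M := by
  ext; simp

end Generic

section Divided

variable {n : ℕ} {B : Type*} [Ring B] [Algebra Scalars B]

/-- A relation of the free algebra in which a formal parameter is substituted for some of the
occurrences of `h`, and which is trivial at the value `0` of the parameter, holds for any central
value `ε` of the parameter with `ε² = h ε`: such a relation is a consequence of the relation
divided by `h`. -/
theorem eval_eq_zero_of_coeff_zero (f : Free n →+* B) (ψ : DYbar n →ₐ[Scalars] B)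
    (hf : ∀ x, f x = ψ (toBar n x)) (ε : B) (hε : ∀ x, Commute x ε)
    (hεh : ε * ε = algebraMap Scalars B hbar * ε) (p : Polynomial (Free n)) (h0 : p.coeff 0 = 0)
    (hp : p.eval (algebraMap _ _ hbar) ∈ relIdeal n) :
    Polynomial.eval₂RingHom' f ε (fun _ => hε _) p = 0 := by
  obtain ⟨q, rfl⟩ := Polynomial.X_dvd_iff.2 h0
  have hX : (Polynomial.X * q).eval (algebraMap Scalars (Free n) hbar) =
      hbar ^ 1 • q.eval (algebraMap _ _ hbar) := by
    rw [Polynomial.X_mul, Polynomial.eval_mul_X, ← Algebra.commutes, pow_one, Algebra.smul_def]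
  rw [hX] at hp
  have h1 := toBar_eq_zero_of_smul 1 hp
  -- A factor `ε` in front replaces every other `ε` by `h`.
  have h2 : ∀ q : Polynomial (Free n), ε * Polynomial.eval₂RingHom' f ε (fun _ => hε _) q =
      ε * ψ (toBar n (q.eval (algebraMap _ _ hbar))) := by
    intro q
    induction q using Polynomial.induction_on with
    | C a => simp [hf]
    | add p q hp hq => rw [map_add, mul_add, hp, hq, Polynomial.eval_add, map_add, map_add, mul_add]
    | monomial m a ih =>
      have e : (Polynomial.C a * Polynomial.X ^ (m + 1)).eval (algebraMap Scalars (Free n) hbar) =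
          (Polynomial.C a * Polynomial.X ^ m).eval (algebraMap Scalars (Free n) hbar) *
            algebraMap _ _ hbar := by
        rw [pow_succ, ← mul_assoc, Polynomial.eval_mul_X]
      have e' : Polynomial.eval₂RingHom' f ε (fun _ => hε _) Polynomial.X = ε := by
        simp [Polynomial.eval₂RingHom']
      rw [e, map_mul (toBar n), map_mul ψ, AlgHom.commutes, AlgHom.commutes, pow_succ, ← mul_assoc,
        map_mul _ (_ * _) Polynomial.X, e', ← mul_assoc, ih]
      generalize ψ _ = W
      rw [mul_assoc, (hε W).eq, ← mul_assoc, hεh, mul_assoc, Algebra.commutes, mul_assoc]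
  have e' : Polynomial.eval₂RingHom' f ε (fun _ => hε _) Polynomial.X = ε := by
    simp [Polynomial.eval₂RingHom']
  rw [map_mul, e', h2, h1, map_zero, mul_zero]

/-- `eval_eq_zero_of_coeff_zero` for the entries of a matrix. -/
theorem map_eq_zero_of_coeff_zero (f : Free n →+* B) (ψ : DYbar n →ₐ[Scalars] B)
    (hf : ∀ x, f x = ψ (toBar n x)) (ε : B) (hε : ∀ x, Commute x ε)
    (hεh : ε * ε = algebraMap Scalars B hbar * ε) {m : Type*} (M : Matrix m m (Polynomial (Free n)))
    (h0 : M.map (Polynomial.eval₂RingHom' (RingHom.id _) 0 fun _ => Commute.zero_right _) = 0)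
    (hM : ∀ x y, M.map (Polynomial.eval₂RingHom' (RingHom.id _) (algebraMap Scalars (Free n) hbar)
      fun _ => Algebra.commute_algebraMap_right _ _) x y ∈ relIdeal n) :
    M.map (Polynomial.eval₂RingHom' f ε fun _ => hε _) = 0 := by
  ext x y
  refine eval_eq_zero_of_coeff_zero f ψ hf ε hε hεh (M x y) ?_ (hM x y)
  rw [Polynomial.coeff_zero_eq_eval_zero]
  exact congrFun (congrFun h0 x) y

end Divided

section Substitution

variable {n : ℕ} {B : Type*} [Ring B]

theorem map_C_eval (M : Matrix (Fin n) (Fin n) (Free n)) (f : Free n →+* B)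
    (ε : B) (hε : ∀ x, Commute (f x) ε) :
    (M.map (Polynomial.C : Free n →+* _)).map (Polynomial.eval₂RingHom' f ε hε) = M.map f := by
  ext i j
  simp [Polynomial.eval₂RingHom']

theorem eval_X (f : Free n →+* B) (ε : B) (hε : ∀ x, Commute (f x) ε) :
    Polynomial.eval₂RingHom' f ε hε Polynomial.X = ε := by
  simp [Polynomial.eval₂RingHom']

theorem eval_C (f : Free n →+* B) (ε : B) (hε : ∀ x, Commute (f x) ε)
    (x : Free n) : Polynomial.eval₂RingHom' f ε hε (Polynomial.C x) = f x := by
  simp [Polynomial.eval₂RingHom']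

theorem eval_comp_C (f : Free n →+* B) (ε : B) (hε : ∀ x, Commute (f x) ε) :
    (Polynomial.eval₂RingHom' f ε hε).comp ((Polynomial.C).comp (complexFree n)) =
      f.comp (complexFree n) := by
  ext z
  simp [Polynomial.eval₂RingHom']

theorem eval_genSame_plus (f : Free n →+* B) (ε : B) (hε : ∀ x, Commute (f x) ε) (a b : ℤ) :
    (genSame Polynomial.X (fun a => (Lplus n a).map Polynomial.C)
      (plusCoeff Polynomial.X fun r => (freeMat n r).map Polynomial.C) a b).map
        (Polynomial.eval₂RingHom' f ε hε) =
      genSame ε (fun a => (Lplus n a).map f) (plusCoeff ε fun r => (freeMat n r).map f) a b := by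
  simp only [genSame_map, plusCoeff_map, map_C_eval, eval_X]

theorem eval_genSame_minus (f : Free n →+* B) (ε : B) (hε : ∀ x, Commute (f x) ε) (a b : ℤ) :
    (genSame Polynomial.X (fun a => (Lminus n a).map Polynomial.C)
      (minusCoeff Polynomial.X fun r => (freeMat n r).map Polynomial.C) a b).map
        (Polynomial.eval₂RingHom' f ε hε) =
      genSame ε (fun a => (Lminus n a).map f) (minusCoeff ε fun r => (freeMat n r).map f) a b := by
  simp only [genSame_map, minusCoeff_map, map_C_eval, eval_X]

theorem eval_genMixed_plus (f : Free n →+* B) (ε : B) (hε : ∀ x, Commute (f x) ε) (w : Free n)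
    (S T : ℕ) :
    (genMixed n ((Polynomial.C).comp (complexFree n)) Polynomial.X (Polynomial.C w)
      (plusCoeff Polynomial.X fun r => (freeMat n r).map Polynomial.C)
      (fun a => (Lminus n a).map Polynomial.C) S T).map (Polynomial.eval₂RingHom' f ε hε) =
    genMixed n (f.comp (complexFree n)) ε (f w) (plusCoeff ε fun r => (freeMat n r).map f)
      (fun a => (Lminus n a).map f) S T := by
  simp only [genMixed_map, plusCoeff_map, map_C_eval, eval_X, eval_C, eval_comp_C]

theorem eval_genMixed_minus (f : Free n →+* B) (ε : B) (hε : ∀ x, Commute (f x) ε) (w : Free n)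
    (S T : ℕ) :
    (genMixed n ((Polynomial.C).comp (complexFree n)) Polynomial.X (Polynomial.C w)
      (fun a => (Lplus n a).map Polynomial.C)
      (minusCoeff Polynomial.X fun r => (freeMat n r).map Polynomial.C) S T).map
        (Polynomial.eval₂RingHom' f ε hε) =
    genMixed n (f.comp (complexFree n)) ε (f w) (fun a => (Lplus n a).map f)
      (minusCoeff ε fun r => (freeMat n r).map f) S T := by
  simp only [genMixed_map, minusCoeff_map, map_C_eval, eval_X, eval_C, eval_comp_C]

end Substitution

section Relations

variable {n : ℕ} {B : Type*} [Ring B] [Algebra Scalars B]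

/-- The relation between two series `L^+`, with `ε` in place of `h` in one of them and in the
`R`-matrix. At the value `0` of the parameter it is trivial, so `eval_eq_zero_of_coeff_zero`
applies; likewise for the three relations below. -/
theorem genSame_plus (f : Free n →+* B) (ψ : DYbar n →ₐ[Scalars] B)
    (hf : ∀ x, f x = ψ (toBar n x)) (ε : B) (hε : ∀ x, Commute x ε)
    (hεh : ε * ε = algebraMap Scalars B hbar * ε) (a b : ℤ) :
    genSame ε (fun a => (Lplus n a).map f) (plusCoeff ε fun r => (freeMat n r).map f) a b = 0 := by
  rw [← eval_genSame_plus f ε fun _ => hε _]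
  refine map_eq_zero_of_coeff_zero f ψ hf ε hε hεh _ ?_ ?_
  · rw [eval_genSame_plus, show plusCoeff (0 : Free n) = _ from funext₂ plusCoeff_zero, genSame_zero]
  · rw [eval_genSame_plus]
    simp only [map_ringHom_id, ← Lplus_eq_plusCoeff, ← relSame_eq_genSame]
    exact fun x y => relIdeal_of (IsRelator.plus_plus a b x y)

theorem genSame_minus (f : Free n →+* B) (ψ : DYbar n →ₐ[Scalars] B)
    (hf : ∀ x, f x = ψ (toBar n x)) (ε : B) (hε : ∀ x, Commute x ε)
    (hεh : ε * ε = algebraMap Scalars B hbar * ε) (a b : ℤ) :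
    genSame ε (fun a => (Lminus n a).map f) (minusCoeff ε fun r => (freeMat n r).map f) a b = 0 := by
  rw [← eval_genSame_minus f ε fun _ => hε _]
  refine map_eq_zero_of_coeff_zero f ψ hf ε hε hεh _ ?_ ?_
  · rw [eval_genSame_minus, show minusCoeff (0 : Free n) = _ from funext₂ minusCoeff_zero,
      genSame_zero]
  · rw [eval_genSame_minus]
    simp only [map_ringHom_id, ← Lminus_eq_minusCoeff, ← relSame_eq_genSame]
    exact fun x y => relIdeal_of (IsRelator.minus_minus a b x y)

/-- At the critical level `c / 2 = -n / 2`. -/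
theorem map_half_central (f : Free n →+* B) (ψ : DYbar n →ₐ[Scalars] B)
    (hf : ∀ x, f x = ψ (toBar n x)) : f (complexFree n (1 / 2) * freeC n) =
    f.comp (complexFree n) (-((n : ℂ) / 2)) := by
  rw [map_mul, hf (freeC n), toBar_freeC, map_neg, map_natCast, RingHom.comp_apply, ← map_natCast f,
    ← map_neg, ← map_mul, ← map_natCast (complexFree n), ← map_neg, ← map_mul]
  congr 2
  ring

theorem genMixed_plus (f : Free n →+* B) (ψ : DYbar n →ₐ[Scalars] B)
    (hf : ∀ x, f x = ψ (toBar n x)) (ε : B) (hε : ∀ x, Commute x ε)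
    (hεh : ε * ε = algebraMap Scalars B hbar * ε) (S T : ℕ) :
    genMixed n (f.comp (complexFree n)) ε (f.comp (complexFree n) (-((n : ℂ) / 2)))
      (plusCoeff ε fun r => (freeMat n r).map f) (fun a => (Lminus n a).map f) S T = 0 := by
  rw [← map_half_central f ψ hf, ← eval_genMixed_plus f ε fun _ => hε _]
  refine map_eq_zero_of_coeff_zero f ψ hf ε hε hεh _ ?_ ?_
  · rw [eval_genMixed_plus, show plusCoeff (0 : Free n) = _ from funext₂ plusCoeff_zero,
      genMixed_zero_left]
  · rw [eval_genMixed_plus]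
    simp only [map_ringHom_id, ← Lplus_eq_plusCoeff, RingHom.id_comp, RingHom.id_apply]
    exact fun x y => (relMixed_eq_genMixed (n := n) S T) ▸ relIdeal_of (IsRelator.plus_minus S T x y)

theorem genMixed_minus (f : Free n →+* B) (ψ : DYbar n →ₐ[Scalars] B)
    (hf : ∀ x, f x = ψ (toBar n x)) (ε : B) (hε : ∀ x, Commute x ε)
    (hεh : ε * ε = algebraMap Scalars B hbar * ε) (S T : ℕ) :
    genMixed n (f.comp (complexFree n)) ε (f.comp (complexFree n) (-((n : ℂ) / 2)))
      (fun a => (Lplus n a).map f) (minusCoeff ε fun r => (freeMat n r).map f) S T = 0 := by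
  rw [← map_half_central f ψ hf, ← eval_genMixed_minus f ε fun _ => hε _]
  refine map_eq_zero_of_coeff_zero f ψ hf ε hε hεh _ ?_ ?_
  · rw [eval_genMixed_minus, show minusCoeff (0 : Free n) = _ from funext₂ minusCoeff_zero,
      genMixed_zero_right]
  · rw [eval_genMixed_minus]
    simp only [map_ringHom_id, ← Lminus_eq_minusCoeff, RingHom.id_comp, RingHom.id_apply]
    exact fun x y => (relMixed_eq_genMixed (n := n) S T) ▸ relIdeal_of (IsRelator.plus_minus S T x y)

end Relations

end YangianDouble

/-! ### Divided relations and their generating series -/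

namespace YangianDouble

open Finset

section Generators

variable {n : ℕ} {B : Type*} [Ring B]

/-- The coefficient of `u^a` in `(L^+(u) - 1) / h`. -/
def plusPart (g : ℤ → Matrix (Fin n) (Fin n) B) (a : ℤ) : Matrix (Fin n) (Fin n) B :=
  Matrix.of fun i j => -(if a < 0 then g (-a - 1) i j else 0)

/-- The coefficient of `u^a` in `(L^-(u) - 1) / h`. -/
def minusPart (g : ℤ → Matrix (Fin n) (Fin n) B) (a : ℤ) : Matrix (Fin n) (Fin n) B :=
  Matrix.of fun i j => if 0 ≤ a then g (-a - 1) i j else 0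

theorem plusCoeff_apply (x : B) (g : ℤ → Matrix (Fin n) (Fin n) B) (a : ℤ) (i j : Fin n) :
    plusCoeff x g a i j = (if a = 0 ∧ i = j then 1 else 0) + x * plusPart g a i j := by
  simp only [plusCoeff, plusPart, Matrix.of_apply, mul_neg, sub_eq_add_neg]
  split_ifs <;> simp

theorem minusCoeff_apply (x : B) (g : ℤ → Matrix (Fin n) (Fin n) B) (a : ℤ) (i j : Fin n) :
    minusCoeff x g a i j = (if a = 0 ∧ i = j then 1 else 0) + x * minusPart g a i j := by
  simp only [minusCoeff, minusPart, Matrix.of_apply]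
  split_ifs <;> simp

/-- The relation `R(u-v) L_1(u) L_2(v) = L_2(v) L_1(u) R(u-v)` for `L = 1 + h X`, divided by `h`. -/
def dividedSame (L X : ℤ → Matrix (Fin n) (Fin n) B) (a b : ℤ) (i j k l : Fin n) : B :=
  (L (a - 1) i j * X b k l - L a i j * X (b - 1) k l + L a k j * L b i l)
      - (X b k l * L (a - 1) i j - X (b - 1) k l * L a i j + L b k j * L a i l)

theorem dividedSame_map {B' : Type*} [Ring B'] (f : B →+* B')
    (L X : ℤ → Matrix (Fin n) (Fin n) B) (a b : ℤ) (i j k l : Fin n) :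
    f (dividedSame L X a b i j k l) =
      dividedSame (fun a => (L a).map f) (fun a => (X a).map f) a b i j k l := by
  simp [dividedSame]

/-- Since `L - 1` is divisible by `h`, every term of the relation is. -/
theorem relSame_eq_smul (L X : ℤ → Matrix (Fin n) (Fin n) (Free n)) (a b : ℤ) (i j k l : Fin n)
    (h : ∀ b i j, L b i j = (if b = 0 ∧ i = j then 1 else 0) + algebraMap _ _ hbar * X b i j) :
    relSame L a b (i, k) (j, l) = hbar • dividedSame L X a b i j k l := by
  have e : ∀ x b i j, x * L b i j - L b i j * x = hbar • (x * X b i j - X b i j * x) := by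
    intro x b i j
    rw [h, mul_add, add_mul, ← Algebra.smul_def, mul_smul_comm, smul_mul_assoc, smul_sub]
    split_ifs <;> simp
  have e1 := e (L (a - 1) i j) b k l
  have e2 := e (L a i j) (b - 1) k l
  rw [relSame_apply, dividedSame]
  simp only [smul_sub, smul_add] at e1 e2 ⊢
  calc _ = (L (a - 1) i j * L b k l - L b k l * L (a - 1) i j) -
        (L a i j * L (b - 1) k l - L (b - 1) k l * L a i j) +
        (hbar • (L a k j * L b i l) - hbar • (L b k j * L a i l)) := by abel
    _ = _ := by rw [e1, e2]; abel

/-- The relation divided by `h` holds because the algebra has no `h`-torsion. -/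
theorem toBar_dividedSame_plus (a b : ℤ) (i j k l : Fin n) :
    toBar n (dividedSame (Lplus n) (plusPart (freeMat n)) a b i j k l) = 0 := by
  refine toBar_eq_zero_of_smul 1 ?_
  rw [pow_one, ← relSame_eq_smul]
  · exact relIdeal_of (IsRelator.plus_plus a b _ _)
  · intro b i j
    rw [Lplus_eq_plusCoeff, plusCoeff_apply]

theorem toBar_dividedSame_minus (a b : ℤ) (i j k l : Fin n) :
    toBar n (dividedSame (Lminus n) (minusPart (freeMat n)) a b i j k l) = 0 := by
  refine toBar_eq_zero_of_smul 1 ?_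
  rw [pow_one, ← relSame_eq_smul]
  · exact relIdeal_of (IsRelator.minus_minus a b _ _)
  · intro b i j
    rw [Lminus_eq_minusCoeff, minusCoeff_apply]

end Generators

section Representation

/-- Matrices `l^{(r)}` over a `K`-algebra which satisfy the relations of the Yangian double at the
critical level, together with their consequences in which one of the two series `L^±` and the
`R`-matrix have the deformation parameter `ε` in place of `h`. -/
structure Relations (n : ℕ) {K B : Type*} [CommRing K] [Algebra ℂ K] [Ring B] [Algebra K B]
    (h ε : K) (l : ℤ → Matrix (Fin n) (Fin n) B) : Prop where
  same_plus (a b : ℤ) : genSame (algebraMap K B ε) (plusCoeff (algebraMap K B h) l)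
    (plusCoeff (algebraMap K B ε) l) a b = 0
  same_minus (a b : ℤ) : genSame (algebraMap K B ε) (minusCoeff (algebraMap K B h) l)
    (minusCoeff (algebraMap K B ε) l) a b = 0
  mixed_plus (S T : ℕ) : genMixed n ((algebraMap K B).comp (algebraMap ℂ K)) (algebraMap K B ε)
    ((algebraMap K B).comp (algebraMap ℂ K) (-((n : ℂ) / 2))) (plusCoeff (algebraMap K B ε) l)
    (minusCoeff (algebraMap K B h) l) S T = 0
  mixed_minus (S T : ℕ) : genMixed n ((algebraMap K B).comp (algebraMap ℂ K)) (algebraMap K B ε)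
    ((algebraMap K B).comp (algebraMap ℂ K) (-((n : ℂ) / 2))) (plusCoeff (algebraMap K B h) l)
    (minusCoeff (algebraMap K B ε) l) S T = 0
  divided_plus (a b : ℤ) (i j p q : Fin n) :
    dividedSame (plusCoeff (algebraMap K B h) l) (plusPart l) a b i j p q = 0
  divided_minus (a b : ℤ) (i j p q : Fin n) :
    dividedSame (minusCoeff (algebraMap K B h) l) (minusPart l) a b i j p q = 0

variable {n : ℕ} {K B : Type*} [CommRing K] [Ring B] [Algebra K B]

/-- `L^+(u)` as a power series in `u^{-1}`. -/
noncomputable def plusSeries (x : K) (l : ℤ → Matrix (Fin n) (Fin n) B) :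
    Matrix (Fin n) (Fin n) (PowerSeries B) :=
  Matrix.of fun i j => PowerSeries.mk fun k => plusCoeff (algebraMap K B x) l (-(k : ℤ)) i j

/-- `L^-(u)` as a power series in `u`. -/
noncomputable def minusSeries (x : K) (l : ℤ → Matrix (Fin n) (Fin n) B) :
    Matrix (Fin n) (Fin n) (PowerSeries B) :=
  Matrix.of fun i j => PowerSeries.mk fun k => minusCoeff (algebraMap K B x) l (k : ℤ) i j

/-- The value of `L^+` at `u = z^{-1}`, where `z ^ R = 0`. -/
def plusValue (x z : K) (R : ℕ) (l : ℤ → Matrix (Fin n) (Fin n) B) (i j : Fin n) : B :=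
  ∑ m ∈ range R, z ^ m • plusCoeff (algebraMap K B x) l (-(m : ℤ)) i j

/-- The value of `L^-` at `u = z`, where `z ^ R = 0`. -/
def minusValue (x z : K) (R : ℕ) (l : ℤ → Matrix (Fin n) (Fin n) B) (i j : Fin n) : B :=
  ∑ m ∈ range R, z ^ m • minusCoeff (algebraMap K B x) l (m : ℤ) i j

/-- Polynomials over `K` as central power series over `B`. -/
noncomputable def polySeries (B : Type*) [Ring B] [Algebra K B] :
    Polynomial K →ₐ[K] PowerSeries B := Polynomial.aeval PowerSeries.X

theorem coeff_polySeries_mul (p : Polynomial K) (φ : PowerSeries B) (N : ℕ) :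
    PowerSeries.coeff N (polySeries B p * φ) =
      ∑ q ∈ antidiagonal N, p.coeff q.1 • PowerSeries.coeff q.2 φ := by
  have h : ∀ m, PowerSeries.coeff m (polySeries B p) = algebraMap K B (p.coeff m) := by
    intro m
    rw [polySeries, Polynomial.aeval_eq_sum_range, map_sum]
    simp only [PowerSeries.coeff_smul, PowerSeries.coeff_X_pow]
    simp only [smul_ite, smul_zero]
    rw [sum_ite_eq]
    split_ifs with h
    · rw [Algebra.smul_def, mul_one]
    · rw [mem_range, not_lt] at h
      rw [Polynomial.coeff_eq_zero_of_natDegree_lt (by omega), map_zero]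
  rw [PowerSeries.coeff_mul]
  exact sum_congr rfl fun q _ => by rw [h, Algebra.smul_def]

theorem polySeries_X : polySeries B (Polynomial.X : Polynomial K) = PowerSeries.X := by
  simp [polySeries]

theorem polySeries_C (a : K) : polySeries B (Polynomial.C a) = algebraMap K _ a := by
  simp [polySeries]

theorem sum_smul_same (x₁ x₂ x₃ x₄ : B) (e : K) (s : ℕ → K) (c d c₁ c₂ : ℕ → B) (I : Finset ℕ) :
    ∑ b ∈ I, s b • ((x₁ * c b - x₂ * d b + algebraMap K B e * (x₃ * c₁ b)) -
      (c b * x₁ - d b * x₂ + algebraMap K B e * (c₂ b * x₄))) =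
    (x₁ * (∑ b ∈ I, s b • c b) - x₂ * (∑ b ∈ I, s b • d b) + e • (x₃ * ∑ b ∈ I, s b • c₁ b)) -
      ((∑ b ∈ I, s b • c b) * x₁ - (∑ b ∈ I, s b • d b) * x₂ + e • ((∑ b ∈ I, s b • c₂ b) * x₄)) := by
  simp only [mul_sum, sum_mul, smul_sum, ← sum_sub_distrib, ← sum_add_distrib]
  refine sum_congr rfl fun b _ => ?_
  simp only [← Algebra.smul_def, smul_sub, smul_add, mul_smul_comm, smul_mul_assoc, smul_comm e]

/-- Summation of a double convolution against the powers of `z` in one of its two variables. -/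
theorem sum_smul_convolution {z : K} {R : ℕ} (hz : z ^ R = 0) (a : ℕ → ℕ → K) (A : Polynomial K)
    (hA : ∀ j, A.coeff j = ∑ N ∈ range R, z ^ N * a N j) (g : ℕ → ℕ → B) (T : ℕ) :
    ∑ S ∈ range R, z ^ S • ∑ s ∈ antidiagonal S, ∑ t ∈ antidiagonal T, a s.1 t.1 • g s.2 t.2 =
      ∑ t ∈ antidiagonal T, A.coeff t.1 • ∑ m ∈ range R, z ^ m • g m t.2 := by
  have h1 : ∀ S, z ^ S • ∑ s ∈ antidiagonal S, ∑ t ∈ antidiagonal T, a s.1 t.1 • g s.2 t.2 =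
      ∑ s ∈ antidiagonal S, z ^ (s.1 + s.2) • ∑ t ∈ antidiagonal T, a s.1 t.1 • g s.2 t.2 := by
    intro S
    rw [smul_sum]
    refine sum_congr rfl fun s hs => ?_
    rw [HasAntidiagonal.mem_antidiagonal] at hs
    rw [hs]
  simp only [h1]
  rw [sum_antidiagonal_eq_sum_range (fun s => z ^ (s.1 + s.2) •
    ∑ t ∈ antidiagonal T, a s.1 t.1 • g s.2 t.2) R (fun a b hab => by
    rw [pow_eq_zero_of_le hab hz, zero_smul])]
  have h2 : ∀ N, ∑ b ∈ range R, z ^ (N + b) • ∑ t ∈ antidiagonal T, a N t.1 • g b t.2 =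
      ∑ t ∈ antidiagonal T, ∑ b ∈ range R, z ^ (N + b) • (a N t.1 • g b t.2) := by
    intro N
    rw [sum_comm]
    simp only [smul_sum]
  simp only [h2]
  rw [sum_comm]
  refine sum_congr rfl fun t _ => ?_
  rw [hA, sum_smul]
  refine sum_congr rfl fun N _ => ?_
  rw [smul_sum]
  refine sum_congr rfl fun b _ => ?_
  simp only [smul_smul, pow_add]
  congr 1
  ring

variable [Algebra ℂ K]

/-- The coefficient of `u^{-N} v^j`, up to the matrix factor, in the expansion of
`φ(u - v + c ε)`, where `φ(x) = ∑ φ_k ε^k x^{-k}`. -/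
noncomputable def mixedScalar (ε : K) (c : ℂ) (φ : ℕ → ℂ) (N j : ℕ) : K :=
  ((N - 1).choose j * complexShift c φ (N - j)) • ε ^ (N - j)

variable {h ε z : K} {R : ℕ} {l : ℤ → Matrix (Fin n) (Fin n) B}

/-- The relation between `L^-(u)` and `L^-(v)`, where `v = z` is nilpotent: the coefficients are
summed against the powers of `z`. -/
theorem same_minus_series (H : Relations n h ε l) (hz : z ^ R = 0) (i j k q : Fin n) :
    PowerSeries.X *
      (minusSeries h l i j * PowerSeries.C (minusValue ε z R l k q) -
        PowerSeries.C (minusValue ε z R l k q) * minusSeries h l i j) -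
    z • (minusSeries h l i j * PowerSeries.C (minusValue ε z R l k q) -
        PowerSeries.C (minusValue ε z R l k q) * minusSeries h l i j) +
    ε • (minusSeries h l k j * PowerSeries.C (minusValue ε z R l i q) -
        PowerSeries.C (minusValue ε z R l k j) * minusSeries h l i q) = 0 := by
  ext N
  have hrel : ∑ b ∈ range R, z ^ b • (genSame (algebraMap K B ε) (minusCoeff (algebraMap K B h) l)
    (minusCoeff (algebraMap K B ε) l) N b (i, k) (j, q)) = 0 :=
    sum_eq_zero fun b _ => by rw [H.same_minus]; simp
  have hshift : ∀ (k q : Fin n), ∑ b ∈ range R, z ^ b •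
      minusCoeff (algebraMap K B ε) l ((b : ℤ) - 1) k q = z • minusValue ε z R l k q := by
    intro k q
    rw [minusValue, smul_sum]
    rcases R with _ | R
    · simp
    rw [sum_range_succ', sum_range_succ, smul_smul, ← pow_succ', hz, zero_smul, add_zero]
    have : minusCoeff (algebraMap K B ε) l (((0 : ℕ) : ℤ) - 1) k q = 0 := by
      simp [minusCoeff]
    rw [this, smul_zero, add_zero]
    refine sum_congr rfl fun b _ => ?_
    rw [smul_smul, ← pow_succ']
    congr 3
    push_cast; ring
  simp only [genSame_apply] at hrel
  rw [sum_smul_same, hshift] at hrel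
  have hv : ∀ k q, ∑ b ∈ range R, z ^ b • minusCoeff (algebraMap K B ε) l (b : ℤ) k q =
      minusValue ε z R l k q := fun _ _ => rfl
  rw [hv, hv, hv] at hrel
  have hN : PowerSeries.coeff N (PowerSeries.X *
      (minusSeries h l i j * PowerSeries.C (minusValue ε z R l k q) -
        PowerSeries.C (minusValue ε z R l k q) * minusSeries h l i j)) =
      minusCoeff (algebraMap K B h) l ((N : ℤ) - 1) i j * minusValue ε z R l k q -
        minusValue ε z R l k q * minusCoeff (algebraMap K B h) l ((N : ℤ) - 1) i j := by
    rcases N with _ | N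
    · simp [minusCoeff]
    · rw [PowerSeries.coeff_succ_X_mul]
      simp [minusSeries, PowerSeries.coeff_mul_C, PowerSeries.coeff_C_mul]
  rw [map_add, map_sub, hN]
  simp only [map_sub, PowerSeries.coeff_smul, PowerSeries.coeff_mul_C, PowerSeries.coeff_C_mul,
    minusSeries, Matrix.of_apply, PowerSeries.coeff_mk, map_zero]
  rw [← hrel]
  simp only [mul_smul_comm, smul_mul_assoc, smul_sub]
  abel

/-- The relation between `L^+(u)` and `L^+(v)`, where `v⁻¹ = z` is nilpotent, multiplied by `u⁻¹
v⁻¹`. -/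
theorem same_plus_series (H : Relations n h ε l) (hz : z ^ R = 0) (i j k q : Fin n) :
    z • (plusSeries h l i j * PowerSeries.C (plusValue ε z R l k q) -
        PowerSeries.C (plusValue ε z R l k q) * plusSeries h l i j) -
    PowerSeries.X *
      (plusSeries h l i j * PowerSeries.C (plusValue ε z R l k q) -
        PowerSeries.C (plusValue ε z R l k q) * plusSeries h l i j) +
    (ε * z) • (PowerSeries.X * (plusSeries h l k j * PowerSeries.C (plusValue ε z R l i q) -
        PowerSeries.C (plusValue ε z R l k j) * plusSeries h l i q)) = 0 := by
  have h0 : ∀ (x : K) (i j : Fin n), plusCoeff (algebraMap K B x) l 0 i j = if i = j then 1 else 0 := by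
    intro x i j; simp [plusCoeff]
  ext N
  rcases N with _ | N
  · simp only [map_add, map_sub, PowerSeries.coeff_smul, PowerSeries.coeff_mul_C,
      PowerSeries.coeff_C_mul, plusSeries, Matrix.of_apply, PowerSeries.coeff_mk,
      PowerSeries.coeff_zero_X_mul, Nat.cast_zero, neg_zero, h0]
    split_ifs <;> simp
  have hrel : ∑ b ∈ range R, (z ^ (b + 1)) • (genSame (algebraMap K B ε)
      (plusCoeff (algebraMap K B h) l) (plusCoeff (algebraMap K B ε) l) (-(N : ℤ)) (-(b : ℤ))
        (i, k) (j, q)) = 0 :=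
    sum_eq_zero fun b _ => by rw [H.same_plus]; simp
  have hshift : ∀ (k q : Fin n), ∑ b ∈ range R, z ^ (b + 1) •
      plusCoeff (algebraMap K B ε) l (-(b : ℤ) - 1) k q =
        plusValue ε z R l k q - z ^ 0 • (if k = q then 1 else 0) := by
    intro k q
    rw [plusValue]
    rcases R with _ | R
    · have hs : Subsingleton B := by
        refine subsingleton_of_zero_eq_one ?_
        rw [pow_zero] at hz
        rw [← map_one (algebraMap K B), hz, map_zero]
      exact Subsingleton.elim _ _
    conv_lhs => rw [sum_range_succ, hz, zero_smul, add_zero]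
    conv_rhs => rw [sum_range_succ', Nat.cast_zero, neg_zero, h0, add_sub_cancel_right]
    refine sum_congr rfl fun b _ => ?_
    congr 3
    push_cast; ring
  have hmul : ∀ (k q : Fin n), ∑ b ∈ range R, z ^ (b + 1) •
      plusCoeff (algebraMap K B ε) l (-(b : ℤ)) k q = z • plusValue ε z R l k q := by
    intro k q
    rw [plusValue, smul_sum]
    exact sum_congr rfl fun b _ => by rw [smul_smul, pow_succ']
  simp only [genSame_apply] at hrel
  rw [sum_smul_same, hshift, hmul, hmul, hmul] at hrel
  simp only [map_add, map_sub, PowerSeries.coeff_smul, PowerSeries.coeff_mul_C,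
    PowerSeries.coeff_C_mul, plusSeries, Matrix.of_apply, PowerSeries.coeff_mk, map_zero,
    PowerSeries.coeff_succ_X_mul]
  rw [← hrel, show -((N + 1 : ℕ) : ℤ) = -(N : ℤ) - 1 by push_cast; ring]
  simp only [mul_smul_comm, smul_mul_assoc, smul_sub, mul_sub, sub_mul, smul_smul]
  split_ifs <;> simp <;> abel

/-- An entry of the mixed relation, when the coefficients of the `R`-matrix are scalars. -/
theorem genMixed_apply (c : ℂ) (P M : ℤ → Matrix (Fin n) (Fin n) B) (S T : ℕ) (i j k q : Fin n) :
    genMixed n ((algebraMap K B).comp (algebraMap ℂ K)) (algebraMap K B ε)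
      ((algebraMap K B).comp (algebraMap ℂ K) (-c)) P M S T (i, k) (j, q) =
    ∑ s ∈ antidiagonal S, ∑ t ∈ antidiagonal T,
      (mixedScalar ε c (normCoeff n) s.1 t.1 • (P (-(s.2 : ℤ)) i j * M t.2 k q) +
        mixedScalar ε c (delay (normCoeff n)) s.1 t.1 • (P (-(s.2 : ℤ)) k j * M t.2 i q) -
        (mixedScalar ε (-c) (normCoeff n) s.1 t.1 • (M t.2 k q * P (-(s.2 : ℤ)) i j) +
        mixedScalar ε (-c) (delay (normCoeff n)) s.1 t.1 • (M t.2 k j * P (-(s.2 : ℤ)) i q))) := by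
  have hc : ∀ z : ℂ, Commute ((algebraMap K B).comp (algebraMap ℂ K) z) (algebraMap K B ε) :=
    fun z => Algebra.commute_algebraMap_left _ _
  have hs : ∀ (c : ℂ) (φ : ℕ → ℂ) (N j : ℕ), (algebraMap K B).comp (algebraMap ℂ K)
      ((N - 1).choose j * complexShift c φ (N - j)) * algebraMap K B ε ^ (N - j) =
        algebraMap K B (mixedScalar ε c φ N j) := by
    intro c φ N j
    rw [mixedScalar, Algebra.smul_def, map_mul (algebraMap K B), RingHom.comp_apply, map_pow]
  have hneg : -((algebraMap K B).comp (algebraMap ℂ K) (-c)) =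
      (algebraMap K B).comp (algebraMap ℂ K) (-(-c)) := (map_neg _ _).symm
  simp only [genMixed, Matrix.sum_apply, Matrix.sub_apply]
  refine sum_congr rfl fun s _ => sum_congr rfl fun t _ => ?_
  rw [hneg, genRshift_scalar _ _ hc, genRshift_scalar _ _ hc, hs, hs, hs, hs]
  rw [mul_assoc, add_mul, mul_add]
  simp only [Matrix.smul_mul, one_mul, Matrix.add_apply, Matrix.smul_apply, smul_eq_mul, permOp_mul,
    inFirst_mul_inSecond, Prod.fst_swap, Prod.snd_swap]
  have hr : ∀ (a : K) (X Y : Matrix (Fin n × Fin n) (Fin n × Fin n) B),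
      X * (algebraMap K B a • Y) = algebraMap K B a • (X * Y) := by
    intro a X Y
    ext x y
    simp only [Matrix.mul_apply, Matrix.smul_apply, smul_eq_mul, mul_sum]
    refine sum_congr rfl fun w _ => ?_
    rw [← mul_assoc, ← mul_assoc, Algebra.commutes]
  rw [hr, hr, mul_one, Matrix.smul_apply, Matrix.smul_apply, mul_permOp, inSecond_mul_inFirst,
    inSecond_mul_inFirst]
  simp only [smul_eq_mul, Algebra.smul_def, Prod.fst_swap, Prod.snd_swap]

/-- The mixed relation, where the argument of `L^+` is `z⁻¹`. The polynomials in the argument of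
`L^-` collect the coefficients of the two `R`-matrices; `coeff_nilEval_plus` supplies them. -/
theorem mixed_plus_series (H : Relations n h ε l) (hz : z ^ R = 0) (c : ℂ) (hc : c = (n : ℂ) / 2)
    (A₁ A₂ B₁ B₂ : Polynomial K)
    (hA₁ : ∀ j, A₁.coeff j = ∑ N ∈ range R, z ^ N * mixedScalar ε c (normCoeff n) N j)
    (hB₁ : ∀ j, B₁.coeff j = ∑ N ∈ range R, z ^ N * mixedScalar ε c (delay (normCoeff n)) N j)
    (hA₂ : ∀ j, A₂.coeff j = ∑ N ∈ range R, z ^ N * mixedScalar ε (-c) (normCoeff n) N j)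
    (hB₂ : ∀ j, B₂.coeff j = ∑ N ∈ range R, z ^ N * mixedScalar ε (-c) (delay (normCoeff n)) N j)
    (i j k q : Fin n) :
    polySeries B A₁ * (PowerSeries.C (plusValue ε z R l i j) * minusSeries h l k q) +
      polySeries B B₁ * (PowerSeries.C (plusValue ε z R l k j) * minusSeries h l i q) =
    polySeries B A₂ * (minusSeries h l k q * PowerSeries.C (plusValue ε z R l i j)) +
      polySeries B B₂ * (minusSeries h l k j * PowerSeries.C (plusValue ε z R l i q)) := by
  ext T
  rw [← sub_eq_zero]
  have hrel : ∑ S ∈ range R, z ^ S • (genMixed n ((algebraMap K B).comp (algebraMap ℂ K))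
      (algebraMap K B ε) ((algebraMap K B).comp (algebraMap ℂ K) (-((n : ℂ) / 2)))
      (plusCoeff (algebraMap K B ε) l) (minusCoeff (algebraMap K B h) l) S T (i, k) (j, q)) = 0 :=
    sum_eq_zero fun b _ => by rw [H.mixed_plus]; simp
  rw [← hrel, ← hc]
  simp only [genMixed_apply, sum_sub_distrib, sum_add_distrib, smul_sub, smul_add, map_add,
    coeff_polySeries_mul]
  rw [sum_smul_convolution hz _ A₁ hA₁ fun s t =>
      plusCoeff (algebraMap K B ε) l (-(s : ℤ)) i j * minusCoeff (algebraMap K B h) l t k q,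
    sum_smul_convolution hz _ B₁ hB₁ fun s t =>
      plusCoeff (algebraMap K B ε) l (-(s : ℤ)) k j * minusCoeff (algebraMap K B h) l t i q,
    sum_smul_convolution hz _ A₂ hA₂ fun s t =>
      minusCoeff (algebraMap K B h) l t k q * plusCoeff (algebraMap K B ε) l (-(s : ℤ)) i j,
    sum_smul_convolution hz _ B₂ hB₂ fun s t =>
      minusCoeff (algebraMap K B h) l t k j * plusCoeff (algebraMap K B ε) l (-(s : ℤ)) i q]
  simp only [PowerSeries.coeff_mul_C, PowerSeries.coeff_C_mul, plusValue, minusSeries,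
    Matrix.of_apply, PowerSeries.coeff_mk, mul_sum, sum_mul, mul_smul_comm, smul_mul_assoc]

/-- The mixed relation, where the argument of `L^-` is `z`. The polynomials in the inverse of the
argument of `L^+` collect the coefficients of the two `R`-matrices; `coeff_nilEval_minus` supplies
them. -/
theorem mixed_minus_series (H : Relations n h ε l) (hz : z ^ R = 0) (c : ℂ) (hc : c = (n : ℂ) / 2)
    (A₁ A₂ B₁ B₂ : Polynomial K)
    (hA₁ : ∀ N, A₁.coeff N = ∑ j ∈ range R, z ^ j * mixedScalar ε c (normCoeff n) N j)
    (hB₁ : ∀ N, B₁.coeff N = ∑ j ∈ range R, z ^ j * mixedScalar ε c (delay (normCoeff n)) N j)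
    (hA₂ : ∀ N, A₂.coeff N = ∑ j ∈ range R, z ^ j * mixedScalar ε (-c) (normCoeff n) N j)
    (hB₂ : ∀ N, B₂.coeff N = ∑ j ∈ range R, z ^ j * mixedScalar ε (-c) (delay (normCoeff n)) N j)
    (i j k q : Fin n) :
    polySeries B A₁ * (plusSeries h l i j * PowerSeries.C (minusValue ε z R l k q)) +
      polySeries B B₁ * (plusSeries h l k j * PowerSeries.C (minusValue ε z R l i q)) =
    polySeries B A₂ * (PowerSeries.C (minusValue ε z R l k q) * plusSeries h l i j) +
      polySeries B B₂ * (PowerSeries.C (minusValue ε z R l k j) * plusSeries h l i q) := by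
  ext S
  rw [← sub_eq_zero]
  have hrel : ∑ T ∈ range R, z ^ T • (genMixed n ((algebraMap K B).comp (algebraMap ℂ K))
      (algebraMap K B ε) ((algebraMap K B).comp (algebraMap ℂ K) (-((n : ℂ) / 2)))
      (plusCoeff (algebraMap K B h) l) (minusCoeff (algebraMap K B ε) l) S T (i, k) (j, q)) = 0 :=
    sum_eq_zero fun b _ => by rw [H.mixed_minus]; simp
  rw [← hrel, ← hc]
  have hcomm : ∀ (T : ℕ) (f : ℕ × ℕ → ℕ × ℕ → B), ∑ s ∈ antidiagonal S, ∑ t ∈ antidiagonal T, f s t =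
      ∑ t ∈ antidiagonal T, ∑ s ∈ antidiagonal S, f s t := fun T f => sum_comm
  simp only [genMixed_apply, hcomm, sum_sub_distrib, sum_add_distrib, smul_sub, smul_add, map_add,
    coeff_polySeries_mul]
  rw [sum_smul_convolution hz (fun j N => _) A₁ hA₁ fun t s =>
      plusCoeff (algebraMap K B h) l (-(s : ℤ)) i j * minusCoeff (algebraMap K B ε) l t k q,
    sum_smul_convolution hz (fun j N => _) B₁ hB₁ fun t s =>
      plusCoeff (algebraMap K B h) l (-(s : ℤ)) k j * minusCoeff (algebraMap K B ε) l t i q,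
    sum_smul_convolution hz (fun j N => _) A₂ hA₂ fun t s =>
      minusCoeff (algebraMap K B ε) l t k q * plusCoeff (algebraMap K B h) l (-(s : ℤ)) i j,
    sum_smul_convolution hz (fun j N => _) B₂ hB₂ fun t s =>
      minusCoeff (algebraMap K B ε) l t k j * plusCoeff (algebraMap K B h) l (-(s : ℤ)) i q]
  simp only [PowerSeries.coeff_mul_C, PowerSeries.coeff_C_mul, minusValue, plusSeries,
    Matrix.of_apply, PowerSeries.coeff_mk, mul_sum, sum_mul, mul_smul_comm, smul_mul_assoc]

/-- The polynomial in `v` collecting the coefficients of `φ(u - v + c ε)` at `u⁻¹ = z`: it is the value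
of the shifted series at `ε / (u - v) = ε z (1 - z v)⁻¹`. -/
theorem coeff_nilEval_plus (hz : z ^ R = 0) (c : ℂ) (φ : ℕ → ℂ) (r : Polynomial K)
    (hr : r * (1 - Polynomial.C z * Polynomial.X) = 1) (j : ℕ) :
    (nilEval (complexShift c φ) (Polynomial.C (ε * z) * r)).coeff j =
      ∑ N ∈ range R, z ^ N * mixedScalar ε c φ N j := by
  rw [← sum_sum_choose (complexShift c φ) (Polynomial.C (ε * z)) (Polynomial.C z * Polynomial.X) r R R
    (by rw [← map_pow, mul_pow, hz, mul_zero, map_zero])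
    (by rw [mul_pow, ← map_pow, hz, map_zero, zero_mul]) hr]
  have e : ∀ k m : ℕ, (complexShift c φ k • (Polynomial.C (ε * z) : Polynomial K) ^ k) *
      (((k + m - 1).choose m : Polynomial K) * (Polynomial.C z * Polynomial.X) ^ m) =
      Polynomial.monomial m (z ^ (k + m) * mixedScalar ε c φ (k + m) m) := by
    intro k m
    rw [← Polynomial.C_mul_X_pow_eq_monomial, mixedScalar, Nat.add_sub_cancel, Algebra.smul_def,
      Algebra.smul_def, IsScalarTower.algebraMap_apply ℂ K (Polynomial K), Polynomial.algebraMap_eq,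
      ← Polynomial.C_eq_natCast]
    simp only [map_mul, map_pow, map_natCast, mul_pow, pow_add]
    ring
  simp only [e, Polynomial.finsetSum_coeff, Polynomial.coeff_monomial]
  rw [← sum_antidiagonal_eq_sum_range (fun s => if s.2 = j then z ^ (s.1 + s.2) *
    mixedScalar ε c φ (s.1 + s.2) s.2 else 0) R (fun a b hab => by
      rw [pow_eq_zero_of_le hab hz, zero_mul, ite_self])]
  refine sum_congr rfl fun N _ => ?_
  rcases le_or_gt j N with hj | hj
  · rw [sum_eq_single (N - j, j)]
    · simp only [if_true]
      rw [Nat.sub_add_cancel hj]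
    · rintro ⟨a, b⟩ hab hne
      rw [HasAntidiagonal.mem_antidiagonal] at hab
      refine if_neg fun hb => hne ?_
      simp only at hab hb
      ext <;> simp <;> omega
    · intro hn
      rw [HasAntidiagonal.mem_antidiagonal] at hn
      simp only at hn
      omega
  · rw [sum_eq_zero, mixedScalar, Nat.choose_eq_zero_of_lt (by omega)]
    · simp
    · rintro ⟨a, b⟩ hab
      rw [HasAntidiagonal.mem_antidiagonal] at hab
      refine if_neg fun hb => ?_
      simp only at hab hb
      omega

/-- The polynomial in `u⁻¹` collecting the coefficients of `φ(u - v + c ε)` at `v = z`: it is the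
value of the shifted series at `ε / (u - v) = ε u⁻¹ (1 - z u⁻¹)⁻¹`. -/
theorem coeff_nilEval_minus (hz : z ^ R = 0) (hε : IsNilpotent ε) (c : ℂ) (φ : ℕ → ℂ)
    (r : Polynomial K) (hr : r * (1 - Polynomial.C z * Polynomial.X) = 1) (N : ℕ) :
    (nilEval (complexShift c φ) (Polynomial.C ε * Polynomial.X * r)).coeff N =
      ∑ j ∈ range R, z ^ j * mixedScalar ε c φ N j := by
  obtain ⟨Q, hQ⟩ := hε
  have hQ' : ε ^ (Q + N + 1) = 0 := pow_eq_zero_of_le (by omega) hQ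
  rw [← sum_sum_choose (complexShift c φ) (Polynomial.C ε * Polynomial.X)
    (Polynomial.C z * Polynomial.X) r (Q + N + 1) R
    (by rw [mul_pow, ← map_pow, hQ', map_zero, zero_mul])
    (by rw [mul_pow, ← map_pow, hz, map_zero, zero_mul]) hr]
  have e : ∀ k m : ℕ, (complexShift c φ k • (Polynomial.C ε * Polynomial.X : Polynomial K) ^ k) *
      (((k + m - 1).choose m : Polynomial K) * (Polynomial.C z * Polynomial.X) ^ m) =
      Polynomial.monomial (k + m) (z ^ m * mixedScalar ε c φ (k + m) m) := by
    intro k m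
    rw [← Polynomial.C_mul_X_pow_eq_monomial, mixedScalar, Nat.add_sub_cancel, Algebra.smul_def,
      Algebra.smul_def, IsScalarTower.algebraMap_apply ℂ K (Polynomial K), Polynomial.algebraMap_eq,
      ← Polynomial.C_eq_natCast]
    simp only [map_mul, map_pow, map_natCast, mul_pow, pow_add]
    ring
  simp only [e, Polynomial.finsetSum_coeff, Polynomial.coeff_monomial]
  rw [sum_comm]
  refine sum_congr rfl fun j _ => ?_
  rcases le_or_gt j N with hj | hj
  · rw [sum_eq_single (N - j)]
    · rw [Nat.sub_add_cancel hj, if_pos rfl]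
    · intro k _ hk
      exact if_neg (by omega)
    · intro hn
      rw [mem_range] at hn
      omega
  · rw [sum_eq_zero, mixedScalar, Nat.choose_eq_zero_of_lt (by omega)]
    · simp
    · intro k _
      exact if_neg (by omega)

end Representation

end YangianDouble

/-! ### Shifts of the argument of a power series -/

namespace YangianDouble

open Finset

section Taylor

variable {K B : Type*} [CommRing K] [Ring B] [Algebra K B]

/-- The coefficient of `X^s` in `(X + a)^k (X + b)^l`. -/
noncomputable def shiftKernel (a b : K) (s k l : ℕ) : K :=
  ((Polynomial.X + Polynomial.C a) ^ k * (Polynomial.X + Polynomial.C b) ^ l).coeff s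

theorem coeff_X_add_C_pow_eq_zero {a : K} {Q : ℕ} (ha : a ^ Q = 0) {s k : ℕ} (h : s + Q ≤ k) :
    ((Polynomial.X + Polynomial.C a) ^ k).coeff s = 0 := by
  rw [Polynomial.coeff_X_add_C_pow, pow_eq_zero_of_le (by omega) ha, zero_mul]

theorem shiftKernel_eq_zero_left {a b : K} {Q : ℕ} (ha : a ^ Q = 0) {s k : ℕ} (h : s + Q ≤ k) (l : ℕ) :
    shiftKernel a b s k l = 0 := by
  rw [shiftKernel, Polynomial.coeff_mul]
  refine sum_eq_zero fun p hp => ?_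
  rw [HasAntidiagonal.mem_antidiagonal] at hp
  rw [coeff_X_add_C_pow_eq_zero ha (by omega), zero_mul]

theorem shiftKernel_comm (a b : K) (s k l : ℕ) : shiftKernel a b s k l = shiftKernel b a s l k := by
  rw [shiftKernel, shiftKernel, mul_comm]

theorem shiftKernel_eq_zero_right {a b : K} {Q : ℕ} (hb : b ^ Q = 0) {s l : ℕ} (h : s + Q ≤ l) (k : ℕ) :
    shiftKernel a b s k l = 0 := by
  rw [shiftKernel_comm, shiftKernel_eq_zero_left hb h]

theorem shiftKernel_zero_succ (a b : K) (k l : ℕ) :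
    shiftKernel a b 0 (k + 1) l = a * shiftKernel a b 0 k l := by
  rw [shiftKernel, pow_succ', mul_assoc, add_mul, Polynomial.coeff_add, Polynomial.coeff_X_mul_zero,
    zero_add, Polynomial.coeff_C_mul, shiftKernel]

theorem shiftKernel_succ_succ (a b : K) (s k l : ℕ) : shiftKernel a b (s + 1) (k + 1) l =
    shiftKernel a b s k l + a * shiftKernel a b (s + 1) k l := by
  rw [shiftKernel, pow_succ', mul_assoc, add_mul, Polynomial.coeff_add, Polynomial.coeff_X_mul,
    Polynomial.coeff_C_mul, shiftKernel, shiftKernel]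

theorem shiftKernel_eq_sum (a b : K) (s k l : ℕ) : shiftKernel a b s k l =
    ∑ p ∈ antidiagonal s, shiftKernel a b p.1 k 0 * shiftKernel a b p.2 0 l := by
  simp only [shiftKernel, pow_zero, mul_one, one_mul]
  rw [Polynomial.coeff_mul]

/-- The family `F k l` summed against `(X + a)^k (X + b)^l`, where `a` and `b` are nilpotent. -/
noncomputable def doubleShift (a b : K) (F : ℕ → ℕ → B) : PowerSeries B :=
  PowerSeries.mk fun s => ∑ k ∈ range (s + nilpotencyClass a), ∑ l ∈ range (s + nilpotencyClass b),
    shiftKernel a b s k l • F k l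

theorem sum_range_extend {M : Type*} [AddCommMonoid M] (f : ℕ → M) {A A' : ℕ} (h : A ≤ A')
    (hf : ∀ k, A ≤ k → f k = 0) : ∑ k ∈ range A, f k = ∑ k ∈ range A', f k :=
  sum_subset (range_mono h) fun k _ hk => hf k (by simpa using hk)

theorem coeff_doubleShift {a b : K} {Q : ℕ} (ha : a ^ Q = 0) (hb : b ^ Q = 0) (F : ℕ → ℕ → B)
    {s M : ℕ} (hM : s + Q ≤ M) : PowerSeries.coeff s (doubleShift a b F) =
      ∑ k ∈ range M, ∑ l ∈ range M, shiftKernel a b s k l • F k l := by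
  have ha' : nilpotencyClass a ≤ Q := by rw [nilpotencyClass]; exact Nat.sInf_le ha
  have hb' : nilpotencyClass b ≤ Q := by rw [nilpotencyClass]; exact Nat.sInf_le hb
  rw [doubleShift, PowerSeries.coeff_mk, sum_range_extend _ (show s + nilpotencyClass a ≤ M by omega)]
  · refine sum_congr rfl fun k _ => ?_
    refine sum_range_extend _ (by omega) fun l hl => ?_
    rw [shiftKernel_eq_zero_right (pow_nilpotencyClass ⟨Q, hb⟩) hl, zero_smul]
  · intro k hk
    refine sum_eq_zero fun l _ => ?_
    rw [shiftKernel_eq_zero_left (pow_nilpotencyClass ⟨Q, ha⟩) hk, zero_smul]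

variable {a b : K} (ha : IsNilpotent a) (hb : IsNilpotent b)

theorem exists_pow_eq_zero (ha : IsNilpotent a) (hb : IsNilpotent b) :
    ∃ Q, a ^ Q = 0 ∧ b ^ Q = 0 := by
  obtain ⟨A, hA⟩ := ha
  obtain ⟨A', hA'⟩ := hb
  exact ⟨max A A', pow_eq_zero_of_le (le_max_left _ _) hA, pow_eq_zero_of_le (le_max_right _ _) hA'⟩

theorem doubleShift_add (F G : ℕ → ℕ → B) :
    doubleShift a b (fun k l => F k l + G k l) = doubleShift a b F + doubleShift a b G := by
  ext s
  simp [doubleShift, sum_add_distrib]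

theorem doubleShift_sub (F G : ℕ → ℕ → B) :
    doubleShift a b (fun k l => F k l - G k l) = doubleShift a b F - doubleShift a b G := by
  ext s
  simp [doubleShift, smul_sub, sum_sub_distrib]

/-- Summation against `(X + a)^{k+1}` instead of `(X + a)^k` multiplies by `X + a`. -/
theorem doubleShift_delay (ha : IsNilpotent a) (hb : IsNilpotent b) (F : ℕ → ℕ → B) :
    doubleShift a b (fun k l => delay (fun k => F k l) k) =
      PowerSeries.X * doubleShift a b F + a • doubleShift a b F := by
  obtain ⟨Q, hQa, hQb⟩ := exists_pow_eq_zero ha hb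
  ext s
  rw [coeff_doubleShift hQa hQb _ (le_refl (s + Q)), sum_range_extend _ (Nat.le_succ (s + Q)),
    sum_range_succ']
  · simp only [delay, smul_zero, sum_const_zero, add_zero, map_add, PowerSeries.coeff_smul]
    rw [coeff_doubleShift hQa hQb _ (le_refl (s + Q))]
    rcases s with _ | s
    · simp only [shiftKernel_zero_succ, PowerSeries.coeff_zero_X_mul, zero_add, smul_sum, smul_smul]
    · rw [PowerSeries.coeff_succ_X_mul, coeff_doubleShift hQa hQb _ (show s + Q ≤ s + 1 + Q by omega)]
      simp only [shiftKernel_succ_succ, add_smul, sum_add_distrib, smul_sum, smul_smul]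
  · intro k hk
    refine sum_eq_zero fun l _ => ?_
    rw [shiftKernel_eq_zero_left hQa hk, zero_smul]

theorem doubleShift_swap (ha : IsNilpotent a) (hb : IsNilpotent b) (F : ℕ → ℕ → B) :
    doubleShift a b F = doubleShift b a fun k l => F l k := by
  obtain ⟨Q, hQa, hQb⟩ := exists_pow_eq_zero ha hb
  ext s
  rw [coeff_doubleShift hQa hQb _ le_rfl, coeff_doubleShift hQb hQa _ le_rfl, sum_comm]
  simp only [shiftKernel_comm a b]

/-- The substitution `X ↦ X + a`. -/
noncomputable def shiftSeries (a : K) (φ : PowerSeries B) : PowerSeries B :=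
  doubleShift a 0 fun k l => if l = 0 then PowerSeries.coeff k φ else 0

theorem coeff_shiftSeries {Q : ℕ} (ha : a ^ Q = 0) (φ : PowerSeries B)
    {s M : ℕ} (hM : s + Q ≤ M) : PowerSeries.coeff s (shiftSeries a φ) =
      ∑ k ∈ range M, (((Polynomial.X + Polynomial.C a) ^ k).coeff s) • PowerSeries.coeff k φ := by
  rw [shiftSeries, coeff_doubleShift (Q := Q + 1) (M := M + 1) (pow_eq_zero_of_le (Nat.le_succ _) ha)
    (by simp) _ (by omega)]
  simp only [smul_ite, smul_zero]
  symm
  rw [sum_range_extend _ (Nat.le_succ M)]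
  · refine sum_congr rfl fun k _ => ?_
    rw [sum_ite_eq', if_pos (by simp), shiftKernel, pow_zero, mul_one]
  · intro k hk
    rw [coeff_X_add_C_pow_eq_zero ha (by omega), zero_smul]

theorem shiftKernel_left (a b : K) (s k : ℕ) : shiftKernel a b s k 0 =
    ((Polynomial.X + Polynomial.C a) ^ k).coeff s := by
  rw [shiftKernel, pow_zero, mul_one]

theorem shiftKernel_right (a b : K) (s l : ℕ) : shiftKernel a b s 0 l =
    ((Polynomial.X + Polynomial.C b) ^ l).coeff s := by
  rw [shiftKernel, pow_zero, one_mul]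

/-- A double family that is a product of coefficients sums to the product of the shifted series.
-/
theorem doubleShift_mul (ha : IsNilpotent a) (hb : IsNilpotent b) (φ ψ : PowerSeries B) :
    doubleShift a b (fun k l => PowerSeries.coeff k φ * PowerSeries.coeff l ψ) =
      shiftSeries a φ * shiftSeries b ψ := by
  obtain ⟨Q, hQa, hQb⟩ := exists_pow_eq_zero ha hb
  ext s
  rw [coeff_doubleShift hQa hQb _ (le_refl (s + Q)), PowerSeries.coeff_mul]
  have : ∀ p ∈ antidiagonal s, PowerSeries.coeff p.1 (shiftSeries a φ) *
      PowerSeries.coeff p.2 (shiftSeries b ψ) = ∑ k ∈ range (s + Q), ∑ l ∈ range (s + Q),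
        (shiftKernel a b p.1 k 0 * shiftKernel a b p.2 0 l) •
          (PowerSeries.coeff k φ * PowerSeries.coeff l ψ) := by
    intro p hp
    rw [HasAntidiagonal.mem_antidiagonal] at hp
    rw [coeff_shiftSeries hQa φ (show p.1 + Q ≤ s + Q by omega),
      coeff_shiftSeries hQb ψ (show p.2 + Q ≤ s + Q by omega), sum_mul_sum]
    simp only [shiftKernel_left, shiftKernel_right, smul_mul_smul_comm]
  rw [sum_congr rfl this]
  conv_rhs => rw [sum_comm]
  refine sum_congr rfl fun k _ => ?_
  conv_rhs => rw [sum_comm]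
  refine sum_congr rfl fun l _ => ?_
  rw [shiftKernel_eq_sum, sum_smul]

theorem doubleShift_mul' (ha : IsNilpotent a) (hb : IsNilpotent b) (φ ψ : PowerSeries B) :
    doubleShift a b (fun k l => PowerSeries.coeff l ψ * PowerSeries.coeff k φ) =
      shiftSeries b ψ * shiftSeries a φ := by
  rw [doubleShift_swap ha hb, doubleShift_mul hb ha]

/-- The substitution `X ↦ X + a` as a ring homomorphism. -/
noncomputable def shiftHom (B : Type*) [Ring B] [Algebra K B] (a : K) (ha : IsNilpotent a) :
    PowerSeries B →+* PowerSeries B where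
  toFun := shiftSeries a
  map_zero' := by
    ext s
    simp [shiftSeries, doubleShift]
  map_add' φ ψ := by
    obtain ⟨Q, hQ⟩ := ha
    ext s
    rw [map_add, coeff_shiftSeries hQ _ le_rfl, coeff_shiftSeries hQ _ le_rfl,
      coeff_shiftSeries hQ _ le_rfl, ← sum_add_distrib]
    simp only [map_add, smul_add]
  map_one' := by
    obtain ⟨Q, hQ⟩ := ha
    ext s
    rw [coeff_shiftSeries hQ _ (Nat.le_succ _), sum_eq_single 0]
    · simp [PowerSeries.coeff_one, Polynomial.coeff_one]
    · intro k _ hk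
      simp [PowerSeries.coeff_one, hk]
    · simp
  map_mul' φ ψ := by
    obtain ⟨Q, hQ⟩ := id ha
    rw [← doubleShift_mul ha ha]
    ext s
    rw [coeff_doubleShift hQ hQ _ le_rfl, coeff_shiftSeries hQ _ le_rfl]
    rw [← sum_antidiagonal_eq_sum_range (fun p => shiftKernel a a s p.1 p.2 •
      (PowerSeries.coeff p.1 φ * PowerSeries.coeff p.2 ψ))]
    · refine sum_congr rfl fun k _ => ?_
      rw [PowerSeries.coeff_mul, smul_sum]
      refine sum_congr rfl fun p hp => ?_
      rw [HasAntidiagonal.mem_antidiagonal] at hp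
      rw [shiftKernel, ← pow_add, hp]
    · intro k l hkl
      rw [shiftKernel, ← pow_add, coeff_X_add_C_pow_eq_zero hQ hkl, zero_smul]

theorem shiftHom_apply (φ : PowerSeries B) : shiftHom B a ha φ = shiftSeries a φ := rfl

theorem shiftHom_C (b : B) : shiftHom B a ha (PowerSeries.C b) = PowerSeries.C b := by
  obtain ⟨Q, hQ⟩ := id ha
  ext s
  rw [shiftHom_apply, coeff_shiftSeries hQ _ (Nat.le_succ _), sum_eq_single 0]
  · simp only [PowerSeries.coeff_C, Polynomial.coeff_one, pow_zero]
    split_ifs <;> simp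
  · intro k _ hk
    simp [PowerSeries.coeff_C, hk]
  · simp

theorem shiftHom_X : shiftHom B a ha PowerSeries.X = PowerSeries.X + PowerSeries.C (algebraMap K B a) := by
  obtain ⟨Q, hQ⟩ := id ha
  ext s
  rw [shiftHom_apply, coeff_shiftSeries hQ _ (show s + Q ≤ s + Q + 2 by omega), sum_eq_single 1]
  · simp only [PowerSeries.coeff_C, PowerSeries.coeff_X, Polynomial.coeff_add, Polynomial.coeff_X,
      Polynomial.coeff_C, pow_one, map_add]
    split_ifs <;> simp_all [Algebra.smul_def]
  · intro k _ hk
    simp [PowerSeries.coeff_X, hk]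
  · simp

end Taylor

end YangianDouble

/-! ### Exchange relations of two shifted series -/

namespace YangianDouble

open Finset

section Cross

variable {n : ℕ} {T : Type*} [Ring T]

/-- `(1 - P) X₁ Y₂ = Y₂ X₁ (1 - P)`, entry by entry. -/
def Cross (X Y : Matrix (Fin n) (Fin n) T) : Prop :=
  ∀ i j p q, X i j * Y p q - X p j * Y i q = Y p q * X i j - Y p j * X i q

theorem Cross.fused {X Y : Matrix (Fin n) (Fin n) T} (h : Cross X Y) : Fused X Y := by
  intro i j p q
  have h1 := h i j p q
  have h2 := h i q p j
  rw [sub_add_eq_add_sub, add_sub_assoc, add_comm] at *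
  calc _ = (X i j * Y p q - X p j * Y i q) + (X i q * Y p j - X p q * Y i j) := by abel
    _ = _ := by rw [h1, h2]; abel

/-- The exchange property of two matrices passes to their inverses, in the opposite order. -/
theorem Cross.inv {X Y X' Y' : Matrix (Fin n) (Fin n) T} (h : Cross X Y)
    (hX : X * X' = 1) (hX' : X' * X = 1) (hY : Y * Y' = 1) (hY' : Y' * Y = 1) : Fused Y' X' := by
  set P := permMat n (k := 2) T (Equiv.swap 0 1)
  have h01 : (0 : Fin 2) ≠ 1 := by decide
  have hone : ∀ a : Fin 2, inCopy a (1 : Matrix (Fin n) (Fin n) T) = 1 := fun a => by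
    rw [← inCopyHom_apply, map_one]
  have hc : (1 - P) * (inCopy 0 X * inCopy 1 Y) = inCopy 1 Y * inCopy 0 X * (1 - P) := by
    ext I K
    rw [sub_mul, mul_sub, one_mul, mul_one]
    simp only [Matrix.sub_apply, P, permMat_mul_apply, mul_permMat_apply, inCopy_mul_inCopy_apply h01,
      inCopy_mul_inCopy_apply h01.symm, Equiv.symm_swap, Function.comp_apply, Equiv.swap_apply_left,
      Equiv.swap_apply_right]
    have hc : ∀ c : Fin 2, c ≠ 0 → c ≠ 1 → False := by decide
    rw [if_pos fun c h1 h2 => (hc c h1 h2).elim, if_pos fun c h1 h2 => (hc c h1 h2).elim,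
      if_pos fun c h1 h2 => (hc c h2 h1).elim, if_pos fun c h1 h2 => (hc c h2 h1).elim]
    exact h _ _ _ _
  have e1 : inCopy (0 : Fin 2) X * inCopy 0 X' = 1 := by rw [← inCopy_mul, hX, hone]
  have e2 : inCopy (0 : Fin 2) X' * inCopy 0 X = 1 := by rw [← inCopy_mul, hX', hone]
  have e3 : inCopy (1 : Fin 2) Y * inCopy 1 Y' = 1 := by rw [← inCopy_mul, hY, hone]
  have e4 : inCopy (1 : Fin 2) Y' * inCopy 1 Y = 1 := by rw [← inCopy_mul, hY', hone]
  have hc' : (inCopy 0 X' * inCopy 1 Y') * (1 - P) = (1 - P) * (inCopy 1 Y' * inCopy 0 X') := by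
    calc (inCopy 0 X' * inCopy 1 Y') * (1 - P)
        = (inCopy 0 X' * inCopy 1 Y') * ((1 - P) * (inCopy 0 X * inCopy 1 Y)) *
          (inCopy 1 Y' * inCopy 0 X') := by
          rw [mul_assoc _ _ (inCopy 1 Y' * _), mul_assoc (1 - P), mul_assoc (inCopy 0 X),
            ← mul_assoc (inCopy 1 Y), e3, one_mul, e1, mul_one]
      _ = inCopy 0 X' * (inCopy 1 Y' * inCopy 1 Y) * inCopy 0 X * (1 - P) *
          (inCopy 1 Y' * inCopy 0 X') := by rw [hc]; simp only [mul_assoc]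
      _ = _ := by rw [e4, mul_one, e2, one_mul]
  have key : ∀ i j p q, Y' i j * X' p q - Y' p j * X' i q = X' p q * Y' i j - X' p j * Y' i q := by
    intro i j p q
    have := congrFun (congrFun hc' ![p, i]) ![q, j]
    rw [sub_mul, mul_sub, one_mul, mul_one] at this
    simp only [Matrix.sub_apply, P, permMat_mul_apply, mul_permMat_apply,
      inCopy_mul_inCopy_apply h01, inCopy_mul_inCopy_apply h01.symm, Equiv.symm_swap,
      Function.comp_apply, Equiv.swap_apply_left, Equiv.swap_apply_right] at this
    have hc : ∀ c : Fin 2, c ≠ 0 → c ≠ 1 → False := by decide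
    rw [if_pos fun c h1 h2 => (hc c h1 h2).elim, if_pos fun c h1 h2 => (hc c h1 h2).elim,
      if_pos fun c h1 h2 => (hc c h2 h1).elim, if_pos fun c h1 h2 => (hc c h2 h1).elim] at this
    exact this.symm
  intro i j p q
  calc _ = (Y' i j * X' p q - Y' p j * X' i q) + (Y' i q * X' p j - Y' p q * X' i j) := by abel
    _ = _ := by rw [key, key]; abel

end Cross

section ShiftCross

variable {n : ℕ} {K B : Type*} [CommRing K] [Ring B] [Algebra K B] [Algebra ℂ K]
  {h ε : K} {l : ℤ → Matrix (Fin n) (Fin n) B}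

/-- The series `L^-(u + a)` and `L^-(u + a + h)` satisfy the exchange relation with `1 - P`: it is the
relation divided by `h`, with `u` and `v = u + h` substituted for its variables. Setting `v = u + h` in the
undivided relation would only give `h` times this. -/
theorem cross_minus (H : Relations n h ε l) (a b : K) (ha : IsNilpotent a) (hb : IsNilpotent b)
    (hab : b = a + h) : Cross ((minusSeries h l).map (shiftHom B a ha))
      ((minusSeries h l).map (shiftHom B b hb)) := by
  intro i j p q
  simp only [Matrix.map_apply, shiftHom_apply]
  set L : ℤ → Matrix (Fin n) (Fin n) B := minusCoeff (algebraMap K B h) l with hL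
  set X := minusPart l with hX
  -- the series `(L^-(u) - 1) / h`
  let φ : PowerSeries B := PowerSeries.mk fun m => X m p q
  have hcoeff : ∀ (m : ℕ) (i j : Fin n), PowerSeries.coeff m (minusSeries h l i j) = L m i j := by
    intro m i j
    simp [minusSeries, hL]
  have hφ : ∀ m : ℕ, PowerSeries.coeff m φ = X m p q := fun m => by simp [φ]
  have hneg : L (-1) = 0 := by ext; simp [hL, minusCoeff]
  have hnegX : X (-1) = 0 := by ext; simp [hX, minusPart]
  have hdelay : ∀ (M : ℤ → Matrix (Fin n) (Fin n) B) (i j : Fin n), M (-1) = 0 → ∀ k : ℕ,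
      M ((k : ℤ) - 1) i j = delay (fun k : ℕ => M k i j) k := by
    intro M i j hM k
    rcases k with _ | k
    · simp [delay, hM]
    · simp [delay]
  have hzero : doubleShift a b (fun k m => dividedSame L X k m i j p q) = 0 := by
    have : (fun k m : ℕ => dividedSame L X k m i j p q) = fun _ _ => 0 :=
      funext₂ fun k m => H.divided_minus k m i j p q
    rw [this]
    ext s
    simp [doubleShift]
  -- The divided relation in the form `(u - v) F + L L - L L = 0`, where `F` is the commutator of
  -- `L^-(u)` and `(L^-(v) - 1) / h`; the delay operations are the multiplications by `u` and `v`.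
  let F : ℕ → ℕ → B := fun k m => L k i j * X m p q - X m p q * L k i j
  have hF : doubleShift a b F = shiftSeries a (minusSeries h l i j) * shiftSeries b φ -
      shiftSeries b φ * shiftSeries a (minusSeries h l i j) := by
    rw [← doubleShift_mul ha hb, ← doubleShift_mul' ha hb, ← doubleShift_sub]
    simp only [hcoeff, hφ]
    rfl
  have hsplit : (fun k m : ℕ => dividedSame L X k m i j p q) = fun k m =>
      (delay (fun k => F k m) k - delay (fun m => F k m) m) +
        (L k p j * L m i q - L m p j * L k i q) := by
    funext k m
    have e1 : delay (fun k => F k m) k = L ((k : ℤ) - 1) i j * X m p q - X m p q * L ((k : ℤ) - 1) i j := by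
      rw [hdelay L i j hneg k]
      rcases k with _ | k <;> simp [delay, F]
    have e2 : delay (fun m => F k m) m = L k i j * X ((m : ℤ) - 1) p q - X ((m : ℤ) - 1) p q * L k i j := by
      rw [hdelay X p q hnegX m]
      rcases m with _ | m <;> simp [delay, F]
    rw [e1, e2, dividedSame]
    abel
  rw [hsplit, doubleShift_add, doubleShift_sub, doubleShift_sub, doubleShift_delay ha hb,
    doubleShift_swap ha hb (fun k m => delay (fun m => F k m) m), doubleShift_delay hb ha
      (fun m k => F k m), ← doubleShift_swap ha hb] at hzero
  have e3 := doubleShift_mul (B := B) ha hb (minusSeries h l p j) (minusSeries h l i q)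
  have e4 := doubleShift_mul' (B := B) ha hb (minusSeries h l i q) (minusSeries h l p j)
  simp only [hcoeff] at e3 e4
  rw [e3, e4, hF, hab] at hzero
  have hb' : minusSeries h l p q = (if p = q then 1 else 0) + PowerSeries.C (algebraMap K B h) * φ := by
    ext m
    rw [map_add, PowerSeries.coeff_C_mul, hφ, hcoeff, hL, minusCoeff_apply]
    congr 1
    by_cases hpq : p = q
    · simp [hpq, PowerSeries.coeff_one]
    · simp [hpq]
  have hY : shiftSeries (a + h) (minusSeries h l p q) =
      (if p = q then 1 else 0) + h • shiftSeries (a + h) φ := by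
    have hb'' : IsNilpotent (a + h) := hab ▸ hb
    have hone : shiftHom B (a + h) hb'' (if p = q then 1 else 0) = if p = q then 1 else 0 := by
      by_cases hpq : p = q
      · rw [if_pos hpq, map_one]
      · rw [if_neg hpq, map_zero]
    rw [hb', ← shiftHom_apply hb'', map_add, map_mul, shiftHom_C, hone, shiftHom_apply]
    congr 1
    ext m
    rw [PowerSeries.coeff_C_mul, PowerSeries.coeff_smul, Algebra.smul_def]
  subst hab
  rw [hY]
  generalize shiftSeries a (minusSeries h l i j) = x at *
  generalize shiftSeries (a + h) φ = y at *
  generalize shiftSeries a (minusSeries h l p j) = x' at *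
  generalize shiftSeries (a + h) (minusSeries h l i q) = y' at *
  generalize shiftSeries (a + h) (minusSeries h l p j) = x'' at *
  generalize shiftSeries a (minusSeries h l i q) = y'' at *
  -- Since `v - u = h`, the term `(u - v) F` is minus the commutator of `L^-(u)` and `L^-(v)`.
  have : h • (x * y - y * x) = x' * y' - x'' * y'' := by
    rw [← sub_eq_zero, ← neg_eq_zero, ← hzero, add_smul]
    abel
  rw [← sub_eq_zero, mul_add, add_mul, mul_smul_comm, smul_mul_assoc]
  rw [smul_sub] at this
  have hcm : x * (if p = q then 1 else 0) = (if p = q then 1 else 0) * x := by split_ifs <;> simp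
  rw [hcm]
  rw [← sub_eq_zero] at this
  rw [← this]
  abel

end ShiftCross

end YangianDouble

/-! ### Locally finite series of operators -/

namespace YangianDouble

open Finset
open scoped TensorProduct

section LocallyFinite

variable {K : Type*} (V : Type*) [CommRing K] [AddCommGroup V] [Module K V]

/-- Series of operators of which every vector is annihilated by all but finitely many coefficients. -/
def locFinite : Subring (PowerSeries (Module.End K V)) where
  carrier := {φ | ∀ w : V, ∃ M, ∀ k, M ≤ k → PowerSeries.coeff k φ w = 0}
  zero_mem' := fun w => ⟨0, by simp⟩
  one_mem' := fun w => ⟨1, fun k hk => by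
    rw [PowerSeries.coeff_one, if_neg (by omega), LinearMap.zero_apply]⟩
  add_mem' := by
    rintro φ ψ hφ hψ w
    obtain ⟨M, hM⟩ := hφ w
    obtain ⟨M', hM'⟩ := hψ w
    refine ⟨max M M', fun k hk => ?_⟩
    rw [map_add, LinearMap.add_apply, hM k (le_trans (le_max_left _ _) hk),
      hM' k (le_trans (le_max_right _ _) hk), add_zero]
  neg_mem' := by
    rintro φ hφ w
    obtain ⟨M, hM⟩ := hφ w
    exact ⟨M, fun k hk => by rw [map_neg, LinearMap.neg_apply, hM k hk, neg_zero]⟩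
  mul_mem' := by
    rintro φ ψ hφ hψ w
    obtain ⟨M, hM⟩ := hψ w
    choose N hN using hφ
    let A := (range M).sup fun l => N (PowerSeries.coeff l ψ w)
    refine ⟨M + A, fun k hk => ?_⟩
    rw [PowerSeries.coeff_mul, LinearMap.sum_apply]
    refine sum_eq_zero fun p hp => ?_
    rw [HasAntidiagonal.mem_antidiagonal] at hp
    rw [Module.End.mul_apply]
    rcases le_or_gt M p.2 with h | h
    · rw [hM _ h, map_zero]
    · refine hN _ _ (le_trans (le_sup (f := fun l => N (PowerSeries.coeff l ψ w))
        (mem_range.2 h)) ?_)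
      change A ≤ _
      omega

variable {V}

theorem C_mem_locFinite (b : Module.End K V) : PowerSeries.C b ∈ locFinite V := fun w =>
  ⟨1, fun k hk => by rw [PowerSeries.coeff_C, if_neg (by omega), LinearMap.zero_apply]⟩

theorem X_mem_locFinite : (PowerSeries.X : PowerSeries (Module.End K V)) ∈ locFinite V := fun w =>
  ⟨2, fun k hk => by rw [PowerSeries.coeff_X, if_neg (by omega), LinearMap.zero_apply]⟩

theorem algebraMap_mem_locFinite (a : K) :
    algebraMap K (PowerSeries (Module.End K V)) a ∈ locFinite V := by
  rw [PowerSeries.algebraMap_apply]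
  exact C_mem_locFinite _

theorem polySeries_mem_locFinite (p : Polynomial K) :
    polySeries (Module.End K V) p ∈ locFinite V := by
  induction p using Polynomial.induction_on' with
  | add p q hp hq => rw [map_add]; exact add_mem hp hq
  | monomial m a =>
    rw [polySeries, Polynomial.aeval_monomial]
    exact mul_mem (algebraMap_mem_locFinite a) (pow_mem X_mem_locFinite m)

variable {S : Type*} [CommRing S] [Algebra K S] (y : S)

/-- The vector `∑ y^k ⊗ φ_k w`. -/
noncomputable def evalVector (φ : locFinite (K := K) V) : V →ₗ[K] S ⊗[K] V where
  toFun w := ∑ k ∈ range (φ.2 w).choose, (y ^ k) ⊗ₜ[K] (PowerSeries.coeff k φ.1 w)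
  map_add' v w := by
    have key : ∀ (w : V) (M : ℕ), (φ.2 w).choose ≤ M →
        ∑ k ∈ range (φ.2 w).choose, (y ^ k) ⊗ₜ[K] (PowerSeries.coeff k φ.1 w) =
        ∑ k ∈ range M, (y ^ k) ⊗ₜ[K] (PowerSeries.coeff k φ.1 w) := fun w M h =>
      sum_range_extend _ h fun k hk => by rw [(φ.2 w).choose_spec k hk, TensorProduct.tmul_zero]
    set M := max (φ.2 (v + w)).choose (max (φ.2 v).choose (φ.2 w).choose)
    rw [key (v + w) M (by omega), key v M (by omega), key w M (by omega), ← sum_add_distrib]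
    simp only [map_add, TensorProduct.tmul_add]
  map_smul' a w := by
    have key : ∀ (w : V) (M : ℕ), (φ.2 w).choose ≤ M →
        ∑ k ∈ range (φ.2 w).choose, (y ^ k) ⊗ₜ[K] (PowerSeries.coeff k φ.1 w) =
        ∑ k ∈ range M, (y ^ k) ⊗ₜ[K] (PowerSeries.coeff k φ.1 w) := fun w M h =>
      sum_range_extend _ h fun k hk => by rw [(φ.2 w).choose_spec k hk, TensorProduct.tmul_zero]
    set M := max (φ.2 (a • w)).choose (φ.2 w).choose
    rw [key (a • w) M (by omega), key w M (by omega), smul_sum]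
    simp only [map_smul, TensorProduct.tmul_smul, RingHom.id_apply]

theorem evalVector_eq (φ : locFinite (K := K) V) (w : V) {M : ℕ}
    (hM : ∀ k, M ≤ k → PowerSeries.coeff k φ.1 w = 0) :
    evalVector y φ w = ∑ k ∈ range M, (y ^ k) ⊗ₜ[K] (PowerSeries.coeff k φ.1 w) := by
  change ∑ k ∈ range (φ.2 w).choose, _ = _
  rw [sum_range_extend _ (le_max_left _ M) fun k hk => by
      rw [(φ.2 w).choose_spec k hk, TensorProduct.tmul_zero],
    ← sum_range_extend _ (le_max_right (φ.2 w).choose M) fun k hk => by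
      rw [hM k hk, TensorProduct.tmul_zero]]

/-- The operator `∑ y^k φ_k` on `S ⊗ V`. -/
noncomputable def evalOp (φ : locFinite (K := K) V) : Module.End S (S ⊗[K] V) :=
  (evalVector y φ).liftBaseChange S

theorem evalOp_tmul (φ : locFinite (K := K) V) (w : V) : evalOp y φ (1 ⊗ₜ w) = evalVector y φ w := by
  rw [evalOp, LinearMap.liftBaseChange_tmul, one_smul]

theorem evalOp_tmul' (φ : locFinite (K := K) V) (s : S) (w : V) :
    evalOp y φ (s ⊗ₜ w) = s • evalVector y φ w := by
  rw [evalOp, LinearMap.liftBaseChange_tmul]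

theorem end_ext {N : Type*} [AddCommGroup N] [Module S N] {f g : S ⊗[K] V →ₗ[S] N}
    (h : ∀ w : V, f (1 ⊗ₜ w) = g (1 ⊗ₜ w)) : f = g := by
  refine LinearMap.ext fun x => ?_
  induction x using TensorProduct.induction_on with
  | zero => simp
  | tmul s w =>
    have : s ⊗ₜ[K] w = s • ((1 : S) ⊗ₜ[K] w) := by rw [TensorProduct.smul_tmul', smul_eq_mul, mul_one]
    rw [this, map_smul, map_smul, h]
  | add x y hx hy => rw [map_add, map_add, hx, hy]

theorem exists_product_bound (φ ψ : locFinite (K := K) V) (w : V) : ∃ M, ∀ k l, M ≤ k ∨ M ≤ l →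
    PowerSeries.coeff k φ.1 (PowerSeries.coeff l ψ.1 w) = 0 := by
  obtain ⟨M, hM⟩ := ψ.2 w
  choose N hN using φ.2
  refine ⟨M + (range M).sup fun l => N (PowerSeries.coeff l ψ.1 w), fun k l h => ?_⟩
  rcases le_or_gt M l with hl | hl
  · rw [hM _ hl, map_zero]
  · have := le_sup (f := fun l => N (PowerSeries.coeff l ψ.1 w)) (mem_range.2 hl)
    exact hN _ _ (by omega)

theorem evalOp_evalOp (y' : S) (φ ψ : locFinite (K := K) V) (w : V) {M : ℕ}
    (hM : ∀ k l, M ≤ k ∨ M ≤ l → PowerSeries.coeff k φ.1 (PowerSeries.coeff l ψ.1 w) = 0) :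
    evalOp y φ (evalOp y' ψ (1 ⊗ₜ w)) = ∑ k ∈ range M, ∑ l ∈ range M,
      (y ^ k * y' ^ l) ⊗ₜ[K] (PowerSeries.coeff k φ.1 (PowerSeries.coeff l ψ.1 w)) := by
  obtain ⟨M', hM'⟩ := ψ.2 w
  rw [evalOp_tmul, evalVector_eq y' ψ w (M := max M M') fun k hk => hM' k (le_trans (le_max_right _ _) hk),
    map_sum]
  have e : ∀ l, evalOp y φ ((y' ^ l) ⊗ₜ[K] (PowerSeries.coeff l ψ.1 w)) = ∑ k ∈ range M,
      (y ^ k * y' ^ l) ⊗ₜ[K] (PowerSeries.coeff k φ.1 (PowerSeries.coeff l ψ.1 w)) := by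
    intro l
    rw [evalOp_tmul', evalVector_eq y φ _ (M := M) fun k hk => hM k l (Or.inl hk), smul_sum]
    refine sum_congr rfl fun k _ => ?_
    rw [TensorProduct.smul_tmul', smul_eq_mul, mul_comm]
  simp only [e]
  rw [← sum_range_extend _ (le_max_left M M'), sum_comm]
  intro l hl
  refine sum_eq_zero fun k _ => ?_
  rw [hM k l (Or.inr hl), TensorProduct.tmul_zero]

/-- Evaluation of locally finite series of operators at a scalar `y`. -/
noncomputable def evalHom : locFinite (K := K) V →+* Module.End S (S ⊗[K] V) where
  toFun := evalOp y
  map_zero' := end_ext fun w => by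
    rw [evalOp_tmul, evalVector_eq y _ w (M := 0) (fun k _ => by simp)]
    simp
  map_one' := end_ext fun w => by
    rw [evalOp_tmul, evalVector_eq y _ w (M := 1) fun k hk => by
      rw [OneMemClass.coe_one, PowerSeries.coeff_one, if_neg (by omega), LinearMap.zero_apply]]
    simp
  map_add' φ ψ := end_ext fun w => by
    obtain ⟨M, hM⟩ := φ.2 w
    obtain ⟨M', hM'⟩ := ψ.2 w
    have h1 : ∀ k, max M M' ≤ k → PowerSeries.coeff k φ.1 w = 0 := fun k hk =>
      hM k (le_trans (le_max_left _ _) hk)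
    have h2 : ∀ k, max M M' ≤ k → PowerSeries.coeff k ψ.1 w = 0 := fun k hk =>
      hM' k (le_trans (le_max_right _ _) hk)
    rw [LinearMap.add_apply, evalOp_tmul, evalOp_tmul, evalOp_tmul, evalVector_eq y φ w h1,
      evalVector_eq y ψ w h2, evalVector_eq y (φ + ψ) w (M := max M M') fun k hk => by
        rw [Subring.coe_add, map_add, LinearMap.add_apply, h1 k hk, h2 k hk, add_zero],
      ← sum_add_distrib]
    simp only [Subring.coe_add, map_add, LinearMap.add_apply, TensorProduct.tmul_add]
  map_mul' φ ψ := end_ext fun w => by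
    obtain ⟨M, hM⟩ := exists_product_bound φ ψ w
    rw [Module.End.mul_apply, evalOp_evalOp y y φ ψ w hM, evalOp_tmul,
      evalVector_eq y (φ * ψ) w (M := M + M),
      sum_range_extend (fun k => ∑ l ∈ range M,
        (y ^ k * y ^ l) ⊗ₜ[K] (PowerSeries.coeff k φ.1 (PowerSeries.coeff l ψ.1 w)))
        (Nat.le_add_right M M)]
    · have e : ∀ k, ∑ l ∈ range M,
          (y ^ k * y ^ l) ⊗ₜ[K] (PowerSeries.coeff k φ.1 (PowerSeries.coeff l ψ.1 w)) =
          ∑ l ∈ range (M + M),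
          (y ^ k * y ^ l) ⊗ₜ[K] (PowerSeries.coeff k φ.1 (PowerSeries.coeff l ψ.1 w)) := fun k =>
        sum_range_extend _ (Nat.le_add_right M M) fun l hl => by
          rw [hM k l (Or.inr hl), TensorProduct.tmul_zero]
      simp only [e]
      rw [← sum_antidiagonal_eq_sum_range (fun p => (y ^ p.1 * y ^ p.2) ⊗ₜ[K]
        (PowerSeries.coeff p.1 φ.1 (PowerSeries.coeff p.2 ψ.1 w)))]
      · refine sum_congr rfl fun N _ => ?_
        rw [Subring.coe_mul, PowerSeries.coeff_mul, LinearMap.sum_apply, TensorProduct.tmul_sum]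
        refine sum_congr rfl fun p hp => ?_
        rw [HasAntidiagonal.mem_antidiagonal] at hp
        rw [← pow_add, hp, Module.End.mul_apply]
      · intro k l hkl
        rw [hM k l (by omega), TensorProduct.tmul_zero]
    · intro k hk
      exact sum_eq_zero fun l _ => by rw [hM k l (Or.inl hk), TensorProduct.tmul_zero]
    · intro k hk
      rw [Subring.coe_mul, PowerSeries.coeff_mul, LinearMap.sum_apply]
      refine sum_eq_zero fun p hp => ?_
      rw [HasAntidiagonal.mem_antidiagonal] at hp
      rw [Module.End.mul_apply, hM _ _ (by omega)]

theorem evalHom_tmul (φ : locFinite (K := K) V) (w : V) {M : ℕ}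
    (hM : ∀ k, M ≤ k → PowerSeries.coeff k φ.1 w = 0) : evalHom y φ (1 ⊗ₜ w) =
      ∑ k ∈ range M, (y ^ k) ⊗ₜ[K] (PowerSeries.coeff k φ.1 w) := by
  rw [← evalVector_eq y φ w hM, ← evalOp_tmul]
  rfl

theorem evalHom_mul_tmul (y' : S) (φ ψ : locFinite (K := K) V) (w : V) {M : ℕ}
    (hM : ∀ k l, M ≤ k ∨ M ≤ l → PowerSeries.coeff k φ.1 (PowerSeries.coeff l ψ.1 w) = 0) :
    (evalHom y φ * evalHom y' ψ) (1 ⊗ₜ w) = ∑ k ∈ range M, ∑ l ∈ range M,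
      (y ^ k * y' ^ l) ⊗ₜ[K] (PowerSeries.coeff k φ.1 (PowerSeries.coeff l ψ.1 w)) :=
  evalOp_evalOp y y' φ ψ w hM

theorem evalHom_C (b : Module.End K V) :
    evalHom y ⟨PowerSeries.C b, C_mem_locFinite b⟩ = b.baseChange S := end_ext fun w => by
  rw [evalHom_tmul y _ w (M := 1) fun k hk => by
    simp only
    rw [PowerSeries.coeff_C, if_neg (by omega), LinearMap.zero_apply]]
  simp

theorem evalHom_X : evalHom y ⟨PowerSeries.X, X_mem_locFinite⟩ =
    algebraMap S (Module.End S (S ⊗[K] V)) y := end_ext fun w => by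
  rw [evalHom_tmul y _ w (M := 2) fun k hk => by
    simp only
    rw [PowerSeries.coeff_X, if_neg (by omega), LinearMap.zero_apply]]
  simp [sum_range_succ, PowerSeries.coeff_X, TensorProduct.smul_tmul', Module.algebraMap_end_apply]

theorem evalHom_algebraMap (a : K) :
    evalHom y ⟨algebraMap K (PowerSeries (Module.End K V)) a, algebraMap_mem_locFinite a⟩ =
      algebraMap S (Module.End S (S ⊗[K] V)) (algebraMap K S a) := by
  have : (⟨algebraMap K (PowerSeries (Module.End K V)) a, algebraMap_mem_locFinite a⟩ :
      locFinite (K := K) V) = ⟨PowerSeries.C (algebraMap K _ a), C_mem_locFinite _⟩ :=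
    Subtype.ext PowerSeries.algebraMap_apply
  rw [this, evalHom_C]
  refine end_ext fun w => ?_
  rw [Module.algebraMap_end_apply, TensorProduct.smul_tmul', LinearMap.baseChange_tmul,
    Module.algebraMap_end_apply, TensorProduct.tmul_smul, TensorProduct.smul_tmul', algebraMap_smul]

theorem evalHom_polySeries (p : Polynomial K) :
    evalHom y ⟨polySeries (Module.End K V) p, polySeries_mem_locFinite p⟩ =
      algebraMap S (Module.End S (S ⊗[K] V)) (Polynomial.aeval y p) := by
  induction p using Polynomial.induction_on' with
  | add p q hp hq =>
    have : (⟨polySeries (Module.End K V) (p + q), polySeries_mem_locFinite (p + q)⟩ :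
        locFinite (K := K) V) = ⟨_, polySeries_mem_locFinite p⟩ + ⟨_, polySeries_mem_locFinite q⟩ :=
      Subtype.ext (map_add _ _ _)
    rw [this, map_add, map_add, map_add, hp, hq]
  | monomial m a =>
    rw [Polynomial.aeval_monomial, map_mul, map_pow, ← evalHom_X y, ← evalHom_algebraMap y, ← map_pow,
      ← map_mul]
    congr 1
    refine Subtype.ext ?_
    change polySeries (Module.End K V) _ = algebraMap K _ a * PowerSeries.X ^ m
    rw [polySeries, Polynomial.aeval_monomial]

/-- Evaluating the coefficients of `φ(u + a)` at `u^{-1} = y` is evaluating `φ` at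
`(u + a)^{-1} = y (1 + a y)^{-1}`. -/
theorem evalHom_shift (a : K) (ha : IsNilpotent a) (r : S)
    (hr : r * (1 + algebraMap K S a * y) = 1) (φ ψ : locFinite (K := K) V)
    (h : ∀ N, PowerSeries.coeff N ψ.1 = ∑ p ∈ antidiagonal N,
      ((((N - 1).choose p.2 : K) * (-a) ^ p.2) • PowerSeries.coeff p.1 φ.1)) :
    evalHom y ψ = evalHom (y * r) φ := end_ext fun w => by
  obtain ⟨M₀, hM₀⟩ := φ.2 w
  obtain ⟨Q₀, hQ₀⟩ := ha
  obtain ⟨M, hM, hQ⟩ : ∃ M, (∀ k, M ≤ k → PowerSeries.coeff k φ.1 w = 0) ∧ (-a) ^ M = 0 :=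
    ⟨max M₀ Q₀, fun k hk => hM₀ k (le_trans (le_max_left _ _) hk), by
      rw [neg_pow, pow_eq_zero_of_le (le_max_right _ _) hQ₀, mul_zero]⟩
  have hz : ∀ k m, M + M ≤ k + m → (-a) ^ m • PowerSeries.coeff k φ.1 w = 0 := by
    intro k m hkm
    rcases le_or_gt M k with hk | hk
    · rw [hM k hk, smul_zero]
    · rw [pow_eq_zero_of_le (by omega) hQ, zero_smul]
  rw [evalHom_tmul (y * r) φ w (M := M + M) fun k hk => hM k (by omega),
    evalHom_tmul y ψ w (M := M + M)]
  · have e : ∀ N, (y ^ N) ⊗ₜ[K] (PowerSeries.coeff N ψ.1 w) = ∑ p ∈ antidiagonal N,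
        (y ^ (p.1 + p.2)) ⊗ₜ[K] (((p.1 + p.2 - 1).choose p.2 : K) • (-a) ^ p.2 •
          PowerSeries.coeff p.1 φ.1 w) := by
      intro N
      rw [h, LinearMap.sum_apply, TensorProduct.tmul_sum]
      refine sum_congr rfl fun p hp => ?_
      rw [HasAntidiagonal.mem_antidiagonal] at hp
      rw [hp, LinearMap.smul_apply, mul_smul]
    simp only [e]
    -- Both sides are the binomial expansion of `∑ y^k (1 + a y)^{-k} φ_k w`, summed in different
    -- orders.
    rw [sum_antidiagonal_eq_sum_range (fun p => (y ^ (p.1 + p.2)) ⊗ₜ[K]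
      (((p.1 + p.2 - 1).choose p.2 : K) • (-a) ^ p.2 • PowerSeries.coeff p.1 φ.1 w))]
    · refine sum_congr rfl fun k _ => ?_
      rw [mul_pow, ← sum_choose_mul_pow (-(algebraMap K S a * y)) r (M + M) _ (by rw [sub_neg_eq_add, hr]) k,
        mul_sum, TensorProduct.sum_tmul]
      · refine sum_congr rfl fun m _ => ?_
        rw [smul_smul, ← TensorProduct.smul_tmul, Algebra.smul_def]
        congr 1
        rw [map_mul, map_pow, map_neg, map_natCast, pow_add, neg_pow (algebraMap K S a * y), mul_pow,
          neg_pow (algebraMap K S a)]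
        ring
      · rw [neg_pow, mul_pow, ← map_pow, ← neg_neg a, neg_pow (-a), pow_add (-a), hQ]
        simp
    · intro k m hkm
      rw [hz k m hkm, smul_zero, TensorProduct.tmul_zero]
  · intro k hk
    rw [h, LinearMap.sum_apply]
    refine sum_eq_zero fun p hp => ?_
    rw [HasAntidiagonal.mem_antidiagonal] at hp
    rw [LinearMap.smul_apply, mul_smul, hz _ _ (by omega), smul_zero]

end LocallyFinite

end YangianDouble

/-! ### The series `L^+` on a locally nilpotent module -/

namespace YangianDouble

open Finset
open scoped TensorProduct

section Commutator

/-- For `y₁ = u⁻¹` and `y₂ = v⁻¹` the hypothesis `y₁ - y₂ = h y₁ y₂` says `v = u + h`; the divided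
relation then gives the exchange relation of `L^+(u)` and `L^+(v)`. The variables are units, so
that no torsion interferes. -/
theorem commutator_eq_of_divided {S T : Type*} [CommRing S] [Ring T] [Algebra S T] {y₁ y₂ h : S}
    (hy₁ : IsUnit y₁) (hy₂ : IsUnit y₂) (hy : y₁ - y₂ = h * (y₁ * y₂)) {x y δ c d : T}
    (hδ : x * δ = δ * x)
    (h0 : algebraMap S T y₂ * (x * y - y * x) - algebraMap S T y₁ * (x * y - y * x) +
      algebraMap S T (y₁ * y₂) * (c - d) = 0) :
    x * (δ + algebraMap S T h * y) - c = (δ + algebraMap S T h * y) * x - d := by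
  have h1 : algebraMap S T (y₁ * y₂) * (c - d - algebraMap S T h * (x * y - y * x)) = 0 := by
    rw [mul_sub, ← mul_assoc, ← map_mul, mul_comm (y₁ * y₂), ← hy, map_sub, ← h0]
    noncomm_ring
  have h2 := (((hy₁.mul hy₂).map (algebraMap S T)).mul_right_eq_zero).1 h1
  rw [mul_sub] at h2
  rw [mul_add, add_mul, hδ, Algebra.left_comm, mul_assoc, ← sub_eq_zero, ← neg_eq_zero, ← h2]
  abel

end Commutator

section PlusSide

variable {n : ℕ} {K V : Type*} [CommRing K] [AddCommGroup V] [Module K V]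
  {l : ℤ → Matrix (Fin n) (Fin n) (Module.End K V)}

/-- Every vector is annihilated by almost all the operators `l^{(r)}` with `r ≥ 0`. -/
def LocNil (l : ℤ → Matrix (Fin n) (Fin n) (Module.End K V)) : Prop :=
  ∀ w : V, ∃ p : ℕ, ∀ r : ℤ, (p : ℤ) ≤ r → ∀ i j, l r i j w = 0

theorem plusPart_mem_locFinite (hl : LocNil l) (i j : Fin n) :
    (PowerSeries.mk fun k : ℕ => plusPart l (-(k : ℤ)) i j) ∈ locFinite V := by
  intro w
  obtain ⟨p, hp⟩ := hl w
  refine ⟨p + 1, fun k hk => ?_⟩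
  rw [PowerSeries.coeff_mk, plusPart, Matrix.of_apply, if_pos (by omega), LinearMap.neg_apply,
    hp _ (by omega), neg_zero]

theorem plusSeries_eq (x : K) (i j : Fin n) : plusSeries x l i j = (if i = j then 1 else 0) +
    algebraMap K _ x * PowerSeries.mk fun k : ℕ => plusPart l (-(k : ℤ)) i j := by
  ext1 k
  rw [plusSeries, Matrix.of_apply, PowerSeries.coeff_mk, plusCoeff_apply, map_add,
    PowerSeries.algebraMap_apply, PowerSeries.coeff_C_mul, PowerSeries.coeff_mk]
  congr 1
  by_cases h : i = j <;> simp [h, PowerSeries.coeff_one]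

theorem plusSeries_mem_locFinite (hl : LocNil l) (x : K) (i j : Fin n) :
    plusSeries x l i j ∈ locFinite V := by
  rw [plusSeries_eq]
  refine add_mem ?_ (mul_mem (algebraMap_mem_locFinite x) (plusPart_mem_locFinite hl i j))
  split_ifs
  exacts [one_mem _, zero_mem _]

/-- `L^+(u)` as a matrix of locally finite series in `u^{-1}`. -/
noncomputable def plusMat (hl : LocNil l) (x : K) : Matrix (Fin n) (Fin n) (locFinite (K := K) V) :=
  Matrix.of fun i j => ⟨plusSeries x l i j, plusSeries_mem_locFinite hl x i j⟩

/-- `(L^+(u) - 1) / h` as a matrix of locally finite series in `u^{-1}`. -/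
noncomputable def plusPartMat (hl : LocNil l) : Matrix (Fin n) (Fin n) (locFinite (K := K) V) :=
  Matrix.of fun i j => ⟨_, plusPart_mem_locFinite hl i j⟩

theorem plusMat_eq (hl : LocNil l) (x : K) : plusMat hl x = 1 +
    Matrix.scalar (Fin n) ⟨algebraMap K _ x, algebraMap_mem_locFinite x⟩ * plusPartMat hl := by
  ext i j : 1
  rw [Matrix.add_apply, Matrix.scalar_apply, Matrix.diagonal_mul, Matrix.one_apply]
  refine Subtype.ext ?_
  refine (plusSeries_eq x i j).trans ?_
  rw [Subring.coe_add]
  congr 1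
  split_ifs <;> rfl

variable {S : Type*} [CommRing S] [Algebra K S] {h ε : K}

theorem evalHom_plusMat (hl : LocNil l) (x : K) (y : S) (i j : Fin n) :
    evalHom y (plusMat hl x i j) = (if i = j then 1 else 0) +
      algebraMap S _ (algebraMap K S x) * evalHom y (plusPartMat hl i j) := by
  rw [plusMat_eq, Matrix.add_apply, Matrix.scalar_apply, Matrix.diagonal_mul, Matrix.one_apply,
    map_add, map_mul, evalHom_algebraMap]
  congr 1
  split_ifs
  exacts [map_one _, map_zero _]

variable [Algebra ℂ K]

/-- The divided exchange relation of `L^+(u)` and `L^+(v)` on `u^{-1} = y₁` and `v^{-1} = y₂`. -/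
theorem divided_plus_eval (H : Relations n h ε l) (hl : LocNil l) (y₁ y₂ : S) (i j p q : Fin n) :
    algebraMap S _ y₂ * (evalHom y₁ (plusMat hl h i j) * evalHom y₂ (plusPartMat hl p q) -
        evalHom y₂ (plusPartMat hl p q) * evalHom y₁ (plusMat hl h i j)) -
      algebraMap S _ y₁ * (evalHom y₁ (plusMat hl h i j) * evalHom y₂ (plusPartMat hl p q) -
        evalHom y₂ (plusPartMat hl p q) * evalHom y₁ (plusMat hl h i j)) +
      algebraMap S _ (y₁ * y₂) * (evalHom y₁ (plusMat hl h p j) * evalHom y₂ (plusMat hl h i q) -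
        evalHom y₂ (plusMat hl h p j) * evalHom y₁ (plusMat hl h i q)) =
      (0 : Module.End S (S ⊗[K] V)) := by
  refine end_ext fun w => ?_
  set L : ℤ → Matrix (Fin n) (Fin n) (Module.End K V) := plusCoeff (algebraMap K _ h) l with hL
  set X := plusPart l with hX
  have hLc : ∀ (k : ℕ) (i j : Fin n), PowerSeries.coeff k (plusMat hl h i j).1 = L (-(k : ℤ)) i j :=
    fun k i j => PowerSeries.coeff_mk k fun k : ℕ => plusCoeff (algebraMap K _ h) l (-(k : ℤ)) i j
  have hXc : ∀ (k : ℕ) (i j : Fin n), PowerSeries.coeff k (plusPartMat hl i j).1 = X (-(k : ℤ)) i j :=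
    fun k i j => PowerSeries.coeff_mk k fun k : ℕ => plusPart l (-(k : ℤ)) i j
  obtain ⟨M, h1, h2, h3, h4⟩ : ∃ M : ℕ,
      (∀ k m : ℕ, M ≤ k ∨ M ≤ m → L (-(k : ℤ)) i j (X (-(m : ℤ)) p q w) = 0) ∧
      (∀ m k : ℕ, M ≤ m ∨ M ≤ k → X (-(m : ℤ)) p q (L (-(k : ℤ)) i j w) = 0) ∧
      (∀ k m : ℕ, M ≤ k ∨ M ≤ m → L (-(k : ℤ)) p j (L (-(m : ℤ)) i q w) = 0) ∧
      (∀ m k : ℕ, M ≤ m ∨ M ≤ k → L (-(m : ℤ)) p j (L (-(k : ℤ)) i q w) = 0) := by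
    obtain ⟨M1, h1⟩ := exists_product_bound (plusMat hl h i j) (plusPartMat hl p q) w
    obtain ⟨M2, h2⟩ := exists_product_bound (plusPartMat hl p q) (plusMat hl h i j) w
    obtain ⟨M3, h3⟩ := exists_product_bound (plusMat hl h p j) (plusMat hl h i q) w
    simp only [hLc, hXc] at h1 h2 h3
    exact ⟨max M1 (max M2 M3), fun k m hk => h1 k m (by omega), fun k m hk => h2 k m (by omega),
      fun k m hk => h3 k m (by omega), fun k m hk => h3 k m (by omega)⟩
  -- The coefficients of the commutator of `L^+(u)` with `(L^+(v) - 1) / h` and of the correction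
  -- term, applied to `w`; the divided relation is the recursion `hab` for them.
  let a : ℕ → ℕ → V := fun k m => L (-(k : ℤ)) i j (X (-(m : ℤ)) p q w) -
    X (-(m : ℤ)) p q (L (-(k : ℤ)) i j w)
  let b : ℕ → ℕ → V := fun k m => L (-(k : ℤ)) p j (L (-(m : ℤ)) i q w) -
    L (-(m : ℤ)) p j (L (-(k : ℤ)) i q w)
  have hab : ∀ k m : ℕ, a (k + 1) m - a k (m + 1) + b k m = 0 := by
    intro k m
    have := congrArg (fun f : Module.End K V => f w) (H.divided_plus (-(k : ℤ)) (-(m : ℤ)) i j p q)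
    simp only [dividedSame, LinearMap.sub_apply, LinearMap.add_apply, Module.End.mul_apply,
      LinearMap.zero_apply] at this
    simp only [a, b]
    rw [← this]
    push_cast
    rw [neg_add, neg_add, ← sub_eq_add_neg, ← sub_eq_add_neg]
    abel
  -- The recursion is summed with a shift of the indices, for which the boundary terms have to
  -- vanish.
  have ha0 : ∀ m, a 0 m = 0 := by
    intro m
    have : L (-((0 : ℕ) : ℤ)) i j = if i = j then 1 else 0 := by simp [hL, plusCoeff]
    simp only [a, this]
    split_ifs <;> simp
  have ha0' : ∀ k, a k 0 = 0 := by
    intro k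
    have : X (-((0 : ℕ) : ℤ)) p q = 0 := by simp [hX, plusPart]
    simp only [a, this]
    simp
  have haM : ∀ k m, M ≤ k ∨ M ≤ m → a k m = 0 := fun k m hkm => by
    simp only [a]
    rw [h1 k m hkm, h2 m k hkm.symm, sub_zero]
  have eA : (evalHom y₁ (plusMat hl h i j) * evalHom y₂ (plusPartMat hl p q) -
        evalHom y₂ (plusPartMat hl p q) * evalHom y₁ (plusMat hl h i j)) ((1 : S) ⊗ₜ[K] w) =
      ∑ k ∈ range M, ∑ m ∈ range M, (y₁ ^ k * y₂ ^ m) ⊗ₜ[K] a k m := by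
    rw [LinearMap.sub_apply, evalHom_mul_tmul y₁ y₂ _ _ w (M := M) (by simpa only [hLc, hXc] using h1),
      evalHom_mul_tmul y₂ y₁ _ _ w (M := M) (by simpa only [hLc, hXc] using h2), sum_comm (s := range M)
        (f := fun k m => (y₂ ^ k * y₁ ^ m) ⊗ₜ[K] _)]
    simp only [← sum_sub_distrib, hLc, hXc, mul_comm (y₂ ^ _), ← TensorProduct.tmul_sub, a]
  have eB : (evalHom y₁ (plusMat hl h p j) * evalHom y₂ (plusMat hl h i q) -
        evalHom y₂ (plusMat hl h p j) * evalHom y₁ (plusMat hl h i q)) ((1 : S) ⊗ₜ[K] w) =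
      ∑ k ∈ range M, ∑ m ∈ range M, (y₁ ^ k * y₂ ^ m) ⊗ₜ[K] b k m := by
    rw [LinearMap.sub_apply, evalHom_mul_tmul y₁ y₂ _ _ w (M := M) (by simpa only [hLc] using h3),
      evalHom_mul_tmul y₂ y₁ _ _ w (M := M) (by simpa only [hLc] using h4), sum_comm (s := range M)
        (f := fun k m => (y₂ ^ k * y₁ ^ m) ⊗ₜ[K] _)]
    simp only [← sum_sub_distrib, hLc, mul_comm (y₂ ^ _), ← TensorProduct.tmul_sub, b]
  have e1 : y₂ • ∑ k ∈ range M, ∑ m ∈ range M, (y₁ ^ k * y₂ ^ m) ⊗ₜ[K] a k m =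
      ∑ k ∈ range M, ∑ m ∈ range M, (y₁ ^ (k + 1) * y₂ ^ (m + 1)) ⊗ₜ[K] a (k + 1) m := by
    rw [sum_range_extend _ (Nat.le_succ M) fun k hk => sum_eq_zero fun m _ => by
      rw [haM k m (Or.inl hk), TensorProduct.tmul_zero], sum_range_succ',
      sum_eq_zero (s := range M) (f := fun m => (y₁ ^ 0 * y₂ ^ m) ⊗ₜ[K] a 0 m) fun m _ => by
        rw [ha0, TensorProduct.tmul_zero], add_zero, smul_sum]
    refine sum_congr rfl fun k _ => ?_
    rw [smul_sum]
    refine sum_congr rfl fun m _ => ?_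
    rw [TensorProduct.smul_tmul', smul_eq_mul]
    congr 1
    ring
  have e2 : y₁ • ∑ k ∈ range M, ∑ m ∈ range M, (y₁ ^ k * y₂ ^ m) ⊗ₜ[K] a k m =
      ∑ k ∈ range M, ∑ m ∈ range M, (y₁ ^ (k + 1) * y₂ ^ (m + 1)) ⊗ₜ[K] a k (m + 1) := by
    rw [smul_sum]
    refine sum_congr rfl fun k _ => ?_
    rw [sum_range_extend _ (Nat.le_succ M) fun m hm => by
      rw [haM k m (Or.inr hm), TensorProduct.tmul_zero], sum_range_succ', ha0',
      TensorProduct.tmul_zero, add_zero, smul_sum]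
    refine sum_congr rfl fun m _ => ?_
    rw [TensorProduct.smul_tmul', smul_eq_mul]
    congr 1
    ring
  have e3 : (y₁ * y₂) • ∑ k ∈ range M, ∑ m ∈ range M, (y₁ ^ k * y₂ ^ m) ⊗ₜ[K] b k m =
      ∑ k ∈ range M, ∑ m ∈ range M, (y₁ ^ (k + 1) * y₂ ^ (m + 1)) ⊗ₜ[K] b k m := by
    rw [smul_sum]
    refine sum_congr rfl fun k _ => ?_
    rw [smul_sum]
    refine sum_congr rfl fun m _ => ?_
    rw [TensorProduct.smul_tmul', smul_eq_mul]
    congr 1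
    ring
  rw [LinearMap.add_apply, LinearMap.sub_apply, Module.End.mul_apply, Module.End.mul_apply,
    Module.End.mul_apply, eA, eB, Module.algebraMap_end_apply, Module.algebraMap_end_apply,
    Module.algebraMap_end_apply, e1, e2, e3, ← sum_sub_distrib, ← sum_add_distrib,
    LinearMap.zero_apply]
  refine sum_eq_zero fun k _ => ?_
  rw [← sum_sub_distrib, ← sum_add_distrib]
  refine sum_eq_zero fun m _ => ?_
  rw [← TensorProduct.tmul_sub, ← TensorProduct.tmul_add, hab, TensorProduct.tmul_zero]

/-- The operators `L^+(u)` and `L^+(u + h)` satisfy the exchange relation with `1 - P`. -/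
theorem cross_plus (H : Relations n h ε l) (hl : LocNil l) (y₁ y₂ : S) (hy₁ : IsUnit y₁)
    (hy₂ : IsUnit y₂) (hy : y₁ - y₂ = algebraMap K S h * (y₁ * y₂)) :
    Cross ((plusMat hl h).map (evalHom y₁)) ((plusMat hl h).map (evalHom y₂)) := by
  intro i j p q
  simp only [Matrix.map_apply]
  rw [evalHom_plusMat hl h y₂ p q]
  refine commutator_eq_of_divided (T := Module.End S (S ⊗[K] V)) hy₁ hy₂ hy ?_
    (divided_plus_eval H hl y₁ y₂ i j p q)
  split_ifs <;> simp

end PlusSide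

end YangianDouble

/-! ### Exchange relations and `R`-matrices with a nilpotent parameter -/

namespace YangianDouble

open Finset

section RMatrix

variable {n : ℕ} {S T : Type*} [CommRing S] [Ring T] [Algebra S T]

theorem flipMat_mul_apply {R : Type*} [Ring R] (X : Matrix (Fin n) (Fin n) (Matrix (Fin n) (Fin n) R))
    (i j p q : Fin n) : (flipMat n R * X) i j p q = X p j i q := by
  rw [Matrix.mul_apply, Matrix.sum_apply, sum_eq_single p]
  · simp [flipMat]
  · intro b _ hb
    simp [flipMat, Matrix.mul_apply, hb]
  · simp

theorem mul_flipMat_apply {R : Type*} [Ring R] (X : Matrix (Fin n) (Fin n) (Matrix (Fin n) (Fin n) R))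
    (i j p q : Fin n) : (X * flipMat n R) i j p q = X i q p j := by
  rw [Matrix.mul_apply, Matrix.sum_apply, sum_eq_single q]
  · simp [flipMat]
  · intro b _ hb
    rw [flipMat, Matrix.of_apply, Matrix.mul_apply]
    refine sum_eq_zero fun c _ => ?_
    rw [Matrix.single_apply, if_neg fun h => hb h.2, mul_zero]
  · simp

theorem outer_mul_inner_apply (A B : Matrix (Fin n) (Fin n) T) (i j p q : Fin n) :
    (outer B * inner A) i j p q = B i j * A p q := by
  simp [outer, inner, Matrix.mul_diagonal, Matrix.diagonal_mul]

theorem inner_mul_outer_apply (A B : Matrix (Fin n) (Fin n) T) (i j p q : Fin n) :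
    (inner A * outer B) i j p q = A p q * B i j := by
  simp [outer, inner, Matrix.mul_diagonal, Matrix.diagonal_mul]

variable (T) in
/-- The operator `s (1 + θ P)` over an algebra `T` of scalars. -/
def rTwoMap (n : ℕ) (s θ : S) : Matrix (Fin n) (Fin n) (Matrix (Fin n) (Fin n) T) :=
  (rTwo n s θ).map (scalarMap n S T)

theorem rTwoMap_eq (s θ : S) : rTwoMap T n s θ =
    s • (1 : Matrix (Fin n) (Fin n) (Matrix (Fin n) (Fin n) T)) + (s * θ) • flipMat n T := by
  have e : ∀ (r : S) (X : Matrix (Fin n) (Fin n) (Matrix (Fin n) (Fin n) S)),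
      (r • X).map (scalarMap n S T) = r • X.map (scalarMap n S T) := by
    intro r X
    ext i j p q
    simp [scalarMap, Algebra.smul_def (A := T)]
  have e1 : (flipMat n S).map (scalarMap n S T) = flipMat n T := flipMat_map _
  have e2 : (1 : Matrix (Fin n) (Fin n) (Matrix (Fin n) (Fin n) S)).map (scalarMap n S T) = 1 :=
    map_one (scalarMap n S T).mapMatrix
  rw [rTwoMap, rTwo, smul_add, smul_smul, Matrix.map_add _ (map_add _), e, e, e1, e2]

theorem rTwoMap_mul_apply (s θ : S) (X : Matrix (Fin n) (Fin n) (Matrix (Fin n) (Fin n) T))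
    (i j p q : Fin n) : (rTwoMap T n s θ * X) i j p q =
      algebraMap S T s * X i j p q + algebraMap S T (s * θ) * X p j i q := by
  rw [rTwoMap_eq, add_mul, smul_mul_assoc, smul_mul_assoc, one_mul]
  simp only [Matrix.add_apply, Matrix.smul_apply, flipMat_mul_apply, Algebra.smul_def (A := T)]

theorem mul_rTwoMap_apply (s θ : S) (X : Matrix (Fin n) (Fin n) (Matrix (Fin n) (Fin n) T))
    (i j p q : Fin n) : (X * rTwoMap T n s θ) i j p q =
      algebraMap S T s * X i j p q + algebraMap S T (s * θ) * X i q p j := by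
  rw [rTwoMap_eq, mul_add, mul_smul_comm, mul_smul_comm, mul_one]
  simp only [Matrix.add_apply, Matrix.smul_apply, mul_flipMat_apply, Algebra.smul_def (A := T)]

theorem rTwo_mul_rTwo {s s' θ : S} (h : s * s' * (1 - θ ^ 2) = 1) :
    rTwo n s θ * rTwo n s' (-θ) = 1 := by
  have hP : flipMat n S * flipMat n S = 1 := by
    ext i j p q
    rw [flipMat_mul_apply]
    simp only [flipMat, Matrix.of_apply, Matrix.single_apply, Matrix.one_apply]
    split_ifs <;> simp_all [Matrix.one_apply]
  rw [rTwo, rTwo, smul_mul_smul_comm, add_mul, one_mul, mul_add, mul_one, smul_mul_smul_comm, hP]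
  rw [neg_smul, ← add_assoc, neg_add_cancel_right, mul_neg, neg_smul, ← sub_eq_add_neg, ← pow_two,
    smul_sub, smul_smul, ← sub_smul, ← mul_one_sub, h, one_smul]

theorem rTwoMap_mul_rTwoMap {s s' θ : S} (h : s * s' * (1 - θ ^ 2) = 1) :
    rTwoMap T n s θ * rTwoMap T n s' (-θ) = 1 := by
  rw [rTwoMap, rTwoMap, ← RingHom.mapMatrix_apply, ← RingHom.mapMatrix_apply, ← map_mul,
    rTwo_mul_rTwo h, map_one]

/-- A relation `r₃ y x = x y r₄` turned into a relation between `x` and the inverse `g` of `y`. -/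
theorem mul_inverse_exchange {R : Type*} [Monoid R] {x y g r₃ r₄ β γ : R} (h : r₃ * y * x = x * y * r₄)
    (hβ : r₄ * β = 1) (hγ : γ * r₃ = 1) (hg : g * y = 1) (hg' : y * g = 1) :
    x * β * g = g * γ * x := by
  calc x * β * g = g * (γ * r₃) * y * (x * β) * g := by rw [hγ, mul_one, hg, one_mul]
    _ = g * γ * (r₃ * y * x) * β * g := by simp only [mul_assoc]
    _ = g * γ * x * y * (r₄ * β) * g := by rw [h]; simp only [mul_assoc]
    _ = _ := by rw [hβ, mul_one, mul_assoc (g * γ * x), hg', mul_one]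

theorem rTwoMap_map {T' : Type*} [Ring T'] [Algebra S T'] (f : T →ₐ[S] T') (s θ : S) :
    (rTwoMap T n s θ).map (f : T →+* T').mapMatrix = rTwoMap T' n s θ := by
  ext i j p q
  simp [rTwoMap, scalarMap]

/-- Moving a matrix on the auxiliary space past one on a tensor copy: the relation
`R₁ A B = B A R₂` in which `A` acts on the auxiliary space, solved for `A B`. -/
theorem inner_mul_outer_of_inner_outer {A B : Matrix (Fin n) (Fin n) T} {g₁ t₁ g₂ t₂ s : S}
    (h : ∀ i j p q, algebraMap S T g₁ * (A p q * B i j) + algebraMap S T (g₁ * t₁) * (A i q * B p j) =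
      algebraMap S T g₂ * (B i j * A p q) + algebraMap S T (g₂ * t₂) * (B i q * A p j))
    (hs : g₁ * s * (1 - t₁ ^ 2) = 1) :
    inner A * outer B = rTwoMap T n s (-t₁) * outer B * inner A * rTwoMap T n g₂ t₂ := by
  have e : rTwoMap T n g₁ t₁ * (inner A * outer B) = outer B * inner A * rTwoMap T n g₂ t₂ := by
    ext i j p q
    simp only [rTwoMap_mul_apply, mul_rTwoMap_apply, inner_mul_outer_apply, outer_mul_inner_apply]
    exact h i j p q
  have h' : rTwoMap T n s (-t₁) * rTwoMap T n g₁ t₁ = 1 := by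
    have := rTwoMap_mul_rTwoMap (n := n) (T := T) (s := s) (s' := g₁) (θ := -t₁)
      (by rw [neg_sq, mul_comm s, hs])
    rwa [neg_neg] at this
  rw [mul_assoc _ (outer B), mul_assoc _ (outer B * inner A), ← e, ← mul_assoc, h', one_mul]

/-- The relation `R₁ B A = A B R₂` in which `A` acts on the auxiliary space. -/
theorem outer_mul_inner_of_outer_inner {A B : Matrix (Fin n) (Fin n) T} {g₁ t₁ g₂ t₂ : S}
    (h : ∀ i j p q, algebraMap S T g₁ * (B i j * A p q) + algebraMap S T (g₁ * t₁) * (B p j * A i q) =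
      algebraMap S T g₂ * (A p q * B i j) + algebraMap S T (g₂ * t₂) * (A p j * B i q)) :
    rTwoMap T n g₁ t₁ * outer B * inner A = inner A * outer B * rTwoMap T n g₂ t₂ := by
  rw [mul_assoc]
  ext i j p q
  simp only [rTwoMap_mul_apply, mul_rTwoMap_apply, inner_mul_outer_apply, outer_mul_inner_apply]
  exact h i j p q

theorem inner_mul_outer_of_outer_inner {A B : Matrix (Fin n) (Fin n) T} {g t r : S}
    (h : rTwoMap T n g t * outer B * inner A = inner A * outer B * rTwoMap T n g t)
    (hr : g * r * (1 - t ^ 2) = 1) :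
    inner A * outer B = rTwoMap T n g t * outer B * inner A * rTwoMap T n r (-t) := by
  rw [h, mul_assoc _ (rTwoMap T n g t), rTwoMap_mul_rTwoMap hr, mul_one]

theorem outer_mul_outer {B G : Matrix (Fin n) (Fin n) T} (h : B * G = 1) : outer B * outer G = 1 := by
  have e : ∀ X : Matrix (Fin n) (Fin n) T, outer X = (Matrix.scalar (Fin n) : T →+* _).mapMatrix X :=
    fun _ => rfl
  rw [e, e, ← map_mul, h, map_one]

end RMatrix

section Corners

variable {n k : ℕ} {S T T₁ T₂ : Type*} [CommRing S] [Ring T] [Algebra S T] [Ring T₁] [Algebra S T₁]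
  [Ring T₂] [Algebra S T₂]

theorem matrix_prod_ext {X Y : Matrix (Fin n) (Fin n) (Matrix (Fin n) (Fin n) (T₂ × T₁))}
    (h₂ : X.map ((AlgHom.fst S T₂ T₁ : T₂ × T₁ →+* T₂)).mapMatrix =
      Y.map ((AlgHom.fst S T₂ T₁ : T₂ × T₁ →+* T₂)).mapMatrix)
    (h₁ : X.map ((AlgHom.snd S T₂ T₁ : T₂ × T₁ →+* T₁)).mapMatrix =
      Y.map ((AlgHom.snd S T₂ T₁ : T₂ × T₁ →+* T₁)).mapMatrix) : X = Y := by
  ext i j p q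
  · exact congrFun (congrFun (congrFun (congrFun h₂ i) j) p) q
  · exact congrFun (congrFun (congrFun (congrFun h₁ i) j) p) q

/-- The exchange theorem for matrices `M a` and `G a` which act on two different modules. -/
theorem commute_trace_of_corners [Algebra ℚ T] (J : T₂ × T₁ →ₐ[S] T)
    (A₂ : Matrix (Fin n) (Fin n) T₂) (A₁ : Matrix (Fin n) (Fin n) T₁)
    (M : Fin k → Matrix (Fin n) (Fin n) T₁) (G : Fin k → Matrix (Fin n) (Fin n) T₂) (ι : T)
    (s s' θ θ' r δ : Fin k → S)
    (hs : ∀ a, s a * s' a = 1) (hθ : ∀ a, θ a + θ' a + n * (θ a * θ' a) = 0)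
    (hc : ∀ a b : Fin k, (b : ℕ) = a + 1 → θ a * (1 - θ b) = θ b)
    (hc' : ∀ a b : Fin k, (b : ℕ) = a + 1 → θ' b * (1 - θ' a) = θ' a)
    (hι : ∀ i j, Commute ι (J (A₂ i j, A₁ i j)))
    (h1 : ∀ a, inner A₁ * outer (M a) =
      rTwoMap T₁ n (s a) (θ a) * outer (M a) * inner A₁ * rTwoMap T₁ n (r a) (δ a))
    (h2 : ∀ a, inner A₂ * rTwoMap T₂ n (r a) (δ a) * outer (G a) =
      outer (G a) * rTwoMap T₂ n (s' a) (θ' a) * inner A₂)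
    (hM : ∀ a b : Fin k, (b : ℕ) = a + 1 → Fused (M a) (M b))
    (hG : ∀ a b : Fin k, (b : ℕ) = a + 1 → Fused (G b) (G a)) (i j : Fin n) :
    Commute (J (A₂ i j, A₁ i j)) (Matrix.trace (signSum n k T *
      (((List.finRange k).map fun a => inCopy a ((M a).map fun x => J (0, x))).prod *
        Matrix.scalar (Fin k → Fin n) ι *
        ((List.finRange k).reverse.map fun a => inCopy a ((G a).map fun x => J (x, 0))).prod))) := by
  let A : Matrix (Fin n) (Fin n) (T₂ × T₁) := Matrix.of fun i j => (A₂ i j, A₁ i j)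
  let M' : Fin k → Matrix (Fin n) (Fin n) (T₂ × T₁) := fun a => (M a).map fun x => (0, x)
  let G' : Fin k → Matrix (Fin n) (Fin n) (T₂ × T₁) := fun a => (G a).map fun x => (x, 0)
  have hA2 : A.map (AlgHom.fst S T₂ T₁ : T₂ × T₁ →+* T₂) = A₂ := rfl
  have hA1 : A.map (AlgHom.snd S T₂ T₁ : T₂ × T₁ →+* T₁) = A₁ := rfl
  have hM2 : ∀ a, (M' a).map (AlgHom.fst S T₂ T₁ : T₂ × T₁ →+* T₂) = 0 := fun a => rfl
  have hM1 : ∀ a, (M' a).map (AlgHom.snd S T₂ T₁ : T₂ × T₁ →+* T₁) = M a := fun a => rfl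
  have hG2 : ∀ a, (G' a).map (AlgHom.fst S T₂ T₁ : T₂ × T₁ →+* T₂) = G a := fun a => rfl
  have hG1 : ∀ a, (G' a).map (AlgHom.snd S T₂ T₁ : T₂ × T₁ →+* T₁) = 0 := fun a => rfl
  have hz2 : outer (0 : Matrix (Fin n) (Fin n) T₂) = 0 := by ext; simp [outer]
  have hz1 : outer (0 : Matrix (Fin n) (Fin n) T₁) = 0 := by ext; simp [outer]
  -- Over `T₂ × T₁` the relations hold in one component by hypothesis and in the other because
  -- both sides vanish.
  have e1 : ∀ a, inner A * outer (M' a) =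
      rTwoMap _ n (s a) (θ a) * outer (M' a) * inner A * rTwoMap _ n (r a) (δ a) := by
    intro a
    refine matrix_prod_ext (S := S) ?_ ?_
    · simp only [← RingHom.mapMatrix_apply _ (_ * _), map_mul]
      simp only [RingHom.mapMatrix_apply, rTwoMap_map, inner_map, outer_map, hM2, hz2, mul_zero,
        zero_mul]
    · simp only [← RingHom.mapMatrix_apply _ (_ * _), map_mul]
      simp only [RingHom.mapMatrix_apply, rTwoMap_map, inner_map, outer_map, hM1, hA1]
      exact h1 a
  have e2 : ∀ a, inner A * rTwoMap _ n (r a) (δ a) * outer (G' a) =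
      outer (G' a) * rTwoMap _ n (s' a) (θ' a) * inner A := by
    intro a
    refine matrix_prod_ext (S := S) ?_ ?_
    · simp only [← RingHom.mapMatrix_apply _ (_ * _), map_mul]
      simp only [RingHom.mapMatrix_apply, rTwoMap_map, inner_map, outer_map, hG2, hA2]
      exact h2 a
    · simp only [← RingHom.mapMatrix_apply _ (_ * _), map_mul]
      simp only [RingHom.mapMatrix_apply, rTwoMap_map, inner_map, outer_map, hG1, hz1, mul_zero,
        zero_mul]
  have key := commute_trace_of_exchange (A.map J) (fun a => (M' a).map J) (fun a => (G' a).map J) ι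
    s s' θ θ' (fun a => rTwo n (r a) (δ a)) hs hθ hc hc' hι (fun a => by
      have := congrArg (fun X => X.map (J : T₂ × T₁ →+* T).mapMatrix) (e1 a)
      simp only [← RingHom.mapMatrix_apply _ (_ * _), map_mul] at this
      simp only [RingHom.mapMatrix_apply, rTwoMap_map, inner_map, outer_map] at this
      exact this) (fun a => by
      have := congrArg (fun X => X.map (J : T₂ × T₁ →+* T).mapMatrix) (e2 a)
      simp only [← RingHom.mapMatrix_apply _ (_ * _), map_mul] at this
      simp only [RingHom.mapMatrix_apply, rTwoMap_map, inner_map, outer_map] at this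
      exact this) (fun a b hab i j p q => by
      have : ∀ x y z w : T₁ , x - y + z - w = 0 → J (0, x) - J (0, y) + J (0, z) - J (0, w) = 0 := by
        intro x y z w h
        rw [← map_sub, ← map_add, ← map_sub]
        simp only [Prod.mk_sub_mk, Prod.mk_add_mk, h, sub_zero, add_zero]
        exact map_zero J
      have h := this _ _ _ _ (hM a b hab i j p q)
      simp only [Matrix.map_apply, M', ← map_mul, Prod.mk_mul_mk, mul_zero]
      exact h) (fun a b hab i j p q => by
      have : ∀ x y z w : T₂ , x - y + z - w = 0 → J (x, 0) - J (y, 0) + J (z, 0) - J (w, 0) = 0 := by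
        intro x y z w h
        rw [← map_sub, ← map_add, ← map_sub]
        simp only [Prod.mk_sub_mk, Prod.mk_add_mk, h, sub_zero, add_zero]
        exact map_zero J
      have h := this _ _ _ _ (hG a b hab i j p q)
      simp only [Matrix.map_apply, G', ← map_mul, Prod.mk_mul_mk, mul_zero]
      exact h) i j
  exact key

end Corners

section ShiftParam

variable {S : Type*} [CommRing S] [Algebra ℂ S]

/-- If `t = h / u` then `shiftParam c t = h / (u + c h)`. -/
noncomputable def shiftParam (c : ℂ) (t : S) : S := t * Ring.inverse (1 + c • t)

theorem shiftParam_mul {t : S} (ht : IsNilpotent t) (c : ℂ) : shiftParam c t * (1 + c • t) = t := by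
  rw [shiftParam, mul_assoc, Ring.inverse_mul_cancel _ (ht.smul c).isUnit_one_add, mul_one]

theorem eq_shiftParam {t t' : S} (ht : IsNilpotent t) {c : ℂ} (h : t' * (1 + c • t) = t) :
    t' = shiftParam c t :=
  (ht.smul c).isUnit_one_add.mul_right_cancel (h.trans (shiftParam_mul ht c).symm)

theorem isNilpotent_shiftParam {t : S} (ht : IsNilpotent t) (c : ℂ) : IsNilpotent (shiftParam c t) :=
  Commute.isNilpotent_mul_right (Commute.all _ _) ht

theorem shiftParam_shiftParam {t : S} (ht : IsNilpotent t) (c d : ℂ) :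
    shiftParam d (shiftParam c t) = shiftParam (c + d) t := by
  refine eq_shiftParam ht ?_
  have h1 := shiftParam_mul ht c
  have h2 := shiftParam_mul (isNilpotent_shiftParam ht c) d
  calc shiftParam d (shiftParam c t) * (1 + (c + d) • t)
      = shiftParam d (shiftParam c t) * (1 + c • t + d • (shiftParam c t * (1 + c • t))) := by
        rw [h1, add_smul, add_assoc]
    _ = shiftParam d (shiftParam c t) * (1 + d • shiftParam c t) * (1 + c • t) := by
        simp only [Algebra.smul_def]; ring
    _ = t := by rw [h2, h1]

theorem nilEval_complexShift' {t : S} (ht : IsNilpotent t) (c : ℂ) (φ : ℕ → ℂ) :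
    nilEval (complexShift c φ) t = nilEval φ (shiftParam c t) :=
  nilEval_complexShift c φ t _ ht (Ring.inverse_mul_cancel _ (ht.smul c).isUnit_one_add)

theorem nilEval_normCoeff_shiftParam {n : ℕ} (hn : 1 ≤ n) {t : S} (ht : IsNilpotent t) :
    nilEval (normCoeff n) (shiftParam (-n) t) = (1 - t ^ 2) * nilEval (normCoeff n) t := by
  refine nilEval_normCoeff_functional n hn t _ ht ?_
  have : (1 : S) - n * t = 1 + (-(n : ℂ)) • t := by
    rw [neg_smul, ← sub_eq_add_neg, Nat.cast_smul_eq_nsmul, nsmul_eq_mul]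
  rw [this]
  exact Ring.inverse_mul_cancel _ (ht.smul _).isUnit_one_add

/-- The relation between the parameters of neighbouring factors that the fusion of `R`-matrices
requires, in its two forms. -/
theorem shiftParam_step {t : S} (ht : IsNilpotent t) (c : ℂ) :
    shiftParam (c + 1) t * (1 + shiftParam c t) = shiftParam c t := by
  rw [← shiftParam_shiftParam ht]
  have := shiftParam_mul (isNilpotent_shiftParam ht c) 1
  rwa [one_smul] at this

theorem shiftParam_step' {t : S} (ht : IsNilpotent t) (c : ℂ) :
    shiftParam c t * (1 - shiftParam (c + 1) t) = shiftParam (c + 1) t := by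
  have h1 : shiftParam (-1) (shiftParam (c + 1) t) = shiftParam c t := by
    rw [shiftParam_shiftParam ht, add_neg_cancel_right]
  have := shiftParam_mul (isNilpotent_shiftParam ht (c + 1)) (-1)
  rwa [h1, neg_smul, one_smul, ← sub_eq_add_neg] at this

theorem shiftParam_nat {t : S} (ht : IsNilpotent t) (c : ℂ) (n : ℕ) :
    shiftParam (c + n) t * (1 + n * shiftParam c t) = shiftParam c t := by
  rw [← shiftParam_shiftParam ht]
  have := shiftParam_mul (isNilpotent_shiftParam ht c) n
  rwa [Nat.cast_smul_eq_nsmul, nsmul_eq_mul] at this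

/-- If `ξ' = ξ / (1 + c h ξ)` and `ε h = ε²`, then `ε ξ'` is the shift of `ε ξ`. -/
theorem eq_shiftParam_of_mul {ε h ξ ξ' : S} (hε : IsNilpotent ε) (hεh : ε * ε = h * ε) (c : ℂ)
    (hξ : ξ' * (1 + c • (h * ξ)) = ξ) : ε * ξ' = shiftParam c (ε * ξ) := by
  refine eq_shiftParam (Commute.isNilpotent_mul_right (Commute.all _ _) hε) ?_
  calc ε * ξ' * (1 + c • (ε * ξ)) = ξ' * (ε + c • (ε * ε * ξ)) := by
        simp only [Algebra.smul_def]; ring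
    _ = ε * (ξ' * (1 + c • (h * ξ))) := by rw [hεh]; simp only [Algebra.smul_def]; ring
    _ = _ := by rw [hξ]

theorem isUnit_one_sub_sq {S : Type*} [CommRing S] {t : S} (ht : IsNilpotent t) : IsUnit (1 - t ^ 2) :=
  (ht.pow_succ 1).isUnit_one_sub

end ShiftParam

end YangianDouble

/-! ### The exchange theorem for the trace -/

namespace YangianDouble

open Finset

section Exchange

variable {n k : ℕ} {S T T₁ T₂ : Type*} [CommRing S] [Algebra ℂ S] [Ring T] [Algebra S T] [Ring T₁]
  [Algebra S T₁] [Ring T₂] [Algebra S T₂] [Algebra ℚ T]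

/-- The exchange theorem for a matrix `A` of type `L^+`. Here `t₀ = ε / (v - u)`, where `v` is the argument
of `A`, and the parameters `t a` and `t' a` are those of `R(v - u_a + n h / 2)` and `R(v - u_a - n h / 2)`,
where `u_a = u + a h`. They differ by the shift `n h`, so the functional equation of the normalizing
series relates the two `R`-matrices. -/
theorem commute_trace_plus (hn : 1 ≤ n) (J : T₂ × T₁ →ₐ[S] T)
    (A₂ : Matrix (Fin n) (Fin n) T₂) (A₁ : Matrix (Fin n) (Fin n) T₁)
    (M : Fin k → Matrix (Fin n) (Fin n) T₁) (L G : Fin k → Matrix (Fin n) (Fin n) T₂) (ι : T)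
    (t₀ : S) (ht₀ : IsNilpotent t₀) (t t' : Fin k → S)
    (ht : ∀ a, t a = shiftParam ((n : ℂ) / 2 - (a : ℕ)) t₀)
    (ht' : ∀ a, t' a = shiftParam (-((n : ℂ) / 2) - (a : ℕ)) t₀)
    (hι : ∀ i j, Commute ι (J (A₂ i j, A₁ i j)))
    (h1 : ∀ a i j p q, algebraMap S T₁ (nilEval (normCoeff n) (t a)) * (A₁ p q * M a i j) +
        algebraMap S T₁ (nilEval (normCoeff n) (t a) * t a) * (A₁ i q * M a p j) =
      algebraMap S T₁ (nilEval (normCoeff n) (t' a)) * (M a i j * A₁ p q) +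
        algebraMap S T₁ (nilEval (normCoeff n) (t' a) * t' a) * (M a i q * A₁ p j))
    (h2 : ∀ a i j p q, (L a i j * A₂ p q - A₂ p q * L a i j) =
      algebraMap S T₂ (t' a) * (L a p j * A₂ i q - A₂ p j * L a i q))
    (hLG : ∀ a, L a * G a = 1) (hGL : ∀ a, G a * L a = 1)
    (hM : ∀ a b : Fin k, (b : ℕ) = a + 1 → Fused (M a) (M b))
    (hG : ∀ a b : Fin k, (b : ℕ) = a + 1 → Fused (G b) (G a)) (i j : Fin n) :
    Commute (J (A₂ i j, A₁ i j)) (Matrix.trace (signSum n k T *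
      (((List.finRange k).map fun a => inCopy a ((M a).map fun x => J (0, x))).prod *
        Matrix.scalar (Fin k → Fin n) ι *
        ((List.finRange k).reverse.map fun a => inCopy a ((G a).map fun x => J (x, 0))).prod))) := by
  set g : S → S := nilEval (normCoeff n) with hg
  have nt : ∀ a, IsNilpotent (t a) := fun a => ht a ▸ isNilpotent_shiftParam ht₀ _
  have nt' : ∀ a, IsNilpotent (t' a) := fun a => ht' a ▸ isNilpotent_shiftParam ht₀ _
  have tt' : ∀ a, t' a = shiftParam (-n) (t a) := fun a => by
    rw [ht, ht', shiftParam_shiftParam ht₀]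
    congr 1
    ring
  have gg : ∀ a, g (t' a) = (1 - t a ^ 2) * g (t a) := fun a => by
    rw [tt', hg]
    exact nilEval_normCoeff_shiftParam hn (nt a)
  have ug' : ∀ a, IsUnit (g (t' a)) := fun a => isUnit_nilEval_normCoeff n _ (nt' a)
  have step : ∀ (c : ℂ) (a b : Fin k), (b : ℕ) = a + 1 → c - ((a : ℕ) : ℂ) = c - ((b : ℕ) : ℂ) + 1 := by
    intro c a b hab
    rw [hab]
    push_cast
    ring
  refine commute_trace_of_corners J A₂ A₁ M G ι (fun a => Ring.inverse (g (t' a))) (fun a => g (t' a))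
    (fun a => -t a) t' (fun a => g (t' a)) t' (fun a => Ring.inverse_mul_cancel _ (ug' a))
    (fun a => ?_) (fun a b hab => ?_) (fun a b hab => ?_) hι (fun a => ?_) (fun a => ?_) hM hG i j
  · have := shiftParam_mul (nt a) (-n)
    rw [← tt', neg_smul, Nat.cast_smul_eq_nsmul, nsmul_eq_mul] at this
    linear_combination this
  · have := shiftParam_step ht₀ ((n : ℂ) / 2 - ((b : ℕ) : ℂ))
    rw [← step _ a b hab, ← ht, ← ht] at this
    linear_combination -this
  · have := shiftParam_step' ht₀ (-((n : ℂ) / 2) - ((b : ℕ) : ℂ))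
    rwa [← step _ a b hab, ← ht', ← ht'] at this
  · refine inner_mul_outer_of_inner_outer (g₁ := g (t a)) (h1 a) ?_
    rw [mul_right_comm, mul_comm (g (t a)), ← gg, Ring.mul_inverse_cancel _ (ug' a)]
  · set r := Ring.inverse (g (t' a) * (1 - t' a ^ 2)) with hr
    have hr1 : g (t' a) * r * (1 - t' a ^ 2) = 1 := by
      rw [mul_right_comm, hr, Ring.mul_inverse_cancel _ ((ug' a).mul (isUnit_one_sub_sq (nt' a)))]
    have e : rTwoMap T₂ n r (-t' a) * outer (L a) * inner A₂ =
        inner A₂ * outer (L a) * rTwoMap T₂ n r (-t' a) := by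
      refine outer_mul_inner_of_outer_inner fun i j p q => ?_
      have := h2 a i j p q
      rw [mul_neg, map_neg, map_mul, neg_mul, neg_mul, mul_assoc, mul_assoc, ← sub_eq_add_neg,
        ← sub_eq_add_neg, ← mul_sub, ← mul_sub]
      congr 1
      rw [mul_sub] at this
      rw [← sub_eq_zero] at this ⊢
      rw [← this]
      abel
    have hb : rTwoMap T₂ n r (-t' a) * rTwoMap T₂ n (g (t' a)) (t' a) = 1 := by
      have := rTwoMap_mul_rTwoMap (n := n) (T := T₂) (s := r) (s' := g (t' a)) (θ := -t' a)
        (by rw [neg_sq, mul_comm r, hr1])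
      rwa [neg_neg] at this
    exact mul_inverse_exchange e hb (rTwoMap_mul_rTwoMap hr1) (outer_mul_outer (hGL a))
      (outer_mul_outer (hLG a))

/-- The exchange theorem for a matrix `A` of type `L^-`. Here `t₀ = ε / (u - v)`, where `v` is the argument
of `A`, and the parameters `t a` and `t' a` are those of `R(u_a - v)` and `R(u_a - v + n h)`, where
`u_a = u + a h`. -/
theorem commute_trace_minus (hn : 1 ≤ n) (J : T₂ × T₁ →ₐ[S] T)
    (A₂ : Matrix (Fin n) (Fin n) T₂) (A₁ : Matrix (Fin n) (Fin n) T₁)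
    (M : Fin k → Matrix (Fin n) (Fin n) T₁) (L G : Fin k → Matrix (Fin n) (Fin n) T₂) (ι : T)
    (t₀ : S) (ht₀ : IsNilpotent t₀) (t t' : Fin k → S)
    (ht : ∀ a, t a = shiftParam ((a : ℕ) : ℂ) t₀)
    (ht' : ∀ a, t' a = shiftParam (((a : ℕ) : ℂ) + n) t₀)
    (hι : ∀ i j, Commute ι (J (A₂ i j, A₁ i j)))
    (h1 : ∀ a i j p q, (M a i j * A₁ p q - A₁ p q * M a i j) +
      algebraMap S T₁ (t a) * (M a p j * A₁ i q - A₁ p j * M a i q) = 0)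
    (h2 : ∀ a i j p q, algebraMap S T₂ (nilEval (normCoeff n) (t' a)) * (L a i j * A₂ p q) +
        algebraMap S T₂ (nilEval (normCoeff n) (t' a) * t' a) * (L a p j * A₂ i q) =
      algebraMap S T₂ (nilEval (normCoeff n) (t a)) * (A₂ p q * L a i j) +
        algebraMap S T₂ (nilEval (normCoeff n) (t a) * t a) * (A₂ p j * L a i q))
    (hLG : ∀ a, L a * G a = 1) (hGL : ∀ a, G a * L a = 1)
    (hM : ∀ a b : Fin k, (b : ℕ) = a + 1 → Fused (M a) (M b))
    (hG : ∀ a b : Fin k, (b : ℕ) = a + 1 → Fused (G b) (G a)) (i j : Fin n) :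
    Commute (J (A₂ i j, A₁ i j)) (Matrix.trace (signSum n k T *
      (((List.finRange k).map fun a => inCopy a ((M a).map fun x => J (0, x))).prod *
        Matrix.scalar (Fin k → Fin n) ι *
        ((List.finRange k).reverse.map fun a => inCopy a ((G a).map fun x => J (x, 0))).prod))) := by
  set g : S → S := nilEval (normCoeff n) with hg
  have nt : ∀ a, IsNilpotent (t a) := fun a => ht a ▸ isNilpotent_shiftParam ht₀ _
  have nt' : ∀ a, IsNilpotent (t' a) := fun a => ht' a ▸ isNilpotent_shiftParam ht₀ _
  have tt' : ∀ a, t a = shiftParam (-n) (t' a) := fun a => by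
    rw [ht, ht', shiftParam_shiftParam ht₀, add_neg_cancel_right]
  have gg : ∀ a, g (t a) = (1 - t' a ^ 2) * g (t' a) := fun a => by
    rw [tt', hg]
    exact nilEval_normCoeff_shiftParam hn (nt' a)
  have ug : ∀ a, IsUnit (g (t a)) := fun a => isUnit_nilEval_normCoeff n _ (nt a)
  refine commute_trace_of_corners J A₂ A₁ M G ι (fun a => g (t a)) (fun a => Ring.inverse (g (t a)))
    t (fun a => -t' a) (fun a => Ring.inverse (g (t a) * (1 - t a ^ 2))) (fun a => -t a)
    (fun a => Ring.mul_inverse_cancel _ (ug a))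
    (fun a => ?_) (fun a b hab => ?_) (fun a b hab => ?_) hι (fun a => ?_) (fun a => ?_) hM hG i j
  · have := shiftParam_nat ht₀ ((a : ℕ) : ℂ) n
    rw [← ht, ← ht'] at this
    linear_combination -this
  · have := shiftParam_step' ht₀ ((a : ℕ) : ℂ)
    rwa [← Nat.cast_succ, ← Nat.add_one, ← hab, ← ht, ← ht] at this
  · have := shiftParam_step ht₀ (((a : ℕ) : ℂ) + n)
    rw [add_right_comm, ← Nat.cast_succ, ← Nat.add_one, ← hab, ← ht', ← ht'] at this
    linear_combination -this
  · refine inner_mul_outer_of_outer_inner ?_ (by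
      rw [mul_right_comm, Ring.mul_inverse_cancel _ ((ug a).mul (isUnit_one_sub_sq (nt a)))])
    refine outer_mul_inner_of_outer_inner fun i j p q => ?_
    have := h1 a i j p q
    rw [map_mul, mul_assoc, mul_assoc, ← mul_add, ← mul_add]
    congr 1
    rw [mul_sub] at this
    rw [← sub_eq_zero, ← this]
    abel
  · have hb : rTwoMap T₂ n (g (t a)) (t a) *
        rTwoMap T₂ n (Ring.inverse (g (t a) * (1 - t a ^ 2))) (-t a) = 1 :=
      rTwoMap_mul_rTwoMap (by
        rw [mul_right_comm, Ring.mul_inverse_cancel _ ((ug a).mul (isUnit_one_sub_sq (nt a)))])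
    have hγ : rTwoMap T₂ n (Ring.inverse (g (t a))) (-t' a) * rTwoMap T₂ n (g (t' a)) (t' a) = 1 := by
      have := rTwoMap_mul_rTwoMap (n := n) (T := T₂) (s := Ring.inverse (g (t a))) (s' := g (t' a))
        (θ := -t' a) (by
          rw [neg_sq, mul_assoc, mul_comm (g (t' a)), ← gg, Ring.inverse_mul_cancel _ (ug a)])
      rwa [neg_neg] at this
    exact mul_inverse_exchange (outer_mul_inner_of_outer_inner (h2 a)) hb hγ (outer_mul_outer (hGL a))
      (outer_mul_outer (hLG a))

end Exchange

end YangianDouble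

/-! ### Laurent series of operators and of vectors -/

namespace YangianDouble

open Finset
open scoped TensorProduct

section LaurentModule

variable (K V : Type*) [CommRing K] [AddCommGroup V] [Module K V]

/-- Laurent series in `u` with operators as coefficients. -/
abbrev OpSeries : Type _ := HahnSeries ℤ (Module.End K V)

/-- Laurent series in `u` with coefficients in `V`. -/
def VecSeries : Type _ := HahnModule ℤ (Module.End K V) V

noncomputable instance : AddCommGroup (VecSeries K V) :=
  inferInstanceAs (AddCommGroup (HahnModule ℤ (Module.End K V) V))

noncomputable instance : Module (OpSeries K V) (VecSeries K V) :=
  inferInstanceAs (Module (HahnSeries ℤ (Module.End K V)) (HahnModule ℤ (Module.End K V) V))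

/-- A Laurent polynomial in `u` as a Laurent series of scalar operators. -/
noncomputable def laurentToOp : LaurentPolynomial K →ₐ[K] OpSeries K V :=
  AddMonoidAlgebra.lift K (OpSeries K V) ℤ
    { toFun := fun m => HahnSeries.single m.toAdd 1
      map_one' := rfl
      map_mul' := fun a b => by rw [HahnSeries.single_mul_single, mul_one]; rfl }

theorem laurentToOp_T (m : ℤ) :
    laurentToOp K V (LaurentPolynomial.T m) = HahnSeries.single m 1 := by
  rw [laurentToOp, LaurentPolynomial.T, AddMonoidAlgebra.lift_single]
  simp

theorem laurentToOp_commute (p : LaurentPolynomial K) (x : OpSeries K V) :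
    laurentToOp K V p * x = x * laurentToOp K V p := by
  have hT : ∀ m : ℤ, HahnSeries.single m 1 * x = x * HahnSeries.single m 1 := by
    intro m
    ext a
    rw [HahnSeries.coeff_single_mul, HahnSeries.coeff_mul_single, one_mul, mul_one]
  have h : ∀ (a : K) (m : ℤ), laurentToOp K V (LaurentPolynomial.C a * LaurentPolynomial.T m) * x =
      x * laurentToOp K V (LaurentPolynomial.C a * LaurentPolynomial.T m) := by
    intro a m
    rw [map_mul, laurentToOp_T, LaurentPolynomial.C_eq_algebraMap, AlgHom.commutes, mul_assoc, hT,
      ← mul_assoc, Algebra.commutes, mul_assoc]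
  induction p using LaurentPolynomial.induction_on with
  | h_C a => simpa using h a 0
  | h_add hp hq => rw [map_add, add_mul, mul_add, hp, hq]
  | h_C_mul_T n a _ => exact h a _
  | h_C_mul_T_Z n a _ => exact h a _

noncomputable instance : Algebra (LaurentPolynomial K) (OpSeries K V) :=
  (laurentToOp K V).toRingHom.toAlgebra' (laurentToOp_commute K V)

noncomputable instance : Module (LaurentPolynomial K) (VecSeries K V) :=
  Module.compHom _ (algebraMap (LaurentPolynomial K) (OpSeries K V))

theorem laurent_smul (p : LaurentPolynomial K) (x : VecSeries K V) : p • x = laurentToOp K V p • x := rfl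

instance : IsScalarTower (LaurentPolynomial K) (OpSeries K V) (VecSeries K V) where
  smul_assoc p x y := by rw [laurent_smul, Algebra.smul_def, mul_smul]; rfl

instance : SMulCommClass (OpSeries K V) (LaurentPolynomial K) (VecSeries K V) :=
  IsScalarTower.to_smulCommClass'

noncomputable instance : Module K (VecSeries K V) :=
  Module.compHom _ (algebraMap K (LaurentPolynomial K))

instance : IsScalarTower K (LaurentPolynomial K) (VecSeries K V) where
  smul_assoc a p y := by rw [Algebra.smul_def, mul_smul]; rfl

variable {K V}

/-- The coefficient of `u^N`. -/
noncomputable def vecCoeff (N : ℤ) : VecSeries K V →+ V where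
  toFun x := ((HahnModule.of (Module.End K V)).symm x).coeff N
  map_zero' := rfl
  map_add' _ _ := rfl

variable (K) in
/-- The series `v u^m`. -/
noncomputable def vecSingle (m : ℤ) (v : V) : VecSeries K V :=
  HahnModule.of (Module.End K V) (HahnSeries.single m v)

theorem vecCoeff_single (N m : ℤ) (v : V) :
    vecCoeff N (vecSingle K m v) = if N = m then v else 0 := by
  change (HahnSeries.single m v).coeff N = _
  rw [HahnSeries.coeff_single]
  congr

theorem vecCoeff_single_smul (m : ℤ) (b : Module.End K V) (x : VecSeries K V) (N : ℤ) :
    vecCoeff N ((HahnSeries.single m b : OpSeries K V) • x) = b (vecCoeff (N - m) x) := by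
  have := HahnModule.coeff_single_smul_vadd (r := b) (x := (x : HahnModule ℤ (Module.End K V) V))
    (a := N - m) (b := m)
  rw [vadd_eq_add, add_sub_cancel] at this
  exact this

theorem vecSeries_ext {x y : VecSeries K V} (h : ∀ N, vecCoeff N x = vecCoeff N y) : x = y :=
  HahnModule.ext _ _ (funext h)

theorem single_smul_vecSingle (m m' : ℤ) (b : Module.End K V) (v : V) :
    (HahnSeries.single m b : OpSeries K V) • vecSingle K m' v = vecSingle K (m + m') (b v) := by
  refine vecSeries_ext fun N => ?_
  rw [vecCoeff_single_smul, vecCoeff_single, vecCoeff_single]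
  by_cases h : N = m + m'
  · rw [if_pos h, if_pos (by omega)]
  · rw [if_neg h, if_neg (by omega), map_zero]

/-- Coefficients of the product of an operator series in `u` and a vector `v u^t`. -/
theorem vecCoeff_ofPowerSeries_smul (φ : PowerSeries (Module.End K V)) (N : ℤ) (t : ℤ) (v : V) :
    vecCoeff N (HahnSeries.ofPowerSeries ℤ (Module.End K V) φ • vecSingle K t v) =
      if t ≤ N then PowerSeries.coeff (N - t).toNat φ v else 0 := by
  set x := HahnSeries.ofPowerSeries ℤ (Module.End K V) φ with hx
  have h1 : vecCoeff N (x • vecSingle K t v) = x.coeff (N - t) v := by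
    have e := HahnModule.coeff_smul x (vecSingle K t v : HahnModule ℤ (Module.End K V) V) N
    refine e.trans ?_
    have hc : ∀ m, ((HahnModule.of (Module.End K V)).symm
        (vecSingle K t v : HahnModule ℤ (Module.End K V) V)).coeff m = if m = t then v else 0 :=
      fun m => vecCoeff_single (K := K) m t v
    rw [sum_eq_single (N - t, t)]
    · rw [hc, if_pos rfl]
      rfl
    · rintro ⟨p, q⟩ hp hne
      rw [mem_vaddAntidiagonal] at hp
      rw [hc, if_neg, smul_zero]
      rintro rfl
      refine hne (Prod.ext ?_ rfl)
      have := hp.2.2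
      simp only [vadd_eq_add] at this ⊢
      omega
    · intro hn
      rw [mem_vaddAntidiagonal] at hn
      by_contra h0
      refine hn ⟨fun h => h0 ?_, fun h => h0 ?_, by simp⟩
      · rw [h, zero_smul]
      · rw [h, smul_zero]
  rw [h1]
  split_ifs with h
  · obtain ⟨m, hm⟩ := Int.eq_ofNat_of_zero_le (sub_nonneg.2 h)
    rw [hm, Int.toNat_natCast, hx]
    exact LinearMap.congr_fun (HahnSeries.ofPowerSeries_apply_coeff φ m) v
  · rw [hx, HahnSeries.ofPowerSeries_apply, HahnSeries.embDomain_of_notMem_range, LinearMap.zero_apply]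
    rintro ⟨m, hm⟩
    have : (m : ℤ) = N - t := hm
    omega

variable (V) in
/-- The inclusion of Laurent polynomials into Laurent series. -/
noncomputable def laurentIncl : LaurentPolynomial K ⊗[K] V →ₗ[LaurentPolynomial K] VecSeries K V :=
  LinearMap.liftBaseChange (LaurentPolynomial K)
    { toFun := vecSingle K 0
      map_add' := fun v w => by
        refine vecSeries_ext fun N => ?_
        rw [map_add, vecCoeff_single, vecCoeff_single, vecCoeff_single]
        split_ifs <;> simp
      map_smul' := fun a v => by
        rw [RingHom.id_apply]
        have : a • vecSingle K 0 v = algebraMap K (OpSeries K V) a • vecSingle K 0 v := by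
          rw [← (laurentToOp K V).commutes]; rfl
        rw [this, HahnSeries.algebraMap_apply, HahnSeries.C_apply, single_smul_vecSingle, add_zero,
          Module.algebraMap_end_apply] }

theorem laurentIncl_tmul (p : LaurentPolynomial K) (v : V) :
    laurentIncl V (p ⊗ₜ v) = p • vecSingle K 0 v := LinearMap.liftBaseChange_tmul _ _ _ _

theorem laurentIncl_T (m : ℤ) (v : V) :
    laurentIncl V (LaurentPolynomial.T m ⊗ₜ v) = vecSingle K m v := by
  rw [laurentIncl_tmul, laurent_smul, laurentToOp_T, single_smul_vecSingle, add_zero,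
    Module.End.one_apply]

variable (K V) in
/-- The sum of the modules on which series in `u^{-1}`, respectively in `u`, act. -/
abbrev TwoSided : Type _ := (LaurentPolynomial K ⊗[K] V) × VecSeries K V

variable (K V) in
/-- The action of pairs of operators on the two summands. -/
noncomputable def twoSidedAction :
    Module.End (LaurentPolynomial K) (LaurentPolynomial K ⊗[K] V) × OpSeries K V
      →ₐ[LaurentPolynomial K] Module.End (LaurentPolynomial K) (TwoSided K V) :=
  (LinearMap.prodMapAlgHom (LaurentPolynomial K) (LaurentPolynomial K ⊗[K] V) (VecSeries K V)).comp
    (AlgHom.prodMap (AlgHom.id _ _) (Algebra.lsmul (LaurentPolynomial K) (LaurentPolynomial K)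
      (VecSeries K V)))

theorem twoSidedAction_apply (f : Module.End (LaurentPolynomial K) (LaurentPolynomial K ⊗[K] V))
    (x : OpSeries K V) (w : TwoSided K V) : twoSidedAction K V (f, x) w = (f w.1, x • w.2) := rfl

variable (K V) in
/-- The inclusion of the first summand into the second. -/
noncomputable def twoSidedIncl : Module.End (LaurentPolynomial K) (TwoSided K V) :=
  LinearMap.inr _ _ _ ∘ₗ laurentIncl V ∘ₗ LinearMap.fst _ _ _

theorem twoSidedIncl_apply (w : TwoSided K V) : twoSidedIncl K V w = (0, laurentIncl V w.1) := rfl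

theorem commute_twoSidedIncl (b : Module.End K V) : Commute (twoSidedIncl K V)
    (twoSidedAction K V (b.baseChange (LaurentPolynomial K), HahnSeries.C b)) := by
  have h : laurentIncl V ∘ₗ b.baseChange (LaurentPolynomial K) =
      Algebra.lsmul (LaurentPolynomial K) (LaurentPolynomial K) (VecSeries K V)
        (HahnSeries.C b : OpSeries K V) ∘ₗ laurentIncl V := by
    refine end_ext fun w => ?_
    rw [LinearMap.comp_apply, LinearMap.comp_apply, LinearMap.baseChange_tmul, Algebra.lsmul_coe,
      laurentIncl_tmul, laurentIncl_tmul, one_smul, one_smul, HahnSeries.C_apply]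
    exact ((single_smul_vecSingle 0 0 b w).trans (by rw [add_zero])).symm
  refine LinearMap.ext fun w => ?_
  rw [Module.End.mul_apply, Module.End.mul_apply, twoSidedIncl_apply, twoSidedIncl_apply,
    twoSidedAction_apply, twoSidedAction_apply, map_zero]
  exact Prod.ext rfl (LinearMap.congr_fun h w.1)

end LaurentModule

end YangianDouble

/-! ### Exchange relations on the auxiliary modules -/

namespace YangianDouble

open Finset
open scoped TensorProduct

section Evaluation

variable {n : ℕ} {K V : Type*} [CommRing K] [AddCommGroup V] [Module K V]

theorem Fused.map {T T' : Type*} [Ring T] [Ring T'] (f : T →+* T') {X Y : Matrix (Fin n) (Fin n) T}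
    (h : Fused X Y) : Fused (X.map f) (Y.map f) := by
  intro i j p q
  simp only [Matrix.map_apply, ← map_mul, ← map_sub, ← map_add]
  rw [h, map_zero]

variable (V) in
/-- Substitution of `u + a` in a series of operators. -/
noncomputable def evalAt (a : K) (ha : IsNilpotent a) :
    PowerSeries (Module.End K V) →+* OpSeries K V :=
  (HahnSeries.ofPowerSeries ℤ _).comp (shiftHom (Module.End K V) a ha)

variable {a : K} (ha : IsNilpotent a)

theorem evalAt_C (b : Module.End K V) : evalAt V a ha (PowerSeries.C b) = HahnSeries.C b := by
  rw [evalAt, RingHom.comp_apply, shiftHom_C, HahnSeries.ofPowerSeries_C]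

theorem evalAt_polySeries (p : Polynomial K) : evalAt V a ha (polySeries _ p) =
    algebraMap (LaurentPolynomial K) (OpSeries K V)
      (Polynomial.aeval (LaurentPolynomial.T 1 + algebraMap K (LaurentPolynomial K) a) p) := by
  have hK : ∀ b : K, HahnSeries.C (algebraMap K (Module.End K V) b) =
      algebraMap (LaurentPolynomial K) (OpSeries K V) (algebraMap K _ b) := fun b =>
    ((laurentToOp K V).commutes b).symm
  have hX : evalAt V a ha PowerSeries.X = algebraMap (LaurentPolynomial K) (OpSeries K V)
      (LaurentPolynomial.T 1 + algebraMap K (LaurentPolynomial K) a) := by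
    rw [evalAt, RingHom.comp_apply, shiftHom_X, map_add, map_add, HahnSeries.ofPowerSeries_C, hK,
      HahnSeries.ofPowerSeries_X]
    congr 1
    exact (laurentToOp_T K V 1).symm
  induction p using Polynomial.induction_on' with
  | add p q hp hq => rw [map_add, map_add, map_add, map_add, hp, hq]
  | monomial m b =>
    rw [polySeries, Polynomial.aeval_monomial, Polynomial.aeval_monomial, map_mul, map_mul, map_pow,
      map_pow, hX, PowerSeries.algebraMap_apply, evalAt_C, hK]

variable [Algebra ℂ K] {h ε z : K} {R : ℕ} {l : ℤ → Matrix (Fin n) (Fin n) (Module.End K V)}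

section General

variable {S : Type*} [CommRing S] [Algebra ℂ S] [Algebra K S] [IsScalarTower ℂ K S]

theorem aeval_nilEval (x : S) (φ : ℕ → ℂ) {t : Polynomial K} (ht : IsNilpotent t) :
    Polynomial.aeval x (nilEval φ t) = nilEval φ (Polynomial.aeval x t) :=
  map_nilEval ((Polynomial.aeval x : Polynomial K →ₐ[K] S).restrictScalars ℂ) φ ht

theorem aeval_complexShift (x : S) (c : ℂ) {t : Polynomial K} (ht : IsNilpotent t) :
    Polynomial.aeval x (nilEval (complexShift c (normCoeff n)) t) =
        nilEval (normCoeff n) (shiftParam c (Polynomial.aeval x t)) ∧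
      Polynomial.aeval x (nilEval (complexShift c (delay (normCoeff n))) t) =
        nilEval (normCoeff n) (shiftParam c (Polynomial.aeval x t)) *
          shiftParam c (Polynomial.aeval x t) := by
  have ht' : IsNilpotent (Polynomial.aeval x t) := ht.map _
  rw [aeval_nilEval x _ ht, aeval_nilEval x _ ht, nilEval_complexShift' ht', nilEval_complexShift' ht',
    nilEval_delay _ _ (isNilpotent_shiftParam ht' c), mul_comm (shiftParam _ _)]
  exact ⟨rfl, rfl⟩

end General

/-- The geometric series of a nilpotent multiple of the variable is a polynomial. -/
theorem exists_inverse_one_sub {K : Type*} [CommRing K] {z : K} {R : ℕ} (hz : z ^ R = 0) :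
    ∃ r : Polynomial K, r * (1 - Polynomial.C z * Polynomial.X) = 1 :=
  ⟨Ring.inverse _, Ring.inverse_mul_cancel _ (IsNilpotent.isUnit_one_sub ⟨R, by
    rw [mul_pow, ← map_pow, hz, map_zero, zero_mul]⟩)⟩

/-- The exchange relation of `L^-(u + a)` with the operators `L^+` in which `v^{-1} = z`. -/
theorem mixed_plus_evalAt (H : Relations n h ε l) (hε : IsNilpotent ε) (hz : z ^ R = 0)
    (ρ t : LaurentPolynomial K)
    (hρ : ρ * (1 - algebraMap K _ z * (LaurentPolynomial.T 1 + algebraMap K _ a)) = 1)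
    (ht : t = algebraMap K _ ε * (algebraMap K _ z * ρ)) (i j k q : Fin n) :
    algebraMap _ (OpSeries K V) (nilEval (normCoeff n) (shiftParam ((n : ℂ) / 2) t)) *
        (HahnSeries.C (plusValue ε z R l i j) * evalAt V a ha (minusSeries h l k q)) +
      algebraMap _ (OpSeries K V) (nilEval (normCoeff n) (shiftParam ((n : ℂ) / 2) t) *
        shiftParam ((n : ℂ) / 2) t) *
        (HahnSeries.C (plusValue ε z R l k j) * evalAt V a ha (minusSeries h l i q)) =
    algebraMap _ (OpSeries K V) (nilEval (normCoeff n) (shiftParam (-((n : ℂ) / 2)) t)) *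
        (evalAt V a ha (minusSeries h l k q) * HahnSeries.C (plusValue ε z R l i j)) +
      algebraMap _ (OpSeries K V) (nilEval (normCoeff n) (shiftParam (-((n : ℂ) / 2)) t) *
        shiftParam (-((n : ℂ) / 2)) t) *
        (evalAt V a ha (minusSeries h l k j) * HahnSeries.C (plusValue ε z R l i q)) := by
  obtain ⟨r, hr⟩ := exists_inverse_one_sub hz
  set x : LaurentPolynomial K := LaurentPolynomial.T 1 + algebraMap K _ a with hx
  have hρr : Polynomial.aeval x r = ρ := by
    have e := congrArg (Polynomial.aeval x) hr
    rw [map_mul, map_sub, map_one, map_mul, Polynomial.aeval_C, Polynomial.aeval_X] at e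
    calc Polynomial.aeval x r = Polynomial.aeval x r * (ρ * (1 - algebraMap K _ z * x)) := by
          rw [hρ, mul_one]
      _ = ρ * (Polynomial.aeval x r * (1 - algebraMap K _ z * x)) := by ring
      _ = ρ := by rw [e, mul_one]
  have hp : IsNilpotent (Polynomial.C (ε * z) * r) := by
    rw [map_mul, mul_assoc]
    exact Commute.isNilpotent_mul_right (Commute.all _ _) (hε.map Polynomial.C)
  have hev : Polynomial.aeval x (Polynomial.C (ε * z) * r) = t := by
    rw [map_mul, Polynomial.aeval_C, hρr, ht, map_mul, mul_assoc]
  have hc := fun c φ => coeff_nilEval_plus (ε := ε) hz c φ r hr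
  generalize Polynomial.C (ε * z) * r = p at hp hev hc
  have main := congrArg (evalAt V a ha) (mixed_plus_series H hz _ rfl _ _ _ _
    (hc _ _) (hc _ _) (hc _ _) (hc _ _) i j k q)
  simp only [map_add, map_mul, evalAt_polySeries, evalAt_C, ← hx] at main
  rw [(aeval_complexShift x _ hp).1, (aeval_complexShift x _ hp).1, (aeval_complexShift x _ hp).2,
    (aeval_complexShift x _ hp).2, hev] at main
  exact main

/-- The exchange relation of `L^-(u + a)` with the operators `L^-` in which `v = z`. -/
theorem same_minus_evalAt (H : Relations n h ε l) (hz : z ^ R = 0)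
    (ξ t : LaurentPolynomial K)
    (hξ : ξ * (LaurentPolynomial.T 1 + algebraMap K _ a - algebraMap K _ z) = 1)
    (ht : t = algebraMap K _ ε * ξ) (i j k q : Fin n) :
    (evalAt V a ha (minusSeries h l i j) * HahnSeries.C (minusValue ε z R l k q) -
        HahnSeries.C (minusValue ε z R l k q) * evalAt V a ha (minusSeries h l i j)) +
      algebraMap _ (OpSeries K V) t *
      (evalAt V a ha (minusSeries h l k j) * HahnSeries.C (minusValue ε z R l i q) -
        HahnSeries.C (minusValue ε z R l k j) * evalAt V a ha (minusSeries h l i q)) = 0 := by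
  have main := same_minus_series H hz i j k q
  simp only [Algebra.smul_def, ← polySeries_C] at main
  rw [← polySeries_X (K := K)] at main
  replace main := congrArg (evalAt V a ha) main
  simp only [map_add, map_sub, map_mul, evalAt_polySeries, evalAt_C, map_zero,
    Polynomial.aeval_X, Polynomial.aeval_C] at main
  rw [← map_add, ← sub_mul, ← map_sub] at main
  replace main := congrArg (fun y => algebraMap (LaurentPolynomial K) (OpSeries K V) ξ * y) main
  simp only [mul_add, mul_zero, ← mul_assoc, ← map_mul] at main
  rw [hξ, map_one, one_mul, mul_comm ξ, ← ht] at main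
  exact main

variable (hl : LocNil l)

/-- The exchange relation of `L^+` at `u^{-1} = y` with the operators `L^-` in which `v = z`. -/
theorem mixed_minus_evalHom (H : Relations n h ε l) (hε : IsNilpotent ε) (hz : z ^ R = 0)
    (y ρ t : LaurentPolynomial K) (hρ : ρ * (1 - algebraMap K _ z * y) = 1)
    (ht : t = algebraMap K _ ε * (y * ρ)) (i j k q : Fin n) :
    algebraMap _ (Module.End (LaurentPolynomial K) (LaurentPolynomial K ⊗[K] V))
        (nilEval (normCoeff n) (shiftParam ((n : ℂ) / 2) t)) *
        (evalHom y (plusMat hl h i j) * (minusValue ε z R l k q).baseChange _) +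
      algebraMap _ (Module.End (LaurentPolynomial K) (LaurentPolynomial K ⊗[K] V))
        (nilEval (normCoeff n) (shiftParam ((n : ℂ) / 2) t) * shiftParam ((n : ℂ) / 2) t) *
        (evalHom y (plusMat hl h k j) * (minusValue ε z R l i q).baseChange _) =
    algebraMap _ (Module.End (LaurentPolynomial K) (LaurentPolynomial K ⊗[K] V))
        (nilEval (normCoeff n) (shiftParam (-((n : ℂ) / 2)) t)) *
        ((minusValue ε z R l k q).baseChange _ * evalHom y (plusMat hl h i j)) +
      algebraMap _ (Module.End (LaurentPolynomial K) (LaurentPolynomial K ⊗[K] V))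
        (nilEval (normCoeff n) (shiftParam (-((n : ℂ) / 2)) t) * shiftParam (-((n : ℂ) / 2)) t) *
        ((minusValue ε z R l k j).baseChange _ * evalHom y (plusMat hl h i q)) := by
  obtain ⟨r, hr⟩ := exists_inverse_one_sub hz
  have hρr : Polynomial.aeval y r = ρ := by
    have e := congrArg (Polynomial.aeval y) hr
    rw [map_mul, map_sub, map_one, map_mul, Polynomial.aeval_C, Polynomial.aeval_X] at e
    calc Polynomial.aeval y r = Polynomial.aeval y r * (ρ * (1 - algebraMap K _ z * y)) := by
          rw [hρ, mul_one]
      _ = ρ * (Polynomial.aeval y r * (1 - algebraMap K _ z * y)) := by ring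
      _ = ρ := by rw [e, mul_one]
  have hp : IsNilpotent (Polynomial.C ε * Polynomial.X * r) := by
    rw [mul_assoc]
    exact Commute.isNilpotent_mul_right (Commute.all _ _) (hε.map Polynomial.C)
  have hev : Polynomial.aeval y (Polynomial.C ε * Polynomial.X * r) = t := by
    rw [map_mul, map_mul, Polynomial.aeval_C, Polynomial.aeval_X, hρr, ht, mul_assoc]
  have hc := fun c φ => coeff_nilEval_minus (ε := ε) hz hε c φ r hr
  generalize Polynomial.C ε * Polynomial.X * r = p at hp hev hc
  have main := mixed_minus_series H hz _ rfl _ _ _ _ (hc _ _) (hc _ _) (hc _ _) (hc _ _) i j k q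
  let lf : Polynomial K → locFinite (K := K) V := fun p => ⟨polySeries _ p, polySeries_mem_locFinite p⟩
  let cf : Module.End K V → locFinite (K := K) V := fun b => ⟨PowerSeries.C b, C_mem_locFinite b⟩
  have hlf : ∀ p, evalHom y (lf p) = algebraMap (LaurentPolynomial K) _ (Polynomial.aeval y p) :=
    evalHom_polySeries y
  have hcf : ∀ b, evalHom y (cf b) = b.baseChange (LaurentPolynomial K) := evalHom_C y
  have main' : lf (nilEval (complexShift ((n : ℂ) / 2) (normCoeff n)) p) *
        (plusMat hl h i j * cf (minusValue ε z R l k q)) +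
      lf (nilEval (complexShift ((n : ℂ) / 2) (delay (normCoeff n))) p) *
        (plusMat hl h k j * cf (minusValue ε z R l i q)) =
      lf (nilEval (complexShift (-((n : ℂ) / 2)) (normCoeff n)) p) *
        (cf (minusValue ε z R l k q) * plusMat hl h i j) +
      lf (nilEval (complexShift (-((n : ℂ) / 2)) (delay (normCoeff n))) p) *
        (cf (minusValue ε z R l k j) * plusMat hl h i q) := Subtype.ext main
  replace main' := congrArg (evalHom y) main'
  simp only [map_add, map_mul (evalHom y), hlf, hcf] at main'
  rw [(aeval_complexShift y _ hp).1, (aeval_complexShift y _ hp).1, (aeval_complexShift y _ hp).2,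
    (aeval_complexShift y _ hp).2, hev] at main'
  exact main'

/-- The relation multiplied by `u⁻¹ v⁻¹`, with `x = u`, `y = u⁻¹` and `z = v⁻¹`, solved for the
commutator. -/
theorem commutator_of_scaled {S T : Type*} [CommRing S] [Ring T] [Algebra S T] {x y z e ρ : S} {c d : T}
    (hy : x * y = 1) (hρ : ρ * (1 - z * x) = 1)
    (h0 : algebraMap S T z * c - algebraMap S T y * c +
      algebraMap S T (e * z) * (algebraMap S T y * d) = 0) :
    c = algebraMap S T (e * (z * ρ)) * d := by
  have h1 := congrArg (fun w => algebraMap S T (ρ * x) * w) h0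
  simp only [mul_add, mul_sub, ← mul_assoc, ← map_mul, mul_zero] at h1
  rw [← sub_mul, ← map_sub, show ρ * x * z - ρ * x * y = -(ρ * (1 - z * x)) by
    rw [mul_assoc ρ x y, hy]; ring, hρ, show ρ * x * e * z * y = e * (z * ρ) by
    rw [show ρ * x * e * z * y = e * (z * ρ) * (x * y) by ring, hy, mul_one], map_neg, map_one,
    neg_one_mul, neg_add_eq_zero] at h1
  exact h1

/-- The exchange relation of `L^+` at `u^{-1} = y` with the operators `L^+` in which `v^{-1} = z`. -/
theorem same_plus_evalHom (H : Relations n h ε l) (hz : z ^ R = 0)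
    (x y ρ t : LaurentPolynomial K) (hxy : x * y = 1) (hρ : ρ * (1 - algebraMap K _ z * x) = 1)
    (ht : t = algebraMap K _ ε * (algebraMap K _ z * ρ)) (i j k q : Fin n) :
    evalHom y (plusMat hl h i j) * (plusValue ε z R l k q).baseChange _ -
        (plusValue ε z R l k q).baseChange _ * evalHom y (plusMat hl h i j) =
      algebraMap _ (Module.End (LaurentPolynomial K) (LaurentPolynomial K ⊗[K] V)) t *
        (evalHom y (plusMat hl h k j) * (plusValue ε z R l i q).baseChange _ -
          (plusValue ε z R l k j).baseChange _ * evalHom y (plusMat hl h i q)) := by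
  have main := same_plus_series H hz i j k q
  simp only [Algebra.smul_def] at main
  let af : K → locFinite (K := K) V := fun a => ⟨algebraMap K _ a, algebraMap_mem_locFinite a⟩
  let cf : Module.End K V → locFinite (K := K) V := fun b => ⟨PowerSeries.C b, C_mem_locFinite b⟩
  have haf : ∀ a, evalHom y (af a) = algebraMap (LaurentPolynomial K) _ (algebraMap K _ a) :=
    evalHom_algebraMap y
  have hcf : ∀ b, evalHom y (cf b) = b.baseChange (LaurentPolynomial K) := evalHom_C y
  have main' : af z * (plusMat hl h i j * cf (plusValue ε z R l k q) -
        cf (plusValue ε z R l k q) * plusMat hl h i j) -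
      ⟨PowerSeries.X, X_mem_locFinite⟩ * (plusMat hl h i j * cf (plusValue ε z R l k q) -
        cf (plusValue ε z R l k q) * plusMat hl h i j) +
      af (ε * z) * (⟨PowerSeries.X, X_mem_locFinite⟩ * (plusMat hl h k j * cf (plusValue ε z R l i q) -
        cf (plusValue ε z R l k j) * plusMat hl h i q)) = 0 := Subtype.ext main
  replace main' := congrArg (evalHom y) main'
  simp only [map_add, map_sub, map_mul (evalHom y), haf, hcf, evalHom_X, map_zero] at main'
  rw [ht]
  refine commutator_of_scaled (T := Module.End (LaurentPolynomial K) (LaurentPolynomial K ⊗[K] V))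
    (e := algebraMap K _ ε) hxy hρ ?_
  rw [← map_mul (algebraMap K (LaurentPolynomial K))]
  exact main'

end Evaluation

end YangianDouble

/-! ### Commutation on the auxiliary module -/

namespace YangianDouble

open Finset
open scoped TensorProduct

section Scalars

variable {S : Type*} [CommRing S] [Algebra ℂ S]

/-- The parameter `ε / (v - u - c h)` in terms of `ε / (v - u)`, where `v⁻¹ = z`. Since `ε² = h
ε`, shifting by `c h` has the same effect as shifting by `c ε`. -/
theorem shiftParam_of_inverse_one_sub {ε h z u ρ₀ ρ : S} (hε : IsNilpotent ε) (hεh : ε * ε = h * ε)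
    (c : ℂ) (hρ₀ : ρ₀ * (1 - z * u) = 1) (hρ : ρ * (1 - z * (u + c • h)) = 1) :
    ε * (z * ρ) = shiftParam (-c) (ε * (z * ρ₀)) := by
  refine eq_shiftParam_of_mul hε hεh _ ?_
  rw [Algebra.smul_def] at hρ ⊢
  rw [map_neg]
  linear_combination (-z * ρ) * hρ₀ + z * ρ₀ * hρ

/-- The parameter `ε / (u + c h - z)` in terms of `ε / (u - z)`. -/
theorem shiftParam_of_inverse_sub {ε h z u ξ₀ ξ : S} (hε : IsNilpotent ε) (hεh : ε * ε = h * ε)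
    (c : ℂ) (hξ₀ : ξ₀ * (u - z) = 1) (hξ : ξ * (u + c • h - z) = 1) :
    ε * ξ = shiftParam c (ε * ξ₀) := by
  refine eq_shiftParam_of_mul hε hεh _ ?_
  rw [Algebra.smul_def] at hξ ⊢
  linear_combination (-ξ) * hξ₀ + ξ₀ * hξ

end Scalars

section Commutation

variable {n k : ℕ} {K V : Type*} [CommRing K] [AddCommGroup V] [Module K V] [Algebra ℂ K] {h ε z : K}
  {R : ℕ} {l : ℤ → Matrix (Fin n) (Fin n) (Module.End K V)}

theorem isUnit_T_add {K : Type*} [CommRing K] {x : LaurentPolynomial K} (hx : IsNilpotent x) :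
    IsUnit ((LaurentPolynomial.T 1 : LaurentPolynomial K) + x) := by
  have : (LaurentPolynomial.T 1 : LaurentPolynomial K) + x =
      LaurentPolynomial.T 1 * (1 + LaurentPolynomial.T (-1) * x) := by
    rw [mul_add, mul_one, ← mul_assoc, ← LaurentPolynomial.T_add]
    simp
  rw [this]
  exact (LaurentPolynomial.isUnit_T 1).mul
    (Commute.isNilpotent_mul_left (Commute.all _ _) hx).isUnit_one_add

variable (V) in
/-- The matrix `L^-(u + a h)` of operators on Laurent series. -/
noncomputable def minusAt (h : K) (hh : IsNilpotent h) (l : ℤ → Matrix (Fin n) (Fin n) (Module.End K V))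
    (a : ℕ) : Matrix (Fin n) (Fin n) (OpSeries K V) :=
  (minusSeries h l).map (evalAt V ((a : K) * h) (Commute.isNilpotent_mul_left (Commute.all _ _) hh))

/-- The operator on the auxiliary module acting by a fixed endomorphism of `V`. -/
noncomputable def constAction (b : Module.End K V) :
    Module.End (LaurentPolynomial K) (TwoSided K V) :=
  twoSidedAction K V (b.baseChange (LaurentPolynomial K), HahnSeries.C b)

/-- The operator `tr A L_1^-(u_1) ⋯ L_k^-(u_k) G_k ⋯ G_1`, up to the normalization of `A`. -/
noncomputable def twoSidedTrace (h : K) (hh : IsNilpotent h)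
    (l : ℤ → Matrix (Fin n) (Fin n) (Module.End K V))
    (G : Fin k → Matrix (Fin n) (Fin n) (Module.End (LaurentPolynomial K) (LaurentPolynomial K ⊗[K] V))) :
    Module.End (LaurentPolynomial K) (TwoSided K V) :=
  Matrix.trace (signSum n k _ *
    (((List.finRange k).map fun a => inCopy a ((minusAt V h hh l a).map fun x =>
        twoSidedAction K V (0, x))).prod *
      Matrix.scalar (Fin k → Fin n) (twoSidedIncl K V) *
      ((List.finRange k).reverse.map fun a => inCopy a ((G a).map fun x =>
        twoSidedAction K V (x, 0))).prod))

theorem algebraMap_add_smul (a : ℕ) (c : ℂ) (h : K) : algebraMap K (LaurentPolynomial K)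
    ((a : K) * h + algebraMap ℂ K c * h) = ((a : ℂ) + c) • algebraMap K (LaurentPolynomial K) h := by
  rw [add_smul, Algebra.smul_def c, IsScalarTower.algebraMap_apply ℂ K (LaurentPolynomial K),
    Nat.cast_smul_eq_nsmul, nsmul_eq_mul, map_add, map_mul, map_mul, map_natCast]

/-- Neighbouring factors `L^-(u + a h)` and `L^-(u + a h + h)` are fused. -/
theorem fused_minusAt (H : Relations n h ε l) (hh : IsNilpotent h) (a b : Fin k) (hab : (b : ℕ) = a + 1) :
    Fused (minusAt V h hh l a) (minusAt V h hh l b) := by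
  have h1 := (cross_minus H (((a : ℕ) : K) * h) (((b : ℕ) : K) * h)
    (Commute.isNilpotent_mul_left (Commute.all _ _) hh)
    (Commute.isNilpotent_mul_left (Commute.all _ _) hh) (by rw [hab]; push_cast; ring)).fused
  exact h1.map (HahnSeries.ofPowerSeries ℤ (Module.End K V))

/-- The inverses of neighbouring factors `L^+` are fused in the opposite order. Here `Y a` is the
inverse of `u + a h + n h / 2`. -/
theorem fused_inverse (H : Relations n h ε l) (hl : LocNil l)
    (Y : Fin k → LaurentPolynomial K)
    (hY : ∀ a : Fin k, (LaurentPolynomial.T 1 + algebraMap K _ (((a : ℕ) : K) * h +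
      algebraMap ℂ K ((n : ℂ) / 2) * h)) * Y a = 1)
    (G : Fin k → Matrix (Fin n) (Fin n) (Module.End (LaurentPolynomial K) (LaurentPolynomial K ⊗[K] V)))
    (hLG : ∀ a, (plusMat hl h).map (evalHom (Y a)) * G a = 1)
    (hGL : ∀ a, G a * (plusMat hl h).map (evalHom (Y a)) = 1)
    (a b : Fin k) (hab : (b : ℕ) = a + 1) : Fused (G b) (G a) := by
  refine (cross_plus H hl (Y a) (Y b) ⟨Units.mkOfMulEqOne _ _ ((mul_comm _ _).trans (hY a)), rfl⟩
    ⟨Units.mkOfMulEqOne _ _ ((mul_comm _ _).trans (hY b)), rfl⟩ ?_).inv (hLG a) (hGL a) (hLG b) (hGL b)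
  have ha := hY a
  have hb := hY b
  rw [hab] at hb
  simp only [map_add, map_mul, map_one, map_natCast, Nat.cast_add, Nat.cast_one] at ha hb
  linear_combination Y b * ha - Y a * hb

/-- The operators `L^+` with argument `z⁻¹` and parameter `ε` commute with the trace: the
relations of `commute_trace_plus` hold over the Laurent polynomials in `u`. -/
theorem commute_twoSidedTrace_plus (hn : 1 ≤ n) (H : Relations n h ε l) (hl : LocNil l)
    (hh : IsNilpotent h) (hε : IsNilpotent ε) (hεh : ε * ε = h * ε) (hz : z ^ R = 0)
    (Y : Fin k → LaurentPolynomial K)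
    (hY : ∀ a : Fin k, (LaurentPolynomial.T 1 + algebraMap K _ (((a : ℕ) : K) * h +
      algebraMap ℂ K ((n : ℂ) / 2) * h)) * Y a = 1)
    (G : Fin k → Matrix (Fin n) (Fin n) (Module.End (LaurentPolynomial K) (LaurentPolynomial K ⊗[K] V)))
    (hLG : ∀ a, (plusMat hl h).map (evalHom (Y a)) * G a = 1)
    (hGL : ∀ a, G a * (plusMat hl h).map (evalHom (Y a)) = 1)
    (i j : Fin n) :
    Commute (constAction (plusValue ε z R l i j)) (twoSidedTrace h hh l G) := by
  -- The rational scalars act through `ℂ ⊆ K`; the exchange theorem divides by `k!`.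
  have : Algebra ℚ (Module.End (LaurentPolynomial K) (TwoSided K V)) :=
    ((algebraMap (LaurentPolynomial K) _).comp ((algebraMap ℂ _).comp (algebraMap ℚ ℂ))).toAlgebra'
      fun c x => Algebra.commutes _ _
  obtain ⟨E, hE⟩ : ∃ E, E = algebraMap K (LaurentPolynomial K) := ⟨_, rfl⟩
  rw [← hE] at hY
  have hz' : IsNilpotent (E z) := ⟨R, by rw [← map_pow, hz, map_zero]⟩
  have hε' : IsNilpotent (E ε) := hε.map E
  have hεh' : E ε * E ε = E h * E ε := by rw [← map_mul, hεh, map_mul]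
  have hinv : ∀ x, ∃ ρ, ρ * (1 - E z * x) = 1 := fun x => ⟨Ring.inverse _, Ring.inverse_mul_cancel _
    (Commute.isNilpotent_mul_right (Commute.all _ _) hz').isUnit_one_sub⟩
  obtain ⟨ρ₀, hρ₀⟩ := hinv (LaurentPolynomial.T 1)
  choose ρ hρ using fun a : Fin k => hinv (LaurentPolynomial.T 1 + E (((a : ℕ) : K) * h))
  choose ρ' hρ' using fun a : Fin k => hinv (LaurentPolynomial.T 1 + E (((a : ℕ) : K) * h +
    algebraMap ℂ K ((n : ℂ) / 2) * h))
  have ht₀ : IsNilpotent (E ε * (E z * ρ₀)) := Commute.isNilpotent_mul_right (Commute.all _ _) hε'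
  -- The parameters of all the `R`-matrices are shifts of the single parameter `ε / (v - u)`.
  have e1 : ∀ a : Fin k, E ε * (E z * ρ a) = shiftParam (-((a : ℕ) : ℂ)) (E ε * (E z * ρ₀)) := by
    intro a
    refine shiftParam_of_inverse_one_sub hε' hεh' _ hρ₀ ?_
    rw [Nat.cast_smul_eq_nsmul, nsmul_eq_mul, ← map_natCast E, ← map_mul]
    exact hρ a
  have e2 : ∀ a : Fin k, E ε * (E z * ρ' a) =
      shiftParam (-((n : ℂ) / 2) - ((a : ℕ) : ℂ)) (E ε * (E z * ρ₀)) := by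
    intro a
    rw [show -((n : ℂ) / 2) - ((a : ℕ) : ℂ) = -(((a : ℕ) : ℂ) + (n : ℂ) / 2) by ring]
    refine shiftParam_of_inverse_one_sub hε' hεh' _ hρ₀ ?_
    rw [hE, ← algebraMap_add_smul, ← hE]
    exact hρ' a
  subst hE
  have h1 := fun (a : Fin k) (i j p q : Fin n) => mixed_plus_evalAt (a := ((a : ℕ) : K) * h)
    (Commute.isNilpotent_mul_left (Commute.all _ _) hh) H hε hz (ρ a) _ (hρ a) rfl p q i j
  simp only [e1, shiftParam_shiftParam ht₀, neg_add_eq_sub] at h1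
  have h2 := fun (a : Fin k) (i j p q : Fin n) =>
    same_plus_evalHom hl H hz _ (Y a) (ρ' a) _ (hY a) (hρ' a) rfl i j p q
  simp only [e2] at h2
  -- The matrices are kept opaque, to keep the unification with the exchange theorem syntactic.
  obtain ⟨A₂, hA₂⟩ : ∃ A : Matrix (Fin n) (Fin n) (Module.End (LaurentPolynomial K)
      (LaurentPolynomial K ⊗[K] V)), ∀ i j, A i j = (plusValue ε z R l i j).baseChange _ :=
    ⟨Matrix.of fun i j => (plusValue ε z R l i j).baseChange _, fun _ _ => rfl⟩
  obtain ⟨A₁, hA₁⟩ : ∃ A : Matrix (Fin n) (Fin n) (OpSeries K V), ∀ i j, A i j =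
      HahnSeries.C (plusValue ε z R l i j) :=
    ⟨Matrix.of fun i j => HahnSeries.C (plusValue ε z R l i j), fun _ _ => rfl⟩
  obtain ⟨M, hM⟩ : ∃ M : Fin k → Matrix (Fin n) (Fin n) (OpSeries K V),
      M = fun a : Fin k => minusAt V h hh l a := ⟨_, rfl⟩
  obtain ⟨L, hL⟩ : ∃ L : Fin k → Matrix (Fin n) (Fin n) (Module.End (LaurentPolynomial K)
      (LaurentPolynomial K ⊗[K] V)), L = fun a => (plusMat hl h).map (evalHom (Y a)) := ⟨_, rfl⟩
  have eM : ∀ (a : Fin k) i j, evalAt V (((a : ℕ) : K) * h)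
      (Commute.isNilpotent_mul_left (Commute.all _ _) hh) (minusSeries h l i j) = M a i j := by
    intro a i j
    rw [hM]
    rfl
  have eL : ∀ (a : Fin k) i j, evalHom (Y a) (plusMat hl h i j) = L a i j := by
    intro a i j
    rw [hL]
    rfl
  have fM : ∀ a b : Fin k, (b : ℕ) = a + 1 → Fused (M a) (M b) := by
    rw [hM]
    exact fused_minusAt H hh
  have key := commute_trace_plus hn (twoSidedAction K V) A₂ A₁ M L G (twoSidedIncl K V) _ ht₀ _ _
    (fun a => rfl) (fun a => rfl) (fun i j => ?_) (fun a i j p q => ?_) (fun a i j p q => ?_)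
    (fun a => ?_) (fun a => ?_) fM (fused_inverse H hl Y hY G hLG hGL) i j
  · rw [hA₂, hA₁, hM] at key
    exact key
  · rw [hA₂, hA₁]
    exact commute_twoSidedIncl _
  · simp only [hA₁, ← eM]
    exact h1 a i j p q
  · simp only [hA₂, ← eL]
    exact h2 a i j p q
  · rw [hL]
    exact hLG a
  · rw [hL]
    exact hGL a

/-- The operators `L^-` with argument `z` and parameter `ε` commute with the trace: the relations
of `commute_trace_minus` hold over the Laurent polynomials in `u`. -/
theorem commute_twoSidedTrace_minus (hn : 1 ≤ n) (H : Relations n h ε l) (hl : LocNil l)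
    (hh : IsNilpotent h) (hε : IsNilpotent ε) (hεh : ε * ε = h * ε) (hz : z ^ R = 0)
    (Y : Fin k → LaurentPolynomial K)
    (hY : ∀ a : Fin k, (LaurentPolynomial.T 1 + algebraMap K _ (((a : ℕ) : K) * h +
      algebraMap ℂ K ((n : ℂ) / 2) * h)) * Y a = 1)
    (G : Fin k → Matrix (Fin n) (Fin n) (Module.End (LaurentPolynomial K) (LaurentPolynomial K ⊗[K] V)))
    (hLG : ∀ a, (plusMat hl h).map (evalHom (Y a)) * G a = 1)
    (hGL : ∀ a, G a * (plusMat hl h).map (evalHom (Y a)) = 1)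
    (i j : Fin n) :
    Commute (constAction (minusValue ε z R l i j)) (twoSidedTrace h hh l G) := by
  -- The rational scalars act through `ℂ ⊆ K`; the exchange theorem divides by `k!`.
  have : Algebra ℚ (Module.End (LaurentPolynomial K) (TwoSided K V)) :=
    ((algebraMap (LaurentPolynomial K) _).comp ((algebraMap ℂ _).comp (algebraMap ℚ ℂ))).toAlgebra'
      fun c x => Algebra.commutes _ _
  obtain ⟨E, hE⟩ : ∃ E, E = algebraMap K (LaurentPolynomial K) := ⟨_, rfl⟩
  rw [← hE] at hY
  have hz' : IsNilpotent (E z) := ⟨R, by rw [← map_pow, hz, map_zero]⟩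
  have hε' : IsNilpotent (E ε) := hε.map E
  have hεh' : E ε * E ε = E h * E ε := by rw [← map_mul, hεh, map_mul]
  have hinv : ∀ x, ∃ ρ, ρ * (1 - E z * x) = 1 := fun x => ⟨Ring.inverse _, Ring.inverse_mul_cancel _
    (Commute.isNilpotent_mul_right (Commute.all _ _) hz').isUnit_one_sub⟩
  have hinv' : ∀ a : K, IsNilpotent a → ∃ ξ, ξ * (LaurentPolynomial.T 1 + E a - E z) = 1 := by
    intro a ha
    refine ⟨Ring.inverse _, Ring.inverse_mul_cancel _ ?_⟩
    rw [add_sub_assoc]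
    exact isUnit_T_add (Commute.isNilpotent_sub (Commute.all _ _) (ha.map E) hz')
  obtain ⟨ξ₀, hξ₀⟩ := hinv' 0 ⟨1, by simp⟩
  rw [map_zero, add_zero] at hξ₀
  choose ξ hξ using fun a : Fin k => hinv' (((a : ℕ) : K) * h)
    (Commute.isNilpotent_mul_left (Commute.all _ _) hh)
  choose ρ' hρ' using fun a : Fin k => hinv (Y a)
  have ht₀ : IsNilpotent (E ε * ξ₀) := Commute.isNilpotent_mul_right (Commute.all _ _) hε'
  -- The parameters of all the `R`-matrices are shifts of the single parameter `ε / (u - v)`.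
  have e1 : ∀ a : Fin k, E ε * ξ a = shiftParam ((a : ℕ) : ℂ) (E ε * ξ₀) := by
    intro a
    refine shiftParam_of_inverse_sub hε' hεh' _ hξ₀ ?_
    rw [Nat.cast_smul_eq_nsmul, nsmul_eq_mul, ← map_natCast E, ← map_mul]
    exact hξ a
  have e2 : ∀ a : Fin k, E ε * (Y a * ρ' a) =
      shiftParam (((a : ℕ) : ℂ) + (n : ℂ) / 2) (E ε * ξ₀) := by
    intro a
    refine shiftParam_of_inverse_sub hε' hεh' _ hξ₀ ?_
    have := hY a
    rw [hE, algebraMap_add_smul, ← hE] at this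
    have h2 := hρ' a
    linear_combination ρ' a * this + h2
  subst hE
  have h1 := fun (a : Fin k) (i j p q : Fin n) =>
    same_minus_evalAt (Commute.isNilpotent_mul_left (Commute.all ((a : ℕ) : K) h) hh) H hz (ξ a) _ (hξ a)
      rfl i j p q
  simp only [e1] at h1
  have h2 := fun (a : Fin k) (i j p q : Fin n) =>
    mixed_minus_evalHom hl H hε hz (Y a) (ρ' a) _ (hρ' a) rfl i j p q
  simp only [e2, shiftParam_shiftParam ht₀, add_assoc, add_halves, add_neg_cancel,
    add_zero] at h2
  -- The matrices are kept opaque, to keep the unification with the exchange theorem syntactic.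
  obtain ⟨A₂, hA₂⟩ : ∃ A : Matrix (Fin n) (Fin n) (Module.End (LaurentPolynomial K)
      (LaurentPolynomial K ⊗[K] V)), ∀ i j, A i j = (minusValue ε z R l i j).baseChange _ :=
    ⟨Matrix.of fun i j => (minusValue ε z R l i j).baseChange _, fun _ _ => rfl⟩
  obtain ⟨A₁, hA₁⟩ : ∃ A : Matrix (Fin n) (Fin n) (OpSeries K V), ∀ i j, A i j =
      HahnSeries.C (minusValue ε z R l i j) :=
    ⟨Matrix.of fun i j => HahnSeries.C (minusValue ε z R l i j), fun _ _ => rfl⟩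
  obtain ⟨M, hM⟩ : ∃ M : Fin k → Matrix (Fin n) (Fin n) (OpSeries K V),
      M = fun a : Fin k => minusAt V h hh l a := ⟨_, rfl⟩
  obtain ⟨L, hL⟩ : ∃ L : Fin k → Matrix (Fin n) (Fin n) (Module.End (LaurentPolynomial K)
      (LaurentPolynomial K ⊗[K] V)), L = fun a => (plusMat hl h).map (evalHom (Y a)) := ⟨_, rfl⟩
  have eM : ∀ (a : Fin k) i j, evalAt V (((a : ℕ) : K) * h)
      (Commute.isNilpotent_mul_left (Commute.all _ _) hh) (minusSeries h l i j) = M a i j := by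
    intro a i j
    rw [hM]
    rfl
  have eL : ∀ (a : Fin k) i j, evalHom (Y a) (plusMat hl h i j) = L a i j := by
    intro a i j
    rw [hL]
    rfl
  have fM : ∀ a b : Fin k, (b : ℕ) = a + 1 → Fused (M a) (M b) := by
    rw [hM]
    exact fused_minusAt H hh
  have key := commute_trace_minus hn (twoSidedAction K V) A₂ A₁ M L G (twoSidedIncl K V) _ ht₀ _ _
    (fun a => rfl) (fun a => rfl) (fun i j => ?_) (fun a i j p q => ?_) (fun a i j p q => ?_)
    (fun a => ?_) (fun a => ?_) fM (fused_inverse H hl Y hY G hLG hGL) i j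
  · rw [hA₂, hA₁, hM] at key
    exact key
  · rw [hA₂, hA₁]
    exact commute_twoSidedIncl _
  · simp only [hA₁, ← eM]
    exact h1 a i j p q
  · simp only [hA₂, ← eL]
    exact h2 a i j p q
  · rw [hL]
    exact hLG a
  · rw [hL]
    exact hGL a

end Commutation

end YangianDouble

/-! ### Coefficients of the trace -/

namespace YangianDouble

open Finset
open scoped TensorProduct

section ShiftedInverse

variable {n : ℕ} {K V : Type*} [CommRing K] [AddCommGroup V] [Module K V]
  {l : ℤ → Matrix (Fin n) (Fin n) (Module.End K V)}

/-- The series `φ(u + β)`, where `φ` is a series in `u^{-1}`. -/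
noncomputable def inverseShift {B : Type*} [Ring B] [Algebra K B] (β : K) (φ : PowerSeries B) :
    PowerSeries B :=
  PowerSeries.mk fun N => ∑ p ∈ antidiagonal N,
    (((N - 1).choose p.2 : K) * (-β) ^ p.2) • PowerSeries.coeff p.1 φ

theorem inverseShift_add {B : Type*} [Ring B] [Algebra K B] (β : K) (φ ψ : PowerSeries B) :
    inverseShift β (φ + ψ) = inverseShift β φ + inverseShift β ψ := by
  ext1 N
  rw [map_add, inverseShift, inverseShift, inverseShift, PowerSeries.coeff_mk, PowerSeries.coeff_mk,
    PowerSeries.coeff_mk, ← sum_add_distrib]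
  exact sum_congr rfl fun p _ => by rw [map_add, smul_add]

theorem inverseShift_algebraMap_mul {B : Type*} [Ring B] [Algebra K B] (β x : K) (φ : PowerSeries B) :
    inverseShift β (algebraMap K _ x * φ) = algebraMap K _ x * inverseShift β φ := by
  ext1 N
  rw [PowerSeries.algebraMap_apply, PowerSeries.coeff_C_mul, inverseShift, inverseShift,
    PowerSeries.coeff_mk, PowerSeries.coeff_mk, mul_sum]
  exact sum_congr rfl fun p _ => by rw [PowerSeries.coeff_C_mul, mul_smul_comm]

theorem inverseShift_zero {B : Type*} [Ring B] [Algebra K B] (β : K) :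
    inverseShift β (0 : PowerSeries B) = 0 := by
  ext1 N
  rw [inverseShift, PowerSeries.coeff_mk, map_zero]
  exact sum_eq_zero fun p _ => by rw [map_zero, smul_zero]

theorem inverseShift_one {B : Type*} [Ring B] [Algebra K B] (β : K) :
    inverseShift β (1 : PowerSeries B) = 1 := by
  ext1 N
  rw [inverseShift, PowerSeries.coeff_mk, sum_eq_single (0, N)]
  · rcases N with _ | N
    · simp
    · simp [PowerSeries.coeff_one]
  · rintro ⟨p, q⟩ hp hne
    rw [HasAntidiagonal.mem_antidiagonal] at hp
    rw [PowerSeries.coeff_one, if_neg, smul_zero]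
    rintro rfl
    exact hne (Prod.ext rfl (by simpa using hp))
  · intro h
    exact absurd (by simp) h

theorem inverseShift_mem_locFinite {β : K} (hβ : IsNilpotent β) {φ : PowerSeries (Module.End K V)}
    (hφ : φ ∈ locFinite V) : inverseShift β φ ∈ locFinite V := by
  intro w
  obtain ⟨M, hM⟩ := hφ w
  obtain ⟨Q, hQ⟩ := hβ
  refine ⟨M + Q, fun k hk => ?_⟩
  rw [inverseShift, PowerSeries.coeff_mk, LinearMap.sum_apply]
  refine sum_eq_zero fun p hp => ?_
  rw [HasAntidiagonal.mem_antidiagonal] at hp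
  rw [LinearMap.smul_apply]
  rcases le_or_gt M p.1 with h | h
  · rw [hM _ h, smul_zero]
  · rw [neg_pow, pow_eq_zero_of_le (by omega) hQ, mul_zero, mul_zero, zero_smul]

/-- `L^+(u + β)` as a matrix of locally finite series in `u^{-1}`. -/
noncomputable def shiftedPlusMat (hl : LocNil l) (x : K) {β : K} (hβ : IsNilpotent β) :
    Matrix (Fin n) (Fin n) (locFinite (K := K) V) :=
  Matrix.of fun i j => ⟨inverseShift β (plusSeries x l i j),
    inverseShift_mem_locFinite hβ (plusSeries_mem_locFinite hl x i j)⟩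

/-- `L^+ - 1` is divisible by the nilpotent `x`, so `L^+` is invertible among the matrices of
locally finite series. -/
theorem isUnit_shiftedPlusMat (hl : LocNil l) {x : K} (hx : IsNilpotent x) {β : K}
    (hβ : IsNilpotent β) : IsUnit (shiftedPlusMat hl x hβ) := by
  have e : shiftedPlusMat hl x hβ = 1 + Matrix.scalar (Fin n)
      (⟨algebraMap K _ x, algebraMap_mem_locFinite x⟩ : locFinite (K := K) V) *
        Matrix.of fun i j => ⟨inverseShift β (PowerSeries.mk fun k : ℕ => plusPart l (-(k : ℤ)) i j),
          inverseShift_mem_locFinite hβ (plusPart_mem_locFinite hl i j)⟩ := by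
    ext i j : 1
    rw [Matrix.add_apply, Matrix.scalar_apply, Matrix.diagonal_mul, Matrix.one_apply]
    refine Subtype.ext ?_
    rw [Subring.coe_add]
    refine (congrArg (inverseShift β) (plusSeries_eq x i j)).trans ?_
    rw [inverseShift_add, inverseShift_algebraMap_mul]
    congr 1
    split_ifs
    exacts [inverseShift_one β, inverseShift_zero β]
  rw [e]
  obtain ⟨Q, hQ⟩ := hx
  refine IsNilpotent.isUnit_one_add ⟨Q, ?_⟩
  rw [(Matrix.scalar_commute _ (fun r => Subtype.ext (Algebra.commutes x r.1)) _).mul_pow, ← map_pow]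
  have : (⟨algebraMap K _ x, algebraMap_mem_locFinite x⟩ : locFinite (K := K) V) ^ Q = 0 :=
    Subtype.ext (by
      change (algebraMap K (PowerSeries (Module.End K V)) x) ^ Q = 0
      rw [← map_pow, hQ, map_zero])
  rw [this, map_zero, zero_mul]

theorem shiftedPlusMat_map_evalHom {S : Type*} [CommRing S] [Algebra K S] (hl : LocNil l) (x : K)
    {β : K} (hβ : IsNilpotent β) (y r : S) (hr : r * (1 + algebraMap K S β * y) = 1) :
    (shiftedPlusMat hl x hβ).map (evalHom y) = (plusMat hl x).map (evalHom (y * r)) := by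
  ext i j : 1
  exact evalHom_shift _ _ hβ _ hr _ _ fun N => by
    change PowerSeries.coeff N (inverseShift β (plusSeries x l i j)) = _
    rw [inverseShift, PowerSeries.coeff_mk]
    rfl

end ShiftedInverse

section Corner

variable {n k : ℕ} {K V : Type*} [CommRing K] [AddCommGroup V] [Module K V]

theorem matrix_map_mul {m A B : Type*} [Fintype m] [NonUnitalNonAssocSemiring A]
    [NonUnitalNonAssocSemiring B] (f : A →ₙ+* B) (X Y : Matrix m m A) :
    (X * Y).map f = X.map f * Y.map f := by
  ext i j
  rw [Matrix.map_apply, Matrix.mul_apply, Matrix.mul_apply, map_sum]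
  exact sum_congr rfl fun _ _ => map_mul f _ _

theorem inCopy_map_nonUnital {A B : Type*} [Ring A] [Ring B] (f : A →ₙ+* B) (a : Fin k)
    (X : Matrix (Fin n) (Fin n) A) : inCopy a (X.map f) = (inCopy a X).map f := by
  ext I J
  simp only [inCopy, Matrix.of_apply, Matrix.map_apply]
  split_ifs
  exacts [rfl, (map_zero f).symm]

/-- A corner inclusion `f` does not preserve `1`, but in front of an element `ι` with `f 1 * ι =
ι` it may be taken out of a product, including the empty one. -/
theorem prod_inCopy_map_mul_scalar {A B : Type*} [Ring A] [Ring B] (f : A →ₙ+* B) (ι : B)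
    (hι : f 1 * ι = ι) (X : Fin k → Matrix (Fin n) (Fin n) A) (c : List (Fin k)) :
    (c.map fun a => inCopy a ((X a).map f)).prod * Matrix.scalar (Fin k → Fin n) ι =
      (c.map fun a => inCopy a (X a)).prod.map f * Matrix.scalar (Fin k → Fin n) ι := by
  induction c with
  | nil =>
    rw [List.map_nil, List.map_nil, List.prod_nil, List.prod_nil, one_mul]
    ext I J
    rw [Matrix.scalar_apply, Matrix.mul_diagonal, Matrix.map_apply, Matrix.one_apply,
      Matrix.diagonal_apply]
    split_ifs
    · exact hι.symm
    · rw [map_zero, zero_mul]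
  | cons a c ih =>
    rw [List.map_cons, List.prod_cons, List.map_cons, List.prod_cons, mul_assoc, ih, matrix_map_mul,
      inCopy_map_nonUnital, mul_assoc]

theorem scalar_mul_prod_inCopy_map {A B : Type*} [Ring A] [Ring B] (f : A →ₙ+* B) (ι : B)
    (hι : ι * f 1 = ι) (X : Fin k → Matrix (Fin n) (Fin n) A) (c : List (Fin k)) :
    Matrix.scalar (Fin k → Fin n) ι * (c.map fun a => inCopy a ((X a).map f)).prod =
      Matrix.scalar (Fin k → Fin n) ι * (c.map fun a => inCopy a (X a)).prod.map f := by
  induction c using List.reverseRecOn with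
  | nil =>
    rw [List.map_nil, List.map_nil, List.prod_nil, List.prod_nil, mul_one]
    ext I J
    rw [Matrix.scalar_apply, Matrix.diagonal_mul, Matrix.map_apply, Matrix.one_apply,
      Matrix.diagonal_apply]
    split_ifs
    · exact hι.symm
    · rw [map_zero, mul_zero]
  | append_singleton c a ih =>
    rw [List.map_append, List.prod_append, List.map_append, List.prod_append, ← mul_assoc, ih,
      matrix_map_mul, ← mul_assoc]
    rw [List.map_singleton, List.prod_singleton, List.map_singleton, List.prod_singleton,
      inCopy_map_nonUnital]

theorem prod_inCopy_map {A B : Type*} [Ring A] [Ring B] (f : A →+* B)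
    (X : Fin k → Matrix (Fin n) (Fin n) A) (c : List (Fin k)) :
    (c.map fun a => inCopy a ((X a).map f)).prod = (c.map fun a => inCopy a (X a)).prod.map f := by
  induction c with
  | nil =>
    rw [List.map_nil, List.map_nil, List.prod_nil, List.prod_nil]
    exact (map_one f.mapMatrix).symm
  | cons a c ih =>
    rw [List.map_cons, List.prod_cons, List.map_cons, List.prod_cons, ih, ← inCopy_map]
    exact (map_mul f.mapMatrix _ _).symm

/-- The trace against the antisymmetrizer, with integral coefficients that do not depend on the
ring. -/
theorem trace_signSum_mul (B : Type*) [Ring B] (Z : Matrix (Fin k → Fin n) (Fin k → Fin n) B) :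
    Matrix.trace (signSum n k B * Z) = ∑ I, ∑ I', signSum n k ℤ I I' • Z I' I := by
  refine sum_congr rfl fun I _ => sum_congr rfl fun I' _ => ?_
  rw [← signSum_map (Int.castRingHom B), zsmul_eq_mul, ← eq_intCast (Int.castRingHom B)]
  rfl

variable (K V) in
/-- The action of operators on the first summand, extended by zero. -/
noncomputable def firstCorner : Module.End (LaurentPolynomial K) (LaurentPolynomial K ⊗[K] V) →ₙ+*
    Module.End (LaurentPolynomial K) (TwoSided K V) where
  toFun x := twoSidedAction K V (x, 0)
  map_zero' := map_zero (twoSidedAction K V)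
  map_add' x y := by rw [← map_add, Prod.mk_add_mk, add_zero]
  map_mul' x y := by rw [← map_mul, Prod.mk_mul_mk, mul_zero]

variable (K V) in
/-- The action of operators on the second summand, extended by zero. -/
noncomputable def secondCorner : OpSeries K V →ₙ+* Module.End (LaurentPolynomial K) (TwoSided K V) where
  toFun x := twoSidedAction K V (0, x)
  map_zero' := map_zero (twoSidedAction K V)
  map_add' x y := by rw [← map_add, Prod.mk_add_mk, add_zero]
  map_mul' x y := by rw [← map_mul, Prod.mk_mul_mk, mul_zero]

/-- The trace as an operator from the module of the factors `G` to that of the factors `L^-`. -/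
theorem twoSidedTrace_apply (h : K) (hh : IsNilpotent h)
    (l : ℤ → Matrix (Fin n) (Fin n) (Module.End K V))
    (G : Fin k → Matrix (Fin n) (Fin n) (Module.End (LaurentPolynomial K) (LaurentPolynomial K ⊗[K] V)))
    (x : LaurentPolynomial K ⊗[K] V) :
    (twoSidedTrace h hh l G (x, 0)).2 = ∑ I, ∑ I', ∑ J, signSum n k ℤ I I' •
      (((List.finRange k).map fun a => inCopy a (minusAt V h hh l a)).prod I' J •
        laurentIncl V (((List.finRange k).reverse.map fun a => inCopy a (G a)).prod J I x)) := by
  have h1 := prod_inCopy_map_mul_scalar (secondCorner K V) (twoSidedIncl K V)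
    (LinearMap.ext fun w => Prod.ext rfl (one_smul (OpSeries K V) (laurentIncl V w.1)))
    (fun a : Fin k => minusAt V h hh l a) (List.finRange k)
  have h2 := scalar_mul_prod_inCopy_map (firstCorner K V) (twoSidedIncl K V)
    (LinearMap.ext fun w => rfl) G (List.finRange k).reverse
  set X := ((List.finRange k).map fun a => inCopy a (minusAt V h hh l a)).prod
  set W := ((List.finRange k).reverse.map fun a => inCopy a (G a)).prod
  have h3 : twoSidedTrace h hh l G = Matrix.trace (signSum n k _ * (X.map (secondCorner K V) *
      Matrix.scalar (Fin k → Fin n) (twoSidedIncl K V) * W.map (firstCorner K V))) := by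
    rw [mul_assoc (X.map _), ← h2, ← mul_assoc (X.map _), ← h1]
    rfl
  rw [h3, trace_signSum_mul, LinearMap.sum_apply, Prod.snd_sum]
  refine sum_congr rfl fun I _ => ?_
  rw [LinearMap.sum_apply, Prod.snd_sum]
  refine sum_congr rfl fun I' _ => ?_
  rw [LinearMap.smul_apply, Prod.smul_snd, Matrix.mul_apply, LinearMap.sum_apply, Prod.snd_sum, smul_sum]
  refine sum_congr rfl fun J _ => ?_
  rw [Matrix.scalar_apply, Matrix.mul_diagonal]
  rfl

/-- The coefficient of `u^{N + t}` in `Φ(u)` and of `u^{-t}` in `Ψ(u)` contribute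
`tr A Φ_{N + t} Ψ_t` to the coefficient of `u^N` in `tr A Φ(u) Ψ(u)`, up to the normalization of `A`. -/
noncomputable def pairTerm (Φ Ψ : Matrix (Fin k → Fin n) (Fin k → Fin n) (PowerSeries (Module.End K V)))
    (N : ℤ) (t : ℕ) : Module.End K V :=
  if -(t : ℤ) ≤ N then Matrix.trace (signSum n k _ *
    (Φ.map (PowerSeries.coeff (N - -(t : ℤ)).toNat) * Ψ.map (PowerSeries.coeff t))) else 0

theorem pairTerm_apply (Φ Ψ : Matrix (Fin k → Fin n) (Fin k → Fin n) (PowerSeries (Module.End K V)))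
    (N : ℤ) (t : ℕ) (w : V) : pairTerm Φ Ψ N t w = ∑ I, ∑ I', ∑ J, signSum n k ℤ I I' •
      if -(t : ℤ) ≤ N then PowerSeries.coeff (N - -(t : ℤ)).toNat (Φ I' J)
        (PowerSeries.coeff t (Ψ J I) w) else 0 := by
  rw [pairTerm]
  split_ifs with h
  · rw [trace_signSum_mul, LinearMap.sum_apply]
    refine sum_congr rfl fun I _ => ?_
    rw [LinearMap.sum_apply]
    refine sum_congr rfl fun I' _ => ?_
    rw [LinearMap.smul_apply, Matrix.mul_apply, LinearMap.sum_apply, smul_sum]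
    rfl
  · simp

/-- The coefficient of `u^N` of the trace, applied to a constant vector `w`, is the finite sum of
the contributions `pairTerm`: the inverses of `L^+` map `w` to a Laurent polynomial in `u⁻¹`, on
which the series in `u` then act. -/
theorem vecCoeff_twoSidedTrace (h : K) (hh : IsNilpotent h)
    (l : ℤ → Matrix (Fin n) (Fin n) (Module.End K V))
    (P : Fin k → Matrix (Fin n) (Fin n) (locFinite (K := K) V)) (w : V) (M : ℕ)
    (hM : ∀ t, M ≤ t → ∀ I J, PowerSeries.coeff t
      (((List.finRange k).reverse.map fun a => inCopy a (P a)).prod I J).1 w = 0) (N : ℤ) :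
    vecCoeff N (twoSidedTrace h hh l (fun a => (P a).map (evalHom (LaurentPolynomial.T (-1))))
      (1 ⊗ₜ w, 0)).2 = ∑ t ∈ range M, pairTerm
        (((List.finRange k).map fun a => inCopy a ((minusSeries h l).map (shiftHom _ (((a : ℕ) : K) * h)
          (Commute.isNilpotent_mul_left (Commute.all _ _) hh)))).prod)
        (((List.finRange k).reverse.map fun a => inCopy a ((P a).map (locFinite V).subtype)).prod)
        N t w := by
  simp only [pairTerm_apply]
  rw [twoSidedTrace_apply, map_sum, sum_comm]
  refine sum_congr rfl fun I _ => ?_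
  rw [map_sum, sum_comm]
  refine sum_congr rfl fun I' _ => ?_
  rw [map_sum, sum_comm]
  refine sum_congr rfl fun J _ => ?_
  rw [map_zsmul, ← smul_sum]
  congr 1
  have e : (fun a : Fin k => inCopy a (minusAt V h hh l a)) = fun a : Fin k => inCopy a
      (((minusSeries h l).map (shiftHom _ (((a : ℕ) : K) * h)
        (Commute.isNilpotent_mul_left (Commute.all _ _) hh))).map (HahnSeries.ofPowerSeries ℤ _)) := rfl
  rw [e, prod_inCopy_map, prod_inCopy_map, prod_inCopy_map, Matrix.map_apply, Matrix.map_apply,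
    evalHom_tmul _ _ _ (fun t ht => hM t ht J I), map_sum, smul_sum, map_sum]
  refine sum_congr rfl fun t _ => ?_
  rw [LaurentPolynomial.T_pow, laurentIncl_T, vecCoeff_ofPowerSeries_smul, mul_neg_one]
  rfl

theorem vecCoeff_constAction (b : Module.End K V) (N : ℤ) (x : TwoSided K V) :
    vecCoeff N (constAction b x).2 = b (vecCoeff N x.2) := by
  have := vecCoeff_single_smul 0 b x.2 N
  rwa [sub_zero] at this

/-- A constant operator that commutes with the trace commutes with its coefficients. -/
theorem apply_pairSum_of_commute (h : K) (hh : IsNilpotent h)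
    (l : ℤ → Matrix (Fin n) (Fin n) (Module.End K V))
    (P : Fin k → Matrix (Fin n) (Fin n) (locFinite (K := K) V)) (b : Module.End K V)
    (hb : Commute (constAction b)
      (twoSidedTrace h hh l fun a => (P a).map (evalHom (LaurentPolynomial.T (-1))))) (w : V) (M : ℕ)
    (hM : ∀ t, M ≤ t → ∀ I J, PowerSeries.coeff t
      (((List.finRange k).reverse.map fun a => inCopy a (P a)).prod I J).1 w = 0)
    (hM' : ∀ t, M ≤ t → ∀ I J, PowerSeries.coeff t
      (((List.finRange k).reverse.map fun a => inCopy a (P a)).prod I J).1 (b w) = 0) (N : ℤ)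
    (Φ Ψ : Matrix (Fin k → Fin n) (Fin k → Fin n) (PowerSeries (Module.End K V)))
    (hΦ : Φ = ((List.finRange k).map fun a => inCopy a ((minusSeries h l).map
      (shiftHom _ (((a : ℕ) : K) * h) (Commute.isNilpotent_mul_left (Commute.all _ _) hh)))).prod)
    (hΨ : Ψ = ((List.finRange k).reverse.map fun a => inCopy a
      ((P a).map (locFinite V).subtype)).prod) :
    b (∑ t ∈ range M, pairTerm Φ Ψ N t w) = ∑ t ∈ range M, pairTerm Φ Ψ N t (b w) := by
  have h1 := congrArg (fun f : Module.End (LaurentPolynomial K) (TwoSided K V) =>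
    vecCoeff N (f (1 ⊗ₜ w, 0)).2) hb.eq
  simp only [Module.End.mul_apply] at h1
  rw [vecCoeff_constAction, vecCoeff_twoSidedTrace h hh l P w M hM] at h1
  have h2 : constAction b ((1 : LaurentPolynomial K) ⊗ₜ[K] w, (0 : VecSeries K V)) =
      ((1 : LaurentPolynomial K) ⊗ₜ[K] (b w), (0 : VecSeries K V)) :=
    Prod.ext rfl (smul_zero (HahnSeries.C b : OpSeries K V))
  rw [h2, vecCoeff_twoSidedTrace h hh l P (b w) M hM', ← hΦ, ← hΨ] at h1
  exact h1

end Corner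

section Main

variable {n k : ℕ} {K V : Type*} [CommRing K] [AddCommGroup V] [Module K V] [Algebra ℂ K] {h ε z : K}
  {R : ℕ} {l : ℤ → Matrix (Fin n) (Fin n) (Module.End K V)}

/-- The shift by `a h + n h / 2` of the argument of `L^+`. -/
noncomputable def plusOffset (n : ℕ) (h : K) (a : ℕ) : K :=
  (a : K) * h + algebraMap ℂ K ((n : ℂ) / 2) * h

theorem isNilpotent_plusOffset (hh : IsNilpotent h) (a : ℕ) : IsNilpotent (plusOffset n h a) := by
  rw [plusOffset, ← add_mul]
  exact Commute.isNilpotent_mul_left (Commute.all _ _) hh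

/-- `L^+(u + a h + n h / 2)` has an inverse with locally finite entries; by uniqueness of the inverse
it is the given one. -/
theorem exists_locFinite_inverse (hl : LocNil l) (hh : IsNilpotent h)
    (P : Fin k → Matrix (Fin n) (Fin n) (PowerSeries (Module.End K V)))
    (hP : ∀ a : Fin k, P a * (plusSeries h l).map (inverseShift (plusOffset n h a)) = 1) :
    ∃ Q : Fin k → Matrix (Fin n) (Fin n) (locFinite (K := K) V),
      (∀ a, P a = (Q a).map (locFinite V).subtype) ∧
      (∀ a : Fin k, shiftedPlusMat hl h (isNilpotent_plusOffset (n := n) hh a) * Q a = 1) ∧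
      ∀ a : Fin k, Q a * shiftedPlusMat hl h (isNilpotent_plusOffset (n := n) hh a) = 1 := by
  choose u hu using fun a : Fin k => isUnit_shiftedPlusMat hl hh (isNilpotent_plusOffset (n := n) hh a)
  have hQ1 : ∀ a : Fin k, shiftedPlusMat hl h (isNilpotent_plusOffset (n := n) hh a) *
      ((u a)⁻¹ : _ˣ).1 = 1 := fun a => by
    rw [← hu]
    exact (u a).mul_inv
  refine ⟨fun a => ((u a)⁻¹ : _ˣ).1, fun a => ?_, hQ1, fun a => ?_⟩
  · refine left_inv_eq_right_inv (hP a) ?_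
    have := congrArg (RingHom.mapMatrix (locFinite (K := K) V).subtype) (hQ1 a)
    rw [map_mul, map_one] at this
    exact this
  · rw [← hu]
    exact (u a).inv_mul

/-- The coefficients of the trace on a locally nilpotent module are finite sums on every vector,
and they commute with the operators `L^+` and `L^-` whose parameter is `ε`. -/
theorem apply_pairSum (hn : 1 ≤ n) (H : Relations n h ε l) (hl : LocNil l)
    (hh : IsNilpotent h) (hε : IsNilpotent ε) (hεh : ε * ε = h * ε) (hz : z ^ R = 0)
    (P : Fin k → Matrix (Fin n) (Fin n) (PowerSeries (Module.End K V)))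
    (hP : ∀ a : Fin k, P a * (plusSeries h l).map (inverseShift (plusOffset n h a)) = 1)
    (Φ Ψ : Matrix (Fin k → Fin n) (Fin k → Fin n) (PowerSeries (Module.End K V)))
    (hΦ : Φ = ((List.finRange k).map fun a => inCopy a ((minusSeries h l).map
      (shiftHom _ (((a : ℕ) : K) * h) (Commute.isNilpotent_mul_left (Commute.all _ _) hh)))).prod)
    (hΨ : Ψ = ((List.finRange k).reverse.map fun a => inCopy a (P a)).prod) :
    (∀ w, ∃ M, ∀ t, M ≤ t → ∀ I J, PowerSeries.coeff t (Ψ I J) w = 0) ∧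
    ∀ b : Module.End K V, (∃ i j, b = plusValue ε z R l i j ∨ b = minusValue ε z R l i j) →
      ∀ (w : V) (M : ℕ), (∀ t, M ≤ t → ∀ I J, PowerSeries.coeff t (Ψ I J) w = 0) →
        (∀ t, M ≤ t → ∀ I J, PowerSeries.coeff t (Ψ I J) (b w) = 0) → ∀ N : ℤ,
        b (∑ t ∈ range M, pairTerm Φ Ψ N t w) = ∑ t ∈ range M, pairTerm Φ Ψ N t (b w) := by
  have hβ := fun a : Fin k => isNilpotent_plusOffset (n := n) hh a
  obtain ⟨Q, hPQ, hQ1, hQ2⟩ := exists_locFinite_inverse hl hh P hP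
  have hΨ' : Ψ = (((List.finRange k).reverse.map fun a => inCopy a (Q a)).prod).map
      (locFinite V).subtype := by
    rw [← prod_inCopy_map, hΨ]
    simp only [hPQ]
  have hb : ∀ (w : V) (M : ℕ), (∀ t, M ≤ t → ∀ I J, PowerSeries.coeff t (Ψ I J) w = 0) →
      ∀ t, M ≤ t → ∀ I J, PowerSeries.coeff t
        (((List.finRange k).reverse.map fun a => inCopy a (Q a)).prod I J).1 w = 0 := by
    intro w M hM
    rw [hΨ'] at hM
    exact hM
  refine ⟨fun w => ?_, fun b hbv w M hM hM' N => ?_⟩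
  · choose m hm using fun I J => (((List.finRange k).reverse.map fun a => inCopy a (Q a)).prod I J).2 w
    refine ⟨univ.sup fun I => univ.sup fun J => m I J, fun t ht I J => ?_⟩
    rw [hΨ']
    exact hm I J t ((le_sup (f := fun J => m I J) (mem_univ J)).trans
      ((le_sup (f := fun I => univ.sup fun J => m I J) (mem_univ I)).trans ht))
  · refine apply_pairSum_of_commute h hh l Q b ?_ w M (hb w M hM) (hb _ M hM') N Φ Ψ hΦ (by
      rw [hΨ', prod_inCopy_map])
    have hr : ∀ a : Fin k, ∃ r : LaurentPolynomial K, r * (1 + algebraMap K _ (plusOffset n h a) *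
        LaurentPolynomial.T (-1)) = 1 := fun a => ⟨Ring.inverse _, Ring.inverse_mul_cancel _
      (Commute.isNilpotent_mul_right (Commute.all _ _) ((hβ a).map _)).isUnit_one_add⟩
    choose r hr using hr
    have hY : ∀ a : Fin k, (LaurentPolynomial.T 1 + algebraMap K (LaurentPolynomial K)
        (((a : ℕ) : K) * h + algebraMap ℂ K ((n : ℂ) / 2) * h)) * (LaurentPolynomial.T (-1) * r a) =
        1 := fun a => by
      have hT : (LaurentPolynomial.T 1 : LaurentPolynomial K) * LaurentPolynomial.T (-1) = 1 := by
        rw [← LaurentPolynomial.T_add]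
        simp
      have := hr a
      rw [plusOffset] at this
      linear_combination this + r a * hT
    have e := fun a => shiftedPlusMat_map_evalHom hl h (hβ a) (LaurentPolynomial.T (-1)) (r a) (hr a)
    have hLG : ∀ a, (plusMat hl h).map (evalHom (LaurentPolynomial.T (-1) * r a)) *
        (Q a).map (evalHom (LaurentPolynomial.T (-1))) = 1 := fun a => by
      rw [← e]
      have := congrArg (RingHom.mapMatrix (evalHom (K := K) (V := V)
        (LaurentPolynomial.T (-1) : LaurentPolynomial K))) (hQ1 a)
      rwa [map_mul, map_one] at this
    have hGL : ∀ a, (Q a).map (evalHom (LaurentPolynomial.T (-1))) *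
        (plusMat hl h).map (evalHom (LaurentPolynomial.T (-1) * r a)) = 1 := fun a => by
      rw [← e]
      have := congrArg (RingHom.mapMatrix (evalHom (K := K) (V := V)
        (LaurentPolynomial.T (-1) : LaurentPolynomial K))) (hQ2 a)
      rwa [map_mul, map_one] at this
    obtain ⟨i, j, rfl | rfl⟩ := hbv
    · exact commute_twoSidedTrace_plus hn H hl hh hε hεh hz _ hY _ hLG hGL i j
    · exact commute_twoSidedTrace_minus hn H hl hh hε hεh hz _ hY _ hLG hGL i j

end Main

end YangianDouble

/-! ### A module over the ring generated by `z` and `ε` -/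

namespace YangianDouble

open Finset

section RelationsOfHom

variable {n : ℕ} {K B : Type*} [CommRing K] [Algebra Scalars K] [Algebra ℂ K] [Ring B]
  [Algebra Scalars B] [Algebra K B] [IsScalarTower Scalars K B]

/-- A homomorphism from the Yangian double to an algebra that contains a central `ε` with `ε² = h
ε` gives matrices that satisfy `Relations`. -/
theorem relations_of_hom (hC : ∀ c, algebraMap ℂ K c = algebraMap Scalars K (PowerSeries.C c))
    (ψ : DYbar n →ₐ[Scalars] B) (ε : K) (hεh : ε * ε = algebraMap Scalars K hbar * ε) :
    Relations n (algebraMap Scalars K hbar) ε fun r => (freeMat n r).map (ψ.comp (toBar n)) := by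
  let f : Free n →+* B := (ψ.comp (toBar n) : Free n →+* B)
  have hf : ∀ x, f x = ψ (toBar n x) := fun x => rfl
  have hε : ∀ x, Commute x (algebraMap K B ε) := fun x => (Algebra.commute_algebraMap_left _ _).symm
  have hh : algebraMap K B ε * algebraMap K B ε = algebraMap Scalars B hbar * algebraMap K B ε := by
    rw [← map_mul, hεh, map_mul, ← IsScalarTower.algebraMap_apply]
  have hb : f (algebraMap Scalars (Free n) hbar) = algebraMap K B (algebraMap Scalars K hbar) := by
    rw [← IsScalarTower.algebraMap_apply]
    exact (ψ.comp (toBar n)).commutes hbar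
  have hp : (fun a => (Lplus n a).map f) = plusCoeff (algebraMap K B (algebraMap Scalars K hbar))
      fun r => (freeMat n r).map f := by
    funext a
    rw [Lplus_eq_plusCoeff, plusCoeff_map, hb]
  have hm : (fun a => (Lminus n a).map f) = minusCoeff (algebraMap K B (algebraMap Scalars K hbar))
      fun r => (freeMat n r).map f := by
    funext a
    rw [Lminus_eq_minusCoeff, minusCoeff_map, hb]
  have hκ : f.comp (complexFree n) = (algebraMap K B).comp (algebraMap ℂ K) := by
    ext c
    rw [RingHom.comp_apply, RingHom.comp_apply, hC, ← IsScalarTower.algebraMap_apply]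
    exact (ψ.comp (toBar n)).commutes _
  refine ⟨fun a b => ?_, fun a b => ?_, fun S T => ?_, fun S T => ?_, fun a b i j p q => ?_,
    fun a b i j p q => ?_⟩
  · have := genSame_plus f ψ hf _ hε hh a b
    rw [hp] at this
    exact this
  · have := genSame_minus f ψ hf _ hε hh a b
    rw [hm] at this
    exact this
  · have := genMixed_plus f ψ hf _ hε hh S T
    rw [hm, hκ] at this
    exact this
  · have := genMixed_minus f ψ hf _ hε hh S T
    rw [hp, hκ] at this
    exact this
  · have := congrArg ψ (toBar_dividedSame_plus a b i j p q)
    rw [← hf, map_zero, dividedSame_map, hp] at this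
    refine Eq.trans ?_ this
    congr 1
    funext c
    ext i j
    simp only [plusPart, Matrix.of_apply, Matrix.map_apply, map_neg, apply_ite f, map_zero]
    rfl
  · have := congrArg ψ (toBar_dividedSame_minus a b i j p q)
    rw [← hf, map_zero, dividedSame_map, hm] at this
    refine Eq.trans ?_ this
    congr 1
    funext c
    ext i j
    simp only [minusPart, Matrix.of_apply, Matrix.map_apply, apply_ite f, map_zero]
    rfl

end RelationsOfHom

section Layers

variable (W : Type*) [AddCommGroup W] [Module Scalars W] (R : ℕ)

/-- The module `(W ⊕ ε W)[z] / z^R`, where `ε² = h ε`. -/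
abbrev Layers : Type _ := Fin R → W × W

/-- Multiplication by `z`. -/
def layerShift : Module.End Scalars (Layers W R) where
  toFun v m := if 0 < (m : ℕ) then v ⟨m - 1, by omega⟩ else 0
  map_add' v w := by
    funext m
    simp only [Pi.add_apply]
    split_ifs <;> simp
  map_smul' a v := by
    funext m
    simp only [Pi.smul_apply, RingHom.id_apply]
    split_ifs <;> simp

/-- Multiplication by `ε`. -/
noncomputable def layerEps : Module.End Scalars (Layers W R) where
  toFun v m := (0, (v m).1 + hbar • (v m).2)
  map_add' v w := by
    funext m
    refine Prod.ext (by simp) ?_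
    simp only [Pi.add_apply, Prod.fst_add, Prod.snd_add, smul_add]
    abel
  map_smul' a v := by
    funext m
    refine Prod.ext (by simp) ?_
    simp only [Pi.smul_apply, Prod.smul_fst, Prod.smul_snd, RingHom.id_apply, smul_add]
    rw [smul_comm]

theorem layerShift_apply (v : Layers W R) (m : Fin R) : layerShift W R v m =
    if 0 < (m : ℕ) then v ⟨m - 1, by omega⟩ else 0 := rfl

theorem layerEps_apply (v : Layers W R) (m : Fin R) :
    layerEps W R v m = (0, (v m).1 + hbar • (v m).2) := rfl

theorem layerShift_mul_layerEps : layerShift W R * layerEps W R = layerEps W R * layerShift W R := by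
  refine LinearMap.ext fun v => funext fun m => ?_
  rw [Module.End.mul_apply, Module.End.mul_apply, layerShift_apply, layerEps_apply, layerEps_apply,
    layerShift_apply]
  split_ifs
  · rfl
  · simp [Prod.ext_iff]

theorem layerEps_mul_self : layerEps W R * layerEps W R = hbar • layerEps W R := by
  refine LinearMap.ext fun v => funext fun m => ?_
  rw [Module.End.mul_apply, LinearMap.smul_apply, Pi.smul_apply, layerEps_apply, layerEps_apply]
  simp

theorem layerShift_pow_apply (s : ℕ) (v : Layers W R) (m : Fin R) : (layerShift W R ^ s) v m =
    if s ≤ (m : ℕ) then v ⟨m - s, by omega⟩ else 0 := by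
  induction s generalizing m with
  | zero => simp
  | succ s ih =>
    rw [pow_succ', Module.End.mul_apply, layerShift_apply]
    by_cases h : s + 1 ≤ (m : ℕ)
    · rw [if_pos (by omega), ih, if_pos (by simp only []; omega), if_pos h]
      congr 2
      simp only []
      omega
    · rw [if_neg h]
      split_ifs with h0
      · rw [ih, if_neg (by simp only []; omega)]
      · rfl

theorem layerShift_pow : layerShift W R ^ R = 0 := by
  refine LinearMap.ext fun v => funext fun m => ?_
  rw [layerShift_pow_apply, if_neg (by omega)]
  rfl

/-- The algebra generated by the operators `z` and `ε`. -/
noncomputable def layerAlgebra : Subalgebra Scalars (Module.End Scalars (Layers W R)) :=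
  Algebra.adjoin Scalars {layerShift W R, layerEps W R}

/-- The commutative ring generated by the operators `z` and `ε`. -/
def LayerRing : Type _ := layerAlgebra W R

noncomputable instance : CommRing (LayerRing W R) :=
  { (layerAlgebra W R).toRing with
    mul_comm := (Algebra.isMulCommutative_adjoin Scalars (by
      rintro a (rfl | rfl) b (rfl | rfl)
      exacts [rfl, layerShift_mul_layerEps W R, (layerShift_mul_layerEps W R).symm, rfl])).is_comm.comm }

noncomputable instance : Algebra Scalars (LayerRing W R) :=
  inferInstanceAs (Algebra Scalars (layerAlgebra W R))

noncomputable instance : Algebra ℂ (LayerRing W R) :=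
  ((algebraMap Scalars (LayerRing W R)).comp PowerSeries.C).toAlgebra

noncomputable instance : Module (LayerRing W R) (Layers W R) :=
  inferInstanceAs (Module (layerAlgebra W R) (Layers W R))

theorem algebraMap_complex (c : ℂ) : algebraMap ℂ (LayerRing W R) c =
    algebraMap Scalars (LayerRing W R) (PowerSeries.C c) := rfl

/-- The operator `z`. -/
noncomputable def layerZ : LayerRing W R := (⟨_, Algebra.subset_adjoin (Or.inl rfl)⟩ : layerAlgebra W R)

/-- The operator `ε`. -/
noncomputable def layerE : LayerRing W R := (⟨_, Algebra.subset_adjoin (Or.inr rfl)⟩ : layerAlgebra W R)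

variable {W R}

theorem layerZ_pow_smul (s : ℕ) (v : Layers W R) : layerZ W R ^ s • v = (layerShift W R ^ s) v := rfl

theorem algebraMap_layerRing_smul (a : Scalars) (v : Layers W R) :
    algebraMap Scalars (LayerRing W R) a • v = a • v := rfl

variable (W R)

theorem layerZ_pow : layerZ W R ^ R = 0 := Subtype.ext (layerShift_pow W R)

theorem layerE_mul_self : layerE W R * layerE W R =
    algebraMap Scalars (LayerRing W R) hbar * layerE W R := by
  refine Subtype.ext ((layerEps_mul_self W R).trans ?_)
  rw [Algebra.smul_def]
  rfl

theorem isNilpotent_layer_hbar {m : ℕ} (hm : ∀ w : W, hbar ^ m • w = 0) :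
    IsNilpotent (algebraMap Scalars (LayerRing W R) hbar) := by
  refine ⟨m, ?_⟩
  rw [← map_pow]
  refine Subtype.ext (LinearMap.ext fun v => funext fun i => ?_)
  exact Prod.ext (hm _) (hm _)

theorem isNilpotent_layerE {m : ℕ} (hm : ∀ w : W, hbar ^ m • w = 0) : IsNilpotent (layerE W R) := by
  refine (IsNilpotent.pow_iff_pos two_ne_zero).1 ?_
  rw [pow_two, layerE_mul_self]
  exact Commute.isNilpotent_mul_right (Commute.all _ _) (isNilpotent_layer_hbar W R hm)

noncomputable instance : Algebra Scalars (Module.End (LayerRing W R) (Layers W R)) :=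
  ((algebraMap (LayerRing W R) (Module.End (LayerRing W R) (Layers W R))).comp
    (algebraMap Scalars (LayerRing W R))).toAlgebra'
      fun a x => Algebra.commutes (algebraMap Scalars (LayerRing W R) a) x

instance : IsScalarTower Scalars (LayerRing W R) (Module.End (LayerRing W R) (Layers W R)) :=
  IsScalarTower.of_algebraMap_eq fun _ => rfl

variable {D : Type*} [Ring D] [Module D W] [SMulCommClass D Scalars W]

instance : SMulCommClass D (LayerRing W R) (Layers W R) where
  smul_comm d a v := by
    obtain ⟨a, ha⟩ := a
    change d • a v = a (d • v)
    induction ha using Algebra.adjoin_induction generalizing v with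
    | mem x hx =>
      rcases hx with rfl | rfl
      · funext m
        rw [Pi.smul_apply, layerShift_apply, layerShift_apply]
        split_ifs
        · rfl
        · exact smul_zero d
      · funext m
        rw [Pi.smul_apply, layerEps_apply, layerEps_apply]
        refine Prod.ext (smul_zero d) ?_
        change d • ((v m).1 + hbar • (v m).2) = d • (v m).1 + hbar • d • (v m).2
        rw [smul_add, smul_comm]
    | algebraMap r => exact smul_comm d r v
    | add x y _ _ hx hy => rw [LinearMap.add_apply, LinearMap.add_apply, smul_add, hx, hy]
    | mul x y _ _ hx hy => rw [Module.End.mul_apply, Module.End.mul_apply, hx, hy]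

variable (D) in
/-- The action of `D` on the module of layers. -/
noncomputable def layerAction : D →+* Module.End (LayerRing W R) (Layers W R) :=
  Module.toModuleEnd (LayerRing W R) (Layers W R)

theorem layerAction_apply (d : D) (v : Layers W R) (m : Fin R) :
    layerAction W R D d v m = (d • (v m).1, d • (v m).2) := rfl

end Layers

end YangianDouble

/-! ### The action of the completed algebra -/

namespace YangianDouble

open Finset
open scoped Topology

section EntrySeries

variable {m D E : Type*} [Fintype m] [DecidableEq m] [Ring D] [Ring E]

/-- A series of matrices as a matrix of series, with a homomorphism applied to the coefficients. -/
noncomputable def entrySeries (m : Type*) [Fintype m] [DecidableEq m] (ψ : D →+* E) :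
    PowerSeries (Matrix m m D) →+* Matrix m m (PowerSeries E) where
  toFun F := Matrix.of fun I J => PowerSeries.mk fun s => ψ (PowerSeries.coeff s F I J)
  map_zero' := by
    ext I J s
    simp
  map_one' := by
    ext I J s
    rw [Matrix.of_apply, PowerSeries.coeff_mk, PowerSeries.coeff_one, Matrix.one_apply]
    by_cases h : I = J <;> by_cases hs : s = 0 <;>
      simp [h, hs, PowerSeries.coeff_one, Matrix.one_apply]
  map_add' F G := by
    ext I J s
    simp
  map_mul' F G := by
    ext I J s
    rw [Matrix.of_apply, PowerSeries.coeff_mk, PowerSeries.coeff_mul, Matrix.sum_apply, map_sum,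
      Matrix.mul_apply, map_sum]
    simp only [PowerSeries.coeff_mul, Matrix.of_apply, PowerSeries.coeff_mk, Matrix.mul_apply, map_sum,
      map_mul]
    exact sum_comm

theorem coeff_entrySeries (ψ : D →+* E) (F : PowerSeries (Matrix m m D)) (I J : m) (s : ℕ) :
    PowerSeries.coeff s (entrySeries m ψ F I J) = ψ (PowerSeries.coeff s F I J) :=
  PowerSeries.coeff_mk s fun s => ψ (PowerSeries.coeff s F I J)

theorem entrySeries_inCopy {n k : ℕ} (ψ : D →+* E) (a : Fin k)
    (F : ℕ → Matrix (Fin n) (Fin n) D) : entrySeries (Fin k → Fin n) ψ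
      (PowerSeries.mk fun s => inCopy a (F s)) =
      inCopy a (entrySeries (Fin n) ψ (PowerSeries.mk F)) := by
  ext I J s
  rw [coeff_entrySeries, PowerSeries.coeff_mk]
  simp only [inCopy, Matrix.of_apply]
  split_ifs
  · rw [coeff_entrySeries, PowerSeries.coeff_mk]
  · rw [map_zero, map_zero]

end EntrySeries

section SmoothModule

/-- A convergent series whose terms almost all annihilate `w` acts on `w` as a finite sum. -/
theorem tsum_smul_eq_sum {n : ℕ} {W : Type*} [AddCommGroup W] [Module (DYcr n) W] (w : W)
    (hw : {d : DYcr n | d • w = 0} ∈ 𝓝 0) {f : ℕ → DYcr n}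
    (hf : Summable f) {Q : ℕ} (hQ : ∀ q, Q ≤ q → f q • w = 0) :
    (∑' q, f q) • w = ∑ q ∈ range Q, f q • w := by
  -- The orbit map of `w` is continuous for the discrete topology.
  let _ : TopologicalSpace W := ⊥
  have : DiscreteTopology W := ⟨rfl⟩
  let g : DYcr n →+ W := (smulAddHom (DYcr n) W).flip w
  have hg : Continuous g := by
    refine continuous_of_continuousAt_zero g ?_
    rw [ContinuousAt, map_zero, nhds_discrete W, Filter.tendsto_pure]
    exact hw
  have h1 : g (∑' q, f q) = ∑' q, g (f q) := hf.map_tsum g hg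
  change g (∑' q, f q) = ∑ q ∈ range Q, g (f q)
  rw [h1, tsum_eq_sum]
  intro q hq
  exact hQ q (by simpa using hq)

variable {n : ℕ} {W : Type*} [AddCommGroup W] [Module Scalars W] [Module (DYcr n) W]

theorem toCr_smul_smul (hW : ∀ (a : Scalars) (w : W), toCr n (algebraMap Scalars (Free n) a) • w = a • w)
    (a : Scalars) (x : Free n) (w : W) : toCr n (a • x) • w = a • toCr n x • w := by
  rw [Algebra.smul_def, map_mul, mul_smul, hW]

/-- The coefficients of `L^-(u + a)` are infinite sums, which become finite on a module on which
`h` is nilpotent. -/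
theorem LminusShift_smul (hW : ∀ (a : Scalars) (w : W), toCr n (algebraMap Scalars (Free n) a) • w = a • w)
    (w : W) (hw : {d : DYcr n | d • w = 0} ∈ 𝓝 0) {Q : ℕ} (hQ : ∀ w : W, hbar ^ Q • w = 0)
    (b : Scalars) (s : ℕ) (i j : Fin n) : LminusShift n (b * hbar) s i j • w =
      ∑ q ∈ range Q, (((s + q).choose s : Scalars) * (b * hbar) ^ q) •
        toCr n (Lminus n ((s + q : ℕ) : ℤ) i j) • w := by
  rw [LminusShift, Matrix.of_apply, tsum_smul_eq_sum w hw (summable_LminusShiftTerm n b s i j) (Q := Q)]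
  · exact sum_congr rfl fun q _ => toCr_smul_smul hW _ _ _
  · intro q hq
    obtain ⟨d, rfl⟩ := Nat.exists_eq_add_of_le hq
    rw [LminusShiftTerm, toCr_smul_smul hW, mul_pow, ← mul_assoc, mul_smul, pow_add hbar,
      mul_smul (hbar ^ Q), hQ, smul_zero]

variable [SMulCommClass (DYcr n) Scalars W] (R : ℕ)

variable (n W) in
/-- The action of the generators on the module of layers. -/
noncomputable def layerGen (r : ℤ) :
    Matrix (Fin n) (Fin n) (Module.End (LayerRing W R) (Layers W R)) :=
  (freeMat n r).map fun x => layerAction W R (DYcr n) (toCr n x)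

theorem relations_layerGen
    (hW : ∀ (a : Scalars) (w : W), toCr n (algebraMap Scalars (Free n) a) • w = a • w) :
    Relations n (algebraMap Scalars (LayerRing W R) hbar) (layerE W R) (layerGen n W R) :=
  relations_of_hom (algebraMap_complex W R)
    { (layerAction W R (DYcr n)).comp UniformSpace.Completion.coeRingHom with
      commutes' := fun a => LinearMap.ext fun _ => funext fun _ => by
        have h := hW a
        rw [← (toBar n).commutes]
        exact Prod.ext (h _) (h _) } _ (layerE_mul_self W R)

theorem locNil_layerGen
    (hl : ∀ w : W, ∃ p : ℕ, ∀ r : ℤ, (p : ℤ) ≤ r → ∀ i j, toCr n (freeL i j r) • w = 0) :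
    LocNil (layerGen n W R) := by
  choose p hp using hl
  intro v
  refine ⟨univ.sup fun m => max (p (v m).1) (p (v m).2), fun r hr i j => funext fun m => ?_⟩
  have : max (p (v m).1) (p (v m).2) ≤ univ.sup fun m => max (p (v m).1) (p (v m).2) :=
    le_sup (f := fun m => max (p (v m).1) (p (v m).2)) (mem_univ m)
  exact Prod.ext (hp _ r (by omega) i j) (hp _ r (by omega) i j)

theorem algebraMap_end_layers (a : Scalars)
    (hW : ∀ (a : Scalars) (w : W), toCr n (algebraMap Scalars (Free n) a) • w = a • w) :
    layerAction W R (DYcr n) (toCr n (algebraMap Scalars (Free n) a)) =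
      algebraMap (LayerRing W R) _ (algebraMap Scalars (LayerRing W R) a) :=
  LinearMap.ext fun _ => funext fun _ => Prod.ext (hW a _) (hW a _)

theorem layerAction_plusCoeff
    (hW : ∀ (a : Scalars) (w : W), toCr n (algebraMap Scalars (Free n) a) • w = a • w)
    (a : ℤ) (i j : Fin n) :
    layerAction W R (DYcr n) (toCr n (Lplus n a i j)) =
      plusCoeff (algebraMap (LayerRing W R) _ (algebraMap Scalars (LayerRing W R) hbar))
        (layerGen n W R) a i j := by
  have := congrFun (congrFun (plusCoeff_map ((layerAction W R (DYcr n)).comp (toCr n))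
    (algebraMap Scalars (Free n) hbar) (freeMat n) a) i) j
  rw [← Lplus_eq_plusCoeff] at this
  refine this.trans ?_
  rw [RingHom.comp_apply, algebraMap_end_layers R _ hW]
  rfl

theorem layerAction_minusCoeff
    (hW : ∀ (a : Scalars) (w : W), toCr n (algebraMap Scalars (Free n) a) • w = a • w)
    (a : ℤ) (i j : Fin n) :
    layerAction W R (DYcr n) (toCr n (Lminus n a i j)) =
      minusCoeff (algebraMap (LayerRing W R) _ (algebraMap Scalars (LayerRing W R) hbar))
        (layerGen n W R) a i j := by
  have := congrFun (congrFun (minusCoeff_map ((layerAction W R (DYcr n)).comp (toCr n))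
    (algebraMap Scalars (Free n) hbar) (freeMat n) a) i) j
  rw [← Lminus_eq_minusCoeff] at this
  refine this.trans ?_
  rw [RingHom.comp_apply, algebraMap_end_layers R _ hW]
  rfl

/-- The series `L^+(u + a)` acts on the layers as the shifted series of the action of `L^+(u)`. -/
theorem entrySeries_LplusShift
    (hW : ∀ (a : Scalars) (w : W), toCr n (algebraMap Scalars (Free n) a) • w = a • w) (a : Scalars) :
    entrySeries (Fin n) (layerAction W R (DYcr n)) (LplusShift n a) =
      (plusSeries (algebraMap Scalars (LayerRing W R) hbar) (layerGen n W R)).map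
        (inverseShift (algebraMap Scalars (LayerRing W R) a)) := by
  refine Matrix.ext fun i j => PowerSeries.ext fun N => ?_
  rw [coeff_entrySeries, LplusShift, PowerSeries.coeff_mk, Matrix.map_apply, Matrix.map_apply,
    inverseShift, PowerSeries.coeff_mk, shiftInv, Matrix.sum_apply, map_sum, map_sum]
  refine sum_congr rfl fun p _ => ?_
  rw [Matrix.smul_apply, Algebra.smul_def, map_mul, map_mul, algebraMap_end_layers R _ hW,
    layerAction_plusCoeff R hW, plusSeries, Matrix.of_apply, PowerSeries.coeff_mk, ← Algebra.smul_def]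
  congr 1
  rw [map_mul, map_pow, map_neg, map_natCast]

/-- The series `L^-(u + a h)` acts on the layers by substituting `u + a h` in the action of
`L^-(u)`, a substitution that makes sense since `a h` is nilpotent there. -/
theorem entrySeries_LminusShift
    (hW : ∀ (a : Scalars) (w : W), toCr n (algebraMap Scalars (Free n) a) • w = a • w)
    (hopen : ∀ w : W, {d : DYcr n | d • w = 0} ∈ 𝓝 0) {Q : ℕ} (hQ : ∀ w : W, hbar ^ Q • w = 0)
    (a : ℕ) (ha : IsNilpotent ((a : LayerRing W R) * algebraMap Scalars (LayerRing W R) hbar)) :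
    entrySeries (Fin n) (layerAction W R (DYcr n))
        (PowerSeries.mk (LminusShift n ((a : Scalars) * hbar))) =
      (minusSeries (algebraMap Scalars (LayerRing W R) hbar) (layerGen n W R)).map
        (shiftHom _ ((a : LayerRing W R) * algebraMap Scalars (LayerRing W R) hbar) ha) := by
  have hβ : ((a : LayerRing W R) * algebraMap Scalars (LayerRing W R) hbar) =
    algebraMap Scalars (LayerRing W R) (a * hbar) := by rw [map_mul, map_natCast]
  have hQ' : ((a : LayerRing W R) * algebraMap Scalars (LayerRing W R) hbar) ^ Q = 0 := by
    rw [mul_pow, ← map_pow]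
    have : algebraMap Scalars (LayerRing W R) (hbar ^ Q) = 0 :=
      Subtype.ext (LinearMap.ext fun v => funext fun i => Prod.ext (hQ _) (hQ _))
    rw [this, mul_zero]
  refine Matrix.ext fun i j => PowerSeries.ext fun s => ?_
  rw [coeff_entrySeries, PowerSeries.coeff_mk, Matrix.map_apply, shiftHom_apply,
    coeff_shiftSeries hQ' _ le_rfl]
  refine LinearMap.ext fun v => ?_
  have e : layerAction W R (DYcr n) (LminusShift n ((a : Scalars) * hbar) s i j) v =
      ∑ q ∈ range Q, (((s + q).choose s : Scalars) * ((a : Scalars) * hbar) ^ q) •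
        layerAction W R (DYcr n) (toCr n (Lminus n ((s + q : ℕ) : ℤ) i j)) v := by
    funext m
    rw [Finset.sum_apply]
    refine Prod.ext ?_ ?_
    · rw [Prod.fst_sum]
      exact LminusShift_smul hW _ (hopen _) hQ _ _ _ _
    · rw [Prod.snd_sum]
      exact LminusShift_smul hW _ (hopen _) hQ _ _ _ _
  rw [e, LinearMap.sum_apply, sum_range_add, sum_eq_zero (s := range s), zero_add]
  · refine sum_congr rfl fun q _ => ?_
    rw [layerAction_minusCoeff R hW, LinearMap.smul_apply, minusSeries, Matrix.of_apply,
      PowerSeries.coeff_mk, Polynomial.coeff_X_add_C_pow, Nat.add_sub_cancel_left, hβ, ← map_pow,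
      ← map_natCast (algebraMap Scalars (LayerRing W R)), ← map_mul, algebraMap_layerRing_smul, mul_comm]
  · intro q hq
    rw [Polynomial.coeff_X_add_C_pow, Nat.choose_eq_zero_of_lt (mem_range.1 hq), Nat.cast_zero, mul_zero,
      zero_smul, LinearMap.zero_apply]

end SmoothModule

end YangianDouble

/-! ### Action of the coefficients on smooth modules -/

namespace YangianDouble

open Finset
open scoped Topology

section Terms

variable {n k : ℕ}

theorem antisymmetrizer_eq (I J : Fin k → Fin n) : antisymmetrizer n k I J =
    toCr n (algebraMap Scalars (Free n) (PowerSeries.C (1 / (k.factorial : ℂ)))) *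
      signSum n k (DYcr n) I J := by
  let g : ℂ →+* DYcr n := ((toCr n).comp (algebraMap Scalars (Free n))).comp PowerSeries.C
  have h : (∑ σ : Equiv.Perm (Fin k), if I = J ∘ σ.symm then ((Equiv.Perm.sign σ : ℤ) : ℂ) else 0) =
      signSum n k ℂ I J := by
    rw [signSum, Matrix.sum_apply]
    refine sum_congr rfl fun σ _ => ?_
    rw [Matrix.smul_apply, permMat, Matrix.of_apply]
    split_ifs <;> simp
  rw [antisymmetrizer, Matrix.of_apply, h, map_mul, map_mul, map_mul, ← signSum_map g]
  rfl

/-- The coefficient of `u^s` times that of `u^{-t}` in `ℓ_k(u)`, without the factor `1 / k!`. -/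
noncomputable def rawTerm (n k s t : ℕ) : DYcr n :=
  Matrix.trace (signSum n k (DYcr n) * (PowerSeries.coeff s (minusProduct n k) *
    PowerSeries.coeff t (plusProduct n k)))

theorem ellTerm_eq (s t : ℕ) : ellTerm n k (s, t) =
    toCr n (algebraMap Scalars (Free n) (PowerSeries.C (1 / (k.factorial : ℂ)))) *
      rawTerm n k s t := by
  have h : antisymmetrizer n k = Matrix.scalar (Fin k → Fin n)
      (toCr n (algebraMap Scalars (Free n) (PowerSeries.C (1 / (k.factorial : ℂ))))) *
      signSum n k (DYcr n) := by
    ext I J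
    rw [antisymmetrizer_eq, Matrix.scalar_apply, Matrix.diagonal_mul]
  rw [ellTerm, h, rawTerm, mul_assoc, mul_assoc, Matrix.trace, Matrix.trace, mul_sum]
  refine sum_congr rfl fun I _ => ?_
  rw [Matrix.diag_apply, Matrix.diag_apply, Matrix.scalar_apply, Matrix.diagonal_mul]

/-- The contributions to the coefficients of the trace are the images of the terms of `ℓ_k(u)`. -/
theorem pairTerm_entrySeries {K V : Type*} [CommRing K] [AddCommGroup V] [Module K V]
    (ψ : DYcr n →+* Module.End K V) (N : ℤ) (t : ℕ) :
    pairTerm (entrySeries _ ψ (minusProduct n k)) (entrySeries _ ψ (plusProduct n k)) N t =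
      ψ (if -(t : ℤ) ≤ N then rawTerm n k (N - -(t : ℤ)).toNat t else 0) := by
  rw [pairTerm]
  split_ifs
  · rw [rawTerm, trace_signSum_mul, trace_signSum_mul, map_sum]
    refine sum_congr rfl fun I _ => ?_
    rw [map_sum]
    refine sum_congr rfl fun I' _ => ?_
    rw [map_zsmul]
    congr 1
    rw [Matrix.mul_apply, Matrix.mul_apply, map_sum]
    refine sum_congr rfl fun J _ => ?_
    rw [map_mul, Matrix.map_apply, Matrix.map_apply, coeff_entrySeries, coeff_entrySeries]
  · rw [map_zero]

end Terms

section LayerUnit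

variable {W : Type*} [AddCommGroup W] (R : ℕ)

variable (W) in
/-- The element `w` of the lowest layer. -/
def layerUnit (w : W) : Layers W R := fun m => if (m : ℕ) = 0 then (w, 0) else 0

theorem layerUnit_sum {ι : Type*} (s : Finset ι) (f : ι → W) :
    ∑ t ∈ s, layerUnit W R (f t) = layerUnit W R (∑ t ∈ s, f t) := by
  funext m
  rw [Finset.sum_apply]
  simp only [layerUnit]
  split_ifs
  · refine Prod.ext ?_ ?_
    · rw [Prod.fst_sum]
    · rw [Prod.snd_sum, sum_const_zero]
  · exact sum_const_zero

end LayerUnit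

section SmoothModule

variable {n : ℕ} {W : Type*} [AddCommGroup W] [Module Scalars W] [Module (DYcr n) W]
  [SMulCommClass (DYcr n) Scalars W] (R : ℕ)

theorem entrySeries_minusProduct
    (hW : ∀ (a : Scalars) (w : W), toCr n (algebraMap Scalars (Free n) a) • w = a • w)
    (hopen : ∀ w : W, {d : DYcr n | d • w = 0} ∈ 𝓝 0) {Q : ℕ} (hQ : ∀ w : W, hbar ^ Q • w = 0) (k : ℕ)
    (ha : ∀ a : Fin k, IsNilpotent (((a : ℕ) : LayerRing W R) *
      algebraMap Scalars (LayerRing W R) hbar)) :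
    entrySeries (Fin k → Fin n) (layerAction W R (DYcr n)) (minusProduct n k) =
      ((List.finRange k).map fun a => inCopy a
        ((minusSeries (algebraMap Scalars (LayerRing W R) hbar) (layerGen n W R)).map
          (shiftHom _ (((a : ℕ) : LayerRing W R) * algebraMap Scalars (LayerRing W R) hbar)
            (ha a)))).prod := by
  rw [minusProduct, map_list_prod, List.ofFn_eq_map, List.map_map]
  refine congrArg List.prod (List.map_congr_left fun a _ => ?_)
  rw [Function.comp_apply, entrySeries_inCopy]
  exact congrArg (inCopy a) (entrySeries_LminusShift R hW hopen hQ a (ha a))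

variable (n W) in
/-- The action of `L^+(u + a h + n h / 2)⁻¹` on the module of layers. -/
noncomputable def layerInverse (a : ℕ) :
    Matrix (Fin n) (Fin n) (PowerSeries (Module.End (LayerRing W R) (Layers W R))) :=
  entrySeries (Fin n) (layerAction W R (DYcr n))
    (LplusShiftInv n ((a : Scalars) * hbar + PowerSeries.C ((n : ℂ) / 2) * hbar))

theorem entrySeries_plusProduct (k : ℕ) :
    entrySeries (Fin k → Fin n) (layerAction W R (DYcr n)) (plusProduct n k) =
      ((List.finRange k).reverse.map fun a => inCopy a (layerInverse n W R a)).prod := by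
  rw [plusProduct, map_list_prod, List.ofFn_eq_map, List.map_reverse, List.map_reverse, List.map_map]
  refine congrArg (fun l => (List.reverse l).prod) (List.map_congr_left fun a _ => ?_)
  rw [Function.comp_apply, entrySeries_inCopy, layerInverse]
  congr 2
  exact PowerSeries.ext fun N => PowerSeries.coeff_mk _ _

/-- The series act as a left inverse of the action of `L^+`. -/
theorem layerInverse_mul
    (hW : ∀ (a : Scalars) (w : W), toCr n (algebraMap Scalars (Free n) a) • w = a • w) (a : ℕ) :
    layerInverse n W R a * (plusSeries (algebraMap Scalars (LayerRing W R) hbar) (layerGen n W R)).map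
      (inverseShift (plusOffset n (algebraMap Scalars (LayerRing W R) hbar) a)) = 1 := by
  have h : plusOffset n (algebraMap Scalars (LayerRing W R) hbar) a =
      algebraMap Scalars (LayerRing W R) ((a : Scalars) * hbar + PowerSeries.C ((n : ℂ) / 2) * hbar) := by
    rw [plusOffset, algebraMap_complex, map_add, map_mul, map_mul, map_natCast]
  rw [h, ← entrySeries_LplusShift R hW, layerInverse, ← map_mul, (LplusShift_mul_inv n _).2, map_one]

theorem layerAction_layerUnit (d : DYcr n) (w : W) :
    layerAction W R (DYcr n) d (layerUnit W R w) = layerUnit W R (d • w) := by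
  funext m
  rw [layerAction_apply, layerUnit, layerUnit]
  split_ifs <;> simp

/-- With `ε` in place of `h`, the coefficient of `z^{m+1}` in `L^+(z⁻¹)` is `-ε l^{(m)}`. Applied
to an element of the lowest layer, its `ε`-part is seen in the second coordinate of the layer `m +
1`, undivided by `h`. -/
theorem plusValue_layerUnit (i j : Fin n) (m : ℕ) (hm : m + 1 < R) (w : W) :
    (plusValue (layerE W R) (layerZ W R) R (layerGen n W R) i j (layerUnit W R w) ⟨m + 1, hm⟩).2 =
      -(toCr n (freeL i j m) • w) := by
  have h : ∀ (s : ℕ) (q : Fin R), plusCoeff (algebraMap (LayerRing W R) _ (layerE W R)) (layerGen n W R)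
      (-(s : ℤ)) i j (layerUnit W R w) q = (if s = 0 ∧ i = j then layerUnit W R w q else 0) -
        (if 0 < s then layerEps W R (layerUnit W R (toCr n (freeL i j (s - 1)) • w)) q else 0) := by
    intro s q
    rw [plusCoeff, Matrix.of_apply, LinearMap.sub_apply, Pi.sub_apply]
    congr 1
    · by_cases h1 : s = 0 <;> by_cases h2 : i = j <;> simp [h1, h2]
    · by_cases h1 : 0 < s
      · rw [if_pos h1, if_pos (by omega), neg_neg, ← layerAction_layerUnit]
        rfl
      · rw [if_neg h1, if_neg (by omega)]
        rfl
  rw [plusValue, LinearMap.sum_apply, Finset.sum_apply, Prod.snd_sum, sum_eq_single (m + 1)]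
  · rw [LinearMap.smul_apply, layerZ_pow_smul, layerShift_pow_apply, if_pos (by simp), h,
      if_neg (by simp), if_pos (by simp), layerEps_apply]
    simp [layerUnit]
  · intro s _ hs
    rw [LinearMap.smul_apply, layerZ_pow_smul, layerShift_pow_apply]
    split_ifs with h1
    · have hq : layerUnit W R w ⟨m + 1 - s, by omega⟩ = 0 := if_neg (by
        simp only at h1 ⊢
        omega)
      rw [h, layerEps_apply, hq]
      have hq' : ∀ w', layerUnit W R w' ⟨m + 1 - s, by omega⟩ = 0 := fun w' => if_neg (by
        simp only at h1 ⊢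
        omega)
      rw [hq']
      simp only [ite_self, zero_sub, Prod.fst_zero, Prod.snd_zero, smul_zero, add_zero]
      split_ifs <;> simp
    · rfl
  · intro hs
    exact absurd (mem_range.2 hm) hs

/-- The coefficient of `z^m` in `L^-(z)` is `ε l^{(-m-1)}`, apart from the identity matrix, which
does not contribute to the second coordinate. -/
theorem minusValue_layerUnit (i j : Fin n) (m : ℕ) (hm : m < R) (w : W) :
    (minusValue (layerE W R) (layerZ W R) R (layerGen n W R) i j (layerUnit W R w) ⟨m, hm⟩).2 =
      toCr n (freeL i j (-(m : ℤ) - 1)) • w := by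
  have h : ∀ (s : ℕ) (q : Fin R), minusCoeff (algebraMap (LayerRing W R) _ (layerE W R))
      (layerGen n W R) (s : ℤ) i j (layerUnit W R w) q =
        (if s = 0 ∧ i = j then layerUnit W R w q else 0) +
        layerEps W R (layerUnit W R (toCr n (freeL i j (-(s : ℤ) - 1)) • w)) q := by
    intro s q
    rw [minusCoeff, Matrix.of_apply, LinearMap.add_apply, Pi.add_apply]
    congr 1
    · by_cases h1 : s = 0 <;> by_cases h2 : i = j <;> simp [h1, h2]
    · rw [if_pos (by omega), ← layerAction_layerUnit]
      rfl
  rw [minusValue, LinearMap.sum_apply, Finset.sum_apply, Prod.snd_sum, sum_eq_single m]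
  · rw [LinearMap.smul_apply, layerZ_pow_smul, layerShift_pow_apply, if_pos (by simp), h,
      layerEps_apply]
    simp only [layerUnit, Nat.sub_self, if_true]
    split_ifs <;> simp
  · intro s _ hs
    rw [LinearMap.smul_apply, layerZ_pow_smul, layerShift_pow_apply]
    split_ifs with h1
    · have hq' : ∀ w', layerUnit W R w' ⟨m - s, by omega⟩ = 0 := fun w' => if_neg (by
        simp only at h1 ⊢
        omega)
      rw [h, layerEps_apply, hq', hq']
      simp
    · rfl
  · intro hs
    exact absurd (mem_range.2 hm) hs

/-- On a module whose elements have open annihilators, `ℓ_k(u)` acts by coefficients that are finite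
sums and that commute with the generators. The commutation on the layers is compared in the second
coordinates, where the generator appears without a factor `h`. -/
theorem smul_rawTerm_commute {k : ℕ} (hn : 1 ≤ n)
    (hW : ∀ (a : Scalars) (w : W), toCr n (algebraMap Scalars (Free n) a) • w = a • w)
    (hopen : ∀ w : W, {d : DYcr n | d • w = 0} ∈ 𝓝 0) {Q : ℕ} (hQ : ∀ w : W, hbar ^ Q • w = 0)
    (hl : ∀ w : W, ∃ p : ℕ, ∀ r : ℤ, (p : ℤ) ≤ r → ∀ i j, toCr n (freeL i j r) • w = 0)
    (i j : Fin n) (r : ℤ) (N : ℤ) (w : W) : ∃ M₀ : ℕ, ∀ M, M₀ ≤ M →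
      toCr n (freeL i j r) • ∑ t ∈ range M,
        (if -(t : ℤ) ≤ N then rawTerm n k (N - -(t : ℤ)).toNat t else 0) • w =
      ∑ t ∈ range M, (if -(t : ℤ) ≤ N then rawTerm n k (N - -(t : ℤ)).toNat t else 0) •
        toCr n (freeL i j r) • w := by
  -- `r = m` is read off from `L^+` and `r = -m - 1` from `L^-`.
  obtain ⟨m, hm⟩ : ∃ m : ℕ, r = m ∨ r = -(m : ℤ) - 1 := ⟨max r.toNat (-r - 1).toNat, by omega⟩
  obtain ⟨R, hR⟩ : ∃ R, m + 1 < R := ⟨m + 2, by omega⟩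
  have hh := isNilpotent_layer_hbar W R hQ
  obtain ⟨hfin, hcomm⟩ := apply_pairSum (k := k) hn (relations_layerGen R hW) (locNil_layerGen R hl) hh
    (isNilpotent_layerE W R hQ) (layerE_mul_self W R) (layerZ_pow W R) (fun a => layerInverse n W R a)
    (fun a => layerInverse_mul R hW a) _ _ (entrySeries_minusProduct R hW hopen hQ k _)
    (entrySeries_plusProduct R k)
  simp only [pairTerm_entrySeries] at hcomm
  set d : ℕ → DYcr n := fun t => if -(t : ℤ) ≤ N then rawTerm n k (N - -(t : ℤ)).toNat t else 0 with hd
  have main : ∀ b : Module.End (LayerRing W R) (Layers W R),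
      (∃ i j, b = plusValue (layerE W R) (layerZ W R) R (layerGen n W R) i j ∨
        b = minusValue (layerE W R) (layerZ W R) R (layerGen n W R) i j) →
      ∃ M₀ : ℕ, ∀ M, M₀ ≤ M → ∀ q : Fin R, (b (layerUnit W R (∑ t ∈ range M, d t • w)) q).2 =
        ∑ t ∈ range M, d t • (b (layerUnit W R w) q).2 := by
    intro b hb
    obtain ⟨M₁, h₁⟩ := hfin (layerUnit W R w)
    obtain ⟨M₂, h₂⟩ := hfin (b (layerUnit W R w))
    refine ⟨max M₁ M₂, fun M hM q => ?_⟩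
    have := hcomm b hb (layerUnit W R w) M (fun t ht => h₁ t (by omega)) (fun t ht => h₂ t (by omega)) N
    simp only [layerAction_layerUnit, layerUnit_sum] at this
    refine (congrArg (fun v : Layers W R => (v q).2) this).trans ?_
    simp only [Finset.sum_apply, Prod.snd_sum, layerAction_apply]
    rfl
  rcases hm with rfl | rfl
  · obtain ⟨M₀, hM₀⟩ := main _ ⟨i, j, Or.inl rfl⟩
    refine ⟨M₀, fun M hM => ?_⟩
    have := hM₀ M hM ⟨m + 1, hR⟩
    simp only [plusValue_layerUnit, smul_neg, sum_neg_distrib, neg_inj] at this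
    exact this
  · obtain ⟨M₀, hM₀⟩ := main _ ⟨i, j, Or.inr rfl⟩
    refine ⟨M₀, fun M hM => ?_⟩
    have := hM₀ M hM ⟨m, by omega⟩
    simp only [minusValue_layerUnit] at this
    exact this

/-- The coefficients of the product of the `L^+(u_i + h n / 2)⁻¹` almost all annihilate `w`. -/
theorem rawTerm_smul_eq_zero {k : ℕ} (hn : 1 ≤ n)
    (hW : ∀ (a : Scalars) (w : W), toCr n (algebraMap Scalars (Free n) a) • w = a • w)
    (hopen : ∀ w : W, {d : DYcr n | d • w = 0} ∈ 𝓝 0) {Q : ℕ} (hQ : ∀ w : W, hbar ^ Q • w = 0)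
    (hl : ∀ w : W, ∃ p : ℕ, ∀ r : ℤ, (p : ℤ) ≤ r → ∀ i j, toCr n (freeL i j r) • w = 0) (w : W) :
    ∃ M : ℕ, ∀ t, M ≤ t → ∀ s, rawTerm n k s t • w = 0 := by
  have hh := isNilpotent_layer_hbar W 1 hQ
  obtain ⟨hfin, -⟩ := apply_pairSum (k := k) hn (relations_layerGen 1 hW) (locNil_layerGen 1 hl) hh
    (isNilpotent_layerE W 1 hQ) (layerE_mul_self W 1) (layerZ_pow W 1) (fun a => layerInverse n W 1 a)
    (fun a => layerInverse_mul 1 hW a) _ _ (entrySeries_minusProduct 1 hW hopen hQ k _)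
    (entrySeries_plusProduct 1 k)
  obtain ⟨M, hM⟩ := hfin (layerUnit W 1 w)
  refine ⟨M, fun t ht s => ?_⟩
  have h : ∀ I J, PowerSeries.coeff t (plusProduct n k) I J • w = 0 := by
    intro I J
    have := hM t ht I J
    rw [coeff_entrySeries, layerAction_layerUnit] at this
    exact congrArg (fun v : Layers W 1 => (v 0).1) this
  rw [rawTerm, trace_signSum_mul, sum_smul]
  refine sum_eq_zero fun I _ => ?_
  rw [sum_smul]
  refine sum_eq_zero fun I' _ => ?_
  rw [smul_assoc, Matrix.mul_apply, sum_smul, sum_eq_zero, smul_zero]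
  intro J _
  rw [mul_smul, h, smul_zero]

end SmoothModule

end YangianDouble

/-! ### Centrality in the completion -/

namespace YangianDouble

open Finset UniformSpace
open scoped Topology

section Topology

variable (n : ℕ) (s : ℕ × ℕ)

/-- The closure of `J_p + h^m DY` in the completion. -/
noncomputable def openIdeal : Ideal (DYcr n) where
  carrier := closure ((fun x : DYbar n => (x : DYcr n)) '' nbhd n s)
  zero_mem' := subset_closure ⟨0, zero_mem _, Completion.coe_zero⟩
  add_mem' := by
    intro x y hx hy
    refine map_mem_closure₂ continuous_add hx hy ?_
    rintro _ ⟨a, ha, rfl⟩ _ ⟨b, hb, rfl⟩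
    exact ⟨a + b, add_mem ha hb, Completion.coe_add a b⟩
  smul_mem' := by
    intro x y hy
    induction x using Completion.induction_on with
    | hp => exact isClosed_closure.preimage (continuous_mul_const y)
    | ih a =>
      refine map_mem_closure (continuous_const_mul (a : DYcr n)) hy ?_
      rintro _ ⟨b, hb, rfl⟩
      exact ⟨a * b, Ideal.mul_mem_left _ a hb, Completion.coe_mul a b⟩

variable {n}

theorem coe_mem_openIdeal {x : DYbar n} (hx : x ∈ nbhd n s) : (x : DYcr n) ∈ openIdeal n s :=
  subset_closure ⟨x, hx, rfl⟩

theorem openIdeal_mem_nhds : (openIdeal n s : Set (DYcr n)) ∈ 𝓝 0 := by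
  have h : (nbhd n s : Set (DYbar n)) ∈ 𝓝 0 :=
    (nbhd_basis n).hasBasis_nhds_zero.mem_of_mem (i := s) trivial
  have := (Completion.isDenseInducing_coe (α := DYbar n)).closure_image_mem_nhds h
  rwa [Completion.coe_zero] at this

theorem isClosed_openIdeal : IsClosed (openIdeal n s : Set (DYcr n)) := isClosed_closure

variable {s}

theorem exists_openIdeal_subset {V : Set (DYcr n)} (hV : V ∈ 𝓝 0) :
    ∃ s, (openIdeal n s : Set (DYcr n)) ⊆ V := by
  obtain ⟨V', hV', hc, hsub⟩ := exists_mem_nhds_isClosed_subset hV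
  have h := (Completion.continuous_coe (DYbar n)).continuousAt.preimage_mem_nhds (x := 0)
    (by rwa [Completion.coe_zero])
  obtain ⟨s, -, hs⟩ := (nbhd_basis n).hasBasis_nhds_zero.mem_iff.1 h
  refine ⟨s, (closure_minimal ?_ hc).trans hsub⟩
  rintro _ ⟨x, hx, rfl⟩
  exact hs hx

theorem eq_zero_of_forall_mem_openIdeal {x : DYcr n} (hx : ∀ s, x ∈ openIdeal n s) : x = 0 := by
  by_contra h
  obtain ⟨s, hs⟩ := exists_openIdeal_subset (n := n) (isOpen_compl_singleton.mem_nhds (Ne.symm h))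
  exact hs (hx s) rfl

theorem scalar_commute (a : Scalars) (d : DYcr n) :
    toCr n (algebraMap Scalars (Free n) a) * d = d * toCr n (algebraMap Scalars (Free n) a) := by
  have h : toCr n (algebraMap Scalars (Free n) a) = ((algebraMap Scalars (DYbar n) a : DYbar n) : DYcr n) :=
    congrArg (fun x : DYbar n => (x : DYcr n)) ((toBar n).commutes a)
  rw [h]
  induction d using Completion.induction_on with
  | hp => exact isClosed_eq (continuous_const_mul _) (continuous_mul_const _)
  | ih b => rw [← Completion.coe_mul, ← Completion.coe_mul, Algebra.commutes]

end Topology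

section Quotient

variable (n : ℕ) (s : ℕ × ℕ)

/-- The quotient of the completed Yangian double by the closure of `J_p + h^m DY`. -/
def OpenQuotient : Type := DYcr n ⧸ openIdeal n s

noncomputable instance : AddCommGroup (OpenQuotient n s) :=
  inferInstanceAs (AddCommGroup (DYcr n ⧸ openIdeal n s))

noncomputable instance : Module (DYcr n) (OpenQuotient n s) :=
  inferInstanceAs (Module (DYcr n) (DYcr n ⧸ openIdeal n s))

noncomputable instance : Module Scalars (OpenQuotient n s) :=
  Module.compHom _ ((toCr n).comp (algebraMap Scalars (Free n)))

instance : SMulCommClass (DYcr n) Scalars (OpenQuotient n s) where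
  smul_comm d a w := by
    change d • toCr n (algebraMap Scalars (Free n) a) • w = toCr n (algebraMap Scalars (Free n) a) • d • w
    rw [smul_smul, smul_smul, scalar_commute]

variable {n}

/-- The class of an element. -/
noncomputable def openClass (d : DYcr n) : OpenQuotient n s := (Submodule.Quotient.mk d : DYcr n ⧸ openIdeal n s)

variable {s}

theorem openClass_surjective (w : OpenQuotient n s) : ∃ d, openClass s d = w :=
  Submodule.Quotient.mk_surjective _ w

theorem smul_openClass (d x : DYcr n) : d • openClass s x = openClass s (d * x) := rfl

theorem openClass_eq_zero {d : DYcr n} : openClass s d = 0 ↔ d ∈ openIdeal n s :=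
  Submodule.Quotient.mk_eq_zero _

theorem scalar_smul_openQuotient (a : Scalars) (w : OpenQuotient n s) :
    toCr n (algebraMap Scalars (Free n) a) • w = a • w := rfl

theorem annihilator_mem_nhds (w : OpenQuotient n s) : {d : DYcr n | d • w = 0} ∈ 𝓝 0 := by
  obtain ⟨x, rfl⟩ := openClass_surjective w
  have h : Filter.Tendsto (fun d : DYcr n => d * x) (𝓝 0) (𝓝 0) := by
    have := (continuous_mul_const x).tendsto (0 : DYcr n)
    rwa [zero_mul] at this
  filter_upwards [h (openIdeal_mem_nhds s)] with d hd
  exact openClass_eq_zero.2 hd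

theorem hbar_pow_smul_openQuotient (w : OpenQuotient n s) : hbar ^ s.2 • w = 0 := by
  obtain ⟨x, rfl⟩ := openClass_surjective w
  refine openClass_eq_zero.2 ?_
  induction x using Completion.induction_on with
  | hp => exact (isClosed_openIdeal s).preimage (continuous_const_mul _)
  | ih a =>
    have h : ((algebraMap Scalars (DYbar n) (hbar ^ s.2) * a : DYbar n) : DYcr n) ∈ openIdeal n s :=
      coe_mem_openIdeal s (by
        rw [← Algebra.smul_def]
        exact smul_mem_nbhd le_rfl a)
    rw [Completion.coe_mul] at h
    have h' : toCr n (algebraMap Scalars (Free n) (hbar ^ s.2)) =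
        ((algebraMap Scalars (DYbar n) (hbar ^ s.2) : DYbar n) : DYcr n) :=
      congrArg (fun x : DYbar n => (x : DYcr n)) ((toBar n).commutes _)
    rw [← h'] at h
    exact h

/-- The generators `l^{(r)}` with `r` large lie in `J_p`, so that they tend to `0` and eventually
annihilate every class. -/
theorem generators_locally_nilpotent (w : OpenQuotient n s) :
    ∃ p : ℕ, ∀ r : ℤ, (p : ℤ) ≤ r → ∀ i j, toCr n (freeL i j r) • w = 0 := by
  obtain ⟨s', hs'⟩ := exists_openIdeal_subset (annihilator_mem_nhds w)
  refine ⟨s'.1, fun r hr i j => hs' (coe_mem_openIdeal s' (J_le_nbhd s' ?_))⟩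
  exact freeL_mem_J _ _ _ hr

end Quotient

section Center

variable {n k : ℕ}

/-- The terms of the coefficient of `u^N` in `ℓ_k(u)`, indexed by the power of `u^{-1}` coming from the
inverses of `L^+`. -/
noncomputable def ellSummand (n k : ℕ) (N : ℤ) (t : ℕ) : DYcr n :=
  if -(t : ℤ) ≤ N then ellTerm n k ((N - -(t : ℤ)).toNat, t) else 0

theorem ellSummand_smul {s : ℕ × ℕ} (N : ℤ) (t : ℕ) (w : OpenQuotient n s) :
    ellSummand n k N t • w = PowerSeries.C (1 / (k.factorial : ℂ)) •
      ((if -(t : ℤ) ≤ N then rawTerm n k (N - -(t : ℤ)).toNat t else 0) • w) := by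
  rw [ellSummand]
  split_ifs
  · rw [ellTerm_eq, mul_smul, scalar_smul_openQuotient]
  · rw [zero_smul, smul_zero]

theorem exists_ellSummand_smul_eq_zero (hn : 1 ≤ n) {s : ℕ × ℕ} (w : OpenQuotient n s) :
    ∃ M : ℕ, ∀ t, M ≤ t → ∀ N, ellSummand n k N t • w = 0 := by
  obtain ⟨M, hM⟩ := rawTerm_smul_eq_zero (k := k) hn scalar_smul_openQuotient annihilator_mem_nhds
    hbar_pow_smul_openQuotient generators_locally_nilpotent w
  refine ⟨M, fun t ht N => ?_⟩
  rw [ellSummand_smul]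
  split_ifs
  · rw [hM t ht, smul_zero]
  · rw [zero_smul, smul_zero]

/-- The completion is nonarchimedean, so it is enough that the terms tend to `0`; that is, that
they almost all annihilate the class of `1` in each quotient. -/
theorem summable_ellSummand (hn : 1 ≤ n) (N : ℤ) : Summable (ellSummand n k N) := by
  apply NonarchimedeanAddGroup.summable_of_tendsto_cofinite_zero
  rw [Nat.cofinite_eq_atTop, Filter.tendsto_def]
  intro V hV
  obtain ⟨s, hs⟩ := exists_openIdeal_subset hV
  obtain ⟨M, hM⟩ := exists_ellSummand_smul_eq_zero (k := k) hn (openClass s (1 : DYcr n))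
  filter_upwards [Filter.eventually_ge_atTop M] with t ht
  have := hM t ht N
  rw [smul_openClass, mul_one, openClass_eq_zero] at this
  exact hs this

theorem ellTerm_eq_ellSummand (N : ℤ) (p : {p : ℕ × ℕ // (p.1 : ℤ) - (p.2 : ℤ) = N}) :
    ellTerm n k p = ellSummand n k N p.1.2 := by
  obtain ⟨⟨a, b⟩, hp⟩ := p
  simp only at hp ⊢
  rw [ellSummand, if_pos (by omega)]
  congr 2
  omega

theorem injective_snd (N : ℤ) :
    Function.Injective fun p : {p : ℕ × ℕ // (p.1 : ℤ) - (p.2 : ℤ) = N} => p.1.2 := by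
  rintro ⟨⟨a, b⟩, hp⟩ ⟨⟨a', b'⟩, hp'⟩ h
  simp only at hp hp' h
  refine Subtype.ext (Prod.ext ?_ h)
  simp only
  omega

theorem support_ellSummand (N : ℤ) : Function.support (ellSummand n k N) ⊆
    Set.range fun p : {p : ℕ × ℕ // (p.1 : ℤ) - (p.2 : ℤ) = N} => p.1.2 := by
  intro t ht
  have h : -(t : ℤ) ≤ N := by
    by_contra h
    exact ht (if_neg h)
  exact ⟨⟨((N - -(t : ℤ)).toNat, t), by simp only; omega⟩, rfl⟩

theorem summable_ellTerm (hn : 1 ≤ n) (N : ℤ) :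
    Summable fun p : {p : ℕ × ℕ // (p.1 : ℤ) - (p.2 : ℤ) = N} => ellTerm n k p := by
  simp only [ellTerm_eq_ellSummand]
  exact ((injective_snd N).summable_iff fun t ht => by
    by_contra h
    exact ht (support_ellSummand N h)).2 (summable_ellSummand hn N)

theorem ellCoeff_eq_tsum (N : ℤ) : ellCoeff n k N = ∑' t, ellSummand n k N t := by
  rw [ellCoeff, ← (injective_snd N).tsum_eq (support_ellSummand N)]
  exact tsum_congr fun p => ellTerm_eq_ellSummand N p

/-- The commutator annihilates the class of `1` in each of the quotients, whose defining left
ideals have intersection `0`. -/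
theorem generator_commute_ellCoeff (hn : 1 ≤ n) (N : ℤ) (i j : Fin n) (r : ℤ) :
    toCr n (freeL i j r) * ellCoeff n k N = ellCoeff n k N * toCr n (freeL i j r) := by
  rw [← sub_eq_zero]
  refine eq_zero_of_forall_mem_openIdeal fun s => ?_
  set x := toCr n (freeL i j r) with hx
  obtain ⟨M₀, hM₀⟩ := smul_rawTerm_commute (k := k) hn scalar_smul_openQuotient annihilator_mem_nhds
    hbar_pow_smul_openQuotient generators_locally_nilpotent i j r N (openClass s (1 : DYcr n))
  obtain ⟨M₁, hM₁⟩ := exists_ellSummand_smul_eq_zero (k := k) hn (openClass s (1 : DYcr n))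
  obtain ⟨M₂, hM₂⟩ := exists_ellSummand_smul_eq_zero (k := k) hn (x • openClass s (1 : DYcr n))
  obtain ⟨M, h₀, h₁, h₂⟩ : ∃ M, M₀ ≤ M ∧ M₁ ≤ M ∧ M₂ ≤ M :=
    ⟨max M₀ (max M₁ M₂), by omega, by omega, by omega⟩
  have e₁ := tsum_smul_eq_sum _ (annihilator_mem_nhds _) (summable_ellSummand (k := k) hn N) (Q := M)
    fun t ht => hM₁ t (h₁.trans ht) N
  have e₂ := tsum_smul_eq_sum _ (annihilator_mem_nhds _) (summable_ellSummand (k := k) hn N) (Q := M)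
    fun t ht => hM₂ t (h₂.trans ht) N
  rw [← ellCoeff_eq_tsum] at e₁ e₂
  simp only [ellSummand_smul, ← smul_sum] at e₁ e₂
  have e : x • ellCoeff n k N • openClass s (1 : DYcr n) = ellCoeff n k N • x • openClass s (1 : DYcr n) := by
    rw [e₁, e₂, ← hM₀ M h₀, smul_comm]
  rw [smul_openClass, smul_openClass, smul_openClass, smul_openClass, mul_one, mul_one] at e
  exact (Submodule.Quotient.eq _).1 e

/-- The centralizer is closed, and the generators generate a dense subalgebra. -/
theorem ellCoeff_mem_center (hn : 1 ≤ n) (N : ℤ) : ellCoeff n k N ∈ Subring.center (DYcr n) := by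
  rw [Subring.mem_center_iff]
  intro d
  induction d using Completion.induction_on with
  | hp => exact isClosed_eq (continuous_mul_const _) (continuous_const_mul _)
  | ih a =>
    obtain ⟨y, rfl⟩ := toBar_surjective n a
    change toCr n y * _ = _ * toCr n y
    induction y using Free.induction with
    | scalar c => exact scalar_commute c _
    | gen_l i j r => exact generator_commute_ellCoeff hn N i j r
    | gen_c =>
      have : toCr n (freeC n) = -(n : DYcr n) := by
        have h := congrArg (Completion.coeRingHom : DYbar n →+* DYcr n) (toBar_freeC n)
        rw [map_neg, map_natCast] at h
        exact h
      rw [this, neg_mul, mul_neg, Nat.cast_comm]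
    | mul a b ha hb => rw [map_mul, mul_assoc, hb, ← mul_assoc, ha, mul_assoc]
    | add a b ha hb => rw [map_add, add_mul, mul_add, ha, hb]

end Center

end YangianDouble

theorem theorem4p4 (n k : ℕ) (hk : 1 ≤ k) (hkn : k ≤ n) (N : ℤ) :
    (Summable fun p : {p : ℕ × ℕ // (p.1 : ℤ) - (p.2 : ℤ) = N} => YangianDouble.ellTerm n k p) ∧
      YangianDouble.ellCoeff n k N ∈ Subring.center (YangianDouble.DYcr n) :=
  ⟨YangianDouble.summable_ellTerm (hk.trans hkn) N, YangianDouble.ellCoeff_mem_center (hk.trans hkn) N⟩
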